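/- **Conventions.** Let $D$ be an oriented knot diagram with $n$ crossings, $n_\pm$ of them positive/negative. $\mathit{CKh}(D)$ is the rational Khovanov complex for the Frobenius algebra $A=\mathbb Q[X]/(X^2)$, with the quantum grading normalized so that $X$ has degree $+2$: on a resolution $v\in\{0,1\}^n$ with $r$ ones (and underlying module $A^{\otimes\,\mathrm{circles}}$) the homological degree is $t=r-n_-$, and the quantum degree is $q=\#\{\text{factors }X\}-\#\{\text{factors }1\}-r-n_++2n_-$. Put $\delta=2t+q$. For a crossing $c$ let $\chi_c$ be the homotopy of degree $-1$ given by the reversal of the part of the differential $d$ at $c$ (the reversed saddles, with the same signs). Color the edges of $D$ by $a,b$ so that at every crossing the two arcs of the orientation preserving resolution are monochromatic and of different colors (an admissible coloring), and choose a base point on an edge. Running once along the knot from the base point, one passes crossings $c_1,\dots,c_{2n}$; let $\epsilon_j=\pm1$ according to whether the edge before the $j$-th passage is colored $a$ or $b$. The $\mathsf e$-operator is $$\mathsf e=\sum_{1\le j<j'\le 2n}(\epsilon_j\chi_{c_j})(\epsilon_{j'}\chi_{c_{j'}}),$$ of bidegree $(t,q)=(-2,4)$. It acts on $\mathit{Kh}(D;\mathbb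 Q)=H(\mathit{CKh}(D))$ and on the reduced homology $\widetilde{\mathit{Kh}}(D;\mathbb Q)$, the homology of the subcomplex $\operatorname{Im}(X_x)$, where $X_x$ is multiplication by $X$ on the circle through a marked point $x$, and where the quantum degree is shifted by $-1$ so that the unknot has reduced homology $\mathbb Q$ in bidegree $(0,0)$. An *$e$-string of dimension $l$ starting at $(t,q)$* is a summand with homogeneous basis $v,\mathsf e v,\dots,\mathsf e^{l-1}v$, $\mathsf e^lv=0$, with $v$ of bidegree $(t,q)$. For $p\ge 0$ let $K_p$ be the standard diagram, with $p+2$ crossings, of the twist knot with a two-crossing clasp and $p$ twist crossings, which are positive; the clasp crossings are positive for $p$ odd and negative for $p$ even. So $K_0$ is the unknot, $K_1=3_1^*$ the positive trefoil, $K_2=4_1^*$, $K_3=5_2^*$, $K_4=6_1^*$, and so on. **Theorem.** For all $p\ge0$, the diagram $K_p$ has an admissible coloring, and $d^2=0$ and $d\,\mathsf e=\mathsf e\,d$ hold on $\mathit{CKh}(K_p)$, for every admissible coloring and every base point. For all $k\ge 0$, every admissible coloring, every base point and every marked point, the following holds. 1. $\mathit{Kh}(K_{2k};\mathbb Q)$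 is supported on $\delta=\pm1$, and $\mathsf e$ acts as $0$. It has a basis of homogeneous elements, of bidegrees $(0,1)$, $(0,-1)$ and, for $0\le j<k$, $(2j-2,5-4j)$, $(2j-1,1-4j)$, $(2j+1,-1-4j)$, $(2j+2,-5-4j)$. 2. $\mathit{Kh}(K_{2k+1};\mathbb Q)$ is supported on $\delta=-1,-3$. It is the direct sum of a single $2$-dimensional $e$-string, which lies on $\delta=-1$ and starts at $(2,-5)$, and of $1$-dimensional $e$-strings at $(0,-3)$, $(3,-9)$ and, for $0\le j<k$, at $(2j+1,-3-4j)$, $(2j+2,-7-4j)$, $(2j+4,-9-4j)$, $(2j+5,-13-4j)$. 3. $\widetilde{\mathit{Kh}}(K_{2k};\mathbb Q)$ is supported on $\delta=0$. It is the direct sum of $2k+1$ one-dimensional $e$-strings, at $(2j,-4j)$ for $0\le j\le k$ and at $(2j-2,4-4j)$ for $0\le j<k$, and of $k$ two-dimensional $e$-strings, starting at $(2j+1,-2-4j)$ for $0\le j<k$. 4. $\widetilde{\mathit{Kh}}(K_{2k+1};\mathbb Q)$ is supported on $\delta=-2$. It is the direct sum of $2k+1$ one-dimensional $e$-strings, at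 $(2j+3,-8-4j)$ for $0\le j\le k$ and at $(2j+1,-4-4j)$ for $0\le j<k$, and of $k+1$ two-dimensional $e$-strings, starting at $(2j+2,-6-4j)$ for $0\le j\le k$. -/

import Mathlib

noncomputable section

/-! ## Diagrams -/

/-- The planar diagram code of an oriented knot diagram with `n` crossings. The `2 * n` edges are
numbered cyclically along the orientation. `edge c 0, …, edge c 3` are the edges at the crossing
`c`, listed counterclockwise, starting from the incoming under-edge; so the lower strand runs from
`edge c 0` to `edge c 2`, while the upper strand runs from `edge c 3` to `edge c 1` if `c` is
positive and from `edge c 1` to `edge c 3` if `c` is negative. -/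
structure KnotDiagram (n : ℕ) where
  edge : Fin n → Fin 4 → ZMod (2 * n)
  pos : Fin n → Bool
  under_eq : ∀ c, edge c 2 = edge c 0 + 1
  over_eq : ∀ c, if pos c then edge c 1 = edge c 3 + 1 else edge c 3 = edge c 1 + 1
  /-- Every edge enters exactly one crossing, exactly once. -/
  incoming_bijective : Function.Bijective fun x : Fin n × Bool =>
    if x.2 then edge x.1 (if pos x.1 then 3 else 1) else edge x.1 0

namespace KnotDiagram

variable {n : ℕ} (D : KnotDiagram n)

/-- The knot passes each crossing `c` twice: the passage `(c, false)` is the one underneath and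
`(c, true)` the one on top. This is the edge along which a passage enters its crossing. -/
def incoming (x : Fin n × Bool) : ZMod (2 * n) :=
  if x.2 then D.edge x.1 (if D.pos x.1 then 3 else 1) else D.edge x.1 0

def posCount : ℕ := (Finset.univ.filter fun c => D.pos c = true).card

def negCount : ℕ := (Finset.univ.filter fun c => D.pos c = false).card

/-! ## Resolutions -/

/-- The ends of a crossing that are joined by its `0`-resolution (`false`): `0, 1` and `2, 3`;
by its `1`-resolution (`true`): `0, 3` and `1, 2`. -/
def mate : Bool → Fin 4 → Fin 4
  | false => ![1, 0, 3, 2]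
  | true => ![3, 2, 1, 0]

/-- Two edges that are joined by an arc of the resolution `v`. -/
def Arc (v : Fin n → Bool) (e f : ZMod (2 * n)) : Prop :=
  ∃ c a, e = D.edge c a ∧ f = D.edge c (mate (v c) a)

/-- The circles of the resolution `v`. -/
abbrev Circles (v : Fin n → Bool) : Type := Quot (D.Arc v)

/-- The circle of the resolution `v` that contains the edge `e`. -/
def circle (v : Fin n → Bool) (e : ZMod (2 * n)) : D.Circles v := Quot.mk _ e

/-- Going from `v` to `v'` changes the resolution of the crossing `c` only, and merges two
circles. -/
def Merges (c : Fin n) (v v' : Fin n → Bool) : Prop :=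
  (∀ c', c' ≠ c → v c' = v' c') ∧
    D.circle v (D.edge c 0) ≠ D.circle v (D.edge c 2) ∧
    D.circle v' (D.edge c 0) = D.circle v' (D.edge c 2)

/-- Going from `v` to `v'` changes the resolution of the crossing `c` only, and splits a circle
into two. -/
def Splits (c : Fin n) (v v' : Fin n → Bool) : Prop :=
  (∀ c', c' ≠ c → v c' = v' c') ∧
    D.circle v (D.edge c 0) = D.circle v (D.edge c 2) ∧
    D.circle v' (D.edge c 0) ≠ D.circle v' (D.edge c 2)

/-! ## The Khovanov complex -/

/-- One dot variable `X e` for each edge `e`. -/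
abbrev Dots (_ : KnotDiagram n) : Type := MvPolynomial (ZMod (2 * n)) ℚ

def circleIdeal (v : Fin n → Bool) : Ideal D.Dots :=
  Ideal.span ({f | ∃ e, f = MvPolynomial.X e ^ 2} ∪
    {f | ∃ e e', D.Arc v e e' ∧ f = MvPolynomial.X e - MvPolynomial.X e'})

/-- The tensor product of one copy of `A = ℚ[X]/(X²)` for each circle of the resolution `v`,
presented as `ℚ[X e | e an edge]` modulo `X e ^ 2 = 0` for all `e`, and `X e = X e'` if `e` and
`e'` lie on the same circle. -/
def Res (v : Fin n → Bool) : Type := D.Dots ⧸ D.circleIdeal v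

instance (v : Fin n → Bool) : CommRing (D.Res v) := Ideal.Quotient.commRing _

instance (v : Fin n → Bool) : Algebra D.Dots (D.Res v) := Ideal.Quotient.algebra _

instance (v : Fin n → Bool) : Algebra ℚ (D.Res v) := Ideal.Quotient.algebra _

instance (v : Fin n → Bool) : IsScalarTower ℚ D.Dots (D.Res v) :=
  inferInstanceAs (IsScalarTower ℚ D.Dots (D.Dots ⧸ D.circleIdeal v))

/-- The quotient map. -/
def resMk (v : Fin n → Bool) : D.Dots →ₐ[ℚ] D.Res v := Ideal.Quotient.mkₐ ℚ (D.circleIdeal v)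

variable {D}

theorem mk_X_eq {v : Fin n → Bool} {e f : ZMod (2 * n)} (h : D.circle v e = D.circle v f) :
    Ideal.Quotient.mk (D.circleIdeal v) (MvPolynomial.X e) =
      Ideal.Quotient.mk (D.circleIdeal v) (MvPolynomial.X f) := by
  have h' := Quot.eqvGen_exact h
  clear h
  induction h' with
  | rel x y hxy =>
    refine Ideal.Quotient.eq.2 (Ideal.subset_span (Or.inr ⟨x, y, hxy, rfl⟩))
  | refl x => rfl
  | symm x y _ ih => exact ih.symm
  | trans x y z _ _ h1 h2 => exact h1.trans h2

theorem mk_X_sq (v : Fin n → Bool) (e : ZMod (2 * n)) :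
    Ideal.Quotient.mk (D.circleIdeal v) (MvPolynomial.X e) ^ 2 = 0 := by
  rw [← map_pow]
  exact Ideal.Quotient.eq_zero_iff_mem.2 (Ideal.subset_span (Or.inl ⟨e, rfl⟩))

theorem circle_mate (v : Fin n → Bool) (c : Fin n) (a : Fin 4) :
    D.circle v (D.edge c a) = D.circle v (D.edge c (mate (v c) a)) :=
  Quot.sound ⟨c, a, rfl, rfl⟩

theorem circle_end (v : Fin n → Bool) (c : Fin n) (a : Fin 4) :
    D.circle v (D.edge c a) = D.circle v (D.edge c 0) ∨
      D.circle v (D.edge c a) = D.circle v (D.edge c 2) := by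
  have h := circle_mate (D := D) v c a
  cases hb : v c <;> rw [hb] at h <;> fin_cases a <;> simp [mate] at h ⊢ <;> simp [h]

theorem merge_mem {c : Fin n} {v v' : Fin n → Bool} (h : D.Merges c v v') :
    ∀ f ∈ D.circleIdeal v, f ∈ D.circleIdeal v' := by
  refine fun f hf => (Ideal.span_le (I := D.circleIdeal v')).2 ?_ hf
  rintro f (⟨e, rfl⟩ | ⟨e, e', ⟨c', a, rfl, rfl⟩, rfl⟩)
  · exact Ideal.subset_span (Or.inl ⟨e, rfl⟩)
  · refine Ideal.Quotient.eq.1 (mk_X_eq ?_)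
    by_cases hc : c' = c
    · subst hc
      have h0 := h.2.2
      rcases circle_end (D := D) v' c' a with h1 | h1 <;>
      rcases circle_end (D := D) v' c' (mate (v c') a) with h2 | h2 <;>
      simp [h1, h2, h0]
    · rw [h.1 c' hc]
      exact circle_mate v' c' a

theorem split_mem {c : Fin n} {v v' : Fin n → Bool} (h : D.Splits c v v') :
    ∀ f ∈ D.circleIdeal v,
      (MvPolynomial.X (D.edge c 0) + MvPolynomial.X (D.edge c 2)) * f ∈ D.circleIdeal v' := by
  intro f hf
  refine Submodule.span_induction ?_ ?_ ?_ ?_ hf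
  · rintro f (⟨e, rfl⟩ | ⟨e, e', ⟨c', a, rfl, rfl⟩, rfl⟩)
    · exact Ideal.mul_mem_left _ _ (Ideal.subset_span (Or.inl ⟨e, rfl⟩))
    · refine Ideal.Quotient.eq_zero_iff_mem.1 ?_
      rw [map_mul, map_add, map_sub]
      by_cases hc : c' = c
      · subst hc
        have s0 := mk_X_sq (D := D) v' (D.edge c' 0)
        have s2 := mk_X_sq (D := D) v' (D.edge c' 2)
        rcases circle_end (D := D) v' c' a with h1 | h1 <;>
        rcases circle_end (D := D) v' c' (mate (v c') a) with h2 | h2 <;>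
        rw [mk_X_eq h1, mk_X_eq h2]
        · ring
        · linear_combination s0 - s2
        · linear_combination s2 - s0
        · ring
      · have h1 := circle_mate (D := D) v' c' a
        rw [← h.1 c' hc] at h1
        rw [mk_X_eq h1]
        ring
  · simp
  · intro x y _ _ hx hy
    rw [mul_add]
    exact Ideal.add_mem _ hx hy
  · intro a x _ hx
    rw [smul_eq_mul, mul_left_comm]
    exact Ideal.mul_mem_left _ _ hx

variable (D)

open scoped Classical in
/-- The map of the saddle cobordism at `c`, from the resolution `v` to the resolution `v'`. If two
circles merge, it is induced by the multiplication `A ⊗ A → A`. If a circle splits into the circles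
of the edges `edge c 0` and `edge c 2`, it is induced by the comultiplication
`a ↦ (X ⊗ 1 + 1 ⊗ X) * (a ⊗ 1)`, that is, `1 ↦ X ⊗ 1 + 1 ⊗ X` and `X ↦ X ⊗ X`. -/
def saddle (c : Fin n) (v v' : Fin n → Bool) : D.Res v →ₗ[D.Dots] D.Res v' :=
  if h : D.Merges c v v' then
    Submodule.mapQ (D.circleIdeal v) (D.circleIdeal v')
      LinearMap.id (merge_mem h)
  else if h : D.Splits c v v' then
    Submodule.mapQ (D.circleIdeal v) (D.circleIdeal v')
      (LinearMap.mulLeft D.Dots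
        (MvPolynomial.X (D.edge c 0) + MvPolynomial.X (D.edge c 2))) (split_mem h)
  else 0

/-- The Khovanov chain group (the direct sum over all resolutions). The variable `X e` acts as
the endomorphism that places a dot on the circle through `e`. -/
abbrev Chain : Type := ∀ v : Fin n → Bool, D.Res v

/-- The standard sign of an edge of the cube of resolutions. -/
def sign (c : Fin n) (v : Fin n → Bool) : ℤ :=
  (-1) ^ (Finset.univ.filter fun c' => c' < c ∧ v c' = true).card

/-- The signed sum of the saddle maps at `c` that start at the resolutions whose value
at `c` is `b`. -/
def edgeMap (c : Fin n) (b : Bool) : D.Chain →ₗ[D.Dots] D.Chain :=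
  LinearMap.pi fun v' => ∑ v : Fin n → Bool,
    if v c = b ∧ v' c = !b then sign c v • (D.saddle c v v' ∘ₗ LinearMap.proj v) else 0

/-- The Khovanov differential. -/
def diff : D.Chain →ₗ[D.Dots] D.Chain := ∑ c, D.edgeMap c false

/-- The dot-sliding homotopy of the crossing `c`: the reversal of the differential at `c`. -/
def dotSlide (c : Fin n) : D.Chain →ₗ[D.Dots] D.Chain := D.edgeMap c true

/-- The bihomogeneous part of homological degree `t` and quantum degree `q`. On a resolution `v`
with `r` ones, the homological degree is `r - n₋`; the quantum degree is `-1` for each factor `1`,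
`+1` for each factor `X`, shifted by `- r - n₊ + 2 n₋`. (A polynomial in the dots that is
homogeneous of degree `m` has `m` factors `X`.) -/
def bidegree (t q : ℤ) : Submodule ℚ D.Chain :=
  Submodule.pi Set.univ fun v =>
    ⨆ (m : ℕ) (_ : ((Finset.univ.filter fun c => v c = true).card : ℤ) - D.negCount = t ∧
        2 * (m : ℤ) - Nat.card (D.Circles v) - (Finset.univ.filter fun c => v c = true).card
          - D.posCount + 2 * D.negCount = q),
      (MvPolynomial.homogeneousSubmodule (ZMod (2 * n)) ℚ m).map
        (D.resMk v).toLinearMap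

/-! ## The operator `e` -/

/-- Admissible `ab`-colorings of the edges (`true` is `a`, `false` is `b`): at every crossing, both
arcs of the orientation preserving resolution are monochromatic, of different colors. -/
def IsAdmissible (θ : ZMod (2 * n) → Bool) : Prop :=
  ∀ c, if D.pos c then
      θ (D.edge c 0) = θ (D.edge c 1) ∧ θ (D.edge c 2) = θ (D.edge c 3) ∧
        θ (D.edge c 0) ≠ θ (D.edge c 2)
    else
      θ (D.edge c 0) = θ (D.edge c 3) ∧ θ (D.edge c 1) = θ (D.edge c 2) ∧
        θ (D.edge c 0) ≠ θ (D.edge c 1)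

def colorSign (θ : ZMod (2 * n) → Bool) (e : ZMod (2 * n)) : ℤ := if θ e then 1 else -1

/-- When does the loop along the knot that starts on the edge `b` run through the passage `x`? -/
def time (b : ZMod (2 * n)) (x : Fin n × Bool) : ℕ := (D.incoming x - b).val

/-- The operator `e = ∑_{j < j'} (ε_j χ_j) (ε_j' χ_j')`, the sum over all pairs of passages of the
loop along the knot that starts on the edge `b`. Here `χ_j` is the dot-sliding homotopy of the
`j`-th crossing on the loop, and `ε_j` is the sign of the color of the edge before it. -/
def eChain (θ : ZMod (2 * n) → Bool) (b : ZMod (2 * n)) : D.Chain →ₗ[D.Dots] D.Chain :=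
  ∑ x : Fin n × Bool, ∑ y : Fin n × Bool,
    if D.time b x < D.time b y then
      (colorSign θ (D.incoming x) * colorSign θ (D.incoming y)) •
        (D.dotSlide x.1 ∘ₗ D.dotSlide y.1)
    else 0

end KnotDiagram

/-! ## Homology of a subcomplex -/

section Homology

variable {R M : Type*} [CommRing R] [Algebra ℚ R] [AddCommGroup M] [Module R M] [Module ℚ M]
  [IsScalarTower ℚ R M]

/-- Cycles in the submodule `W` modulo boundaries of elements of `W`. -/
def SubHomology (d : M →ₗ[R] M) (W : Submodule R M) : Type _ :=
  (W ⊓ LinearMap.ker d : Submodule R M) ⧸ (W.map d).submoduleOf (W ⊓ LinearMap.ker d)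

instance (d : M →ₗ[R] M) (W : Submodule R M) : AddCommGroup (SubHomology d W) :=
  Submodule.Quotient.addCommGroup _

instance (d : M →ₗ[R] M) (W : Submodule R M) : Module R (SubHomology d W) :=
  Submodule.Quotient.module _

instance (d : M →ₗ[R] M) (W : Submodule R M) : Module ℚ (SubHomology d W) :=
  Submodule.Quotient.module' _

instance (d : M →ₗ[R] M) (W : Submodule R M) : IsScalarTower ℚ R (SubHomology d W) :=
  inferInstanceAs (IsScalarTower ℚ R
    ((W ⊓ LinearMap.ker d : Submodule R M) ⧸ (W.map d).submoduleOf (W ⊓ LinearMap.ker d)))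

/-- The class of a cycle. -/
def SubHomology.mk (d : M →ₗ[R] M) (W : Submodule R M) :
    (W ⊓ LinearMap.ker d : Submodule R M) →ₗ[R] SubHomology d W :=
  Submodule.mkQ _

/-- The map on homology that is induced by a chain map. -/
def SubHomology.map {d : M →ₗ[R] M} (W : Submodule R M) (f : M →ₗ[R] M)
    (hf : d ∘ₗ f = f ∘ₗ d) (hW : ∀ x ∈ W, f x ∈ W) : SubHomology d W →ₗ[R] SubHomology d W :=
  Submodule.mapQ ((W.map d).submoduleOf (W ⊓ LinearMap.ker d))
    ((W.map d).submoduleOf (W ⊓ LinearMap.ker d))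
    (f.restrict (p := W ⊓ LinearMap.ker d) (q := W ⊓ LinearMap.ker d) (by
      rintro x ⟨hx, hk⟩
      refine ⟨hW x hx, ?_⟩
      have h := LinearMap.congr_fun hf x
      simp only [LinearMap.comp_apply] at h
      rw [SetLike.mem_coe, LinearMap.mem_ker] at hk
      rw [SetLike.mem_coe, LinearMap.mem_ker, h, hk, map_zero]))
    (by
      rintro ⟨x, hx⟩ ⟨w, hw, hwx⟩
      refine ⟨f w, hW w hw, ?_⟩
      have h := LinearMap.congr_fun hf w
      simp only [LinearMap.comp_apply] at h
      rw [h, hwx]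
      rfl)

/-- The classes of the cycles in `G`. -/
def SubHomology.piece (d : M →ₗ[R] M) (W : Submodule R M) (G : Submodule ℚ M) :
    Submodule ℚ (SubHomology d W) :=
  (G.comap ((W ⊓ LinearMap.ker d).subtype.restrictScalars ℚ)).map
    ((SubHomology.mk d W).restrictScalars ℚ)

end Homology

namespace KnotDiagram

variable {n : ℕ} (D : KnotDiagram n)

/-- Rational Khovanov homology. -/
def Kh : Type := SubHomology D.diff ⊤

instance : AddCommGroup D.Kh := inferInstanceAs (AddCommGroup (SubHomology D.diff ⊤))

instance : Module ℚ D.Kh := inferInstanceAs (Module ℚ (SubHomology D.diff ⊤))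

def KhBidegree (t q : ℤ) : Submodule ℚ D.Kh := SubHomology.piece D.diff ⊤ (D.bidegree t q)

/-- The operator `e` on Khovanov homology. -/
def eKh (θ : ZMod (2 * n) → Bool) (b : ZMod (2 * n))
    (h : D.diff ∘ₗ D.eChain θ b = D.eChain θ b ∘ₗ D.diff) : D.Kh →ₗ[ℚ] D.Kh :=
  LinearMap.restrictScalars ℚ (M := SubHomology D.diff ⊤) (M₂ := SubHomology D.diff ⊤)
    (SubHomology.map ⊤ (D.eChain θ b) h fun _ _ => trivial)

/-- The reduced complex at the point `p`: the image of the endomorphism that places a dot at `p`. -/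
def reducedChain (p : ZMod (2 * n)) : Submodule D.Dots D.Chain :=
  LinearMap.range (LinearMap.lsmul D.Dots D.Chain (MvPolynomial.X p))

theorem map_mem_reducedChain (p : ZMod (2 * n)) (f : D.Chain →ₗ[D.Dots] D.Chain) :
    ∀ x ∈ D.reducedChain p, f x ∈ D.reducedChain p := by
  rintro _ ⟨y, rfl⟩
  exact ⟨f y, by simp⟩

/-- Reduced rational Khovanov homology. -/
def RKh (p : ZMod (2 * n)) : Type := SubHomology D.diff (D.reducedChain p)

instance (p : ZMod (2 * n)) : AddCommGroup (D.RKh p) :=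
  inferInstanceAs (AddCommGroup (SubHomology D.diff (D.reducedChain p)))

instance (p : ZMod (2 * n)) : Module ℚ (D.RKh p) :=
  inferInstanceAs (Module ℚ (SubHomology D.diff (D.reducedChain p)))

/-- The quantum degree of the reduced theory is shifted by `-1`, so that the reduced homology of
the unknot lies in bidegree `(0, 0)`. -/
def RKhBidegree (p : ZMod (2 * n)) (t q : ℤ) : Submodule ℚ (D.RKh p) :=
  SubHomology.piece D.diff (D.reducedChain p) (D.bidegree t (q + 1))

/-- The operator `e` on reduced Khovanov homology. -/
def eRKh (p : ZMod (2 * n)) (θ : ZMod (2 * n) → Bool) (b : ZMod (2 * n))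
    (h : D.diff ∘ₗ D.eChain θ b = D.eChain θ b ∘ₗ D.diff) : D.RKh p →ₗ[ℚ] D.RKh p :=
  LinearMap.restrictScalars ℚ (M := SubHomology D.diff (D.reducedChain p))
    (M₂ := SubHomology D.diff (D.reducedChain p))
    (SubHomology.map (D.reducedChain p) (D.eChain θ b) h (D.map_mem_reducedChain p _))

end KnotDiagram

/-! ## Strings -/

section Strings

variable {H : Type*} [AddCommGroup H] [Module ℚ H]

/-- A bigraded vector space is supported on a set of values of `δ = 2 t + q`. -/
def SupportedOnDelta (G : ℤ → ℤ → Submodule ℚ H) (S : Set ℤ) : Prop :=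
  ∀ t q : ℤ, 2 * t + q ∉ S → G t q = ⊥

/-- The type of a string `v → e v → ⋯ → e ^ (len - 1) v` with `v` of bidegree `(t, q)`. -/
structure EString where
  len : ℕ
  t : ℤ
  q : ℤ

/-- `H` is, as a bigraded `ℚ[e]`-module with `e` of bidegree `(-2, 4)`, the direct sum of strings
of the given types: `H` has a bihomogeneous basis that consists of such strings. -/
def HasStringDecomposition (G : ℤ → ℤ → Submodule ℚ H) (e : H →ₗ[ℚ] H) {ι : Type*}
    (S : ι → EString) : Prop :=
  ∃ B : Module.Basis (Σ i, Fin (S i).len) ℚ H, ∀ i (a : Fin (S i).len),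
    B ⟨i, a⟩ ∈ G ((S i).t - 2 * (a : ℕ)) ((S i).q + 4 * (a : ℕ)) ∧
      e (B ⟨i, a⟩) = if h : (a : ℕ) + 1 < (S i).len then B ⟨i, ⟨a + 1, h⟩⟩ else 0

end Strings

/-! ## Twist knots -/

/-- The edges at the crossings of the twist knot diagram with two clasp crossings (`0` and `1`) and
a row of `p` twist crossings (`2, …, p + 1`), as natural numbers modulo `2 * (p + 2)`. -/
def twistCode (p : ℕ) : ℕ → Fin 4 → ℕ
  | 0 => if Even p then ![1, p + 2, 2, p + 3] else ![1, p + 4, 2, p + 3]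
  | 1 => if Even p then ![p + 3, 0, p + 4, 1] else ![p + 2, 1, p + 3, 0]
  | i + 2 => if Even i then ![2 * p + 3 - i, i + 3, 2 * p + 4 - i, i + 2]
      else ![i + 2, 2 * p + 4 - i, i + 3, 2 * p + 3 - i]

/-- All crossings are positive, except the two clasp crossings if `p` is even. -/
def twistPos (p c : ℕ) : Bool := decide (2 ≤ c ∨ ¬ Even p)

theorem twistCode_incoming (p c : ℕ) (s : Bool) (hc : c < p + 2) :
    twistCode p c (if s then (if twistPos p c then 3 else 1) else 0) =
      match c, s with
      | 0, false => 1
      | 0, true => if Even p then p + 2 else p + 3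
      | 1, false => if Even p then p + 3 else p + 2
      | 1, true => 0
      | i + 2, s => if (Even i ↔ s = true) then i + 2 else 2 * p + 3 - i := by
  rcases c with _ | _ | i <;> cases s <;> by_cases hp : Even p <;>
    simp [twistCode, twistPos, hp]
  all_goals by_cases hi : Even i <;> simp [hi]

theorem twistCode_incoming_lt (p c : ℕ) (s : Bool) (hc : c < p + 2) :
    twistCode p c (if s then (if twistPos p c then 3 else 1) else 0) < 2 * (p + 2) := by
  rw [twistCode_incoming p c s hc]
  rcases c with _ | _ | i <;> cases s <;> simp only <;> (try split_ifs) <;> omega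

theorem twistCode_incoming_injective (p c c' : ℕ) (s s' : Bool) (hc : c < p + 2)
    (hc' : c' < p + 2)
    (h : twistCode p c (if s then (if twistPos p c then 3 else 1) else 0) =
      twistCode p c' (if s' then (if twistPos p c' then 3 else 1) else 0)) :
    c = c' ∧ s = s' := by
  rw [twistCode_incoming p c s hc, twistCode_incoming p c' s' hc'] at h
  by_cases hp : Even p <;>
  rcases c with _ | _ | i <;> rcases c' with _ | _ | j <;> cases s <;> cases s' <;>
    simp only [hp, if_true, if_false, Bool.false_eq_true, iff_true, iff_false] at h ⊢
  all_goals grind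

/-- The diagram of the twist knot `K_p`, `p ≥ 0`. The clasp consists of the crossing `0` above the
crossing `1`; below it the crossings `2, …, p + 1` form a row, from left to right. In the plane, at
each crossing the strand from the lower left to the upper right is on top. The four ends of the
clasp are joined to the four ends of the row: the lower left (right) end of the clasp to the upper
left (right) end of the row by an inner arc, the upper left (right) end of the clasp to the lower
left (right) end of the row by an outer arc. The numbering of the edges starts at the inner left
arc, oriented towards the clasp. So `K_0` is the unknot, `K_1` the positive trefoil, `K_2` the
figure eight knot, `K_3` the mirror image `5_2^*` of `5_2`, and so on. -/
def twistKnot (p : ℕ) : KnotDiagram (p + 2) where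
  edge c a := (twistCode p c a : ℕ)
  pos c := twistPos p c
  under_eq := by
    rintro ⟨c, hc⟩
    rcases c with _ | _ | i
    · by_cases hp : Even p <;> simp [twistCode, hp] <;> ring1
    · by_cases hp : Even p <;> simp [twistCode, hp] <;> ring1
    · by_cases hi : Even i <;> simp [twistCode, hi] <;> norm_cast <;> congr 1 <;> omega
  over_eq := by
    rintro ⟨c, hc⟩
    rcases c with _ | _ | i
    · by_cases hp : Even p <;> simp [twistCode, twistPos, hp] <;> ring1
    · by_cases hp : Even p <;> simp [twistCode, twistPos, hp] <;> ring1
    · by_cases hi : Even i <;> simp [twistCode, twistPos, hi] <;> norm_cast <;> congr 1 <;> omega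
  incoming_bijective := by
    have : NeZero (2 * (p + 2)) := ⟨by omega⟩
    rw [Fintype.bijective_iff_injective_and_card]
    refine ⟨?_, by simp [ZMod.card, mul_comm]⟩
    rintro ⟨⟨c, hc⟩, s⟩ ⟨⟨c', hc'⟩, s'⟩ h
    have key : ((twistCode p c (if s then (if twistPos p c then 3 else 1) else 0) : ℕ) :
        ZMod (2 * (p + 2))) =
        (twistCode p c' (if s' then (if twistPos p c' then 3 else 1) else 0) : ℕ) := by
      cases s <;> cases s' <;> simpa using h
    rw [ZMod.natCast_eq_natCast_iff', Nat.mod_eq_of_lt (twistCode_incoming_lt p c s hc),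
      Nat.mod_eq_of_lt (twistCode_incoming_lt p c' s' hc')] at key
    obtain ⟨h1, h2⟩ := twistCode_incoming_injective p c c' s s' hc hc' key
    subst h1 h2
    rfl

/-! ## The strings of the twist knots -/

/-- Unreduced homology of `K_{2k}`: all strings are one-dimensional. -/
def khStringsEven (k : ℕ) : Fin 2 ⊕ Fin k × Fin 4 → EString
  | Sum.inl i => ![⟨1, 0, 1⟩, ⟨1, 0, -1⟩] i
  | Sum.inr (j, i) => ![⟨1, 2 * (j : ℕ) - 2, 5 - 4 * (j : ℕ)⟩, ⟨1, 2 * (j : ℕ) - 1, 1 - 4 * (j : ℕ)⟩,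
      ⟨1, 2 * (j : ℕ) + 1, -1 - 4 * (j : ℕ)⟩, ⟨1, 2 * (j : ℕ) + 2, -5 - 4 * (j : ℕ)⟩] i

/-- Unreduced homology of `K_{2k+1}`: a single two-dimensional string, with `δ = -1`; all the others
are one-dimensional. -/
def khStringsOdd (k : ℕ) : Fin 3 ⊕ Fin k × Fin 4 → EString
  | Sum.inl i => ![⟨2, 2, -5⟩, ⟨1, 0, -3⟩, ⟨1, 3, -9⟩] i
  | Sum.inr (j, i) => ![⟨1, 2 * (j : ℕ) + 1, -3 - 4 * (j : ℕ)⟩, ⟨1, 2 * (j : ℕ) + 2, -7 - 4 * (j : ℕ)⟩,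
      ⟨1, 2 * (j : ℕ) + 4, -9 - 4 * (j : ℕ)⟩, ⟨1, 2 * (j : ℕ) + 5, -13 - 4 * (j : ℕ)⟩] i

/-- Reduced homology of `K_{2k}`: `(k + 1) + k` one-dimensional and `k` two-dimensional strings. -/
def rkhStringsEven (k : ℕ) : (Fin (k + 1) ⊕ Fin k) ⊕ Fin k → EString
  | Sum.inl (Sum.inl j) => ⟨1, 2 * (j : ℕ), -4 * (j : ℕ)⟩
  | Sum.inl (Sum.inr j) => ⟨1, 2 * (j : ℕ) - 2, 4 - 4 * (j : ℕ)⟩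
  | Sum.inr j => ⟨2, 2 * (j : ℕ) + 1, -2 - 4 * (j : ℕ)⟩

/-- Reduced homology of `K_{2k+1}`: `(k + 1) + k` one-dimensional and `k + 1` two-dimensional
strings. -/
def rkhStringsOdd (k : ℕ) : (Fin (k + 1) ⊕ Fin k) ⊕ Fin (k + 1) → EString
  | Sum.inl (Sum.inl j) => ⟨1, 2 * (j : ℕ) + 3, -8 - 4 * (j : ℕ)⟩
  | Sum.inl (Sum.inr j) => ⟨1, 2 * (j : ℕ) + 1, -4 - 4 * (j : ℕ)⟩
  | Sum.inr j => ⟨2, 2 * (j : ℕ) + 2, -6 - 4 * (j : ℕ)⟩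

end

/-! The chain group is a product of quotients of the ring of dot polynomials, and every map in sight
is linear over that ring, hence determined by the generators `gen v 1`. An admissible coloring
orients the edges so that each crossing has two incoming and two outgoing ends, alternating around
it. Both resolutions respect this orientation, so the circles of a resolution are the cycles of a
permutation, and changing one crossing multiplies the permutation by a transposition. Hence each
saddle merges or splits (`IsAdmissible.isOrientable`), the squares of the cube commute, d² = 0,
different homotopies χ anticommute, and d χ_c + χ_c d is the sum of the two dots at c.

Let u_j be the signed homotopy of the j-th passage and P_j the signed dot in front of it. Colors
alternate along the knot, so d u_j + u_j d = P_j - P_{j+1}. Moreover the sum of all u_j is zero,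
since each crossing is passed twice with opposite signs. A telescoping computation
(`commute_pairSum`) shows that d commutes with the sum of u_i u_j over i < j. The same vanishing
makes this sum independent of the base point; the coloring enters only through products of two
signs.

For K_p the marked point is first placed at `upper p 0`; write X for the dot there. Gaussian
elimination along the row of twist crossings (`goodPair_of_merge`, `goodPair_rowGen`) replaces the
reduced complex by the subcomplex of rows of m zeros followed by ones, in which the first m columns
(or just column 0, if m = 0) carry dots. For fixed m the four resolutions of the clasp form a small
complex. Its homology is spanned by one class with both clasp crossings resolved by 0 (absent for m
= 0) and one with both resolved by 1. They are represented by the explicit chains X s_m and X t_m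
(`sChain`, `tChain`). These are cycles of the full complex, so they form a basis of the reduced
homology, with 2p + 1 elements (`reduced_homology`).

The kernel of X on the full complex C equals its image, so 0 → Im X → C → Im X → 0 is exact. Its
connecting map is read off from d s_{m+1} = (1 - (-1)^m) X s_m and d t_{m+1} = `tCoef m` X t_m,
where `tCoef m` is zero exactly for odd m. This yields the unreduced homology
(`isHomologyBasis_unreduced`).

The knot runs through the clasp, along the row, through the clasp again and back along the row. This
gives e = 2 (χ_1 - χ_0) T, minus 2 χ_1 χ_0 if p is odd, where T is the alternating sum of the
homotopies of the row (`eChain_twistKnot`). It kills s_m. On t_m, T opens gaps in the row of ones;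
neighbouring gaps cancel up to boundaries (`diff_twoGapGen`), and at most the first gap survives.
The outcome, for either parity of p, is that e sends X t_m to 0 for even m and to 2 X s_m for odd m.
So the reduced homology has one string of length two for each odd m. In the unreduced homology 2 X
s_m = d s_{m+1} for odd m < p, so only m = p can survive, and this requires p to be odd.

Other marked points are reached by sliding the dot through one crossing at a time, with χ_c as the
homotopy (`IsDotSlide.isStringFamily`). The support on δ follows from an operator that acts on each
bidegree by a power of two depending only on δ (`IsStringFamily.supportedOnDelta`). -/

noncomputable section

namespace KnotDiagram

variable {n : ℕ} (D : KnotDiagram n)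

/-! ## Generators of the chain groups -/

/-- The class of the polynomial `f` in the summand of the resolution `v`. -/
def gen (v : Fin n → Bool) : D.Dots →ₗ[D.Dots] D.Chain :=
  LinearMap.single D.Dots D.Res v ∘ₗ Algebra.linearMap D.Dots (D.Res v)

theorem gen_apply (v : Fin n → Bool) (f : D.Dots) :
    D.gen v f = Pi.single v (algebraMap D.Dots (D.Res v) f) := rfl

theorem algebraMap_res_surjective (v : Fin n → Bool) :
    Function.Surjective (algebraMap D.Dots (D.Res v)) := Ideal.Quotient.mk_surjective

theorem gen_apply_same (v : Fin n → Bool) (f : D.Dots) :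
    D.gen v f v = algebraMap D.Dots (D.Res v) f := by
  rw [gen_apply, Pi.single_eq_same]

theorem gen_apply_ne {v v' : Fin n → Bool} (h : v' ≠ v) (f : D.Dots) : D.gen v f v' = 0 := by
  rw [gen_apply, Pi.single_eq_of_ne h]

theorem smul_gen (v : Fin n → Bool) (f g : D.Dots) : f • D.gen v g = D.gen v (f * g) := by
  exact ((D.gen v).map_smul f g).symm

theorem gen_eq_smul (v : Fin n → Bool) (f : D.Dots) : D.gen v f = f • D.gen v 1 := by
  rw [smul_gen, mul_one]

theorem algebraMap_X_eq {v : Fin n → Bool} {e f : ZMod (2 * n)}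
    (h : D.circle v e = D.circle v f) :
    algebraMap D.Dots (D.Res v) (MvPolynomial.X e) =
      algebraMap D.Dots (D.Res v) (MvPolynomial.X f) := mk_X_eq h

theorem algebraMap_X_sq (v : Fin n → Bool) (e : ZMod (2 * n)) :
    algebraMap D.Dots (D.Res v) (MvPolynomial.X e) ^ 2 = 0 := mk_X_sq v e

theorem gen_eq_gen_iff {v : Fin n → Bool} {f g : D.Dots} :
    D.gen v f = D.gen v g ↔
      algebraMap D.Dots (D.Res v) f = algebraMap D.Dots (D.Res v) g :=
  ⟨fun h => by simpa [gen_apply_same] using congrFun h v, fun h => by rw [gen_apply, h]; rfl⟩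

theorem gen_eq_zero_iff {v : Fin n → Bool} {f : D.Dots} :
    D.gen v f = 0 ↔ algebraMap D.Dots (D.Res v) f = 0 := by
  rw [← map_zero (D.gen v), gen_eq_gen_iff, map_zero]

theorem gen_X_congr {v : Fin n → Bool} {e e' : ZMod (2 * n)} (h : D.circle v e = D.circle v e')
    (f : D.Dots) : D.gen v (MvPolynomial.X e * f) = D.gen v (MvPolynomial.X e' * f) := by
  rw [gen_eq_gen_iff, map_mul, map_mul, D.algebraMap_X_eq h]

theorem gen_X_sq (v : Fin n → Bool) (e : ZMod (2 * n)) (f : D.Dots) :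
    D.gen v (MvPolynomial.X e ^ 2 * f) = 0 := by
  rw [gen_eq_zero_iff, map_mul, map_pow, algebraMap_X_sq, zero_mul]

theorem X_sq_smul (e : ZMod (2 * n)) (x : D.Chain) :
    (MvPolynomial.X e : D.Dots) ^ 2 • x = 0 := by
  funext v
  rw [Pi.smul_apply, Algebra.smul_def, map_pow, algebraMap_X_sq, zero_mul]
  rfl

theorem X_smul_X_smul (e : ZMod (2 * n)) (x : D.Chain) :
    (MvPolynomial.X e : D.Dots) • (MvPolynomial.X e : D.Dots) • x = 0 := by
  rw [smul_smul, ← pow_two, X_sq_smul]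

theorem chain_eq_sum (x : D.Chain) : ∃ f : (Fin n → Bool) → D.Dots,
    (∀ v, algebraMap D.Dots (D.Res v) (f v) = x v) ∧ x = ∑ v, D.gen v (f v) := by
  choose f hf using fun v => D.algebraMap_res_surjective v (x v)
  refine ⟨f, hf, ?_⟩
  funext v
  rw [Finset.sum_apply, Finset.sum_eq_single v]
  · rw [gen_apply_same, hf]
  · intro w _ hw
    exact D.gen_apply_ne hw.symm _
  · simp

variable {D} in
theorem hom_ext {P : Type*} [AddCommGroup P] [Module D.Dots P] {F G : D.Chain →ₗ[D.Dots] P}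
    (h : ∀ v, F (D.gen v 1) = G (D.gen v 1)) : F = G := by
  refine LinearMap.ext fun x => ?_
  obtain ⟨f, -, rfl⟩ := D.chain_eq_sum x
  rw [map_sum, map_sum]
  refine Finset.sum_congr rfl fun v _ => ?_
  rw [gen_eq_smul, map_smul, map_smul, h]

/-! ## Saddles on generators -/

/-- The two sides of the crossing `c` lie on the same circle. -/
def Joined (c : Fin n) (v : Fin n → Bool) : Prop :=
  D.circle v (D.edge c 0) = D.circle v (D.edge c 2)

/-- Change the resolution of one crossing. -/
def flip (c : Fin n) (v : Fin n → Bool) : Fin n → Bool := Function.update v c (!v c)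

@[simp] theorem flip_same (c : Fin n) (v : Fin n → Bool) : flip c v c = !v c := by simp [flip]

theorem flip_ne {c c' : Fin n} (h : c' ≠ c) (v : Fin n → Bool) : flip c v c' = v c' := by
  simp [flip, h]

@[simp] theorem flip_flip (c : Fin n) (v : Fin n → Bool) : flip c (flip c v) = v := by
  simp [flip]

theorem flip_comm (c c' : Fin n) (v : Fin n → Bool) :
    flip c (flip c' v) = flip c' (flip c v) := by
  by_cases h : c = c'
  · rw [h]
  · funext a
    simp only [flip, Function.update_apply]
    split_ifs <;> simp_all

/-- The sum of the dots on the two sides of a crossing. -/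
def dotSum (c : Fin n) : D.Dots := MvPolynomial.X (D.edge c 0) + MvPolynomial.X (D.edge c 2)

open scoped Classical in
/-- The value of a saddle map on the generator of a resolution. -/
def coef (c : Fin n) (v : Fin n → Bool) : D.Dots := if D.Joined c v then D.dotSum c else 1

theorem coef_joined {c : Fin n} {v : Fin n → Bool} (h : D.Joined c v) :
    D.coef c v = D.dotSum c := if_pos h

theorem coef_not_joined {c : Fin n} {v : Fin n → Bool} (h : ¬ D.Joined c v) :
    D.coef c v = 1 := if_neg h

/-- Every edge of the cube of resolutions merges two circles or splits a circle. -/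
def IsOrientable : Prop := ∀ c v, D.Joined c (flip c v) ↔ ¬ D.Joined c v

variable {D}

/-- Orientability excludes the third case of `saddle`, so a saddle is multiplication by `coef`,
whichever way the edge of the cube is traversed. -/
theorem saddle_flip (hD : D.IsOrientable) (c : Fin n) (v : Fin n → Bool) (f : D.Dots) :
    D.saddle c v (flip c v) (algebraMap D.Dots (D.Res v) f) =
      algebraMap D.Dots (D.Res (flip c v)) (D.coef c v * f) := by
  have h0 : ∀ c', c' ≠ c → v c' = flip c v c' := fun c' h => (flip_ne h v).symm
  by_cases h : D.Joined c v
  · have h1 : ¬ D.Merges c v (flip c v) := fun h' => h'.2.1 h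
    have h2 : D.Splits c v (flip c v) := ⟨h0, h, fun h' => (hD c v).1 h' h⟩
    have e : D.saddle c v (flip c v) = Submodule.mapQ _ _ _ (split_mem h2) :=
      (dif_neg h1).trans (dif_pos h2)
    rw [coef_joined _ h, e]
    rfl
  · have h1 : D.Merges c v (flip c v) := ⟨h0, h, (hD c v).2 h⟩
    have e : D.saddle c v (flip c v) = Submodule.mapQ _ _ _ (merge_mem h1) := dif_pos h1
    rw [coef_not_joined _ h, e, one_mul]
    rfl

theorem saddle_eq_zero {c : Fin n} {v v' : Fin n → Bool} (h : v' c = !v c) (h' : v' ≠ flip c v) :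
    D.saddle c v v' = 0 := by
  have key : ¬ ∀ c', c' ≠ c → v c' = v' c' := by
    intro h0
    apply h'
    funext a
    by_cases ha : a = c
    · subst ha
      rw [h, flip_same]
    · rw [flip_ne ha, h0 a ha]
  exact (dif_neg fun h1 => key h1.1).trans (dif_neg fun h1 => key h1.1)

theorem edgeMap_apply (c : Fin n) (b : Bool) (x : D.Chain) (v' : Fin n → Bool) :
    D.edgeMap c b x v' = ∑ v : Fin n → Bool,
      if v c = b ∧ v' c = !b then sign c v • D.saddle c v v' (x v) else 0 := by
  rw [edgeMap, LinearMap.pi_apply, LinearMap.sum_apply]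
  refine Finset.sum_congr rfl fun v _ => ?_
  split_ifs <;> rfl

theorem edgeMap_gen (hD : D.IsOrientable) (c : Fin n) (b : Bool) (v : Fin n → Bool) (f : D.Dots) :
    D.edgeMap c b (D.gen v f) =
      if v c = b then sign c v • D.gen (flip c v) (D.coef c v * f) else 0 := by
  funext v'
  rw [edgeMap_apply, Finset.sum_eq_single v]
  · by_cases h : v c = b
    · rw [if_pos h, gen_apply_same, Pi.smul_apply]
      by_cases h' : v' = flip c v
      · subst h'
        rw [if_pos ⟨h, by rw [flip_same, h]⟩, saddle_flip hD, gen_apply_same]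
      · rw [gen_apply_ne _ h', smul_zero]
        split_ifs with h2
        · rw [saddle_eq_zero (by rw [h2.2, h]) h', LinearMap.zero_apply, smul_zero]
        · rfl
    · rw [if_neg h, if_neg fun h2 => h h2.1]
      rfl
  · intro w _ hw
    rw [gen_apply_ne _ hw, map_zero, smul_zero, ite_self]
  · simp

end KnotDiagram

/-! ## Multiplying a permutation by a transposition -/

namespace Equiv.Perm

variable {α : Type*} [DecidableEq α] {f : Equiv.Perm α} {a b : α}

/-- The transposition moves b to a before f acts, so the orbit of b joins the f-orbit of a and
follows it as long as that orbit avoids both points. -/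
theorem pow_mul_swap_apply {k : ℕ} (hk : ∀ j, 0 < j → j < k → (f ^ j) a ≠ a ∧ (f ^ j) a ≠ b) :
    ∀ j, 0 < j → j ≤ k → ((f * Equiv.swap a b) ^ j) b = (f ^ j) a := by
  intro j hj hjk
  induction j with
  | zero => exact absurd hj (lt_irrefl _)
  | succ j ih =>
    rcases Nat.eq_zero_or_pos j with rfl | hj'
    · simp
    · rw [pow_succ', mul_apply, ih hj' (by omega), mul_apply,
        Equiv.swap_apply_of_ne_of_ne (hk j hj' (by omega)).1 (hk j hj' (by omega)).2, pow_succ',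
        mul_apply]

/-- If the f-cycle of a misses b, the orbit of b under the product runs once through it and arrives
at a: two cycles are joined. -/
theorem sameCycle_mul_swap [Finite α] (h : ¬ f.SameCycle a b) :
    (f * Equiv.swap a b).SameCycle a b := by
  have hex : ∃ k, 0 < k ∧ (f ^ k) a = a :=
    ⟨orderOf f, orderOf_pos f, by rw [pow_orderOf_eq_one, one_apply]⟩
  classical
  have hs := Nat.find_spec hex
  refine SameCycle.symm ⟨(Nat.find hex : ℕ), ?_⟩
  rw [zpow_natCast, pow_mul_swap_apply (k := Nat.find hex) ?_ _ hs.1 le_rfl, hs.2]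
  exact fun j hj hjk => ⟨fun h' => Nat.find_min hex hjk ⟨hj, h'⟩, fun h' => h ⟨(j : ℕ), by simpa⟩⟩

/-- If b = f^k a with k minimal, the product closes up f a, …, f^(k-1) a, b to a cycle that misses
a: one cycle is cut in two. -/
theorem not_sameCycle_mul_swap [Finite α] (hab : a ≠ b) (h : f.SameCycle a b) :
    ¬ (f * Equiv.swap a b).SameCycle a b := by
  obtain ⟨k₀, hk₀⟩ := h.exists_nat_pow_eq
  have hex : ∃ k, (f ^ k) a = b := ⟨k₀, hk₀⟩
  classical
  have hs := Nat.find_spec hex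
  set k := Nat.find hex with hkdef
  have hk0 : 0 < k := by
    rcases Nat.eq_zero_or_pos k with h0 | h0
    · rw [h0] at hs
      exact absurd hs hab
    · exact h0
  have hmin : ∀ j, 0 < j → j < k → (f ^ j) a ≠ a ∧ (f ^ j) a ≠ b := by
    -- A return to a at time j would mean that b is reached already at time k - j.
    refine fun j hj hjk => ⟨fun h' => ?_, fun h' => Nat.find_min hex hjk h'⟩
    refine Nat.find_min hex (m := k - j) (by omega) ?_
    rw [← hs]
    conv_rhs => rw [← Nat.sub_add_cancel hjk.le, pow_add, mul_apply, h']
  have hkey := pow_mul_swap_apply hmin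
  intro h'
  obtain ⟨i, hi⟩ := h'.symm.exists_nat_pow_eq
  have hb : ((f * Equiv.swap a b) ^ k) b = b := by rw [hkey k hk0 le_rfl, hs]
  have hi' : ((f * Equiv.swap a b) ^ (i % k)) b = a := by
    conv_lhs at hi => rw [← Nat.mod_add_div i k, pow_add, mul_apply, pow_mul,
      pow_apply_eq_self_of_apply_eq_self hb]
    exact hi
  rcases Nat.eq_zero_or_pos (i % k) with h0 | h0
  · rw [h0] at hi'
    exact hab hi'.symm
  · have hlt := Nat.mod_lt i hk0
    rw [hkey _ h0 hlt.le] at hi'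
    exact (hmin _ h0 hlt).1 hi'

end Equiv.Perm

namespace KnotDiagram

variable {n : ℕ} {D : KnotDiagram n}

/-! ## Orientations of the resolutions -/

/-- The `β`-th of the two ends at the crossing `c` at which the edges, oriented along the knot if
they are colored `a` and against it otherwise, point towards the crossing. -/
def headEnd (D : KnotDiagram n) (θ : ZMod (2 * n) → Bool) (c : Fin n) (β : Bool) : Fin 4 :=
  if θ (D.edge c 0) then (if β then 2 else 0) else (if β then 3 else 1)

/-- The `β`-th of the other two ends. -/
def tailEnd (D : KnotDiagram n) (θ : ZMod (2 * n) → Bool) (c : Fin n) (β : Bool) : Fin 4 :=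
  if θ (D.edge c 0) then (if β then 3 else 1) else (if β then 2 else 0)

def headEdge (D : KnotDiagram n) (θ : ZMod (2 * n) → Bool) (x : Fin n × Bool) : ZMod (2 * n) :=
  D.edge x.1 (D.headEnd θ x.1 x.2)

def tailEdge (D : KnotDiagram n) (θ : ZMod (2 * n) → Bool) (x : Fin n × Bool) : ZMod (2 * n) :=
  D.edge x.1 (D.tailEnd θ x.1 x.2)

/-- Either resolution joins heads to tails, so the orientation descends to the circles; the
resolutions differ only by an exchange of the two tails. -/
theorem mate_headEnd (θ : ZMod (2 * n) → Bool) (c : Fin n) (β b : Bool) :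
    mate b (D.headEnd θ c β) = D.tailEnd θ c (xor β b) := by
  cases h : θ (D.edge c 0) <;> cases β <;> cases b <;> simp [headEnd, tailEnd, h, mate]

theorem exists_end (θ : ZMod (2 * n) → Bool) (c : Fin n) (a : Fin 4) (b : Bool) :
    ∃ β, (a = D.headEnd θ c β ∧ mate b a = D.tailEnd θ c (xor β b)) ∨
      (mate b a = D.headEnd θ c β ∧ a = D.tailEnd θ c (xor β b)) := by
  cases h : θ (D.edge c 0) <;> cases b <;> fin_cases a <;>
    simp [headEnd, tailEnd, h, mate]

theorem exists_incoming (e : ZMod (2 * n)) : ∃ x, D.incoming x = e :=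
  D.incoming_bijective.2 e

theorem incoming_false (c : Fin n) : D.incoming (c, false) = D.edge c 0 := rfl

theorem incoming_true (c : Fin n) :
    D.incoming (c, true) = D.edge c (if D.pos c then 3 else 1) := rfl

theorem incoming_true_add_one (c : Fin n) :
    D.incoming (c, true) + 1 = D.edge c (if D.pos c then 1 else 3) := by
  have h := D.over_eq c
  rw [incoming_true]
  cases hp : D.pos c <;> simp [hp] at h ⊢ <;> exact h.symm

theorem two_mul_ne_zero_of_fin (c : Fin n) : NeZero (2 * n) := ⟨by have := c.pos; omega⟩

variable {θ : ZMod (2 * n) → Bool}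

theorem IsAdmissible.colors (hθ : D.IsAdmissible θ) (c : Fin n) :
    θ (D.edge c 2) = !θ (D.edge c 0) ∧
      θ (D.edge c 1) = (if D.pos c then θ (D.edge c 0) else !θ (D.edge c 0)) ∧
      θ (D.edge c 3) = (if D.pos c then !θ (D.edge c 0) else θ (D.edge c 0)) := by
  have h := hθ c
  cases hp : D.pos c <;> simp only [hp, if_true, if_false, Bool.false_eq_true] at h ⊢ <;>
    obtain ⟨h1, h2, h3⟩ := h <;> revert h1 h2 h3 <;>
    cases θ (D.edge c 0) <;> cases θ (D.edge c 1) <;> cases θ (D.edge c 2) <;>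
    cases θ (D.edge c 3) <;> simp

/-- An edge colored a has its head at the crossing that it enters along the knot, an edge colored b
at the crossing that it leaves. Surjectivity suffices, as both sides have 2n elements. -/
theorem headEdge_bijective (hθ : D.IsAdmissible θ) : Function.Bijective (D.headEdge θ) := by
  rcases Nat.eq_zero_or_pos n with h0 | h0
  · subst h0
    refine ⟨fun x => x.1.elim0, fun e => ?_⟩
    obtain ⟨x, -⟩ := D.exists_incoming e
    exact x.1.elim0
  have : NeZero (2 * n) := ⟨by omega⟩
  rw [Fintype.bijective_iff_surjective_and_card]
  refine ⟨fun e => ?_, by simp [ZMod.card, mul_comm]⟩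
  cases he : θ e
  -- The edge is traversed backwards, so its head lies at the passage entered along the preceding
  -- edge.
  · obtain ⟨⟨c, s⟩, hx⟩ := D.exists_incoming (e - 1)
    obtain ⟨h2, h1, h3⟩ := hθ.colors c
    rw [eq_sub_iff_add_eq] at hx
    cases s
    · rw [incoming_false, ← D.under_eq c] at hx
      refine ⟨(c, true), ?_⟩
      rw [← hx] at he
      simp [headEdge, headEnd, ← hx, he] at h2 ⊢
      simp [h2]
    · rw [incoming_true_add_one] at hx
      rw [← hx] at he
      cases hp : D.pos c <;> simp only [hp, if_true, if_false, Bool.false_eq_true] at hx he h1 h3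
      · refine ⟨(c, true), ?_⟩
        simp [headEdge, headEnd, ← hx, ← h3, he]
      · refine ⟨(c, false), ?_⟩
        simp [headEdge, headEnd, ← hx, ← h1, he]
  · obtain ⟨⟨c, s⟩, hx⟩ := D.exists_incoming e
    obtain ⟨h2, h1, h3⟩ := hθ.colors c
    cases s
    · rw [incoming_false] at hx
      refine ⟨(c, false), ?_⟩
      simp [headEdge, headEnd, hx, he]
    · rw [incoming_true] at hx
      rw [← hx] at he
      cases hp : D.pos c <;> simp only [hp, if_true, if_false, Bool.false_eq_true] at hx he h1 h3
      · refine ⟨(c, false), ?_⟩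
        have h0 : θ (D.edge c 0) = false := by simpa [he] using h1
        simp [headEdge, headEnd, ← hx, h0]
      · refine ⟨(c, true), ?_⟩
        have h0 : θ (D.edge c 0) = false := by simpa [he] using h3
        simp [headEdge, headEnd, ← hx, h0]

/-- Exchanging the colors reverses all edges and turns heads into tails. -/
theorem tailEdge_bijective (hθ : D.IsAdmissible θ) : Function.Bijective (D.tailEdge θ) := by
  have hθ' : D.IsAdmissible fun e => !θ e := by
    intro c
    have h := hθ c
    cases hp : D.pos c <;> simp only [hp, if_true, if_false, Bool.false_eq_true] at h ⊢ <;>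
      simpa using h
  convert headEdge_bijective hθ' using 1
  funext x
  cases h : θ (D.edge x.1 0) <;> simp [headEdge, tailEdge, headEnd, tailEnd, h]

/-- The permutation of the edges whose cycles are the circles of the resolution `v`. -/
def circlePerm (hθ : D.IsAdmissible θ) (v : Fin n → Bool) : Equiv.Perm (ZMod (2 * n)) :=
  ((Equiv.ofBijective _ (headEdge_bijective hθ)).symm.trans
    (Equiv.prodShear (Equiv.refl (Fin n)) fun c => Equiv.boolNot.symm ^ (if v c then 1 else 0))).trans
    (Equiv.ofBijective _ (tailEdge_bijective hθ))

theorem circlePerm_headEdge (hθ : D.IsAdmissible θ) (v : Fin n → Bool) (c : Fin n) (β : Bool) :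
    circlePerm hθ v (D.headEdge θ (c, β)) = D.tailEdge θ (c, xor β (v c)) := by
  have h : (Equiv.ofBijective _ (headEdge_bijective hθ)).symm (D.headEdge θ (c, β)) = (c, β) :=
    (Equiv.symm_apply_eq _).2 rfl
  simp only [circlePerm, Equiv.trans_apply, h]
  cases hv : v c <;> simp [hv, Equiv.boolNot]

/-- Each arc of the resolution is one step of the permutation, in the direction of the orientation.
-/
theorem circle_eq_iff_sameCycle (hθ : D.IsAdmissible θ) (v : Fin n → Bool) (e f : ZMod (2 * n)) :
    D.circle v e = D.circle v f ↔ (circlePerm hθ v).SameCycle e f := by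
  constructor
  · intro h
    have h' := Quot.eqvGen_exact h
    clear h
    induction h' with
    | rel e f h =>
      obtain ⟨c, a, rfl, rfl⟩ := h
      obtain ⟨β, ⟨h1, h2⟩ | ⟨h1, h2⟩⟩ := D.exists_end θ c a (v c)
      · refine ⟨1, ?_⟩
        have := circlePerm_headEdge hθ v c β
        rw [headEdge, tailEdge] at this
        simp only at this
        rw [zpow_one, h2, h1, this]
      · refine Equiv.Perm.SameCycle.symm ⟨1, ?_⟩
        have := circlePerm_headEdge hθ v c β
        rw [headEdge, tailEdge] at this
        simp only at this
        rw [zpow_one, h1, this, ← h2]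
    | refl x => exact Equiv.Perm.SameCycle.refl _ _
    | symm x y _ ih => exact ih.symm
    | trans x y z _ _ h1 h2 => exact h1.trans h2
  · rintro ⟨i, rfl⟩
    have h1 : ∀ e, D.circle v (circlePerm hθ v e) = D.circle v e := by
      intro e
      obtain ⟨⟨c, β⟩, rfl⟩ := (headEdge_bijective hθ).2 e
      rw [circlePerm_headEdge, headEdge, tailEdge, ← mate_headEnd, ← circle_mate]
    induction i with
    | zero => simp
    | succ i ih => rw [add_comm, zpow_add, zpow_one, Equiv.Perm.mul_apply, h1, ih]
    | pred i ih =>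
      rw [ih, ← h1 ((circlePerm hθ v ^ (-(i : ℤ) - 1)) e), ← Equiv.Perm.mul_apply, ← zpow_one_add]
      congr 3
      ring

theorem circle_one_three (v : Fin n → Bool) (c : Fin n) :
    D.circle v (D.edge c 1) = D.circle v (D.edge c 3) ↔ D.Joined c v := by
  have h0 := circle_mate (D := D) v c 0
  have h2 := circle_mate (D := D) v c 2
  cases hv : v c <;> simp only [hv, mate, Matrix.cons_val] at h0 h2
  · rw [Joined, h0, h2]
  · rw [Joined, h0, h2, eq_comm]

theorem joined_iff_sameCycle (hθ : D.IsAdmissible θ) (c : Fin n) (v : Fin n → Bool) :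
    D.Joined c v ↔
      (circlePerm hθ v).SameCycle (D.headEdge θ (c, false)) (D.headEdge θ (c, true)) := by
  rw [← circle_eq_iff_sameCycle]
  cases h : θ (D.edge c 0) <;> simp only [headEdge, headEnd, h]
  · exact (circle_one_three v c).symm
  · rfl

/-- The other resolution of c exchanges the tails that follow its two heads. -/
theorem circlePerm_flip (hθ : D.IsAdmissible θ) (c : Fin n) (v : Fin n → Bool) :
    circlePerm hθ (flip c v) =
      circlePerm hθ v * Equiv.swap (D.headEdge θ (c, false)) (D.headEdge θ (c, true)) := by
  ext1 e
  obtain ⟨⟨c', β⟩, rfl⟩ := (headEdge_bijective hθ).2 e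
  rw [Equiv.Perm.mul_apply, circlePerm_headEdge]
  by_cases h : c' = c
  · subst h
    cases β
    · rw [Equiv.swap_apply_left, circlePerm_headEdge, flip_same]
      simp
    · rw [Equiv.swap_apply_right, circlePerm_headEdge, flip_same]
      simp
  · rw [Equiv.swap_apply_of_ne_of_ne, circlePerm_headEdge, flip_ne h] <;>
    · intro h'
      exact h (Prod.ext_iff.1 ((headEdge_bijective hθ).1 h')).1

/-- Multiplication by a transposition always changes whether its two points lie on a common cycle,
so no saddle can preserve the number of circles. -/
theorem IsAdmissible.isOrientable (hθ : D.IsAdmissible θ) : D.IsOrientable := by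
  intro c v
  have := two_mul_ne_zero_of_fin c
  have hne : D.headEdge θ (c, false) ≠ D.headEdge θ (c, true) := fun h => by
    simpa using (headEdge_bijective hθ).1 h
  rw [joined_iff_sameCycle hθ, joined_iff_sameCycle hθ, circlePerm_flip]
  exact ⟨fun h h' => Equiv.Perm.not_sameCycle_mul_swap hne h' h,
    Equiv.Perm.sameCycle_mul_swap⟩

end KnotDiagram

namespace KnotDiagram

variable {n : ℕ} {D : KnotDiagram n}

/-! ## Commuting saddles -/

theorem circle_flip_of_circle {c : Fin n} {v : Fin n → Bool} (hD : D.IsOrientable)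
    (h : ¬ D.Joined c v) {e f : ZMod (2 * n)} (hef : D.circle v e = D.circle v f) :
    D.circle (flip c v) e = D.circle (flip c v) f := by
  have h' := Quot.eqvGen_exact hef
  clear hef
  have hJ : D.circle (flip c v) (D.edge c 0) = D.circle (flip c v) (D.edge c 2) := (hD c v).2 h
  induction h' with
  | rel x y hxy =>
    obtain ⟨c', a, rfl, rfl⟩ := hxy
    by_cases hc : c' = c
    · subst hc
      rcases circle_end (D := D) (flip c' v) c' a with h1 | h1 <;>
      rcases circle_end (D := D) (flip c' v) c' (mate (v c') a) with h2 | h2 <;>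
      simp [h1, h2, hJ]
    · rw [← flip_ne hc v]
      exact circle_mate _ c' a
  | refl x => rfl
  | symm x y _ ih => exact ih.symm
  | trans x y z _ _ h1 h2 => exact h1.trans h2

/-- The circles after a merge. -/
theorem circle_flip_iff {c : Fin n} {v : Fin n → Bool} (hD : D.IsOrientable)
    (h : ¬ D.Joined c v) (e f : ZMod (2 * n)) :
    D.circle (flip c v) e = D.circle (flip c v) f ↔
      D.circle v e = D.circle v f ∨
      (D.circle v e = D.circle v (D.edge c 0) ∧ D.circle v f = D.circle v (D.edge c 2)) ∨
      (D.circle v e = D.circle v (D.edge c 2) ∧ D.circle v f = D.circle v (D.edge c 0)) := by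
  constructor
  · intro hef
    have h' := Quot.eqvGen_exact hef
    clear hef
    induction h' with
    | rel x y hxy =>
      obtain ⟨c', a, rfl, rfl⟩ := hxy
      by_cases hc : c' = c
      · subst hc
        rcases circle_end (D := D) v c' a with h1 | h1 <;>
        rcases circle_end (D := D) v c' (mate (flip c' v c') a) with h2 | h2 <;>
        rw [h1, h2] <;> simp
      · rw [flip_ne hc v]
        exact Or.inl (circle_mate _ c' a)
    | refl x => exact Or.inl rfl
    | symm x y _ ih =>
      rcases ih with h | h | h
      · exact Or.inl h.symm
      · exact Or.inr (Or.inr h.symm)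
      · exact Or.inr (Or.inl h.symm)
    | trans x y z _ _ h1 h2 =>
      rcases h1 with h1 | h1 | h1 <;> rcases h2 with h2 | h2 | h2
      · exact Or.inl (h1.trans h2)
      · exact Or.inr (Or.inl ⟨h1.trans h2.1, h2.2⟩)
      · exact Or.inr (Or.inr ⟨h1.trans h2.1, h2.2⟩)
      · exact Or.inr (Or.inl ⟨h1.1, h2 ▸ h1.2⟩)
      · exact absurd (h2.1.symm.trans h1.2) h
      · exact Or.inl (h1.1.trans h2.2.symm)
      · exact Or.inr (Or.inr ⟨h1.1, h2 ▸ h1.2⟩)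
      · exact Or.inl (h1.1.trans h2.2.symm)
      · exact absurd (h1.2.symm.trans h2.1) h
  · have hJ : D.circle (flip c v) (D.edge c 0) = D.circle (flip c v) (D.edge c 2) := (hD c v).2 h
    rintro (h' | ⟨h1, h2⟩ | ⟨h1, h2⟩)
    · exact circle_flip_of_circle hD h h'
    · rw [circle_flip_of_circle hD h h1, circle_flip_of_circle hD h h2, hJ]
    · rw [circle_flip_of_circle hD h h1, circle_flip_of_circle hD h h2, hJ]

theorem joined_flip_of_joined {c c' : Fin n} {v : Fin n → Bool} (hD : D.IsOrientable)
    (h : ¬ D.Joined c v) (h' : D.Joined c' v) : D.Joined c' (flip c v) :=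
  circle_flip_of_circle hD h h'

theorem joined_of_joined_flip {c c' : Fin n} {v : Fin n → Bool} (hD : D.IsOrientable)
    (h : D.Joined c v) (h' : D.Joined c' (flip c v)) : D.Joined c' v := by
  have := joined_flip_of_joined (v := flip c v) hD (fun h2 => (hD c v).1 h2 h) h'
  rwa [flip_flip] at this

/-- If merging at `c'` joins the two sides of `c`, the two crossings meet the same circles. -/
theorem circles_eq_of_joined_flip {c c' : Fin n} {v : Fin n → Bool} (hD : D.IsOrientable)
    (h' : ¬ D.Joined c' v) (h : ¬ D.Joined c v) (hf : D.Joined c (flip c' v)) :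
    (D.circle v (D.edge c 0) = D.circle v (D.edge c' 0) ∧
      D.circle v (D.edge c 2) = D.circle v (D.edge c' 2)) ∨
    (D.circle v (D.edge c 0) = D.circle v (D.edge c' 2) ∧
      D.circle v (D.edge c 2) = D.circle v (D.edge c' 0)) :=
  ((circle_flip_iff hD h' _ _).1 hf).resolve_left h

theorem gen_dotSum_congr {c c' : Fin n} {v : Fin n → Bool}
    (h : (D.circle v (D.edge c 0) = D.circle v (D.edge c' 0) ∧
      D.circle v (D.edge c 2) = D.circle v (D.edge c' 2)) ∨
    (D.circle v (D.edge c 0) = D.circle v (D.edge c' 2) ∧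
      D.circle v (D.edge c 2) = D.circle v (D.edge c' 0))) :
    D.gen v (D.dotSum c) = D.gen v (D.dotSum c') := by
  rw [gen_eq_gen_iff, dotSum, dotSum, map_add, map_add]
  rcases h with ⟨h1, h2⟩ | ⟨h1, h2⟩
  · rw [algebraMap_X_eq _ h1, algebraMap_X_eq _ h2]
  · rw [algebraMap_X_eq _ h1, algebraMap_X_eq _ h2, add_comm]

/-- Commutativity of the squares of the cube, in all directions of its edges. Merging coarsens the
partition into circles, which rules out the inconsistent patterns of joined corners. In two of the
remaining patterns the sides are the dot sums of different crossings; there both crossings meet the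
same two circles. -/
theorem gen_coef_comm (hD : D.IsOrientable) {c c' : Fin n} (v : Fin n → Bool) :
    D.gen (flip c (flip c' v)) (D.coef c (flip c' v) * D.coef c' v) =
      D.gen (flip c' (flip c v)) (D.coef c' (flip c v) * D.coef c v) := by
  rw [flip_comm c' c]
  by_cases hA : D.Joined c v <;> by_cases hB : D.Joined c (flip c' v) <;>
  by_cases hA' : D.Joined c' v <;> by_cases hB' : D.Joined c' (flip c v)
  · rw [coef_joined _ hA, coef_joined _ hB, coef_joined _ hA', coef_joined _ hB',
      mul_comm (D.dotSum c)]
  · exact absurd hA' fun h => hB' (by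
      have h2 := joined_flip_of_joined (v := flip c' (flip c v)) (c := c') (c' := c') hD
      have h3 : ¬ D.Joined c (flip c (flip c' v)) := fun h4 => (hD c _).1 h4 hB
      have h4 : ¬ D.Joined c (flip c' (flip c v)) := by rwa [flip_comm]
      have h5 : ¬ D.Joined c (flip c v) := fun h6 => (hD c _).1 h6 hA
      have h6 : D.Joined c' (flip c' (flip c v)) := (hD c' _).2 hB'
      have h7 : D.Joined c' (flip c (flip c' (flip c v))) := joined_flip_of_joined hD h4 h6
      rw [flip_comm c c', flip_flip] at h7
      exact absurd h ((hD c' v).1 h7))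
  · exact absurd (joined_of_joined_flip hD hA hB') hA'
  · rw [coef_joined _ hA, coef_joined _ hB, coef_not_joined _ hA', coef_not_joined _ hB',
      mul_one, one_mul]
  · have h5 : ¬ D.Joined c (flip c v) := fun h6 => (hD c _).1 h6 hA
    have h6 : D.Joined c (flip c (flip c' v)) := (hD c _).2 hB
    rw [flip_comm] at h6
    exact absurd (joined_of_joined_flip hD hB' h6) h5
  · have h5 : ¬ D.Joined c (flip c v) := fun h6 => (hD c _).1 h6 hA
    have h6 : D.Joined c (flip c (flip c' v)) := (hD c _).2 hB
    rw [flip_comm] at h6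
    rw [coef_joined _ hA, coef_not_joined _ hB, coef_joined _ hA', coef_not_joined _ hB', one_mul,
      one_mul, flip_comm]
    have h7 := circles_eq_of_joined_flip hD hB' h5 h6
    have h8 := gen_dotSum_congr (v := flip c' (flip c v)) (D := D) (c := c) (c' := c') (by
      rcases h7 with h7 | h7
      · exact Or.inl ⟨circle_flip_of_circle hD hB' h7.1, circle_flip_of_circle hD hB' h7.2⟩
      · exact Or.inr ⟨circle_flip_of_circle hD hB' h7.1, circle_flip_of_circle hD hB' h7.2⟩)
    exact h8.symm
  · exact absurd (joined_of_joined_flip hD hA hB') hA'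
  · exact absurd (joined_flip_of_joined hD hA' hA) hB
  · exact absurd (joined_of_joined_flip hD hA' hB) hA
  · exact absurd (joined_of_joined_flip hD hA' hB) hA
  · have h5 : D.Joined c (flip c v) := (hD c _).2 hA
    have h6 : ¬ D.Joined c (flip c (flip c' v)) := fun h => (hD c _).1 h hB
    have h6' : ¬ D.Joined c' (flip c (flip c' v)) := by
      rw [flip_comm]
      exact fun h => (hD c' _).1 h hB'
    have h7 := circles_eq_of_joined_flip hD h6' h6 (by rwa [flip_comm c c', flip_flip])
    rw [coef_not_joined _ hA, coef_joined _ hB, coef_not_joined _ hA', coef_joined _ hB',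
      mul_one, mul_one]
    exact gen_dotSum_congr h7
  · have h5 : D.Joined c (flip c v) := (hD c _).2 hA
    have h6 : ¬ D.Joined c (flip c (flip c' v)) := fun h => (hD c _).1 h hB
    rw [flip_comm] at h6
    exact absurd (joined_flip_of_joined hD hB' h5) h6
  · rw [coef_not_joined _ hA, coef_not_joined _ hB, coef_joined _ hA', coef_joined _ hB',
      one_mul, mul_one]
  · exact absurd (joined_flip_of_joined hD hA hA') hB'
  · have h5 : D.Joined c' (flip c' (flip c v)) → False := fun h => (hD c' _).1 h hB'
    have h6 : D.Joined c' (flip c' v) := (hD c' _).2 hA'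
    have h7 := joined_flip_of_joined hD hB h6
    rw [flip_comm] at h7
    exact (h5 h7).elim
  · rw [coef_not_joined _ hA, coef_not_joined _ hB, coef_not_joined _ hA',
      coef_not_joined _ hB']

/-- Of the saddles to and fro, one is a merge and the other a split. -/
theorem gen_coef_coef (hD : D.IsOrientable) (c : Fin n) (v : Fin n → Bool) :
    D.coef c (flip c v) * D.coef c v = D.dotSum c := by
  by_cases h : D.Joined c v
  · rw [coef_joined _ h, coef_not_joined _ fun h' => (hD c v).1 h' h, one_mul]
  · rw [coef_not_joined _ h, coef_joined _ ((hD c v).2 h), mul_one]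

end KnotDiagram

namespace KnotDiagram

variable {n : ℕ} {D : KnotDiagram n}

/-! ## The differential and the dot-sliding homotopies -/

theorem sign_eq_prod (c : Fin n) (v : Fin n → Bool) :
    sign c v = ∏ c' : Fin n, if c' < c ∧ v c' = true then -1 else 1 := by
  rw [sign, Finset.prod_ite, Finset.prod_const_one, mul_one, Finset.prod_const]

theorem sign_flip_same (c : Fin n) (v : Fin n → Bool) : sign c (flip c v) = sign c v := by
  rw [sign_eq_prod, sign_eq_prod]
  refine Finset.prod_congr rfl fun c' _ => ?_
  by_cases h : c' = c
  · subst h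
    simp
  · rw [flip_ne h]

theorem sign_flip_of_lt {c c' : Fin n} (h : c < c') (v : Fin n → Bool) :
    sign c (flip c' v) = sign c v := by
  rw [sign_eq_prod, sign_eq_prod]
  refine Finset.prod_congr rfl fun a _ => ?_
  by_cases ha : a = c'
  · subst ha
    simp [h.not_gt]
  · rw [flip_ne ha]

theorem sign_flip_of_gt {c c' : Fin n} (h : c' < c) (v : Fin n → Bool) :
    sign c (flip c' v) = -sign c v := by
  rw [sign_eq_prod, sign_eq_prod, ← Finset.mul_prod_erase _ _ (Finset.mem_univ c'),
    ← Finset.mul_prod_erase _ (fun a => if a < c ∧ v a = true then (-1 : ℤ) else 1)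
      (Finset.mem_univ c'), ← neg_mul]
  congr 1
  · cases hv : v c' <;> simp [h, hv]
  · refine Finset.prod_congr rfl fun a ha => ?_
    rw [flip_ne (Finset.ne_of_mem_erase ha)]

theorem sign_mul_self (c : Fin n) (v : Fin n → Bool) : sign c v * sign c v = 1 := by
  rw [sign, ← mul_pow]
  simp

theorem sign_anticomm {c c' : Fin n} (h : c ≠ c') (v : Fin n → Bool) :
    sign c (flip c' v) * sign c' v = -(sign c' (flip c v) * sign c v) := by
  rcases lt_or_gt_of_ne h with h | h
  · rw [sign_flip_of_lt h, sign_flip_of_gt h]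
    ring
  · rw [sign_flip_of_lt h, sign_flip_of_gt h]
    ring

theorem edgeMap_edgeMap_gen (hD : D.IsOrientable) (c c' : Fin n) (b b' : Bool)
    (v : Fin n → Bool) :
    D.edgeMap c b (D.edgeMap c' b' (D.gen v 1)) =
      if v c' = b' ∧ flip c' v c = b then
        (sign c (flip c' v) * sign c' v) •
          D.gen (flip c (flip c' v)) (D.coef c (flip c' v) * D.coef c' v) else 0 := by
  rw [edgeMap_gen hD, mul_one]
  by_cases h1 : v c' = b'
  · rw [if_pos h1, map_zsmul, edgeMap_gen hD]
    by_cases h2 : flip c' v c = b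
    · rw [if_pos h2, if_pos ⟨h1, h2⟩, smul_smul, mul_comm (sign c' v)]
    · rw [if_neg h2, if_neg fun h => h2 h.2, smul_zero]
  · rw [if_neg h1, if_neg fun h => h1 h.1, map_zero]

/-- The directions are arbitrary, so this covers two parts of d, two homotopies, and a part of d
with the homotopy of another crossing. -/
theorem edgeMap_anticomm (hD : D.IsOrientable) {c c' : Fin n} (h : c ≠ c') (b b' : Bool) :
    D.edgeMap c b ∘ₗ D.edgeMap c' b' = -(D.edgeMap c' b' ∘ₗ D.edgeMap c b) := by
  refine hom_ext fun v => ?_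
  rw [LinearMap.neg_apply, LinearMap.comp_apply, LinearMap.comp_apply, edgeMap_edgeMap_gen hD,
    edgeMap_edgeMap_gen hD, flip_ne h, flip_ne h.symm, gen_coef_comm hD, sign_anticomm h]
  by_cases h1 : v c' = b' <;> by_cases h2 : v c = b <;> simp [h1, h2]

theorem edgeMap_comp_self (hD : D.IsOrientable) (c : Fin n) (b : Bool) :
    D.edgeMap c b ∘ₗ D.edgeMap c b = 0 := by
  refine hom_ext fun v => ?_
  rw [LinearMap.comp_apply, edgeMap_edgeMap_gen hD, if_neg, LinearMap.zero_apply]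
  rintro ⟨h1, h2⟩
  rw [flip_same, h1] at h2
  simp at h2

theorem dotSlide_anticomm (hD : D.IsOrientable) (c c' : Fin n) :
    D.dotSlide c ∘ₗ D.dotSlide c' = -(D.dotSlide c' ∘ₗ D.dotSlide c) := by
  by_cases h : c = c'
  · subst h
    rw [dotSlide, edgeMap_comp_self hD, neg_zero]
  · exact edgeMap_anticomm hD h _ _

theorem dotSlide_comp_self (hD : D.IsOrientable) (c : Fin n) :
    D.dotSlide c ∘ₗ D.dotSlide c = 0 := edgeMap_comp_self hD c true

/-- On each resolution exactly one of the two composites is nonzero. It is a merge and a split in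
some order, with equal signs, hence multiplication by the dot sum. -/
theorem edgeMap_comp_dotSlide_self (hD : D.IsOrientable) (c : Fin n) :
    D.edgeMap c false ∘ₗ D.dotSlide c + D.dotSlide c ∘ₗ D.edgeMap c false =
      D.dotSum c • LinearMap.id := by
  refine hom_ext fun v => ?_
  rw [LinearMap.add_apply, LinearMap.comp_apply, LinearMap.comp_apply, dotSlide,
    edgeMap_edgeMap_gen hD, edgeMap_edgeMap_gen hD, sign_flip_same, sign_mul_self, flip_flip,
    gen_coef_coef hD, LinearMap.smul_apply, LinearMap.id_apply, smul_gen, mul_one, flip_same]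
  cases h : v c <;> simp

theorem sum_comp {ι : Type*} (s : Finset ι) (F : ι → D.Chain →ₗ[D.Dots] D.Chain)
    (G : D.Chain →ₗ[D.Dots] D.Chain) : (∑ i ∈ s, F i) ∘ₗ G = ∑ i ∈ s, F i ∘ₗ G :=
  Finset.sum_mul s F (G : Module.End D.Dots D.Chain)

theorem comp_sum {ι : Type*} (s : Finset ι) (F : ι → D.Chain →ₗ[D.Dots] D.Chain)
    (G : D.Chain →ₗ[D.Dots] D.Chain) : G ∘ₗ (∑ i ∈ s, F i) = ∑ i ∈ s, G ∘ₗ F i :=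
  Finset.mul_sum s F (G : Module.End D.Dots D.Chain)

theorem diff_comp_dotSlide (hD : D.IsOrientable) (c : Fin n) :
    D.diff ∘ₗ D.dotSlide c + D.dotSlide c ∘ₗ D.diff = D.dotSum c • LinearMap.id := by
  rw [diff, sum_comp, comp_sum, ← Finset.sum_add_distrib,
    Finset.sum_eq_single c]
  · exact edgeMap_comp_dotSlide_self hD c
  · intro c' _ h
    rw [dotSlide, edgeMap_anticomm hD h, neg_add_cancel]
  · simp

theorem diff_comp_diff (hD : D.IsOrientable) : D.diff ∘ₗ D.diff = 0 := by
  -- Exchanging the two summations turns each term into its negative; over ℚ an element equal to its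
  -- negative is zero.
  have h : D.diff ∘ₗ D.diff = -(D.diff ∘ₗ D.diff) := by
    rw [diff, sum_comp]
    simp only [comp_sum]
    rw [← Finset.sum_neg_distrib]
    rw [Finset.sum_comm]
    refine Finset.sum_congr rfl fun c _ => ?_
    rw [← Finset.sum_neg_distrib]
    refine Finset.sum_congr rfl fun c' _ => ?_
    by_cases h : c' = c
    · subst h
      rw [edgeMap_comp_self hD, neg_zero]
    · exact edgeMap_anticomm hD h _ _
  refine LinearMap.ext fun x => ?_
  have hx : (D.diff ∘ₗ D.diff) x = -(D.diff ∘ₗ D.diff) x := LinearMap.congr_fun h x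
  generalize (D.diff ∘ₗ D.diff) x = y at hx ⊢
  have h2 : (2 : ℚ) • y = 0 := by
    rw [two_smul]
    nth_rewrite 1 [hx]
    exact neg_add_cancel y
  exact (smul_eq_zero.1 h2).resolve_left two_ne_zero

theorem diff_diff (hD : D.IsOrientable) (x : D.Chain) : D.diff (D.diff x) = 0 :=
  LinearMap.congr_fun (diff_comp_diff hD) x

theorem diff_dotSlide (hD : D.IsOrientable) (c : Fin n) (x : D.Chain) :
    D.diff (D.dotSlide c x) = D.dotSum c • x - D.dotSlide c (D.diff x) :=
  eq_sub_of_add_eq (LinearMap.congr_fun (diff_comp_dotSlide hD c) x)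

/-! ## Sliding dots through a crossing -/

theorem algebraMap_X_one_three (c : Fin n) (v : Fin n → Bool) :
    (algebraMap D.Dots (D.Res v) (MvPolynomial.X (D.edge c 1)) =
        algebraMap D.Dots (D.Res v) (MvPolynomial.X (D.edge c 0)) ∧
      algebraMap D.Dots (D.Res v) (MvPolynomial.X (D.edge c 3)) =
        algebraMap D.Dots (D.Res v) (MvPolynomial.X (D.edge c 2))) ∨
    (algebraMap D.Dots (D.Res v) (MvPolynomial.X (D.edge c 1)) =
        algebraMap D.Dots (D.Res v) (MvPolynomial.X (D.edge c 2)) ∧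
      algebraMap D.Dots (D.Res v) (MvPolynomial.X (D.edge c 3)) =
        algebraMap D.Dots (D.Res v) (MvPolynomial.X (D.edge c 0))) := by
  have h1 := circle_mate (D := D) v c 1
  have h3 := circle_mate (D := D) v c 3
  cases hv : v c <;> simp only [hv, mate, Matrix.cons_val] at h1 h3
  · exact Or.inl ⟨algebraMap_X_eq _ h1, algebraMap_X_eq _ h3⟩
  · exact Or.inr ⟨algebraMap_X_eq _ h1, algebraMap_X_eq _ h3⟩

theorem smul_ext {f g : D.Dots}
    (h : ∀ v, algebraMap D.Dots (D.Res v) f = algebraMap D.Dots (D.Res v) g) (x : D.Chain) :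
    f • x = g • x := by
  funext v
  rw [Pi.smul_apply, Pi.smul_apply, Algebra.smul_def, Algebra.smul_def, h]

theorem incoming_cases (x : Fin n × Bool) :
    (D.incoming x = D.edge x.1 0 ∧ D.incoming x + 1 = D.edge x.1 2) ∨
    (D.incoming x = D.edge x.1 1 ∧ D.incoming x + 1 = D.edge x.1 3) ∨
    (D.incoming x = D.edge x.1 3 ∧ D.incoming x + 1 = D.edge x.1 1) := by
  obtain ⟨c, s⟩ := x
  cases s
  · exact Or.inl ⟨rfl, (D.under_eq c).symm⟩
  · have h1 := D.incoming_true c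
    have h2 := D.incoming_true_add_one c
    cases hp : D.pos c <;> simp only [hp, if_true, if_false, Bool.false_eq_true] at h1 h2
    · exact Or.inr (Or.inl ⟨h1, h2⟩)
    · exact Or.inr (Or.inr ⟨h1, h2⟩)

/-- The ends 1 and 3 carry the same two dots as 0 and 2, in some order, so the dot sum can be read
off from the two edges of either passage. -/
theorem dotSum_smul_eq (x : Fin n × Bool) (y : D.Chain) :
    D.dotSum x.1 • y = (MvPolynomial.X (D.incoming x) + MvPolynomial.X (D.incoming x + 1) :
      D.Dots) • y := by
  refine smul_ext (fun v => ?_) y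
  rw [dotSum, map_add, map_add]
  rcases D.incoming_cases x with ⟨h1, h2⟩ | ⟨h1, h2⟩ | ⟨h1, h2⟩ <;> rw [h2, h1] <;>
    rcases algebraMap_X_one_three (D := D) x.1 v with ⟨h3, h4⟩ | ⟨h3, h4⟩ <;>
    simp only [h3, h4] <;> ring

/-- After a merge the two dots agree; after a split the coefficient is X + Y, and (X - Y)(X + Y) =
X² - Y² = 0. -/
theorem dots_gen_coef (hD : D.IsOrientable) (c : Fin n) (v : Fin n → Bool) :
    algebraMap D.Dots (D.Res (flip c v)) ((MvPolynomial.X (D.edge c 0) -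
      MvPolynomial.X (D.edge c 2)) * D.coef c v) = 0 := by
  by_cases h : D.Joined c v
  · have h1 := D.algebraMap_X_sq (flip c v) (D.edge c 0)
    have h2 := D.algebraMap_X_sq (flip c v) (D.edge c 2)
    rw [coef_joined _ h, dotSum, map_mul, map_sub, map_add]
    linear_combination h1 - h2
  · have h1 : D.Joined c (flip c v) := (hD c v).2 h
    rw [coef_not_joined _ h, mul_one, map_sub, D.algebraMap_X_eq h1, sub_self]

/-- The dots on the two sides of a passage agree on the image of the dot-sliding homotopy. -/
theorem X_smul_dotSlide (hD : D.IsOrientable) (x : Fin n × Bool) (y : D.Chain) :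
    (MvPolynomial.X (D.incoming x) : D.Dots) • D.dotSlide x.1 y =
      (MvPolynomial.X (D.incoming x + 1) : D.Dots) • D.dotSlide x.1 y := by
  rw [← sub_eq_zero, ← sub_smul]
  have key : (MvPolynomial.X (D.incoming x) - MvPolynomial.X (D.incoming x + 1) : D.Dots) •
      D.dotSlide x.1 = 0 := by
    refine hom_ext fun v => ?_
    rw [LinearMap.smul_apply, dotSlide, edgeMap_gen hD, LinearMap.zero_apply, mul_one]
    split_ifs with hv
    · rw [smul_comm, smul_gen, (gen_eq_zero_iff D).2, smul_zero]
      have h0 := dots_gen_coef hD x.1 v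
      rw [map_mul, map_sub] at h0 ⊢
      rcases D.incoming_cases x with ⟨h1, h2⟩ | ⟨h1, h2⟩ | ⟨h1, h2⟩ <;> rw [h2, h1]
      · exact h0
      · rcases algebraMap_X_one_three (D := D) x.1 (flip x.1 v) with ⟨h3, h4⟩ | ⟨h3, h4⟩ <;>
          rw [h3, h4]
        · exact h0
        · linear_combination -h0
      · rcases algebraMap_X_one_three (D := D) x.1 (flip x.1 v) with ⟨h3, h4⟩ | ⟨h3, h4⟩ <;>
          rw [h3, h4]
        · linear_combination -h0
        · exact h0
    · rw [smul_zero]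
  exact LinearMap.congr_fun key y

end KnotDiagram

/-! ## Sums over pairs in a ring -/

section PairSum

variable {A : Type*} [Ring A]

/-- The sum of `u i * u j` over all `i < j < m`. -/
def pairSum (u : ℕ → A) (m : ℕ) : A := ∑ j ∈ Finset.range m, (∑ i ∈ Finset.range j, u i) * u j

theorem pairSum_succ (u : ℕ → A) (m : ℕ) :
    pairSum u (m + 1) = pairSum u m + (∑ i ∈ Finset.range m, u i) * u m :=
  Finset.sum_range_succ _ _

theorem pairSum_eq_sum_ite (u : ℕ → A) (m : ℕ) :
    pairSum u m = ∑ i ∈ Finset.range m, ∑ j ∈ Finset.range m, if i < j then u i * u j else 0 := by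
  rw [Finset.sum_comm, pairSum]
  refine Finset.sum_congr rfl fun j hj => ?_
  rw [Finset.sum_mul, ← Finset.sum_filter]
  refine Finset.sum_congr ?_ fun _ _ => rfl
  ext i
  have := Finset.mem_range.1 hj
  simp only [Finset.mem_range, Finset.mem_filter]
  omega

theorem pairSum_congr {u w : ℕ → A} {m : ℕ} (h : ∀ i j, u i * u j = w i * w j) :
    pairSum u m = pairSum w m := by
  rw [pairSum_eq_sum_ite, pairSum_eq_sum_ite]
  simp only [h]

/-- The sum over pairs does not change under cyclic shifts, if the sum of all elements is zero. -/
theorem pairSum_shift {u : ℕ → A} {m : ℕ} (hp : u m = u 0)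
    (hs : ∑ i ∈ Finset.range m, u i = 0) :
    pairSum (fun j => u (j + 1)) m = pairSum u m := by
  -- The pairs among k shifted terms are the pairs among the first k + 1 terms that do not involve u
  -- 0.
  have key : ∀ k, pairSum (fun j => u (j + 1)) k =
      pairSum u (k + 1) - u 0 * ∑ j ∈ Finset.range k, u (j + 1) := by
    intro k
    induction k with
    | zero => simp [pairSum]
    | succ k ih =>
      have e1 : ∑ i ∈ Finset.range (k + 1), u i = ∑ i ∈ Finset.range k, u (i + 1) + u 0 :=
        Finset.sum_range_succ' u k
      have e2 : ∑ i ∈ Finset.range (k + 1), u (i + 1) =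
          ∑ i ∈ Finset.range k, u (i + 1) + u (k + 1) :=
        Finset.sum_range_succ (fun i => u (i + 1)) k
      rw [pairSum_succ, ih, pairSum_succ _ (k + 1), e1, e2]
      noncomm_ring
  have h1 : ∑ j ∈ Finset.range m, u (j + 1) = 0 := by
    have h2 := Finset.sum_range_succ u m
    rw [hs, Finset.sum_range_succ', hp, zero_add] at h2
    exact add_eq_right.1 h2
  rw [key, pairSum_succ, hs, h1]
  simp

/-- If the anticommutators of `d` with the `u j` telescope, `d` commutes with the sum over
pairs. -/
theorem commute_pairSum {d : A} {u P : ℕ → A} {m : ℕ} (hP : ∀ i a, P i * a = a * P i)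
    (hd : ∀ i, d * u i + u i * d = P i - P (i + 1)) (hu : ∀ i, (P i + P (i + 1)) * u i = 0)
    (hs : ∑ i ∈ Finset.range m, u i = 0) : d * pairSum u m = pairSum u m * d := by
  have hS : ∀ k, d * (∑ i ∈ Finset.range k, u i) + (∑ i ∈ Finset.range k, u i) * d =
      P 0 - P k := by
    intro k
    induction k with
    | zero => simp
    | succ k ih =>
      have e : d * (∑ i ∈ Finset.range (k + 1), u i) + (∑ i ∈ Finset.range (k + 1), u i) * d =
          (d * (∑ i ∈ Finset.range k, u i) + (∑ i ∈ Finset.range k, u i) * d) +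
          (d * u k + u k * d) := by
        rw [Finset.sum_range_succ]
        noncomm_ring
      rw [e, ih, hd]
      abel
  -- The new summand contributes (P 0 - P k) u k, and the partial sum times P (k + 1) - P k. By
  -- `hu`, - P k can be replaced by P (k + 1) in front of u k, which completes the induction.
  have key : ∀ k, d * pairSum u k - pairSum u k * d =
      (P 0 + P k) * ∑ i ∈ Finset.range k, u i := by
    intro k
    induction k with
    | zero => simp [pairSum]
    | succ k ih =>
      have e1 : d * pairSum u (k + 1) - pairSum u (k + 1) * d =
          (d * pairSum u k - pairSum u k * d) +
          (d * (∑ i ∈ Finset.range k, u i) + (∑ i ∈ Finset.range k, u i) * d) * u k -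
          (∑ i ∈ Finset.range k, u i) * (d * u k + u k * d) := by
        rw [pairSum_succ]
        noncomm_ring
      rw [e1, ih, hS, hd, mul_sub, ← hP k, ← hP (k + 1), Finset.sum_range_succ]
      have e2 := hu k
      have e3 : P (k + 1) * u k = -(P k * u k) := by
        rw [add_mul, add_comm] at e2
        exact eq_neg_of_add_eq_zero_left e2
      rw [mul_add, add_mul (P 0) (P (k + 1)) (u k), e3]
      noncomm_ring
  have h := key m
  rw [hs, mul_zero] at h
  exact sub_eq_zero.1 h

end PairSum

namespace KnotDiagram

variable {n : ℕ} {D : KnotDiagram n} {θ : ZMod (2 * n) → Bool}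

/-! ## The operator `e` -/

theorem IsAdmissible.color_add_one (hθ : D.IsAdmissible θ) (e : ZMod (2 * n)) :
    θ (e + 1) = !θ e := by
  obtain ⟨⟨c, s⟩, rfl⟩ := D.exists_incoming e
  obtain ⟨h2, h1, h3⟩ := hθ.colors c
  rcases D.incoming_cases (c, s) with ⟨h, h'⟩ | ⟨h, h'⟩ | ⟨h, h'⟩ <;> rw [h', h] <;> simp only
  · exact h2
  · rw [h1, h3]
    cases D.pos c <;> simp
  · rw [h1, h3]
    cases D.pos c <;> simp

theorem IsAdmissible.colorSign_add_one (hθ : D.IsAdmissible θ) (e : ZMod (2 * n)) :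
    colorSign θ (e + 1) = -colorSign θ e := by
  rw [colorSign, colorSign, hθ.color_add_one]
  cases θ e <;> simp

theorem IsAdmissible.colorSign_add_natCast (hθ : D.IsAdmissible θ) (e : ZMod (2 * n)) (j : ℕ) :
    colorSign θ (e + j) = colorSign θ e * (-1) ^ j := by
  induction j with
  | zero => simp
  | succ j ih =>
    push_cast
    rw [← add_assoc, hθ.colorSign_add_one, ih]
    ring

/-- The passage of the knot that starts on the edge `e`. -/
def passage (D : KnotDiagram n) (e : ZMod (2 * n)) : Fin n × Bool := (D.exists_incoming e).choose

theorem incoming_passage (e : ZMod (2 * n)) : D.incoming (D.passage e) = e :=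
  (D.exists_incoming e).choose_spec

theorem passage_incoming (x : Fin n × Bool) : D.passage (D.incoming x) = x :=
  D.incoming_bijective.1 (D.incoming_passage (D.incoming x))

/-- The dot-sliding homotopy of the passage that starts on the edge `e`, with the sign of the color
of `e`. -/
def signedSlide (D : KnotDiagram n) (θ : ZMod (2 * n) → Bool) (e : ZMod (2 * n)) :
    Module.End D.Dots D.Chain :=
  colorSign θ e • D.dotSlide (D.passage e).1

theorem sum_passages {M : Type*} [AddCommMonoid M] (b : ZMod (2 * n)) (G : ℕ → M) :
    ∑ x : Fin n × Bool, G (D.time b x) = ∑ i ∈ Finset.range (2 * n), G i := by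
  rcases Nat.eq_zero_or_pos n with h0 | h0
  · subst h0
    simp
  have : NeZero (2 * n) := ⟨by omega⟩
  refine Finset.sum_nbij' (fun x => D.time b x) (fun i => D.passage (b + i)) ?_ ?_ ?_ ?_ ?_
  · intro x _
    exact Finset.mem_range.2 (ZMod.val_lt _)
  · intro i _
    exact Finset.mem_univ _
  · intro x _
    rw [time, ZMod.natCast_zmod_val, add_sub_cancel, passage_incoming]
  · intro i hi
    rw [time, incoming_passage, add_sub_cancel_left, ZMod.val_natCast,
      Nat.mod_eq_of_lt (Finset.mem_range.1 hi)]
  · intro x _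
    rfl

theorem eChain_eq_pairSum (θ : ZMod (2 * n) → Bool) (b : ZMod (2 * n)) :
    D.eChain θ b = pairSum (fun j : ℕ => D.signedSlide θ (b + j)) (2 * n) := by
  rcases Nat.eq_zero_or_pos n with h0 | h0
  · subst h0
    simp [eChain, pairSum]
  have : NeZero (2 * n) := ⟨by omega⟩
  have hb : ∀ x, D.signedSlide θ (b + (D.time b x : ℕ)) =
      colorSign θ (D.incoming x) • D.dotSlide x.1 := by
    intro x
    rw [time, ZMod.natCast_zmod_val, add_sub_cancel, signedSlide, passage_incoming]
  rw [pairSum_eq_sum_ite, ← sum_passages (D := D) b, eChain]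
  refine Finset.sum_congr rfl fun x _ => ?_
  rw [← sum_passages (D := D) b]
  refine Finset.sum_congr rfl fun y _ => ?_
  rw [hb, hb, smul_mul_smul_comm]
  rfl

/-- The two passages of a crossing start on edges of different colors, so each homotopy occurs twice
with opposite signs. -/
theorem IsAdmissible.sum_signedSlide (hθ : D.IsAdmissible θ) (b : ZMod (2 * n)) :
    ∑ j ∈ Finset.range (2 * n), D.signedSlide θ (b + (j : ℕ)) = 0 := by
  rcases Nat.eq_zero_or_pos n with h0 | h0
  · subst h0
    simp
  have : NeZero (2 * n) := ⟨by omega⟩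
  rw [← sum_passages (D := D) b fun j => D.signedSlide θ (b + (j : ℕ)), Fintype.sum_prod_type]
  refine Finset.sum_eq_zero fun c _ => ?_
  have hb : ∀ x, D.signedSlide θ (b + (D.time b x : ℕ)) =
      colorSign θ (D.incoming x) • D.dotSlide x.1 := by
    intro x
    rw [time, ZMod.natCast_zmod_val, add_sub_cancel, signedSlide, passage_incoming]
  rw [Fintype.sum_bool, hb, hb, ← add_smul]
  have h : colorSign θ (D.incoming (c, true)) + colorSign θ (D.incoming (c, false)) = 0 := by
    obtain ⟨h2, h1, h3⟩ := hθ.colors c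
    rw [incoming_true, incoming_false, colorSign, colorSign]
    cases hp : D.pos c <;> simp only [hp, if_true, if_false, Bool.false_eq_true] at h1 h3 ⊢
    · rw [h1]
      cases θ (D.edge c 0) <;> simp
    · rw [h3]
      cases θ (D.edge c 0) <;> simp
  rw [h, zero_smul]

/-- The operator `e` depends neither on the base point nor on the coloring. -/
theorem IsAdmissible.eChain_eq (hθ : D.IsAdmissible θ) (b : ZMod (2 * n)) :
    D.eChain θ b = pairSum (fun j : ℕ => ((-1 : ℤ) ^ j • D.dotSlide (D.passage (j : ℕ)).1 :
      Module.End D.Dots D.Chain)) (2 * n) := by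
  rcases Nat.eq_zero_or_pos n with h0 | h0
  · subst h0
    simp [eChain, pairSum]
  have : NeZero (2 * n) := ⟨by omega⟩
  have h1 : ∀ k : ℕ, D.eChain θ (k : ℕ) = D.eChain θ 0 := by
    intro k
    induction k with
    | zero => simp
    | succ k ih =>
      rw [← ih, eChain_eq_pairSum, eChain_eq_pairSum,
        ← pairSum_shift (u := fun j : ℕ => D.signedSlide θ ((k : ℕ) + (j : ℕ)))]
      · congr 1
        funext j
        congr 1
        push_cast
        ring
      · simp only [ZMod.natCast_self, Nat.cast_zero]
      · exact hθ.sum_signedSlide _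
  have h2 := h1 b.val
  rw [ZMod.natCast_zmod_val] at h2
  rw [h2, eChain_eq_pairSum]
  -- Colors alternate along the knot, so the coloring is determined by its sign on the edge 0, and
  -- this sign occurs squared.
  refine pairSum_congr fun i j => ?_
  simp only [signedSlide, zero_add]
  rw [smul_mul_smul_comm, smul_mul_smul_comm]
  congr 1
  have h3 := hθ.colorSign_add_natCast 0 i
  have h4 := hθ.colorSign_add_natCast 0 j
  rw [zero_add] at h3 h4
  rw [h3, h4]
  have h5 : colorSign θ 0 * colorSign θ 0 = 1 := by
    rw [colorSign]
    cases θ 0 <;> simp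
  linear_combination ((-1 : ℤ) ^ i * (-1) ^ j) * h5

/-- Take for P the dot on the edge before a passage, signed by its color. As colors alternate, the
homotopy relation X_e + X_{e+1} becomes a telescoping difference, and the equality of the two dots
on the image of χ becomes the condition on P i + P (i + 1). -/
theorem IsAdmissible.diff_comp_eChain (hθ : D.IsAdmissible θ) (b : ZMod (2 * n)) :
    D.diff ∘ₗ D.eChain θ b = D.eChain θ b ∘ₗ D.diff := by
  have hD := hθ.isOrientable
  rw [eChain_eq_pairSum]
  refine commute_pairSum (A := Module.End D.Dots D.Chain)
    (P := fun j : ℕ => (colorSign θ (b + j) : ℤ) • (MvPolynomial.X (b + j) : D.Dots) •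
      (LinearMap.id : D.Chain →ₗ[D.Dots] D.Chain)) ?_ ?_ ?_ (hθ.sum_signedSlide b)
  · intro i a
    refine LinearMap.ext fun x => ?_
    simp only [Module.End.mul_apply, LinearMap.smul_apply, LinearMap.id_apply, map_zsmul, map_smul]
  · intro i
    refine LinearMap.ext fun x => ?_
    have h := diff_dotSlide hD (D.passage (b + i)).1 x
    rw [dotSum_smul_eq, incoming_passage] at h
    simp only [Nat.cast_add, Nat.cast_one, ← add_assoc]
    rw [hθ.colorSign_add_one, signedSlide]
    simp only [Module.End.mul_apply, LinearMap.smul_apply, LinearMap.id_apply, map_zsmul,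
      LinearMap.add_apply, LinearMap.sub_apply, h, add_smul]
    module
  · intro i
    refine LinearMap.ext fun x => ?_
    have h := X_smul_dotSlide hD (D.passage (b + i)) x
    rw [incoming_passage] at h
    simp only [Nat.cast_add, Nat.cast_one, ← add_assoc]
    rw [hθ.colorSign_add_one, signedSlide]
    simp only [Module.End.mul_apply, LinearMap.smul_apply, LinearMap.id_apply,
      LinearMap.add_apply, LinearMap.zero_apply]
    rw [smul_comm _ (colorSign θ (b + i)), h, smul_comm (MvPolynomial.X _) (colorSign θ (b + i)),
      ← add_smul, add_neg_cancel, zero_smul]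

end KnotDiagram

namespace KnotDiagram

variable {n : ℕ} {D : KnotDiagram n}

/-! ## The algebra of a resolution -/

theorem algebraMap_eq_zero_iff {v : Fin n → Bool} {f : D.Dots} :
    algebraMap D.Dots (D.Res v) f = 0 ↔ f ∈ D.circleIdeal v :=
  Ideal.Quotient.eq_zero_iff_mem

/-- A ring homomorphism kills the ideal of a resolution if it kills the generators. -/
theorem map_eq_zero_of_mem_circleIdeal {v : Fin n → Bool} {A : Type*} [Ring A]
    (F : D.Dots →+* A) (h0 : ∀ e, F (MvPolynomial.X e) ^ 2 = 0)
    (h1 : ∀ e e', D.circle v e = D.circle v e' → F (MvPolynomial.X e) = F (MvPolynomial.X e'))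
    {f : D.Dots} (hf : algebraMap D.Dots (D.Res v) f = 0) : F f = 0 := by
  have h : D.circleIdeal v ≤ RingHom.ker F := by
    refine Ideal.span_le.2 ?_
    rintro _ (⟨e, rfl⟩ | ⟨e, e', he, rfl⟩)
    · rw [SetLike.mem_coe, RingHom.mem_ker, map_pow, h0]
    · rw [SetLike.mem_coe, RingHom.mem_ker, map_sub, h1 e e' (Quot.sound he), sub_self]
  exact h (algebraMap_eq_zero_iff.1 hf)

section Dual

variable {A : Type*} [CommRing A] [Algebra ℚ A] (φ : D.Dots →ₐ[ℚ] A)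

open scoped Classical in
/-- Replace the dots on the circle of `e` in the resolution `v` by `ε`. -/
def dual (v : Fin n → Bool) (e : ZMod (2 * n)) : D.Dots →ₐ[ℚ] DualNumber A :=
  MvPolynomial.aeval fun f => if D.circle v f = D.circle v e then DualNumber.eps else
    TrivSqZeroExt.inl (φ (MvPolynomial.X f))

variable {φ}

theorem dual_X_of_eq {v : Fin n → Bool} {e f : ZMod (2 * n)}
    (h : D.circle v f = D.circle v e) : dual φ v e (MvPolynomial.X f) = DualNumber.eps := by
  rw [dual, MvPolynomial.aeval_X, if_pos h]

theorem dual_X_of_ne {v : Fin n → Bool} {e f : ZMod (2 * n)}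
    (h : D.circle v f ≠ D.circle v e) :
    dual φ v e (MvPolynomial.X f) = TrivSqZeroExt.inl (φ (MvPolynomial.X f)) := by
  rw [dual, MvPolynomial.aeval_X, if_neg h]

/-- The homomorphism φ need not be the quotient map of the resolution v; for splits it comes from
the coarser resolution in which the circle of e is merged with another one. -/
theorem dual_eq_zero {v : Fin n → Bool} {e : ZMod (2 * n)}
    (h0 : ∀ f, φ (MvPolynomial.X f) ^ 2 = 0)
    (h : ∀ f g, D.circle v f = D.circle v g → φ (MvPolynomial.X f) = φ (MvPolynomial.X g))
    {f : D.Dots} (hf : algebraMap D.Dots (D.Res v) f = 0) : dual φ v e f = 0 := by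
  refine map_eq_zero_of_mem_circleIdeal (dual φ v e).toRingHom (fun f => ?_)
    (fun f g hfg => ?_) hf
  · change dual φ v e _ ^ 2 = 0
    by_cases hf : D.circle v f = D.circle v e
    · rw [dual_X_of_eq hf, pow_two, DualNumber.eps_mul_eps]
    · rw [dual_X_of_ne hf]
      have h2 := map_pow (TrivSqZeroExt.inlHom A A) (φ (MvPolynomial.X f)) 2
      rw [h0, map_zero] at h2
      exact h2.symm
  · change dual φ v e _ = dual φ v e _
    by_cases hf : D.circle v f = D.circle v e
    · rw [dual_X_of_eq hf, dual_X_of_eq (hfg.symm.trans hf)]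
    · rw [dual_X_of_ne hf, dual_X_of_ne (fun hg => hf (hfg.trans hg)), h f g hfg]

/-- Putting ε = φ (X e) recovers φ, which is consistent because φ (X e) has square zero. -/
theorem dual_fst_add_snd {v : Fin n → Bool} {e : ZMod (2 * n)}
    (h0 : φ (MvPolynomial.X e) ^ 2 = 0)
    (h : ∀ f g, D.circle v f = D.circle v g → φ (MvPolynomial.X f) = φ (MvPolynomial.X g))
    (f : D.Dots) :
    (dual φ v e f).fst + φ (MvPolynomial.X e) * (dual φ v e f).snd = φ f := by
  induction f using MvPolynomial.induction_on with
  | C a =>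
    rw [MvPolynomial.algHom_C, MvPolynomial.algHom_C, TrivSqZeroExt.algebraMap_eq_inl',
      TrivSqZeroExt.fst_inl, TrivSqZeroExt.snd_inl, mul_zero, add_zero]
  | add f g hf hg =>
    rw [map_add, map_add, ← hf, ← hg, TrivSqZeroExt.fst_add, TrivSqZeroExt.snd_add]
    ring
  | mul_X f i hf =>
    rw [map_mul, map_mul, ← hf, TrivSqZeroExt.fst_mul, DualNumber.snd_mul]
    by_cases hi : D.circle v i = D.circle v e
    · rw [dual_X_of_eq hi, DualNumber.fst_eps, DualNumber.snd_eps, h _ _ hi]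
      linear_combination -(dual φ v e f).snd * h0
    · rw [dual_X_of_ne hi, TrivSqZeroExt.fst_inl, TrivSqZeroExt.snd_inl]
      ring

end Dual

/-- The quotient map, as a homomorphism of `ℚ`-algebras. -/
def resHom (v : Fin n → Bool) : D.Dots →ₐ[ℚ] D.Res v := IsScalarTower.toAlgHom ℚ D.Dots (D.Res v)

/-- A dot is exact: its kernel is its image. -/
theorem exists_eq_X_mul {v : Fin n → Bool} {e : ZMod (2 * n)} {f : D.Dots}
    (h : algebraMap D.Dots (D.Res v) (MvPolynomial.X e * f) = 0) :
    ∃ g, algebraMap D.Dots (D.Res v) f = algebraMap D.Dots (D.Res v) (MvPolynomial.X e * g) := by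
  have h1 := dual_eq_zero (φ := D.resHom v) (e := e) (D.algebraMap_X_sq v)
    (fun _ _ h => D.algebraMap_X_eq h) h
  rw [map_mul, dual_X_of_eq rfl] at h1
  -- The ε-part of ε f is the part of f free of ε; once this vanishes, f is a multiple of the dot.
  have h2 := congrArg TrivSqZeroExt.snd h1
  rw [DualNumber.snd_mul, DualNumber.fst_eps, DualNumber.snd_eps, zero_mul, zero_add, one_mul,
    TrivSqZeroExt.snd_zero] at h2
  obtain ⟨g, hg⟩ := D.algebraMap_res_surjective v (dual (D.resHom v) v e f).snd
  refine ⟨g, ?_⟩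
  have h3 := dual_fst_add_snd (φ := D.resHom v) (e := e) (D.algebraMap_X_sq v e)
    (fun _ _ h => D.algebraMap_X_eq h) f
  rw [h2, zero_add] at h3
  rw [map_mul, hg]
  exact h3.symm

theorem exists_eq_X_smul {e : ZMod (2 * n)} {x : D.Chain}
    (h : (MvPolynomial.X e : D.Dots) • x = 0) :
    ∃ y : D.Chain, x = (MvPolynomial.X e : D.Dots) • y := by
  obtain ⟨f, hf, -⟩ := D.chain_eq_sum x
  have h1 : ∀ v, ∃ g, algebraMap D.Dots (D.Res v) (f v) =
      algebraMap D.Dots (D.Res v) (MvPolynomial.X e * g) := by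
    intro v
    refine exists_eq_X_mul ?_
    rw [map_mul, hf, ← Algebra.smul_def]
    exact congrFun h v
  choose g hg using h1
  refine ⟨fun v => algebraMap D.Dots (D.Res v) (g v), ?_⟩
  funext v
  rw [Pi.smul_apply, Algebra.smul_def, ← map_mul, ← hg, hf]

/-- Splitting a circle is injective. -/
theorem gen_eq_zero_of_split (hD : D.IsOrientable) {c : Fin n} {v : Fin n → Bool}
    (hv : D.Joined c v) {f : D.Dots} (h : D.gen (flip c v) (D.dotSum c * f) = 0) :
    D.gen v f = 0 := by
  rw [gen_eq_zero_iff] at h ⊢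
  have hn : ¬ D.Joined c (flip c v) := fun h' => (hD c v).1 h' hv
  have hc : ∀ e e', D.circle (flip c v) e = D.circle (flip c v) e' →
      D.circle v e = D.circle v e' := by
    intro e e' he
    have := circle_flip_of_circle hD hn he
    rwa [flip_flip] at this
  have hc' := fun e e' he => D.algebraMap_X_eq (hc e e' he)
  -- Write ε for the dot on one of the two new circles and evaluate everything else before the
  -- split. The ε-part of (X + ε) f is then f itself.
  have h1 := dual_eq_zero (φ := D.resHom v) (e := D.edge c 2) (D.algebraMap_X_sq v) hc' h
  rw [map_mul, dotSum, map_add, dual_X_of_eq rfl, dual_X_of_ne hn] at h1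
  have h2 := congrArg TrivSqZeroExt.snd h1
  rw [DualNumber.snd_mul, TrivSqZeroExt.fst_add, TrivSqZeroExt.snd_add, TrivSqZeroExt.fst_inl,
    TrivSqZeroExt.snd_inl, DualNumber.fst_eps, DualNumber.snd_eps, TrivSqZeroExt.snd_zero] at h2
  have h3 := dual_fst_add_snd (φ := D.resHom v) (D.algebraMap_X_sq v (D.edge c 2)) hc' f
  have h4 : D.resHom v (MvPolynomial.X (D.edge c 0)) = D.resHom v (MvPolynomial.X (D.edge c 2)) :=
    D.algebraMap_X_eq hv
  rw [h4] at h2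
  change D.resHom v f = 0
  linear_combination h2 - h3

theorem constantCoeff_eq_zero {v : Fin n → Bool} {f : D.Dots}
    (h : algebraMap D.Dots (D.Res v) f = 0) : MvPolynomial.constantCoeff f = 0 :=
  map_eq_zero_of_mem_circleIdeal MvPolynomial.constantCoeff (by simp) (by simp) h

theorem gen_X_ne_zero (v : Fin n → Bool) (e : ZMod (2 * n)) :
    D.gen v (MvPolynomial.X e) ≠ 0 := by
  intro h
  rw [gen_eq_zero_iff, ← mul_one (MvPolynomial.X e)] at h
  obtain ⟨g, hg⟩ := exists_eq_X_mul h
  have := constantCoeff_eq_zero (v := v) (f := 1 - MvPolynomial.X e * g)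
    (by rw [map_sub, hg, sub_self])
  simp at this

open scoped Classical in
/-- Replace the dots on the circle of `b` by dots on the edge `a`. -/
def subst (v : Fin n → Bool) (a b : ZMod (2 * n)) : D.Dots →ₐ[ℚ] D.Dots :=
  MvPolynomial.aeval fun e => if D.circle v e = D.circle v b then MvPolynomial.X a else
    MvPolynomial.X e

theorem subst_X_of_eq {v : Fin n → Bool} {a b e : ZMod (2 * n)}
    (h : D.circle v e = D.circle v b) : D.subst v a b (MvPolynomial.X e) = MvPolynomial.X a := by
  rw [subst, MvPolynomial.aeval_X, if_pos h]

theorem subst_X_of_ne {v : Fin n → Bool} {a b e : ZMod (2 * n)}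
    (h : D.circle v e ≠ D.circle v b) : D.subst v a b (MvPolynomial.X e) = MvPolynomial.X e := by
  rw [subst, MvPolynomial.aeval_X, if_neg h]

/-- The substitution is the identity modulo the difference of the two dots. -/
theorem exists_sub_subst (v : Fin n → Bool) (a b : ZMod (2 * n)) (f : D.Dots) :
    ∃ g, algebraMap D.Dots (D.Res v) (f - D.subst v a b f) =
      algebraMap D.Dots (D.Res v) ((MvPolynomial.X b - MvPolynomial.X a) * g) := by
  induction f using MvPolynomial.induction_on with
  | C r => exact ⟨0, by rw [MvPolynomial.algHom_C, MvPolynomial.algebraMap_eq]; simp⟩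
  | add f g hf hg =>
    obtain ⟨f', hf⟩ := hf
    obtain ⟨g', hg⟩ := hg
    refine ⟨f' + g', ?_⟩
    simp only [map_sub, map_add, map_mul] at hf hg ⊢
    linear_combination hf + hg
  | mul_X f i hf =>
    obtain ⟨f', hf⟩ := hf
    by_cases hi : D.circle v i = D.circle v b
    · refine ⟨f' * MvPolynomial.X i + D.subst v a b f, ?_⟩
      rw [map_mul, subst_X_of_eq hi]
      simp only [map_sub, map_add, map_mul, D.algebraMap_X_eq hi] at hf ⊢
      linear_combination algebraMap D.Dots (D.Res v) (MvPolynomial.X b) * hf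
    · refine ⟨f' * MvPolynomial.X i, ?_⟩
      rw [map_mul, subst_X_of_ne hi]
      simp only [map_sub, map_mul] at hf ⊢
      linear_combination algebraMap D.Dots (D.Res v) (MvPolynomial.X i) * hf

/-- The kernel of the map that merges the circles of `a` and `b`, on the multiples of an element
that does not involve the circle of `b`. -/
theorem exists_eq_of_merge {v v' : Fin n → Bool} {a b : ZMod (2 * n)}
    (h : ∀ e f, D.circle v' e = D.circle v' f → D.circle v e = D.circle v f ∨
      ((D.circle v e = D.circle v a ∨ D.circle v e = D.circle v b) ∧
        (D.circle v f = D.circle v a ∨ D.circle v f = D.circle v b)))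
    {g : D.Dots} (hg : D.subst v a b g = g) {f : D.Dots} (hf : D.gen v' (g * f) = 0) :
    ∃ f', D.gen v (g * f) = D.gen v (g * ((MvPolynomial.X b - MvPolynomial.X a) * f')) := by
  obtain ⟨f', hf'⟩ := D.exists_sub_subst v a b f
  refine ⟨f', ?_⟩
  have hX : ∀ e, D.circle v e = D.circle v a ∨ D.circle v e = D.circle v b →
      algebraMap D.Dots (D.Res v) (D.subst v a b (MvPolynomial.X e)) =
        algebraMap D.Dots (D.Res v) (MvPolynomial.X a) := by
    intro e he
    by_cases h1 : D.circle v e = D.circle v b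
    · rw [subst_X_of_eq h1]
    · rw [subst_X_of_ne h1, D.algebraMap_X_eq (he.resolve_right h1)]
  -- The substitution followed by the quotient map of v factors through the merged resolution, so it
  -- kills g f. As it fixes g, the product g f equals g times the difference of f and its
  -- substitute.
  have h0 := map_eq_zero_of_mem_circleIdeal (v := v')
    ((algebraMap D.Dots (D.Res v)).comp (D.subst v a b : D.Dots →+* D.Dots)) ?_ ?_
    (gen_eq_zero_iff D |>.1 hf)
  · simp only [RingHom.comp_apply, RingHom.coe_coe] at h0
    rw [map_mul, hg] at h0
    rw [gen_eq_gen_iff]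
    simp only [map_sub, map_mul] at hf' h0 ⊢
    linear_combination algebraMap D.Dots (D.Res v) g * hf' + h0
  · intro e
    simp only [RingHom.comp_apply, RingHom.coe_coe]
    by_cases h1 : D.circle v e = D.circle v b
    · rw [subst_X_of_eq h1, algebraMap_X_sq]
    · rw [subst_X_of_ne h1, algebraMap_X_sq]
  · intro e f hef
    simp only [RingHom.comp_apply, RingHom.coe_coe]
    rcases h e f hef with h1 | ⟨h1, h2⟩
    · by_cases h2 : D.circle v e = D.circle v b
      · rw [subst_X_of_eq h2, subst_X_of_eq (h1.symm.trans h2)]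
      · rw [subst_X_of_ne h2, subst_X_of_ne fun h3 => h2 (h1.trans h3), D.algebraMap_X_eq h1]
    · rw [hX e h1, hX f h2]

end KnotDiagram

namespace KnotDiagram

variable {n : ℕ} {D : KnotDiagram n}

/-! ## Gradings -/

/-- The number of ones of a resolution. -/
def ones (v : Fin n → Bool) : ℕ := (Finset.univ.filter fun c => v c = true).card

theorem ones_flip {c : Fin n} {v : Fin n → Bool} (h : v c = false) :
    ones (flip c v) = ones v + 1 := by
  have : (Finset.univ.filter fun c' => flip c v c' = true) =
      insert c (Finset.univ.filter fun c' => v c' = true) := by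
    ext c'
    by_cases hc : c' = c
    · subst hc
      simp [h]
    · simp [flip_ne hc, hc]
  rw [ones, this, Finset.card_insert_of_notMem (by simp [h]), ones]

theorem ones_flip_add_one {c : Fin n} {v : Fin n → Bool} (h : v c = true) :
    ones (flip c v) + 1 = ones v := by
  rw [← ones_flip (c := c) (by simp [h]), flip_flip]

/-- All circles but that of `edge c 2` correspond bijectively to the circles after the merge. -/
theorem card_circles_flip (hD : D.IsOrientable) {c : Fin n} {v : Fin n → Bool}
    (h : ¬ D.Joined c v) :
    Nat.card (D.Circles (flip c v)) + 1 = Nat.card (D.Circles v) := by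
  classical
  have : NeZero (2 * n) := two_mul_ne_zero_of_fin c
  have hf : Finite (D.Circles v) := Quot.finite _
  let p : D.Circles v → D.Circles (flip c v) := Quot.lift (fun e => D.circle (flip c v) e)
    fun e e' he => circle_flip_of_circle hD h (Quot.sound he)
  have hp : ∀ e, p (D.circle v e) = D.circle (flip c v) e := fun e => rfl
  have hb : Function.Bijective
      fun C : {C : D.Circles v // C ≠ D.circle v (D.edge c 2)} => p C.1 := by
    constructor
    · rintro ⟨C, hC⟩ ⟨C', hC'⟩ hCC
      induction C using Quot.ind with | _ e
      induction C' using Quot.ind with | _ e'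
      rcases (circle_flip_iff hD h e e').1 hCC with h1 | ⟨-, h1⟩ | ⟨h1, -⟩
      · exact Subtype.ext h1
      · exact absurd h1 hC'
      · exact absurd h1 hC
    · intro C
      induction C using Quot.ind with | _ e
      by_cases he : D.circle v e = D.circle v (D.edge c 2)
      · exact ⟨⟨D.circle v (D.edge c 0), h⟩,
          (circle_flip_iff hD h _ _).2 (Or.inr (Or.inl ⟨rfl, he⟩))⟩
      · exact ⟨⟨D.circle v e, he⟩, rfl⟩
  rw [← Nat.card_congr (Equiv.ofBijective _ hb)]
  have := Fintype.ofFinite (D.Circles v)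
  rw [Nat.card_eq_fintype_card, Nat.card_eq_fintype_card, Fintype.card_subtype_compl,
    Fintype.card_subtype_eq]
  have : 0 < Fintype.card (D.Circles v) := Fintype.card_pos_iff.2 ⟨D.circle v (D.edge c 0)⟩
  omega

variable (D) in
/-- The homological degree of a resolution. -/
def homDegree (v : Fin n → Bool) : ℤ := ones v - D.negCount

variable (D) in
/-- The quantum degree of the generator of a resolution. -/
def qDegree (v : Fin n → Bool) : ℤ :=
  -Nat.card (D.Circles v) - ones v - D.posCount + 2 * D.negCount

/-- At a given resolution the bidegree admits at most one polynomial degree m, so the supremum has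
at most one nonzero term. -/
theorem mem_bidegree_iff {t q : ℤ} {x : D.Chain} : x ∈ D.bidegree t q ↔
    ∀ v, ∃ f : D.Dots, x v = algebraMap D.Dots (D.Res v) f ∧
      (f = 0 ∨ ∃ m : ℕ, f.IsHomogeneous m ∧ D.homDegree v = t ∧ D.qDegree v + 2 * m = q) := by
  rw [bidegree, Submodule.mem_pi]
  refine ⟨fun h v => ?_, fun h v _ => ?_⟩
  · have h1 := h v (Set.mem_univ v)
    by_cases hm : ∃ m : ℕ, D.homDegree v = t ∧ D.qDegree v + 2 * m = q
    · obtain ⟨m, hm1, hm2⟩ := hm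
      have h2 : x v ∈ (MvPolynomial.homogeneousSubmodule (ZMod (2 * n)) ℚ m).map
          (D.resMk v).toLinearMap := by
        refine SetLike.le_def.1 (iSup₂_le ?_) h1
        rintro m' ⟨-, h3⟩
        have : m' = m := by
          rw [qDegree, ones] at hm2
          omega
        rw [this]
      obtain ⟨f, hf, hfx⟩ := h2
      exact ⟨f, hfx.symm, Or.inr ⟨m, hf, hm1, hm2⟩⟩
    · have h2 : x v ∈ (⊥ : Submodule ℚ (D.Res v)) := by
        refine SetLike.le_def.1 (iSup₂_le ?_) h1
        rintro m' ⟨h3, h4⟩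
        refine absurd ⟨m', ?_, ?_⟩ hm
        · rw [homDegree, ones, h3]
        · rw [qDegree, ones, ← h4]
          ring
      exact ⟨0, by rw [(Submodule.mem_bot ℚ).1 h2, map_zero], Or.inl rfl⟩
  · obtain ⟨f, hf, rfl | ⟨m, hm, h1, h2⟩⟩ := h v
    · rw [hf, map_zero]
      exact Submodule.zero_mem _
    · refine Submodule.mem_iSup_of_mem m (Submodule.mem_iSup_of_mem ⟨?_, ?_⟩ ⟨f, hm, hf.symm⟩)
      · rw [← h1, homDegree, ones]
      · rw [← h2, qDegree, ones]
        ring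

theorem gen_mem_bidegree {v : Fin n → Bool} {f : D.Dots} {m : ℕ} (hf : f.IsHomogeneous m)
    {t q : ℤ} (ht : D.homDegree v = t) (hq : D.qDegree v + 2 * m = q) :
    D.gen v f ∈ D.bidegree t q := by
  refine mem_bidegree_iff.2 fun w => ?_
  by_cases hw : w = v
  · subst hw
    exact ⟨f, gen_apply_same _ _ _, Or.inr ⟨m, hf, ht, hq⟩⟩
  · exact ⟨0, by rw [gen_apply_ne _ hw, map_zero], Or.inl rfl⟩

theorem exists_sum_of_mem_bidegree {t q : ℤ} {x : D.Chain} (hx : x ∈ D.bidegree t q) :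
    ∃ f : (Fin n → Bool) → D.Dots, x = ∑ v, D.gen v (f v) ∧ ∀ v, f v = 0 ∨
      ∃ m : ℕ, (f v).IsHomogeneous m ∧ D.homDegree v = t ∧ D.qDegree v + 2 * m = q := by
  choose f hf hm using mem_bidegree_iff.1 hx
  refine ⟨f, ?_, hm⟩
  funext v
  rw [Finset.sum_apply, Finset.sum_eq_single v, gen_apply_same, hf]
  · intro w _ hw
    exact D.gen_apply_ne hw.symm _
  · simp

theorem map_mem_bidegree {t q t' q' : ℤ} (F : D.Chain →+ D.Chain)
    (hF : ∀ (v : Fin n → Bool) (f : D.Dots) (m : ℕ), f.IsHomogeneous m → D.homDegree v = t →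
      D.qDegree v + 2 * m = q → F (D.gen v f) ∈ D.bidegree t' q')
    {x : D.Chain} (hx : x ∈ D.bidegree t q) : F x ∈ D.bidegree t' q' := by
  obtain ⟨f, rfl, hf⟩ := exists_sum_of_mem_bidegree hx
  rw [map_sum]
  refine Submodule.sum_mem _ fun v _ => ?_
  rcases hf v with h | ⟨m, h0, h1, h2⟩
  · rw [h, map_zero, map_zero]
    exact Submodule.zero_mem _
  · exact hF v _ m h0 h1 h2

theorem X_smul_mem_bidegree {t q : ℤ} (e : ZMod (2 * n)) {x : D.Chain}
    (hx : x ∈ D.bidegree t q) : (MvPolynomial.X e : D.Dots) • x ∈ D.bidegree t (q + 2) := by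
  refine map_mem_bidegree
    (LinearMap.lsmul D.Dots D.Chain (MvPolynomial.X e)).toAddMonoidHom ?_ hx
  intro v f m hf ht hq
  change (MvPolynomial.X e : D.Dots) • D.gen v f ∈ _
  rw [smul_gen]
  refine gen_mem_bidegree ((MvPolynomial.isHomogeneous_X _ _).mul hf) ht ?_
  push_cast
  linarith

theorem isHomogeneous_dotSum (c : Fin n) : (D.dotSum c).IsHomogeneous 1 :=
  (MvPolynomial.isHomogeneous_X _ _).add (MvPolynomial.isHomogeneous_X _ _)

/-- A merge loses a circle; a split gains a circle and a dot. Either way the quantum degree rises by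
one before the shift by the number of ones, which cancels this for d and doubles it for the
reversal. -/
theorem edgeMap_mem_bidegree (hD : D.IsOrientable) {t q : ℤ} (c : Fin n) (b : Bool) {x : D.Chain}
    (hx : x ∈ D.bidegree t q) : D.edgeMap c b x ∈
      D.bidegree (if b then t - 1 else t + 1) (if b then q + 2 else q) := by
  refine map_mem_bidegree (D.edgeMap c b).toAddMonoidHom ?_ hx
  intro v f m hf ht hq
  change D.edgeMap c b (D.gen v f) ∈ _
  rw [edgeMap_gen hD]
  by_cases hv : v c = b
  · rw [if_pos hv]
    refine zsmul_mem (S := Submodule ℚ D.Chain) ?_ _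
    cases b
    · change _ ∈ D.bidegree (t + 1) q
      have h1 := ones_flip hv
      by_cases hj : D.Joined c v
      · have h2 := card_circles_flip hD (c := c) (v := flip c v) fun h => (hD c v).1 h hj
        rw [flip_flip] at h2
        rw [coef_joined _ hj]
        refine gen_mem_bidegree ((isHomogeneous_dotSum c).mul hf) ?_ ?_
        · rw [homDegree] at ht ⊢
          omega
        · rw [qDegree] at hq ⊢
          push_cast
          omega
      · have h2 := card_circles_flip hD hj
        rw [coef_not_joined _ hj, one_mul]
        refine gen_mem_bidegree hf ?_ ?_
        · rw [homDegree] at ht ⊢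
          omega
        · rw [qDegree] at hq ⊢
          omega
    · change _ ∈ D.bidegree (t - 1) (q + 2)
      have h1 := ones_flip_add_one hv
      by_cases hj : D.Joined c v
      · have h2 := card_circles_flip hD (c := c) (v := flip c v) fun h => (hD c v).1 h hj
        rw [flip_flip] at h2
        rw [coef_joined _ hj]
        refine gen_mem_bidegree ((isHomogeneous_dotSum c).mul hf) ?_ ?_
        · rw [homDegree] at ht ⊢
          omega
        · rw [qDegree] at hq ⊢
          push_cast
          omega
      · have h2 := card_circles_flip hD hj
        rw [coef_not_joined _ hj, one_mul]
        refine gen_mem_bidegree hf ?_ ?_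
        · rw [homDegree] at ht ⊢
          omega
        · rw [qDegree] at hq ⊢
          omega
  · rw [if_neg hv]
    exact Submodule.zero_mem _

theorem dotSlide_mem_bidegree (hD : D.IsOrientable) {t q : ℤ} (c : Fin n) {x : D.Chain}
    (hx : x ∈ D.bidegree t q) : D.dotSlide c x ∈ D.bidegree (t - 1) (q + 2) :=
  edgeMap_mem_bidegree hD c true hx

theorem diff_mem_bidegree (hD : D.IsOrientable) {t q : ℤ} {x : D.Chain}
    (hx : x ∈ D.bidegree t q) : D.diff x ∈ D.bidegree (t + 1) q := by
  rw [diff, LinearMap.sum_apply]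
  exact Submodule.sum_mem _ fun c _ => edgeMap_mem_bidegree hD c false hx

section Homogeneous

attribute [local instance] MvPolynomial.gradedAlgebra

theorem isHomogeneous_circleIdeal (v : Fin n → Bool) :
    (D.circleIdeal v).IsHomogeneous (MvPolynomial.homogeneousSubmodule (ZMod (2 * n)) ℚ) := by
  refine Ideal.homogeneous_span _ _ ?_
  rintro _ (⟨e, rfl⟩ | ⟨e, e', -, rfl⟩)
  · exact ⟨2, (MvPolynomial.isHomogeneous_X _ _).pow 2⟩
  · exact ⟨1, (MvPolynomial.isHomogeneous_X _ _).sub (MvPolynomial.isHomogeneous_X _ _)⟩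

/-- A homogeneous multiple of a dot is a homogeneous multiple of it. -/
theorem exists_homogeneous_X_mul {v : Fin n → Bool} {e : ZMod (2 * n)} {f g : D.Dots} {m : ℕ}
    (hf : f.IsHomogeneous m)
    (h : algebraMap D.Dots (D.Res v) f = algebraMap D.Dots (D.Res v) (MvPolynomial.X e * g)) :
    f ∈ D.circleIdeal v ∨ ∃ g', 1 ≤ m ∧ g'.IsHomogeneous (m - 1) ∧
      algebraMap D.Dots (D.Res v) f = algebraMap D.Dots (D.Res v) (MvPolynomial.X e * g') := by
  have h1 : f - MvPolynomial.X e * g ∈ D.circleIdeal v :=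
    algebraMap_eq_zero_iff.1 (by rw [map_sub, h, sub_self])
  -- The ideal is homogeneous, so it contains the component of degree m of the difference; in it g
  -- is replaced by its component of degree m - 1.
  have h2 := isHomogeneous_circleIdeal v m h1
  rw [DirectSum.decompose_sub, DirectSum.sub_apply, Submodule.coe_sub,
    DirectSum.decompose_of_mem_same _ (show f ∈ MvPolynomial.homogeneousSubmodule _ ℚ m from hf),
    DirectSum.coe_decompose_mul_of_left_mem _ m
      (show MvPolynomial.X e ∈ MvPolynomial.homogeneousSubmodule _ ℚ 1 from
        MvPolynomial.isHomogeneous_X _ _)] at h2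
  split_ifs at h2 with hm
  · refine Or.inr ⟨_, hm, (show _ ∈ MvPolynomial.homogeneousSubmodule (ZMod (2 * n)) ℚ (m - 1) from
      SetLike.coe_mem (DirectSum.decompose _ g (m - 1))), ?_⟩
    rw [← sub_eq_zero, ← map_sub, algebraMap_eq_zero_iff]
    exact h2
  · rw [sub_zero] at h2
    exact Or.inl h2

end Homogeneous

/-- Changing the marked point requires division by a dot; homogeneous quotients keep the bidegrees
under control. -/
theorem exists_X_smul_of_mem_bidegree {t q : ℤ} {e : ZMod (2 * n)} {x : D.Chain}
    (hx : (MvPolynomial.X e : D.Dots) • x ∈ D.bidegree t q) : ∃ y ∈ D.bidegree t (q - 2),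
      (MvPolynomial.X e : D.Dots) • x = (MvPolynomial.X e : D.Dots) • y := by
  obtain ⟨g, hg, -⟩ := D.chain_eq_sum x
  have key : ∀ v, ∃ f : D.Dots, (f = 0 ∨ ∃ m : ℕ, f.IsHomogeneous m ∧ D.homDegree v = t ∧
      D.qDegree v + 2 * m = q - 2) ∧ ((MvPolynomial.X e : D.Dots) • x) v =
      algebraMap D.Dots (D.Res v) (MvPolynomial.X e * f) := by
    intro v
    have h0 : ((MvPolynomial.X e : D.Dots) • x) v =
        algebraMap D.Dots (D.Res v) (MvPolynomial.X e * g v) := by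
      rw [map_mul, hg, Pi.smul_apply, Algebra.smul_def]
    obtain ⟨f, hf, rfl | ⟨m, hm, h1, h2⟩⟩ := mem_bidegree_iff.1 hx v
    · exact ⟨0, Or.inl rfl, by rw [hf, mul_zero]⟩
    · rcases exists_homogeneous_X_mul hm (hf.symm.trans h0) with h3 | ⟨g', h3, h4, h5⟩
      · exact ⟨0, Or.inl rfl, by rw [hf, algebraMap_eq_zero_iff.2 h3, mul_zero, map_zero]⟩
      · exact ⟨g', Or.inr ⟨m - 1, h4, h1, by omega⟩, hf.trans h5⟩
  choose f hf hx' using key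
  refine ⟨fun v => algebraMap D.Dots (D.Res v) (f v),
    mem_bidegree_iff.2 fun v => ⟨f v, rfl, hf v⟩, ?_⟩
  funext v
  rw [hx', map_mul, Pi.smul_apply, Algebra.smul_def]

/-! ## The scaling operator -/

variable (D) in
/-- Multiply all dots by `4`. -/
def dotScale : D.Dots →ₐ[ℚ] D.Dots := MvPolynomial.aeval fun e => 4 • MvPolynomial.X e

theorem dotScale_X (e : ZMod (2 * n)) :
    D.dotScale (MvPolynomial.X e) = 4 • MvPolynomial.X e := MvPolynomial.aeval_X _ _

theorem circleIdeal_le_comap_dotScale (v : Fin n → Bool) :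
    D.circleIdeal v ≤ (D.circleIdeal v).comap (D.dotScale : D.Dots →+* D.Dots) := by
  refine Ideal.span_le.2 ?_
  rintro _ (⟨e, rfl⟩ | ⟨e, e', he, rfl⟩)
  · rw [SetLike.mem_coe, Ideal.mem_comap, RingHom.coe_coe, map_pow, dotScale_X, smul_pow]
    rw [nsmul_eq_mul]
    exact Ideal.mul_mem_left _ _ (Ideal.subset_span (Or.inl ⟨e, rfl⟩))
  · rw [SetLike.mem_coe, Ideal.mem_comap, RingHom.coe_coe, map_sub, dotScale_X, dotScale_X,
      ← smul_sub]
    rw [nsmul_eq_mul]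
    exact Ideal.mul_mem_left _ _ (Ideal.subset_span (Or.inr ⟨e, e', he, rfl⟩))

variable (D) in
/-- Multiply all dots of a resolution by `4`. -/
def resScale (v : Fin n → Bool) : D.Res v →ₗ[ℚ] D.Res v :=
  (Ideal.quotientMapₐ (D.circleIdeal v) D.dotScale (circleIdeal_le_comap_dotScale v)).toLinearMap

theorem resScale_algebraMap (v : Fin n → Bool) (f : D.Dots) :
    D.resScale v (algebraMap D.Dots (D.Res v) f) =
      algebraMap D.Dots (D.Res v) (D.dotScale f) := rfl

variable (D) in
/-- Multiply a resolution by a power of two and its dots by `4`. -/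
def scale : D.Chain →ₗ[ℚ] D.Chain := LinearMap.pi fun v =>
  ((2 : ℚ) ^ ((ones v : ℤ) - Nat.card (D.Circles v))) • (D.resScale v ∘ₗ LinearMap.proj v)

theorem scale_apply (x : D.Chain) (v : Fin n → Bool) (f : D.Dots)
    (h : x v = algebraMap D.Dots (D.Res v) f) : D.scale x v =
      ((2 : ℚ) ^ ((ones v : ℤ) - Nat.card (D.Circles v))) •
        algebraMap D.Dots (D.Res v) (D.dotScale f) := by
  rw [scale, LinearMap.pi_apply, LinearMap.smul_apply, LinearMap.comp_apply, LinearMap.proj_apply,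
    h, resScale_algebraMap]

theorem scale_gen (v : Fin n → Bool) (f : D.Dots) : D.scale (D.gen v f) =
    ((2 : ℚ) ^ ((ones v : ℤ) - Nat.card (D.Circles v))) • D.gen v (D.dotScale f) := by
  funext w
  by_cases hw : w = v
  · subst hw
    rw [scale_apply _ _ f (gen_apply_same _ _ _), Pi.smul_apply, gen_apply_same]
  · rw [scale_apply _ _ 0 (by rw [gen_apply_ne _ hw, map_zero]), Pi.smul_apply, gen_apply_ne _ hw,
      map_zero, map_zero, smul_zero, smul_zero]

theorem scale_X_smul (e : ZMod (2 * n)) (x : D.Chain) :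
    D.scale ((MvPolynomial.X e : D.Dots) • x) =
      (MvPolynomial.X e : D.Dots) • ((4 : ℚ) • D.scale x) := by
  obtain ⟨f, -, rfl⟩ := D.chain_eq_sum x
  simp only [map_sum, Finset.smul_sum]
  refine Finset.sum_congr rfl fun v _ => ?_
  rw [smul_gen, scale_gen, scale_gen, map_mul, dotScale_X, smul_comm _ (4 : ℚ),
    smul_comm (MvPolynomial.X e) (_ : ℚ), smul_gen, smul_mul_assoc, map_nsmul, smul_comm (4 : ℚ)]
  congr 1

/-- The differential raises δ by 2, whence the factor 4. The identity is checked on all generators,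
so no decomposition of a chain into bihomogeneous parts is needed. -/
theorem scale_diff (hD : D.IsOrientable) (x : D.Chain) :
    D.scale (D.diff x) = D.diff ((4 : ℚ) • D.scale x) := by
  obtain ⟨f, -, rfl⟩ := D.chain_eq_sum x
  simp only [map_sum, Finset.smul_sum]
  refine Finset.sum_congr rfl fun v _ => ?_
  rw [diff, LinearMap.sum_apply, LinearMap.sum_apply, map_sum]
  refine Finset.sum_congr rfl fun c _ => ?_
  have hq : ∀ (r : ℚ) (y : D.Chain), D.edgeMap c false (r • y) = r • D.edgeMap c false y :=
    fun r y => ((D.edgeMap c false).restrictScalars ℚ).map_smul r y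
  rw [scale_gen, hq, hq, edgeMap_gen hD, edgeMap_gen hD]
  split_ifs with hv
  · have h1 := ones_flip hv
    rw [map_zsmul, scale_gen, map_mul, h1]
    by_cases hj : D.Joined c v
    · have h2 := card_circles_flip hD (c := c) (v := flip c v) fun h => (hD c v).1 h hj
      rw [flip_flip] at h2
      have h3 : D.dotScale (D.dotSum c) = 4 • D.dotSum c := by
        rw [dotSum, map_add, dotScale_X, dotScale_X, smul_add]
      rw [coef_joined _ hj, h3, smul_mul_assoc, map_nsmul, ← h2]
      have h4 : ((ones v + 1 : ℕ) : ℤ) - (Nat.card (D.Circles v) + 1 : ℕ) =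
        (ones v : ℤ) - Nat.card (D.Circles v) := by push_cast; ring
      rw [h4]
      module
    · have h2 := card_circles_flip hD hj
      rw [coef_not_joined _ hj, map_one, one_mul, ← h2]
      have h4 : ((ones v + 1 : ℕ) : ℤ) - (Nat.card (D.Circles (flip c v)) : ℕ) =
        ((ones v : ℤ) - (Nat.card (D.Circles (flip c v)) + 1 : ℕ)) + 2 := by push_cast; ring
      rw [h4, zpow_add₀ (by norm_num)]
      norm_num
      module
  · rw [map_zero, smul_zero, smul_zero]

theorem dotScale_of_isHomogeneous {f : D.Dots} {m : ℕ} (hf : f.IsHomogeneous m) :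
    D.dotScale f = ((4 : ℚ) ^ m) • f := by
  have h : D.dotScale = MvPolynomial.aeval fun e => (4 : ℚ) • (MvPolynomial.X e : D.Dots) := by
    rw [dotScale]
    congr 1
  rw [h]
  conv_lhs => rw [f.as_sum]
  conv_rhs => rw [f.as_sum]
  rw [map_sum, Finset.smul_sum]
  refine Finset.sum_congr rfl fun s hs => ?_
  rw [MvPolynomial.aeval_monomial, MvPolynomial.monomial_eq, Finsupp.prod, Finsupp.prod]
  simp only [smul_pow]
  rw [Finset.prod_smul, Finset.prod_pow_eq_pow_sum, MvPolynomial.algebraMap_eq,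
    mul_smul_comm]
  congr 2
  have := hf (MvPolynomial.mem_support_iff.1 hs)
  rw [← this, Finsupp.weight_apply]
  simp [Finsupp.sum]

/-- On a bidegree the scaling operator is the multiplication by a power of two that depends on
`δ` only. -/
theorem scale_of_mem_bidegree {t q : ℤ} {x : D.Chain} (hx : x ∈ D.bidegree t q) :
    D.scale x = ((2 : ℚ) ^ (2 * t + q + D.posCount)) • x := by
  obtain ⟨f, rfl, hf⟩ := exists_sum_of_mem_bidegree hx
  rw [map_sum, Finset.smul_sum]
  refine Finset.sum_congr rfl fun v _ => ?_
  rcases hf v with h | ⟨m, hm, h1, h2⟩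
  · rw [h, map_zero, map_zero, smul_zero]
  · have hq : ∀ (r : ℚ) (y : D.Dots), D.gen v (r • y) = r • D.gen v y :=
      fun r y => ((D.gen v).restrictScalars ℚ).map_smul r y
    rw [scale_gen, dotScale_of_isHomogeneous hm, hq, smul_smul]
    congr 1
    have h4 : (4 : ℚ) ^ m = (2 : ℚ) ^ (2 * (m : ℤ)) := by
      rw [zpow_mul, zpow_natCast]
      norm_num
    rw [h4, ← zpow_add₀ (by norm_num)]
    congr 1
    rw [← h1, ← h2, homDegree, qDegree]
    ring

end KnotDiagram

/-! ## Strings of cycles -/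

section StringFamily

set_option linter.unusedSectionVars false

variable {R M : Type*} [CommRing R] [Algebra ℚ R] [AddCommGroup M] [Module R M] [Module ℚ M]
  [IsScalarTower ℚ R M] {ι : Type*} [Fintype ι]

/-- A family of cycles in `W` whose classes are a basis of the homology of `W` that consists of
strings of the types `S`. -/
structure IsStringFamily (d e : M →ₗ[R] M) (W : Submodule R M) (G : ℤ → ℤ → Submodule ℚ M)
    (S : ι → EString) (z : (Σ i, Fin (S i).len) → M) : Prop where
  mem : ∀ j, z j ∈ W
  cycle : ∀ j, d (z j) = 0
  degree : ∀ i (a : Fin (S i).len),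
    z ⟨i, a⟩ ∈ G ((S i).t - 2 * (a : ℕ)) ((S i).q + 4 * (a : ℕ))
  step : ∀ i (a : Fin (S i).len),
    e (z ⟨i, a⟩) - (if h : (a : ℕ) + 1 < (S i).len then z ⟨i, ⟨a + 1, h⟩⟩ else 0) ∈ W.map d
  indep : ∀ α : (Σ i, Fin (S i).len) → ℚ, ∑ j, α j • z j ∈ W.map d → ∀ j, α j = 0
  span : ∀ x ∈ W, d x = 0 → ∃ α : (Σ i, Fin (S i).len) → ℚ, x - ∑ j, α j • z j ∈ W.map d

theorem SubHomology.mk_eq_zero_iff {d : M →ₗ[R] M} {W : Submodule R M}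
    {x : (W ⊓ LinearMap.ker d : Submodule R M)} :
    SubHomology.mk d W x = 0 ↔ (x : M) ∈ W.map d :=
  (Submodule.Quotient.mk_eq_zero _).trans Iff.rfl

theorem SubHomology.mk_surjective (d : M →ₗ[R] M) (W : Submodule R M) :
    Function.Surjective (SubHomology.mk d W) := Submodule.mkQ_surjective _

variable {d e : M →ₗ[R] M} {W : Submodule R M} {G : ℤ → ℤ → Submodule ℚ M}
  {S : ι → EString} {z : (Σ i, Fin (S i).len) → M}

/-- The class of a cycle of a family. -/
def IsStringFamily.cls (h : IsStringFamily d e W G S z) (j : Σ i, Fin (S i).len) :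
    (W ⊓ LinearMap.ker d : Submodule R M) := ⟨z j, h.mem j, h.cycle j⟩

theorem IsStringFamily.mk_sum (h : IsStringFamily d e W G S z)
    (α : (Σ i, Fin (S i).len) → ℚ) : ∑ j, α j • SubHomology.mk d W (h.cls j) =
      SubHomology.mk d W (∑ j, α j • h.cls j) := by
  rw [map_sum]
  exact Finset.sum_congr rfl fun j _ =>
    (((SubHomology.mk d W).restrictScalars ℚ).map_smul (α j) (h.cls j)).symm

theorem IsStringFamily.coe_sum (h : IsStringFamily d e W G S z)
    (α : (Σ i, Fin (S i).len) → ℚ) :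
    ((∑ j, α j • h.cls j : (W ⊓ LinearMap.ker d : Submodule R M)) : M) = ∑ j, α j • z j := by
  rw [AddSubmonoidClass.coe_finsetSum]
  rfl

theorem IsStringFamily.hasStringDecomposition (h : IsStringFamily d e W G S z)
    (hf : d ∘ₗ e = e ∘ₗ d) (hW : ∀ x ∈ W, e x ∈ W) :
    HasStringDecomposition (fun t q => SubHomology.piece d W (G t q))
      ((SubHomology.map W e hf hW).restrictScalars ℚ) S := by
  classical
  have hli : LinearIndependent ℚ fun j => SubHomology.mk d W (h.cls j) := by
    refine Fintype.linearIndependent_iff.2 fun α hα => h.indep α ?_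
    rw [h.mk_sum, SubHomology.mk_eq_zero_iff, h.coe_sum] at hα
    exact hα
  have hsp : ⊤ ≤ Submodule.span ℚ (Set.range fun j => SubHomology.mk d W (h.cls j)) := by
    rintro x -
    obtain ⟨⟨x, hx, hk⟩, rfl⟩ := SubHomology.mk_surjective d W x
    obtain ⟨α, hα⟩ := h.span x hx hk
    have h1 : SubHomology.mk d W ⟨x, hx, hk⟩ = ∑ j, α j • SubHomology.mk d W (h.cls j) := by
      rw [h.mk_sum, ← sub_eq_zero, ← map_sub, SubHomology.mk_eq_zero_iff, Submodule.coe_sub,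
        h.coe_sum]
      exact hα
    rw [h1]
    exact Submodule.sum_mem _ fun j _ => Submodule.smul_mem _ _ (Submodule.subset_span ⟨j, rfl⟩)
  refine ⟨Module.Basis.mk hli hsp, fun i a => ⟨?_, ?_⟩⟩
  · rw [Module.Basis.mk_apply]
    exact ⟨h.cls ⟨i, a⟩, h.degree i a, rfl⟩
  · simp only [Module.Basis.mk_apply]
    have h1 := h.step i a
    have h2 : (SubHomology.map W e hf hW).restrictScalars ℚ (SubHomology.mk d W (h.cls ⟨i, a⟩)) =
      SubHomology.mk d W ⟨e (z ⟨i, a⟩), hW _ (h.mem _), by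
        change d (e (z ⟨i, a⟩)) = 0
        rw [← LinearMap.comp_apply, hf, LinearMap.comp_apply, h.cycle,
          map_zero]⟩ := rfl
    rw [h2]
    split_ifs at h1 ⊢ with hl
    · rw [← sub_eq_zero, ← map_sub, SubHomology.mk_eq_zero_iff]
      exact h1
    · rw [SubHomology.mk_eq_zero_iff]
      rwa [sub_zero] at h1

/-- The support of the homology, read off from an operator that scales the degrees. -/
theorem IsStringFamily.supportedOnDelta (h : IsStringFamily d e W G S z) {L : M →ₗ[ℚ] M}
    (hLW : ∀ x ∈ W, L x ∈ W) {c : ℚ} (hLd : ∀ x, L (d x) = d (c • L x)) {ν : ℤ → ℚ}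
    (hν : Function.Injective ν) (hL : ∀ t q, ∀ x ∈ G t q, L x = ν (2 * t + q) • x) {Δ : Set ℤ}
    (hS : ∀ i, 2 * (S i).t + (S i).q ∈ Δ) :
    SupportedOnDelta (fun t q => SubHomology.piece d W (G t q)) Δ := by
  intro t q hδ
  rw [eq_bot_iff]
  rintro _ ⟨⟨x, hx, hk⟩, hxG, rfl⟩
  rw [Submodule.mem_bot]
  change SubHomology.mk d W _ = 0
  rw [SubHomology.mk_eq_zero_iff]
  obtain ⟨α, w, hw, hwα⟩ := h.span x hx hk
  have h1 : L x = ν (2 * t + q) • x := hL t q x hxG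
  have h2 : ∀ j, L (z j) = ν (2 * (S j.1).t + (S j.1).q) • z j := by
    rintro ⟨i, a⟩
    rw [hL _ _ _ (h.degree i a)]
    congr 2
    ring
  have hdq : ∀ (r : ℚ) (y : M), d (r • y) = r • d y := fun r y => (d.restrictScalars ℚ).map_smul r y
  have h3 : ∀ j, α j = 0 := by
    -- Apply the operator minus its eigenvalue on x to the relation between x and the z j. This
    -- kills x, multiplies each z j by a difference of eigenvalues, and keeps boundaries boundaries.
    have h4 := h.indep (fun j => α j * (ν (2 * (S j.1).t + (S j.1).q) - ν (2 * t + q))) ?_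
    · intro j
      refine (mul_eq_zero.1 (h4 j)).resolve_right fun h5 => hδ ?_
      rw [← hν (sub_eq_zero.1 h5)]
      exact hS j.1
    · refine ⟨ν (2 * t + q) • w - c • L w,
        W.sub_mem (Submodule.smul_of_tower_mem W _ hw) (Submodule.smul_of_tower_mem W _ (hLW w hw)), ?_⟩
      rw [map_sub, ← hLd, hwα, hdq, hwα, map_sub, h1, map_sum]
      simp only [map_smul, h2, smul_sub, Finset.smul_sum, mul_sub, sub_smul,
        Finset.sum_sub_distrib, mul_smul]
      simp only [smul_comm (ν (2 * t + q))]
      abel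
  refine ⟨w, hw, ?_⟩
  rw [hwα]
  simp [h3]

/-! ## Change of the base point -/

/-- Two commuting square-zero operators whose sum is homotopic to zero. -/
structure IsDotSlide (d : M →ₗ[R] M) (X Y : R) (χ : M →ₗ[R] M) : Prop where
  diff_diff : ∀ x, d (d x) = 0
  sq_left : ∀ x : M, X • X • x = 0
  sq_right : ∀ x : M, Y • Y • x = 0
  exact_left : ∀ x : M, X • x = 0 → ∃ y, x = X • y
  exact_right : ∀ x : M, Y • x = 0 → ∃ y, x = Y • y
  homotopy : ∀ x, d (χ x) + χ (d x) = X • x + Y • x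
  slide : ∀ x, X • χ x = Y • χ x
  sq : ∀ x, χ (χ x) = 0

variable {X Y : R} {χ : M →ₗ[R] M}

theorem IsDotSlide.symm (h : IsDotSlide d X Y χ) : IsDotSlide d Y X χ where
  diff_diff := h.diff_diff
  sq_left := h.sq_right
  sq_right := h.sq_left
  exact_left := h.exact_right
  exact_right := h.exact_left
  homotopy x := (h.homotopy x).trans (add_comm _ _)
  slide x := (h.slide x).symm
  sq := h.sq

/-- Corresponding cycles of the reduced complexes of two operators. -/
def SlideRel (d : M →ₗ[R] M) (X Y : R) (χ : M →ₗ[R] M) (z z' : M) : Prop :=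
  ∃ a a' : M, z = X • a ∧ d a = X • a' ∧ z' = Y • (a - χ a')

theorem SlideRel.sub {z₁ z₁' z₂ z₂' : M} (h₁ : SlideRel d X Y χ z₁ z₁')
    (h₂ : SlideRel d X Y χ z₂ z₂') : SlideRel d X Y χ (z₁ - z₂) (z₁' - z₂') := by
  obtain ⟨a, a', rfl, ha, rfl⟩ := h₁
  obtain ⟨b, b', rfl, hb, rfl⟩ := h₂
  refine ⟨a - b, a' - b', (smul_sub _ _ _).symm, by rw [map_sub, ha, hb, smul_sub], ?_⟩
  rw [map_sub, ← smul_sub]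
  congr 1
  abel

theorem SlideRel.zero : SlideRel d X Y χ 0 0 := ⟨0, 0, by simp, by simp, by simp⟩

theorem SlideRel.sum {κ : Type*} (s : Finset κ) (α : κ → ℚ) {z z' : κ → M}
    (h : ∀ j, SlideRel d X Y χ (z j) (z' j)) :
    SlideRel d X Y χ (∑ j ∈ s, α j • z j) (∑ j ∈ s, α j • z' j) := by
  choose a a' h1 h2 h3 using h
  have hq : ∀ (f : M →ₗ[R] M) (r : ℚ) (y : M), f (r • y) = r • f y :=
    fun f r y => (f.restrictScalars ℚ).map_smul r y
  have hX : ∀ (f : R) (r : ℚ) (y : M), f • r • y = r • f • y := fun f r y => smul_comm _ _ _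
  refine ⟨∑ j ∈ s, α j • a j, ∑ j ∈ s, α j • a' j, ?_, ?_, ?_⟩
  · rw [Finset.smul_sum]
    exact Finset.sum_congr rfl fun j _ => by rw [h1, hX]
  · rw [Finset.smul_sum, map_sum]
    exact Finset.sum_congr rfl fun j _ => by rw [hq, h2, hX]
  · rw [map_sum, ← Finset.sum_sub_distrib, Finset.smul_sum]
    exact Finset.sum_congr rfl fun j _ => by rw [h3, hq, ← smul_sub, hX]

theorem SlideRel.map {z z' : M} (h : SlideRel d X Y χ z z') (hd : ∀ x, d (e x) = e (d x))
    (hχ : ∀ x, χ (e x) = e (χ x)) : SlideRel d X Y χ (e z) (e z') := by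
  obtain ⟨a, a', rfl, ha, rfl⟩ := h
  exact ⟨e a, e a', by rw [map_smul], by rw [hd, ha, map_smul],
    by rw [hχ, ← map_sub, map_smul]⟩

/-- The homotopy relation shows that subtracting χ a' turns d a, a multiple of X, into a multiple of
Y. The same construction with X and Y exchanged returns to a, because χ has square zero. -/
theorem IsDotSlide.rel_symm (h : IsDotSlide d X Y χ) {z z' : M} (hz : SlideRel d X Y χ z z') :
    d z' = 0 ∧ SlideRel d Y X χ z' z := by
  obtain ⟨a, a', rfl, ha, rfl⟩ := hz
  obtain ⟨a'', ha''⟩ := h.exact_left (d a') (by rw [← map_smul, ← ha, h.diff_diff])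
  have h1 : d (a - χ a') = Y • (-a' + χ a'') := by
    have h2 := h.homotopy a'
    rw [ha'', map_smul, h.slide] at h2
    rw [map_sub, ha, smul_add, smul_neg, eq_sub_of_add_eq h2]
    abel
  refine ⟨by rw [map_smul, h1, h.sq_right], a - χ a', -a' + χ a'', rfl, h1, ?_⟩
  rw [map_add, map_neg, h.sq]
  congr 1
  abel

/-- If X a = d (X b), exactness gives a = d b + X c and then a' = d c + X g. The corresponding cycle
is the boundary of Y (b + χ c). -/
theorem IsDotSlide.boundary (h : IsDotSlide d X Y χ) {z z' : M} (hz : SlideRel d X Y χ z z')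
    (hb : ∃ b, z = d (X • b)) : ∃ b, z' = d (Y • b) := by
  obtain ⟨a, a', rfl, ha, rfl⟩ := hz
  obtain ⟨b, hb⟩ := hb
  obtain ⟨c, hc⟩ := h.exact_left (a - d b) (by rw [smul_sub, hb, map_smul, sub_self])
  have ha1 : a = d b + X • c := by rw [← hc]; abel
  have h1 : X • (a' - d c) = 0 := by
    rw [smul_sub, ← ha, ha1, map_add, h.diff_diff, map_smul]
    abel
  obtain ⟨g, hg⟩ := h.exact_left _ h1
  have ha2 : a' = d c + X • g := by rw [← hg]; abel
  refine ⟨b + χ c, ?_⟩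
  have h2 : d (χ c) = X • c + Y • c - χ (d c) := eq_sub_of_add_eq (h.homotopy c)
  have h3 : Y • X • χ g = 0 := by rw [h.slide, h.sq_right]
  rw [map_smul, map_add, h2, ha1, ha2, map_add, map_smul]
  have h4 : Y • (d b + X • c - (χ (d c) + X • χ g)) =
      Y • (d b + (X • c + Y • c - χ (d c))) - Y • Y • c - Y • X • χ g := by module
  rw [h4, h.sq_right, h3]
  abel

theorem mem_map_range_lsmul {z : M} :
    z ∈ (LinearMap.range (LinearMap.lsmul R M X)).map d ↔ ∃ b, z = d (X • b) := by
  constructor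
  · rintro ⟨_, ⟨b, rfl⟩, rfl⟩
    exact ⟨b, rfl⟩
  · rintro ⟨b, rfl⟩
    exact ⟨_, ⟨b, rfl⟩, rfl⟩

theorem IsDotSlide.exists_rel (h : IsDotSlide d X Y χ) (a : M) (hz : d (X • a) = 0) :
    ∃ z', SlideRel d X Y χ (X • a) z' := by
  obtain ⟨a', ha'⟩ := h.exact_left (d a) (by rw [← map_smul, hz])
  exact ⟨_, a, a', rfl, ha', rfl⟩

/-- Bases of strings of the reduced homologies of two homotopic operators correspond. -/
theorem IsDotSlide.isStringFamily (h : IsDotSlide d X Y χ)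
    (hz : IsStringFamily d e (LinearMap.range (LinearMap.lsmul R M X)) G S z)
    (hd : ∀ x, d (e x) = e (d x)) (hχ : ∀ x, χ (e x) = e (χ x))
    (hG : ∀ t q x, d (X • x) = 0 → X • x ∈ G t q →
      ∃ z' ∈ G t q, SlideRel d X Y χ (X • x) z') :
    ∃ z', IsStringFamily d e (LinearMap.range (LinearMap.lsmul R M Y)) G S z' := by
  have h0 : ∀ j : (Σ i, Fin (S i).len), ∃ z' ∈ G ((S j.1).t - 2 * (j.2 : ℕ))
      ((S j.1).q + 4 * (j.2 : ℕ)), SlideRel d X Y χ (z j) z' := by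
    intro j
    obtain ⟨x, hx⟩ := hz.mem j
    have h1 := hz.degree j.1 j.2
    have h2 := hz.cycle j
    rw [← hx] at h2
    change z j ∈ _ at h1
    rw [← hx] at h1 ⊢
    exact hG _ _ x h2 h1
  choose z' hdeg hrel using h0
  refine ⟨z', ⟨?_, fun j => (h.rel_symm (hrel j)).1, fun i a => hdeg ⟨i, a⟩, ?_, ?_, ?_⟩⟩
  · intro j
    obtain ⟨a, a', -, -, h3⟩ := hrel j
    exact ⟨_, h3.symm⟩
  · intro i a
    rw [mem_map_range_lsmul]
    refine h.boundary (((hrel ⟨i, a⟩).map hd hχ).sub (z₂ := if h : (a : ℕ) + 1 < (S i).len then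
      z ⟨i, ⟨a + 1, h⟩⟩ else 0) ?_) (mem_map_range_lsmul.1 (hz.step i a))
    split_ifs
    · exact hrel _
    · exact SlideRel.zero
  · intro α hα
    refine hz.indep α (mem_map_range_lsmul.2 (h.symm.boundary
      (h.rel_symm (SlideRel.sum _ α hrel)).2 (mem_map_range_lsmul.1 hα)))
  · rintro _ ⟨x, rfl⟩ hx
    obtain ⟨y, hy⟩ := h.symm.exists_rel x hx
    obtain ⟨h1, h2⟩ := h.symm.rel_symm hy
    obtain ⟨a, a', rfl, -, -⟩ := h2
    obtain ⟨α, hα⟩ := hz.span _ ⟨a, rfl⟩ h1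
    exact ⟨α, mem_map_range_lsmul.2 (h.boundary
      ((h.symm.rel_symm hy).2.sub (SlideRel.sum _ α hrel)) (mem_map_range_lsmul.1 hα))⟩

end StringFamily

namespace KnotDiagram

variable {n : ℕ} {D : KnotDiagram n} {θ : ZMod (2 * n) → Bool} {ι : Type*} [Fintype ι]
  {S : ι → EString}

/-! ## Strings in Khovanov homology -/

theorem isDotSlide (hD : D.IsOrientable) (e : ZMod (2 * n)) :
    IsDotSlide D.diff (MvPolynomial.X e : D.Dots) (MvPolynomial.X (e + 1))
      (D.dotSlide (D.passage e).1) where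
  diff_diff := diff_diff hD
  sq_left := D.X_smul_X_smul e
  sq_right := D.X_smul_X_smul (e + 1)
  exact_left _ := exists_eq_X_smul
  exact_right _ := exists_eq_X_smul
  homotopy x := by
    have h := dotSum_smul_eq (D.passage e) x
    rw [incoming_passage] at h
    rw [diff_dotSlide hD, sub_add_cancel, h, add_smul]
  slide x := by
    have h := X_smul_dotSlide hD (D.passage e) x
    rwa [incoming_passage] at h
  sq x := LinearMap.congr_fun (dotSlide_comp_self hD _) x

/-- Moving past a product of two anticommuting factors costs two signs. Hence e commutes with each
χ, and sliding a dot respects strings. -/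
theorem mul_pairSum_comm {A : Type*} [Ring A] {a : A} {u : ℕ → A}
    (h : ∀ i, a * u i = -(u i * a)) (m : ℕ) : a * pairSum u m = pairSum u m * a := by
  have h2 : ∀ i j, a * (u i * u j) = u i * u j * a := by
    intro i j
    rw [← mul_assoc, h, neg_mul, mul_assoc, h, mul_neg, neg_neg, mul_assoc]
  rw [pairSum, Finset.mul_sum, Finset.sum_mul]
  refine Finset.sum_congr rfl fun j _ => ?_
  rw [Finset.sum_mul, Finset.mul_sum, Finset.sum_mul]
  exact Finset.sum_congr rfl fun i _ => h2 i j

theorem dotSlide_eChain (hD : D.IsOrientable) (c : Fin n) (b : ZMod (2 * n)) (x : D.Chain) :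
    D.dotSlide c (D.eChain θ b x) = D.eChain θ b (D.dotSlide c x) := by
  rw [eChain_eq_pairSum]
  refine LinearMap.congr_fun (mul_pairSum_comm (A := Module.End D.Dots D.Chain)
    (a := D.dotSlide c) (fun i => ?_) (2 * n)) x
  rw [signedSlide, mul_smul_comm, smul_mul_assoc, ← zsmul_neg]
  congr 1
  exact dotSlide_anticomm hD _ _

theorem IsAdmissible.isStringFamily_add_one (hθ : D.IsAdmissible θ) {b x : ZMod (2 * n)}
    (h : ∃ z, IsStringFamily D.diff (D.eChain θ b) (D.reducedChain x)
      (fun t q => D.bidegree t (q + 1)) S z) :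
    ∃ z, IsStringFamily D.diff (D.eChain θ b) (D.reducedChain (x + 1))
      (fun t q => D.bidegree t (q + 1)) S z := by
  obtain ⟨z, hz⟩ := h
  have hD := hθ.isOrientable
  refine (isDotSlide hD x).isStringFamily hz
    (fun y => LinearMap.congr_fun (hθ.diff_comp_eChain b) y) (dotSlide_eChain hD _ b) ?_
  intro t q y hy hyG
  -- Both quotients by the dot, that of y and that of the differential of the first one, are chosen
  -- homogeneous, so the corresponding cycle has the bidegree of y.
  obtain ⟨a, ha, hya⟩ := exists_X_smul_of_mem_bidegree hyG
  have h1 : (MvPolynomial.X x : D.Dots) • D.diff a = 0 := by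
    rw [← map_smul, ← hya, hy]
  obtain ⟨a₁, ha₁⟩ := exists_eq_X_smul h1
  have h2 := diff_mem_bidegree hD ha
  rw [ha₁] at h2
  obtain ⟨a', ha', h3⟩ := exists_X_smul_of_mem_bidegree h2
  refine ⟨_, ?_, a, a', hya, ha₁.trans h3, rfl⟩
  have h4 := dotSlide_mem_bidegree hD (D.passage x).1 ha'
  have h5 := X_smul_mem_bidegree (x + 1) (Submodule.sub_mem _ ha (by
    convert h4 using 1
    congr 1 <;> ring))
  convert h5 using 1
  congr 1
  ring

/-- The reduced homology does not depend on the marked point. -/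
theorem IsAdmissible.isStringFamily_reduced (hθ : D.IsAdmissible θ) (hn : 0 < n)
    {b x : ZMod (2 * n)} (h : ∃ z, IsStringFamily D.diff (D.eChain θ b) (D.reducedChain x)
      (fun t q => D.bidegree t (q + 1)) S z) (y : ZMod (2 * n)) :
    ∃ z, IsStringFamily D.diff (D.eChain θ b) (D.reducedChain y)
      (fun t q => D.bidegree t (q + 1)) S z := by
  have : NeZero (2 * n) := ⟨by omega⟩
  have h1 : ∀ k : ℕ, ∃ z, IsStringFamily D.diff (D.eChain θ b) (D.reducedChain (x + k))
      (fun t q => D.bidegree t (q + 1)) S z := by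
    intro k
    induction k with
    | zero => simpa using h
    | succ k ih =>
      have := hθ.isStringFamily_add_one ih
      rw [add_assoc] at this
      exact_mod_cast this
  have h2 := h1 (y - x).val
  rwa [ZMod.natCast_zmod_val, add_sub_cancel] at h2

theorem scale_factor_injective (k : ℤ) :
    Function.Injective fun δ : ℤ => (2 : ℚ) ^ (δ + k + D.posCount) := by
  intro a b hab
  have := zpow_right_injective₀ (by norm_num : (0 : ℚ) < 2) (by norm_num) hab
  linarith

theorem IsAdmissible.kh_of_isStringFamily (hθ : D.IsAdmissible θ) {b : ZMod (2 * n)}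
    {z : (Σ i, Fin (S i).len) → D.Chain} (h : IsStringFamily D.diff (D.eChain θ b) ⊤ D.bidegree S z)
    (he : D.diff ∘ₗ D.eChain θ b = D.eChain θ b ∘ₗ D.diff) {Δ : Set ℤ}
    (hS : ∀ i, 2 * (S i).t + (S i).q ∈ Δ) :
    SupportedOnDelta D.KhBidegree Δ ∧ HasStringDecomposition D.KhBidegree (D.eKh θ b he) S := by
  refine ⟨?_, h.hasStringDecomposition he fun _ _ => trivial⟩
  refine h.supportedOnDelta (L := D.scale) (fun _ _ => trivial)
    (scale_diff hθ.isOrientable) (scale_factor_injective (D := D) 0) ?_ hS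
  intro t q x hx
  rw [scale_of_mem_bidegree hx, add_zero]

theorem IsAdmissible.rkh_of_isStringFamily (hθ : D.IsAdmissible θ) (hn : 0 < n)
    {b x : ZMod (2 * n)} (h : ∃ z, IsStringFamily D.diff (D.eChain θ b) (D.reducedChain x)
      (fun t q => D.bidegree t (q + 1)) S z) (y : ZMod (2 * n))
    (he : D.diff ∘ₗ D.eChain θ b = D.eChain θ b ∘ₗ D.diff) {Δ : Set ℤ}
    (hS : ∀ i, 2 * (S i).t + (S i).q ∈ Δ) :
    SupportedOnDelta (D.RKhBidegree y) Δ ∧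
      HasStringDecomposition (D.RKhBidegree y) (D.eRKh y θ b he) S := by
  obtain ⟨z, hz⟩ := hθ.isStringFamily_reduced hn h y
  refine ⟨?_, hz.hasStringDecomposition he (D.map_mem_reducedChain y _)⟩
  refine hz.supportedOnDelta (L := D.scale) ?_
    (scale_diff hθ.isOrientable) (scale_factor_injective (D := D) 1) ?_ hS
  · rintro _ ⟨w, rfl⟩
    exact ⟨_, (scale_X_smul y w).symm⟩
  · intro t q w hw
    rw [scale_of_mem_bidegree hw, ← add_assoc (2 * t)]

end KnotDiagram

/-! ## The geometry of the twist knot diagrams -/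

namespace KnotDiagram.TwistKnot

variable {p : ℕ}

/-- The `i`-th twist crossing. -/
def tw (p i : ℕ) : Fin (p + 2) := ⟨min (i + 2) (p + 1), by omega⟩

theorem tw_val {i : ℕ} (hi : i < p) : (tw p i : ℕ) = i + 2 := by
  simp only [tw]
  omega

theorem tw_ne {i j : ℕ} (hi : i < p) (hj : j < p) (h : i ≠ j) : tw p i ≠ tw p j := by
  intro h'
  have := congrArg Fin.val h'
  rw [tw_val hi, tw_val hj] at this
  omega

theorem tw_ne_zero {i : ℕ} (hi : i < p) : tw p i ≠ 0 := by
  intro h'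
  have := congrArg Fin.val h'
  rw [tw_val hi] at this
  simp at this

theorem tw_ne_one {i : ℕ} (hi : i < p) : tw p i ≠ 1 := by
  intro h'
  have := congrArg Fin.val h'
  rw [tw_val hi] at this
  simp at this

theorem crossing_cases (c : Fin (p + 2)) : c = 0 ∨ c = 1 ∨ ∃ i < p, c = tw p i := by
  obtain ⟨c, hc⟩ := c
  rcases c with _ | _ | i
  · exact Or.inl rfl
  · exact Or.inr (Or.inl (Fin.ext (by simp)))
  · refine Or.inr (Or.inr ⟨i, by omega, Fin.ext ?_⟩)
    rw [tw_val (by omega)]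

/-- The upper edge in the `k`-th column of the row of twist crossings. -/
def upper (p k : ℕ) : ZMod (2 * (p + 2)) := ((k + 2 : ℕ) : ZMod (2 * (p + 2)))

/-- The lower edge in the `k`-th column of the row of twist crossings. -/
def lower (p k : ℕ) : ZMod (2 * (p + 2)) := ((2 * p + 4 - k : ℕ) : ZMod (2 * (p + 2)))

/-- The two edges of the bigon of the clasp. -/
def bigon (p : ℕ) (b : Bool) : ZMod (2 * (p + 2)) :=
  if b then ((p + 3 : ℕ) : ZMod (2 * (p + 2))) else ((1 : ℕ) : ZMod (2 * (p + 2)))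

/-- The edges from the right end of the row of twist crossings to the clasp crossings. -/
def ending (p : ℕ) (b : Bool) : ZMod (2 * (p + 2)) :=
  if (Even p ↔ b = false) then upper p p else lower p p

theorem edge_eq (c : Fin (p + 2)) (a : Fin 4) :
    (twistKnot p).edge c a = ((twistCode p c a : ℕ) : ZMod (2 * (p + 2))) := rfl

theorem edge_tw {i : ℕ} (hi : i < p) (a : Fin 4) : (twistKnot p).edge (tw p i) a =
    (if Even i then ![lower p (i + 1), upper p (i + 1), lower p i, upper p i] else
      ![upper p i, lower p i, upper p (i + 1), lower p (i + 1)]) a := by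
  rw [edge_eq, tw_val hi]
  have h : 2 * p + 4 - (i + 1) = 2 * p + 3 - i := by omega
  by_cases he : Even i <;> fin_cases a <;> simp [twistCode, he, upper, lower, h] <;> ring

theorem edge_zero (a : Fin 4) : (twistKnot p).edge 0 a =
    ![bigon p false, ending p false, upper p 0, bigon p true] a := by
  rw [edge_eq]
  have h : 2 * p + 4 - p = p + 4 := by omega
  by_cases he : Even p <;> fin_cases a <;> simp [twistCode, he, upper, lower, bigon, ending, h]

theorem edge_one (a : Fin 4) : (twistKnot p).edge 1 a =
    (if Even p then ![bigon p true, lower p 0, ending p true, bigon p false] else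
      ![ending p true, bigon p false, bigon p true, lower p 0]) a := by
  rw [edge_eq]
  have h : 2 * p + 4 - p = p + 4 := by omega
  by_cases he : Even p <;> fin_cases a <;>
    simp [twistCode, he, upper, lower, bigon, ending, h]

theorem edge_cases (e : ZMod (2 * (p + 2))) :
    (∃ k ≤ p, e = upper p k) ∨ (∃ k ≤ p, e = lower p k) ∨ e = bigon p false ∨
      e = bigon p true := by
  have : NeZero (2 * (p + 2)) := ⟨by omega⟩
  have h := ZMod.natCast_zmod_val e
  have hl := ZMod.val_lt e
  generalize e.val = k at h hl
  subst h
  rcases Nat.eq_zero_or_pos k with h0 | h0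
  · refine Or.inr (Or.inl ⟨0, by omega, ?_⟩)
    have h2 : 2 * p + 4 - 0 = 2 * (p + 2) := by omega
    rw [h0, lower, h2, Nat.cast_zero, ZMod.natCast_self]
  rcases Nat.lt_or_ge k 2 with h2 | h2
  · refine Or.inr (Or.inr (Or.inl ?_))
    rw [bigon, if_neg (by simp)]
    congr 1
    omega
  rcases Nat.lt_or_ge (p + 2) k with h3 | h3
  · rcases Nat.lt_or_ge (p + 3) k with h4 | h4
    · refine Or.inr (Or.inl ⟨2 * p + 4 - k, by omega, ?_⟩)
      rw [lower]
      congr 1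
      omega
    · refine Or.inr (Or.inr (Or.inr ?_))
      rw [bigon, if_pos rfl]
      congr 1
      omega
  · refine Or.inl ⟨k - 2, by omega, ?_⟩
    rw [upper]
    congr 1
    omega

/-! ### The standard coloring -/

/-- The coloring by the parity of the edges. -/
def parityColoring (p : ℕ) (e : ZMod (2 * (p + 2))) : Bool :=
  decide (ZMod.castHom (Dvd.intro _ rfl : 2 ∣ 2 * (p + 2)) (ZMod 2) e = 0)

theorem parityColoring_natCast (k : ℕ) :
    parityColoring p (k : ZMod (2 * (p + 2))) = decide (Even k) := by
  rw [parityColoring, map_natCast]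
  congr 1
  rw [ZMod.natCast_eq_zero_iff_even]

theorem isAdmissible_parityColoring (p : ℕ) :
    (twistKnot p).IsAdmissible (parityColoring p) := by
  rintro ⟨c, hc⟩
  simp only [edge_eq, parityColoring_natCast]
  have hpos : (twistKnot p).pos ⟨c, hc⟩ = twistPos p c := rfl
  rw [hpos]
  rcases c with _ | _ | i
  · by_cases hp : Even p <;> simp [twistPos, twistCode, hp] <;> grind
  · by_cases hp : Even p <;> simp [twistPos, twistCode, hp] <;> grind
  · have h1 : 2 * p + 3 - i = 2 * (p - i) + i + 3 := by omega
    have h2 : 2 * p + 4 - i = 2 * (p - i) + i + 4 := by omega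
    by_cases hi : Even i <;> simp [twistPos, twistCode, hi, h1, h2] <;> grind

theorem isOrientable (p : ℕ) : (twistKnot p).IsOrientable :=
  (isAdmissible_parityColoring p).isOrientable

/-! ### Circles -/

theorem circle_upper_of_zero {v : Fin (p + 2) → Bool} {i : ℕ} (hi : i < p)
    (h : v (tw p i) = false) :
    (twistKnot p).circle v (upper p i) = (twistKnot p).circle v (lower p i) ∧
      (twistKnot p).circle v (upper p (i + 1)) = (twistKnot p).circle v (lower p (i + 1)) := by
  have h0 := circle_mate (D := twistKnot p) v (tw p i) 0
  have h2 := circle_mate (D := twistKnot p) v (tw p i) 2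
  rw [h, edge_tw hi, edge_tw hi] at h0 h2
  by_cases he : Even i <;> simp [he, mate] at h0 h2 <;> simp [h0, h2]

/-- A one lets both strands of the row pass. The labels are exchanged because they follow the
strands of the knot, which cross here. -/
theorem circle_upper_of_one {v : Fin (p + 2) → Bool} {i : ℕ} (hi : i < p)
    (h : v (tw p i) = true) :
    (twistKnot p).circle v (upper p i) = (twistKnot p).circle v (lower p (i + 1)) ∧
      (twistKnot p).circle v (lower p i) = (twistKnot p).circle v (upper p (i + 1)) := by
  have h0 := circle_mate (D := twistKnot p) v (tw p i) 0
  have h1 := circle_mate (D := twistKnot p) v (tw p i) 1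
  rw [h, edge_tw hi, edge_tw hi] at h0 h1
  by_cases he : Even i <;> simp [he, mate] at h0 h1 <;> simp [h0, h1]

theorem circle_clasp_zero {v : Fin (p + 2) → Bool} : if v 0 then
    (twistKnot p).circle v (bigon p false) = (twistKnot p).circle v (bigon p true) ∧
      (twistKnot p).circle v (ending p false) = (twistKnot p).circle v (upper p 0) else
    (twistKnot p).circle v (bigon p false) = (twistKnot p).circle v (ending p false) ∧
      (twistKnot p).circle v (bigon p true) = (twistKnot p).circle v (upper p 0) := by
  have h0 := circle_mate (D := twistKnot p) v 0 0
  have h1 := circle_mate (D := twistKnot p) v 0 1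
  have h2 := circle_mate (D := twistKnot p) v 0 2
  rw [edge_zero, edge_zero] at h0 h1 h2
  cases h : v 0 <;> rw [h] at h0 h1 h2 <;> simp [mate] at h0 h1 h2 ⊢ <;>
    grind

theorem circle_clasp_one {v : Fin (p + 2) → Bool} : if v 1 then
    (twistKnot p).circle v (bigon p false) = (twistKnot p).circle v (bigon p true) ∧
      (twistKnot p).circle v (ending p true) = (twistKnot p).circle v (lower p 0) else
    (twistKnot p).circle v (bigon p false) = (twistKnot p).circle v (ending p true) ∧
      (twistKnot p).circle v (bigon p true) = (twistKnot p).circle v (lower p 0) := by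
  have h0 := circle_mate (D := twistKnot p) v 1 0
  have h1 := circle_mate (D := twistKnot p) v 1 1
  have h2 := circle_mate (D := twistKnot p) v 1 2
  rw [edge_one, edge_one] at h0 h1 h2
  cases h : v 1 <;> rw [h] at h0 h1 h2 <;> by_cases he : Even p <;>
    simp [mate, he] at h0 h1 h2 ⊢ <;> grind

theorem joined_zero_iff {v : Fin (p + 2) → Bool} : (twistKnot p).Joined 0 v ↔
    (twistKnot p).circle v (bigon p false) = (twistKnot p).circle v (upper p 0) := by
  rw [KnotDiagram.Joined, edge_zero, edge_zero]
  rfl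

theorem joined_one_iff {v : Fin (p + 2) → Bool} : (twistKnot p).Joined 1 v ↔
    (twistKnot p).circle v (bigon p true) = (twistKnot p).circle v (ending p true) := by
  rw [KnotDiagram.Joined, edge_one, edge_one]
  by_cases he : Even p <;> simp [he, eq_comm]

theorem dotSum_zero : (twistKnot p).dotSum 0 =
    MvPolynomial.X (bigon p false) + MvPolynomial.X (upper p 0) := by
  rw [dotSum, edge_zero, edge_zero]
  rfl

theorem dotSum_one : (twistKnot p).dotSum 1 =
    MvPolynomial.X (bigon p true) + MvPolynomial.X (ending p true) := by
  rw [dotSum, edge_one, edge_one]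
  by_cases he : Even p <;> simp [he, add_comm]

/-! ### Closed columns -/

/-- The two edges of the `k`-th column lie on the same circle. -/
def Closed (v : Fin (p + 2) → Bool) (k : ℕ) : Prop :=
  (twistKnot p).circle v (upper p k) = (twistKnot p).circle v (lower p k)

theorem closed_succ_iff (v : Fin (p + 2) → Bool) {i : ℕ} (hi : i < p) :
    Closed v (i + 1) ↔ Closed v i := by
  cases h : v (tw p i)
  · obtain ⟨h0, h1⟩ := circle_upper_of_zero hi h
    exact iff_of_true h1 h0
  · obtain ⟨h0, h1⟩ := circle_upper_of_one hi h
    rw [Closed, Closed, h0, h1, eq_comm]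

theorem closed_iff (v : Fin (p + 2) → Bool) {k : ℕ} (hk : k ≤ p) : Closed v k ↔ Closed v 0 := by
  induction k with
  | zero => rfl
  | succ k ih => rw [closed_succ_iff v (by omega), ih (by omega)]

theorem closed_of_zero {v : Fin (p + 2) → Bool} {i : ℕ} (hi : i < p) (h : v (tw p i) = false) :
    Closed v 0 := (closed_iff v hi.le).1 (circle_upper_of_zero hi h).1

variable {v : Fin (p + 2) → Bool}

theorem circle_upper_succ (hv : Closed v 0) {i : ℕ} (hi : i < p) (h : v (tw p i) = true) :
    (twistKnot p).circle v (upper p i) = (twistKnot p).circle v (upper p (i + 1)) := by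
  have h1 := (closed_iff v (k := i + 1) hi).2 hv
  rw [Closed] at h1
  rw [h1, (circle_upper_of_one hi h).1]

theorem circle_upper_eq (hv : Closed v 0) {i j : ℕ} (hij : i ≤ j) (hj : j ≤ p)
    (h : ∀ k, i ≤ k → k < j → v (tw p k) = true) :
    (twistKnot p).circle v (upper p i) = (twistKnot p).circle v (upper p j) := by
  induction j, hij using Nat.le_induction with
  | base => rfl
  | succ j hij ih =>
    rw [ih (by omega) fun k h1 h2 => h k h1 (by omega),
      circle_upper_succ hv (by omega) (h j hij (by omega))]

theorem circle_ending (hv : Closed v 0) (b : Bool) :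
    (twistKnot p).circle v (ending p b) = (twistKnot p).circle v (upper p p) := by
  have h := (closed_iff v le_rfl).2 hv
  rw [Closed] at h
  rw [ending]
  split_ifs
  · rfl
  · exact h.symm

theorem joined_tw_iff (hv : Closed v 0) {i : ℕ} (hi : i < p) :
    (twistKnot p).Joined (tw p i) v ↔
      (twistKnot p).circle v (upper p i) = (twistKnot p).circle v (upper p (i + 1)) := by
  have h0 := (closed_iff v hi.le).2 hv
  have h1 := (closed_iff v (k := i + 1) hi).2 hv
  rw [Closed] at h0 h1
  rw [KnotDiagram.Joined, edge_tw hi, edge_tw hi]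
  by_cases he : Even i <;> simp [he]
  rw [← h0, ← h1, eq_comm]

theorem gen_dotSum_tw (hv : Closed v 0) {i : ℕ} (hi : i < p) (f : (twistKnot p).Dots) :
    (twistKnot p).gen v ((twistKnot p).dotSum (tw p i) * f) = (twistKnot p).gen v
      ((MvPolynomial.X (upper p i) + MvPolynomial.X (upper p (i + 1))) * f) := by
  have h0 := (closed_iff v hi.le).2 hv
  have h1 := (closed_iff v (k := i + 1) hi).2 hv
  rw [Closed] at h0 h1
  rw [gen_eq_gen_iff, dotSum, edge_tw hi, edge_tw hi]
  by_cases he : Even i <;> simp [he]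
  rw [← algebraMap_X_eq _ h0, ← algebraMap_X_eq _ h1]
  ring

theorem joined_tw_of_one (hv : Closed v 0) {i : ℕ} (hi : i < p) (h : v (tw p i) = true) :
    (twistKnot p).Joined (tw p i) v := (joined_tw_iff hv hi).2 (circle_upper_succ hv hi h)

/-- A zero in the row merges two different circles, if there is another zero. -/
theorem not_joined_tw {i j : ℕ} (hi : i < p) (hj : j < p) (hij : i ≠ j)
    (h : v (tw p i) = false) (h' : v (tw p j) = false) : ¬ (twistKnot p).Joined (tw p i) v := by
  -- After the change at i the zero at j still closes the columns, so the new one at i connects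
  -- columns i and i + 1; before the change they were apart.
  refine (isOrientable p _ _).1 (joined_tw_of_one ?_ hi (by simp [h]))
  exact closed_of_zero hj (by rw [flip_ne (tw_ne hj hi hij.symm), h'])

/-- Different columns that are separated by a zero in the row, with another zero to the right, lie
on different circles. -/
theorem circle_upper_ne {i j m : ℕ} (hij : i ≤ j) (hjm : j < m) (hm : m < p)
    (h : v (tw p i) = false) (h' : v (tw p m) = false) :
    (twistKnot p).circle v (upper p i) ≠ (twistKnot p).circle v (upper p (j + 1)) := by
  induction j, hij using Nat.le_induction generalizing v with
  | base =>
    exact fun h0 => not_joined_tw (by omega) hm (by omega) h h'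
      ((joined_tw_iff (closed_of_zero hm h') (by omega)).2 h0)
  | succ j hij ih =>
    intro h0
    cases hv : v (tw p (j + 1))
    -- Turning the zero at j + 1 into a one is a merge. It preserves the supposed equality and moves
    -- it one column to the left.
    · have hn := not_joined_tw (show j + 1 < p by omega) hm (by omega) hv h'
      have h1 := circle_flip_of_circle (isOrientable p) hn h0
      have h2 : flip (tw p (j + 1)) v (tw p m) = false := by
        rw [flip_ne (tw_ne hm (by omega) (by omega)), h']
      refine ih (by omega) ?_ h2 (h1.trans ?_)
      · rw [flip_ne (tw_ne (by omega) (by omega) (by omega)), h]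
      · exact (circle_upper_succ (closed_of_zero hm h2) (by omega) (by simp [hv])).symm
    · exact ih (by omega) h h'
        (h0.trans (circle_upper_succ (closed_of_zero hm h') (by omega) hv).symm)

end KnotDiagram.TwistKnot

/-! ## Quasi-isomorphic subcomplexes -/

section GoodPair

variable {R M : Type*} [CommRing R] [AddCommGroup M] [Module R M]

/-- If `A ≤ B` are subcomplexes, this says that the quotient `B / A` is acyclic. -/
def GoodPair (d : M →ₗ[R] M) (A B : Submodule R M) : Prop :=
  ∀ x ∈ B, d x ∈ A → ∃ a ∈ A, ∃ b ∈ B, x = a + d b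

theorem GoodPair.refl (d : M →ₗ[R] M) (A : Submodule R M) : GoodPair d A A :=
  fun x hx _ => ⟨x, hx, 0, A.zero_mem, by simp⟩

theorem GoodPair.trans {d : M →ₗ[R] M} (hd : ∀ x, d (d x) = 0) {A B C : Submodule R M}
    (hAB : A ≤ B) (hBC : B ≤ C) (h : GoodPair d A B) (h' : GoodPair d B C) :
    GoodPair d A C := by
  intro x hx hdx
  obtain ⟨b, hb, c, hc, rfl⟩ := h' x hx (hAB hdx)
  rw [map_add, hd, add_zero] at hdx
  obtain ⟨a, ha, b', hb', rfl⟩ := h b hb hdx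
  exact ⟨a, ha, b' + c, C.add_mem (hBC hb') hc, by rw [map_add, add_assoc]⟩

end GoodPair

/-! ### Chains with prescribed divisors, and Gaussian elimination -/

namespace KnotDiagram

variable {n : ℕ} {D : KnotDiagram n}

theorem sum_gen_apply (F : (Fin n → Bool) → D.Dots) (v : Fin n → Bool) :
    (∑ w, D.gen w (F w)) v = algebraMap D.Dots (D.Res v) (F v) := by
  rw [Finset.sum_apply, Finset.sum_eq_single v, gen_apply_same]
  · intro w _ hw
    exact D.gen_apply_ne hw.symm _
  · simp

theorem edgeMap_apply_of_ne {c : Fin n} {b : Bool} {v : Fin n → Bool} (hv : v c ≠ !b)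
    (x : D.Chain) : D.edgeMap c b x v = 0 := by
  rw [edgeMap_apply]
  exact Finset.sum_eq_zero fun w _ => if_neg fun h => hv h.2

theorem edgeMap_apply_of_eq (hD : D.IsOrientable) {c : Fin n} {b : Bool} {v : Fin n → Bool}
    (hv : v c = !b) {x : D.Chain} {f : D.Dots}
    (hf : x (flip c v) = algebraMap D.Dots (D.Res (flip c v)) f) :
    D.edgeMap c b x v =
      sign c v • algebraMap D.Dots (D.Res v) (D.coef c (flip c v) * f) := by
  have hvf : flip c v c = b := by rw [flip_same, hv, Bool.not_not]
  rw [edgeMap_apply, Finset.sum_eq_single (flip c v)]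
  · have h := saddle_flip hD c (flip c v) f
    rw [flip_flip] at h
    rw [if_pos ⟨hvf, hv⟩, hf, h, sign_flip_same]
  · intro w _ hw
    split_ifs with h
    · rw [saddle_eq_zero (by rw [h.1, hv]) (fun h' => hw (by rw [h', flip_flip])),
        LinearMap.zero_apply, smul_zero]
    · rfl
  · simp

theorem diff_apply (x : D.Chain) (v : Fin n → Bool) :
    D.diff x v = ∑ c, D.edgeMap c false x v := by
  rw [diff, LinearMap.sum_apply, Finset.sum_apply]

/-- The submodule of all chains whose value at each resolution `v` is a multiple of `β v`. -/
def multiples (D : KnotDiagram n) (β : (Fin n → Bool) → D.Dots) : Submodule D.Dots D.Chain :=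
  Submodule.span D.Dots (Set.range fun v => D.gen v (β v))

theorem mem_multiples_iff {β : (Fin n → Bool) → D.Dots} {x : D.Chain} :
    x ∈ D.multiples β ↔ ∃ F : (Fin n → Bool) → D.Dots, x = ∑ v, D.gen v (β v * F v) := by
  rw [multiples, Submodule.mem_span_range_iff_exists_fun]
  refine exists_congr fun F => ?_
  rw [eq_comm]
  simp only [smul_gen, mul_comm]

theorem gen_mem_multiples (β : (Fin n → Bool) → D.Dots) (v : Fin n → Bool) (f : D.Dots) :
    D.gen v (β v * f) ∈ D.multiples β := by
  rw [mul_comm (β v), ← smul_gen]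
  exact Submodule.smul_mem _ _ (Submodule.subset_span ⟨v, rfl⟩)

theorem gen_mem_multiples_of_dvd {β : (Fin n → Bool) → D.Dots} {v : Fin n → Bool} {f : D.Dots}
    (h : β v ∣ f) : D.gen v f ∈ D.multiples β := by
  obtain ⟨g, rfl⟩ := h
  exact gen_mem_multiples β v g

theorem multiples_le {β : (Fin n → Bool) → D.Dots} {A : Submodule D.Dots D.Chain}
    (h : ∀ v, D.gen v (β v) ∈ A) : D.multiples β ≤ A := by
  refine Submodule.span_le.2 ?_
  rintro _ ⟨v, rfl⟩
  exact h v

theorem diff_mem_multiples {β : (Fin n → Bool) → D.Dots}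
    (h : ∀ v c, D.edgeMap c false (D.gen v (β v)) ∈ D.multiples β) {x : D.Chain}
    (hx : x ∈ D.multiples β) : D.diff x ∈ D.multiples β := by
  have h1 : D.multiples β ≤ (D.multiples β).comap D.diff := by
    refine multiples_le fun v => ?_
    rw [Submodule.mem_comap, diff, LinearMap.sum_apply]
    exact Submodule.sum_mem _ fun c _ => h v c
  exact h1 hx

/-- Gaussian elimination along the crossing `c`, simultaneously for all resolutions `v` with
`v c = true` that satisfy `P`. -/
theorem goodPair_of_merge (hD : D.IsOrientable) {β : (Fin n → Bool) → D.Dots} {c : Fin n}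
    {P : (Fin n → Bool) → Prop} {A : Submodule D.Dots D.Chain}
    (hB : ∀ x ∈ D.multiples β, D.diff x ∈ D.multiples β)
    (hPc : ∀ v, P v → v c = true)
    (hP : ∀ v, P v → ∀ c', c' ≠ c → v c' = true → P (flip c' v))
    (hβ : ∀ v, P v → β (flip c v) = β v)
    (hj : ∀ v, P v → ¬ D.Joined c (flip c v))
    (hker : ∀ v, P v → ∀ f, D.gen v (β v * f) = 0 → D.gen (flip c v) (β v * f) ∈ A)
    (hA0 : ∀ x ∈ A, ∀ v, P v → x v = 0)
    (hA : ∀ v, ¬ P v → (v c = false → ¬ P (flip c v)) → D.gen v (β v) ∈ A) :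
    GoodPair D.diff A (D.multiples β) := by
  classical
  intro x hx hdx
  obtain ⟨F, hF⟩ := mem_multiples_iff.1 hx
  have hflip : ∀ v, P v → flip c v c = false := fun v hv => by rw [flip_same, hPc v hv]; rfl
  -- The chain b lives on the sources of the merges at c, which hit every multiple of the generator
  -- of the target. Every other saddle into v starts at a resolution with value one at c, where b
  -- vanishes.
  have hbe : ∃ b ∈ D.multiples β, ∀ v, P v → D.diff b v = x v := by
    refine ⟨∑ w, D.gen w (if w c = false ∧ P (flip c w) then
      sign c w • (β w * F (flip c w)) else 0), ?_, ?_⟩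
    · refine Submodule.sum_mem _ fun w _ => ?_
      split_ifs
      · rw [map_zsmul]
        exact zsmul_mem (gen_mem_multiples _ _ _) _
      · rw [map_zero]
        exact Submodule.zero_mem _
    · intro v hv
      rw [diff_apply, Finset.sum_eq_single c]
      · rw [edgeMap_apply_of_eq hD (hPc v hv) (sum_gen_apply _ _),
          if_pos ⟨hflip v hv, by rwa [flip_flip]⟩, coef_not_joined _ (hj v hv), one_mul,
          flip_flip, hβ v hv, sign_flip_same, map_zsmul, smul_smul, sign_mul_self, one_smul, hF,
          sum_gen_apply]
      · intro c' _ hc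
        by_cases hv' : v c' = true
        · rw [edgeMap_apply_of_eq hD hv' (sum_gen_apply _ _), if_neg, mul_zero, map_zero,
            smul_zero]
          rintro ⟨h1, -⟩
          rw [flip_ne hc.symm, hPc v hv] at h1
          exact absurd h1 (by simp)
        · exact edgeMap_apply_of_ne hv' _
      · simp
  obtain ⟨b, hb, hbx⟩ := hbe
  refine ⟨x - D.diff b, ?_, b, hb, by rw [sub_add_cancel]⟩
  obtain ⟨F', hF'⟩ := mem_multiples_iff.1 (Submodule.sub_mem _ hx (hB b hb))
  have h0 : ∀ v, P v → algebraMap D.Dots (D.Res v) (β v * F' v) = 0 := by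
    intro v hv
    rw [← sum_gen_apply (fun v => β v * F' v), ← hF', Pi.sub_apply, hbx v hv, sub_self]
  -- The other saddles into v start at resolutions satisfying P, where x - d b vanishes. As d x lies
  -- in A, the merge at c alone must kill the component at its source.
  have h1 : ∀ v, P v → D.gen (flip c v) (β (flip c v) * F' (flip c v)) ∈ A := by
    intro v hv
    rw [hβ v hv]
    refine hker v hv _ ?_
    have h2 := hA0 (D.diff (x - D.diff b)) (by rwa [map_sub, diff_diff hD, sub_zero]) v hv
    rw [diff_apply, hF', Finset.sum_eq_single c] at h2
    · rw [edgeMap_apply_of_eq hD (hPc v hv) (sum_gen_apply _ _), coef_not_joined _ (hj v hv),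
        one_mul, hβ v hv] at h2
      rw [gen_eq_zero_iff]
      have h3 := congrArg (fun y => sign c v • y) h2
      simp only [smul_smul, sign_mul_self, one_smul, smul_zero] at h3
      exact h3
    · intro c' _ hc
      by_cases hv' : v c' = true
      · rw [edgeMap_apply_of_eq hD hv' (f := 0)
          (by rw [sum_gen_apply, h0 _ (hP v hv c' hc hv'), map_zero]),
          mul_zero, map_zero, smul_zero]
      · exact edgeMap_apply_of_ne hv' _
    · simp
  rw [hF']
  refine Submodule.sum_mem _ fun v _ => ?_
  by_cases hv : P v
  · rw [(gen_eq_zero_iff D).2 (h0 v hv)]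
    exact Submodule.zero_mem _
  · by_cases hv' : v c = false ∧ P (flip c v)
    · have := h1 _ hv'.2
      rwa [flip_flip] at this
    · rw [mul_comm (β v), ← smul_gen]
      exact Submodule.smul_mem _ _ (hA v hv fun h2 h3 => hv' ⟨h2, h3⟩)

end KnotDiagram

namespace KnotDiagram.TwistKnot

variable {p : ℕ} {v : Fin (p + 2) → Bool}

/-! ### Reduction to rows without a zero behind a one -/

/-- There is a zero of the row to the right of the crossing `i`. -/
def Later (v : Fin (p + 2) → Bool) (i : ℕ) : Prop := ∃ m, i < m ∧ m < p ∧ v (tw p m) = false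

theorem Later.mono {i k : ℕ} (h : Later v k) (hik : i ≤ k) : Later v i := by
  obtain ⟨m, h1, h2, h3⟩ := h
  exact ⟨m, by omega, h2, h3⟩

theorem later_of_flip {i : ℕ} {c : Fin (p + 2)} (hc : v c = false) (h : Later (flip c v) i) :
    Later v i := by
  obtain ⟨m, h1, h2, h3⟩ := h
  refine ⟨m, h1, h2, ?_⟩
  by_cases hm : tw p m = c
  · rw [hm, hc]
  · rwa [flip_ne hm] at h3

theorem later_flip_iff {i j : ℕ} (hj : j < p) (hij : j ≤ i) :
    Later (flip (tw p j) v) i ↔ Later v i := by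
  refine exists_congr fun m => and_congr_right fun h1 => and_congr_right fun h2 => ?_
  rw [flip_ne (tw_ne h2 hj (by omega))]

open scoped Classical in
/-- The product of the dots on the columns to the right of the first `j` crossings that have a zero
to their right. -/
def dotProd (j : ℕ) (v : Fin (p + 2) → Bool) : (twistKnot p).Dots :=
  MvPolynomial.X (upper p 0) *
    ∏ i ∈ Finset.range j, if Later v i then MvPolynomial.X (upper p (i + 1)) else 1

theorem dotProd_succ_of_later {j : ℕ} (h : Later v j) :
    dotProd (j + 1) v = dotProd j v * MvPolynomial.X (upper p (j + 1)) := by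
  rw [dotProd, Finset.prod_range_succ, if_pos h, dotProd, mul_assoc]

theorem dotProd_succ_of_not_later {j : ℕ} (h : ¬ Later v j) :
    dotProd (j + 1) v = dotProd j v := by
  rw [dotProd, Finset.prod_range_succ, if_neg h, dotProd, mul_one]

theorem dotProd_dvd {i j : ℕ} (h : i ≤ j) : dotProd i v ∣ dotProd j v :=
  mul_dvd_mul_left _ (Finset.prod_dvd_prod_of_subset _ _ _
    (Finset.range_subset_range.2 h))

theorem X_dvd_dotProd {i j : ℕ} (h : i ≤ j) (hi : i = 0 ∨ Later v (i - 1)) :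
    MvPolynomial.X (upper p i) ∣ dotProd j v := by
  refine dvd_trans ?_ (dotProd_dvd h)
  rcases Nat.eq_zero_or_pos i with rfl | h0
  · exact dvd_mul_right _ _
  · obtain ⟨k, rfl⟩ : ∃ k, i = k + 1 := ⟨i - 1, by omega⟩
    have hk : Later v k := hi.resolve_left (by omega)
    rw [dotProd_succ_of_later hk]
    exact dvd_mul_left _ _

theorem X_mul_X_dvd_dotProd {i j : ℕ} (h : i < j) (hi : Later v i) :
    MvPolynomial.X (upper p i) * MvPolynomial.X (upper p (i + 1)) ∣ dotProd j v := by
  refine dvd_trans ?_ (dotProd_dvd h)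
  rw [dotProd_succ_of_later hi]
  exact mul_dvd_mul_right (X_dvd_dotProd le_rfl (Or.inr (hi.mono (by omega)))) _

theorem dotProd_congr {v' : Fin (p + 2) → Bool} {j : ℕ}
    (h : ∀ i < j, Later v i ↔ Later v' i) : dotProd j v = dotProd j v' := by
  classical
  rw [dotProd, dotProd]
  congr 1
  exact Finset.prod_congr rfl fun i hi => if_congr (h i (Finset.mem_range.1 hi)) rfl rfl

theorem dotProd_flip_dvd {j : ℕ} {c : Fin (p + 2)} (hc : v c = false) :
    dotProd j (flip c v) ∣ dotProd j v := by
  refine mul_dvd_mul_left _ (Finset.prod_dvd_prod_of_dvd _ _ fun i _ => ?_)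
  by_cases h : Later (flip c v) i
  · rw [if_pos h, if_pos (later_of_flip hc h)]
  · rw [if_neg h]
    exact one_dvd _

/-- None of the first `j` crossings is a one with a zero to the right. -/
def Sorted (j : ℕ) (v : Fin (p + 2) → Bool) : Prop :=
  ∀ i < j, v (tw p i) = true → ¬ Later v i

open scoped Classical in
/-- The generator of the subcomplex after `j` steps of the reduction, for the resolution `v`. -/
def rowGen (j : ℕ) (v : Fin (p + 2) → Bool) : (twistKnot p).Dots :=
  if Sorted j v then dotProd j v else 0

theorem rowGen_of_sorted {j : ℕ} (h : Sorted j v) : rowGen j v = dotProd j v := if_pos h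

theorem rowGen_of_not_sorted {j : ℕ} (h : ¬ Sorted j v) : rowGen j v = 0 := if_neg h

theorem rowGen_dvd_succ (j : ℕ) (v : Fin (p + 2) → Bool) : rowGen j v ∣ rowGen (j + 1) v := by
  by_cases h : Sorted (j + 1) v
  · rw [rowGen_of_sorted h, rowGen_of_sorted fun i hi => h i (by omega)]
    exact dotProd_dvd (by omega)
  · rw [rowGen_of_not_sorted h]
    exact dvd_zero _

/-- These multiples form a subcomplex. Turning a zero that has a later zero into a one would spoil
the order, but it merges two columns that both carry dots and gives zero. Any other change keeps the
row sorted and requires no further dots. -/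
theorem edgeMap_rowGen_mem {j : ℕ} (hj : j ≤ p) (v : Fin (p + 2) → Bool) (c : Fin (p + 2)) :
    (twistKnot p).edgeMap c false ((twistKnot p).gen v (rowGen j v)) ∈
      (twistKnot p).multiples (rowGen j) := by
  by_cases hs : Sorted j v
  swap
  · rw [rowGen_of_not_sorted hs, map_zero, map_zero]
    exact Submodule.zero_mem _
  rw [edgeMap_gen (isOrientable p), rowGen_of_sorted hs]
  split_ifs with hc
  swap
  · exact Submodule.zero_mem _
  refine zsmul_mem ?_ _
  by_cases hB : ∃ i < j, c = tw p i ∧ Later v i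
  · obtain ⟨i, hi, rfl, hl⟩ := hB
    obtain ⟨m, hm1, hm2, hm3⟩ := hl
    have hn := not_joined_tw (hi.trans_le hj) hm2 (by omega) hc hm3
    rw [coef_not_joined _ hn, one_mul]
    obtain ⟨g, hg⟩ := X_mul_X_dvd_dotProd hi ⟨m, hm1, hm2, hm3⟩
    have hcl : Closed (flip (tw p i) v) 0 := closed_of_zero hm2
      (by rw [flip_ne (tw_ne hm2 (hi.trans_le hj) (by omega)), hm3])
    have h1 := circle_upper_succ hcl (hi.trans_le hj) (by simp [hc])
    rw [hg, mul_assoc, gen_X_congr _ h1, ← mul_assoc, ← pow_two, gen_X_sq]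
    exact Submodule.zero_mem _
  · have hs' : Sorted j (flip c v) := by
      intro k hk hk' hl
      by_cases h : tw p k = c
      · exact hB ⟨k, hk, h.symm, later_of_flip hc hl⟩
      · rw [flip_ne h] at hk'
        exact hs k hk hk' (later_of_flip hc hl)
    refine gen_mem_multiples_of_dvd ?_
    rw [rowGen_of_sorted hs']
    exact (dotProd_flip_dvd hc).mul_left _

theorem sorted_iff_of_later {j : ℕ} (hl : Later v j) :
    Sorted j v ↔ ∀ i < j, v (tw p i) = false := by
  refine forall₂_congr fun i hi => ?_
  have : Later v i := hl.mono hi.le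
  simp [this]

/-- One elimination step, along the twist crossing j. A sorted row with a zero to the right of j has
only zeros before j. Merging columns j and j + 1 is onto, and on multiples of a dot on column j its
kernel is generated by one more dot, on column j + 1. -/
theorem goodPair_rowGen_succ {j : ℕ} (hj : j < p) :
    GoodPair (twistKnot p).diff ((twistKnot p).multiples (rowGen (j + 1)))
      ((twistKnot p).multiples (rowGen j)) := by
  have hD := isOrientable p
  have key : ∀ v : Fin (p + 2) → Bool, (v (tw p j) = true ∧ Later v j ∧ Sorted j v) →
      Later (flip (tw p j) v) j ∧ (∀ i ≤ j, flip (tw p j) v (tw p i) = false) ∧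
      Sorted j (flip (tw p j) v) ∧ dotProd j (flip (tw p j) v) = dotProd j v := by
    rintro v ⟨h1, h2, h3⟩
    have h2' := (later_flip_iff hj le_rfl).2 h2
    rw [sorted_iff_of_later h2] at h3
    have h4 : ∀ i ≤ j, flip (tw p j) v (tw p i) = false := by
      intro i hi
      rcases hi.lt_or_eq with hi | rfl
      · rw [flip_ne (tw_ne (by omega) hj (by omega)), h3 i hi]
      · simp [h1]
    refine ⟨h2', h4, (sorted_iff_of_later h2').2 fun i hi => h4 i hi.le, ?_⟩
    exact dotProd_congr fun i hi => iff_of_true (h2'.mono hi.le) (h2.mono hi.le)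
  refine goodPair_of_merge hD (c := tw p j)
    (P := fun v => v (tw p j) = true ∧ Later v j ∧ Sorted j v)
    (fun x hx => diff_mem_multiples (fun v c => edgeMap_rowGen_mem hj.le v c) hx)
    (fun v hv => hv.1) ?_ ?_ ?_ ?_ ?_ ?_
  · rintro v ⟨h1, h2, h3⟩ c hc hvc
    rw [sorted_iff_of_later h2] at h3
    have h4 : Later (flip c v) j := by
      obtain ⟨m, hm1, hm2, hm3⟩ := h2
      refine ⟨m, hm1, hm2, ?_⟩
      rw [flip_ne (fun h => by rw [h, hvc] at hm3; simp at hm3), hm3]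
    refine ⟨by rw [flip_ne hc.symm, h1], h4, (sorted_iff_of_later h4).2 fun i hi => ?_⟩
    rw [flip_ne (fun h => by have := h3 i hi; rw [h, hvc] at this; simp at this), h3 i hi]
  · intro v hv
    obtain ⟨-, -, h3, h4⟩ := key v hv
    rw [rowGen_of_sorted h3, rowGen_of_sorted hv.2.2, h4]
  · intro v hv
    obtain ⟨⟨m, hm1, hm2, hm3⟩, h4, -, -⟩ := key v hv
    exact not_joined_tw hj hm2 (by omega) (h4 j le_rfl) hm3
  · intro v hv f hf
    obtain ⟨h2, h4, h3, h5⟩ := key v hv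
    obtain ⟨m, hm1, hm2, hm3⟩ := h2
    have hn := not_joined_tw hj hm2 (by omega) (h4 j le_rfl) hm3
    have hcl : Closed (flip (tw p j) v) 0 := closed_of_zero hm2 hm3
    have he : ∀ a : Fin 4, (twistKnot p).circle (flip (tw p j) v) ((twistKnot p).edge (tw p j) a) =
        (twistKnot p).circle (flip (tw p j) v) (upper p j) ∨
        (twistKnot p).circle (flip (tw p j) v) ((twistKnot p).edge (tw p j) a) =
        (twistKnot p).circle (flip (tw p j) v) (upper p (j + 1)) := by
      have hc0 := (closed_iff _ hj.le).2 hcl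
      have hc1 := (closed_iff _ (k := j + 1) hj).2 hcl
      rw [Closed] at hc0 hc1
      intro a
      rw [edge_tw hj]
      by_cases hev : Even j <;> fin_cases a <;> simp [hev, hc0, hc1]
    rw [rowGen_of_sorted hv.2.2, ← h5] at hf ⊢
    have hs : Sorted (j + 1) (flip (tw p j) v) := by
      intro i hi hi'
      rw [h4 i (by omega)] at hi'
      simp at hi'
    have hcoarse : ∀ e f, (twistKnot p).circle v e = (twistKnot p).circle v f →
        (twistKnot p).circle (flip (tw p j) v) e = (twistKnot p).circle (flip (tw p j) v) f ∨
        (((twistKnot p).circle (flip (tw p j) v) e =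
            (twistKnot p).circle (flip (tw p j) v) (upper p j) ∨
          (twistKnot p).circle (flip (tw p j) v) e =
            (twistKnot p).circle (flip (tw p j) v) (upper p (j + 1))) ∧
        ((twistKnot p).circle (flip (tw p j) v) f =
            (twistKnot p).circle (flip (tw p j) v) (upper p j) ∨
          (twistKnot p).circle (flip (tw p j) v) f =
            (twistKnot p).circle (flip (tw p j) v) (upper p (j + 1)))) := by
      intro e f hef
      rcases (circle_flip_iff hD hn e f).1 (by rwa [flip_flip]) with h7 | ⟨h7, h8⟩ | ⟨h7, h8⟩
      · exact Or.inl h7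
      · rw [h7, h8]
        exact Or.inr ⟨he 0, he 2⟩
      · rw [h7, h8]
        exact Or.inr ⟨he 2, he 0⟩
    -- Columns 0, …, j lie on circles different from that of column j + 1, so the substitution does
    -- not touch their dots.
    have hfix : subst (flip (tw p j) v) (upper p j) (upper p (j + 1))
        (dotProd j (flip (tw p j) v)) = dotProd j (flip (tw p j) v) := by
      have h8 : ∀ k ≤ j, subst (flip (tw p j) v) (upper p j) (upper p (j + 1))
          (MvPolynomial.X (upper p k) : (twistKnot p).Dots) = MvPolynomial.X (upper p k) :=
        fun k hk => subst_X_of_ne (circle_upper_ne hk hm1 hm2 (h4 k hk) hm3)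
      rw [dotProd, map_mul, map_prod, h8 0 (by omega)]
      congr 1
      refine Finset.prod_congr rfl fun i hi => ?_
      split_ifs
      · exact h8 _ (Finset.mem_range.1 hi)
      · exact map_one _
    obtain ⟨f', hf'⟩ := exists_eq_of_merge hcoarse hfix hf
    obtain ⟨g, hg⟩ := X_dvd_dotProd (v := flip (tw p j) v) (i := j) le_rfl
      (Or.inr ⟨m, by omega, hm2, hm3⟩)
    -- In the presence of a dot on column j, the difference of the two dots acts as the dot on
    -- column j + 1.
    have h6 : dotProd j (flip (tw p j) v) * ((MvPolynomial.X (upper p (j + 1)) -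
        MvPolynomial.X (upper p j)) * f') = dotProd j (flip (tw p j) v) *
        MvPolynomial.X (upper p (j + 1)) * f' - MvPolynomial.X (upper p j) ^ 2 * (g * f') := by
      rw [hg]
      ring
    rw [hf', h6, map_sub, gen_X_sq, sub_zero, ← dotProd_succ_of_later ⟨m, hm1, hm2, hm3⟩,
      ← rowGen_of_sorted hs]
    exact gen_mem_multiples _ _ _
  · intro x hx v hv
    obtain ⟨F, rfl⟩ := mem_multiples_iff.1 hx
    rw [sum_gen_apply, rowGen_of_not_sorted fun h => h j (by omega) hv.1 hv.2.1, zero_mul, map_zero]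
  · intro v h1 h2
    by_cases hs : Sorted j v
    swap
    · rw [rowGen_of_not_sorted hs, map_zero]
      exact Submodule.zero_mem _
    have hl : ¬ Later v j := by
      intro hl
      cases hv : v (tw p j)
      · have hl' : Later (flip (tw p j) v) j := (later_flip_iff hj le_rfl).2 hl
        refine h2 hv ⟨by simp [hv], hl', (sorted_iff_of_later hl').2 fun i hi => ?_⟩
        rw [flip_ne (tw_ne (by omega) hj (by omega)), (sorted_iff_of_later hl).1 hs i hi]
      · exact h1 ⟨hv, hl, hs⟩
    refine gen_mem_multiples_of_dvd ?_
    rw [rowGen_of_sorted hs, rowGen_of_sorted, dotProd_succ_of_not_later hl]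
    intro i hi hi'
    rcases Nat.lt_succ_iff_lt_or_eq.1 hi with hi | rfl
    · exact hs i hi hi'
    · exact hl

theorem reducedChain_eq : (twistKnot p).reducedChain (upper p 0) =
    (twistKnot p).multiples (rowGen 0) := by
  have h0 : ∀ v : Fin (p + 2) → Bool, rowGen 0 v = MvPolynomial.X (upper p 0) := by
    intro v
    rw [rowGen_of_sorted fun i hi => absurd hi (by omega), dotProd, Finset.prod_range_zero, mul_one]
  refine le_antisymm ?_ (multiples_le fun v => ?_)
  · rintro _ ⟨x, rfl⟩
    obtain ⟨f, -, rfl⟩ := (twistKnot p).chain_eq_sum x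
    rw [LinearMap.lsmul_apply, Finset.smul_sum]
    refine Submodule.sum_mem _ fun v _ => ?_
    rw [smul_gen, ← h0 v]
    exact gen_mem_multiples _ _ _
  · rw [h0, gen_eq_smul]
    exact ⟨_, rfl⟩

theorem goodPair_rowGen : GoodPair (twistKnot p).diff ((twistKnot p).multiples (rowGen p))
    ((twistKnot p).reducedChain (upper p 0)) := by
  rw [reducedChain_eq]
  have h : ∀ j ≤ p, (twistKnot p).multiples (rowGen j) ≤ (twistKnot p).multiples (rowGen 0) ∧
      GoodPair (twistKnot p).diff ((twistKnot p).multiples (rowGen j))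
        ((twistKnot p).multiples (rowGen 0)) := by
    intro j
    induction j with
    | zero => exact fun _ => ⟨le_rfl, GoodPair.refl _ _⟩
    | succ j ih =>
      intro hj
      obtain ⟨h1, h2⟩ := ih (by omega)
      have h3 : (twistKnot p).multiples (rowGen (j + 1)) ≤ (twistKnot p).multiples (rowGen j) :=
        multiples_le fun v => gen_mem_multiples_of_dvd (rowGen_dvd_succ j v)
      exact ⟨h3.trans h1, GoodPair.trans (diff_diff (isOrientable p)) h3 h1
        (goodPair_rowGen_succ (by omega)) h2⟩
  exact (h p le_rfl).2

end KnotDiagram.TwistKnot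

namespace KnotDiagram.TwistKnot

open MvPolynomial (X)

variable {p : ℕ}

/-! ### Rows of zeros followed by ones -/

/-- The resolution with the given values at the clasp crossings, and a row of `m` zeros followed by
ones. -/
def rowV (p : ℕ) (a b : Bool) (m : ℕ) (c : Fin (p + 2)) : Bool :=
  if (c : ℕ) = 0 then a else if (c : ℕ) = 1 then b else decide (m + 2 ≤ (c : ℕ))

@[simp] theorem rowV_zero (a b : Bool) (m : ℕ) : rowV p a b m 0 = a := by simp [rowV]

@[simp] theorem rowV_one (a b : Bool) (m : ℕ) : rowV p a b m 1 = b := by simp [rowV]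

theorem rowV_tw (a b : Bool) (m : ℕ) {i : ℕ} (hi : i < p) :
    rowV p a b m (tw p i) = decide (m ≤ i) := by
  simp [rowV, tw_val hi]

theorem ext_crossings {v w : Fin (p + 2) → Bool} (h0 : v 0 = w 0) (h1 : v 1 = w 1)
    (h : ∀ i < p, v (tw p i) = w (tw p i)) : v = w := by
  funext c
  rcases crossing_cases c with rfl | rfl | ⟨i, hi, rfl⟩
  exacts [h0, h1, h i hi]

theorem zero_ne_one_crossing : (0 : Fin (p + 2)) ≠ 1 := by
  intro h
  have := congrArg Fin.val h
  simp at this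

theorem flip_zero_rowV (a b : Bool) (m : ℕ) : flip 0 (rowV p a b m) = rowV p (!a) b m := by
  refine ext_crossings (by simp) ?_ fun i hi => ?_
  · rw [flip_ne zero_ne_one_crossing.symm, rowV_one, rowV_one]
  · rw [flip_ne (tw_ne_zero hi), rowV_tw _ _ _ hi, rowV_tw _ _ _ hi]

theorem flip_one_rowV (a b : Bool) (m : ℕ) : flip 1 (rowV p a b m) = rowV p a (!b) m := by
  refine ext_crossings ?_ (by simp) fun i hi => ?_
  · rw [flip_ne zero_ne_one_crossing, rowV_zero, rowV_zero]
  · rw [flip_ne (tw_ne_one hi), rowV_tw _ _ _ hi, rowV_tw _ _ _ hi]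

theorem flip_tw_rowV (a b : Bool) {m : ℕ} (hm : m < p) :
    flip (tw p m) (rowV p a b (m + 1)) = rowV p a b m := by
  refine ext_crossings ?_ ?_ fun i hi => ?_
  · rw [flip_ne (tw_ne_zero hm).symm, rowV_zero, rowV_zero]
  · rw [flip_ne (tw_ne_one hm).symm, rowV_one, rowV_one]
  · rw [rowV_tw _ _ _ hi]
    by_cases h : i = m
    · subst h
      rw [flip_same, rowV_tw _ _ _ hi]
      simp
    · rw [flip_ne (tw_ne hi hm h), rowV_tw _ _ _ hi]
      congr 1
      apply propext
      omega

theorem flip_tw_rowV' (a b : Bool) {m : ℕ} (hm : m < p) :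
    flip (tw p m) (rowV p a b m) = rowV p a b (m + 1) := by
  rw [← flip_tw_rowV a b hm, flip_flip]

theorem rowV_injective {a b a' b' : Bool} {m m' : ℕ} (hm : m ≤ p) (hm' : m' ≤ p)
    (h : rowV p a b m = rowV p a' b' m') : a = a' ∧ b = b' ∧ m = m' := by
  refine ⟨by simpa using congrFun h 0, by simpa using congrFun h 1, ?_⟩
  by_contra hne
  rcases Nat.lt_or_gt_of_ne hne with h1 | h1
  · have h2 := congrFun h (tw p m)
    rw [rowV_tw _ _ _ (by omega), rowV_tw _ _ _ (by omega), decide_eq_decide] at h2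
    omega
  · have h2 := congrFun h (tw p m')
    rw [rowV_tw _ _ _ (by omega), rowV_tw _ _ _ (by omega), decide_eq_decide] at h2
    omega

theorem later_rowV_iff {a b : Bool} {m i : ℕ} (hm : m ≤ p) :
    Later (rowV p a b m) i ↔ i + 1 < m := by
  constructor
  · rintro ⟨k, h1, h2, h3⟩
    rw [rowV_tw _ _ _ h2] at h3
    simp at h3
    omega
  · intro h
    refine ⟨m - 1, by omega, by omega, ?_⟩
    rw [rowV_tw _ _ _ (by omega)]
    simp
    omega

theorem exists_rowV_of_sorted {v : Fin (p + 2) → Bool} (h : Sorted p v) :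
    ∃ m ≤ p, v = rowV p (v 0) (v 1) m := by
  by_cases he : ∃ i, i < p ∧ v (tw p i) = true
  · classical
    have h1 := Nat.find_spec he
    have h2 := fun k (hk : k < Nat.find he) => Nat.find_min he hk
    generalize Nat.find he = m at h1 h2
    refine ⟨m, h1.1.le, ext_crossings (by simp) (by simp) fun i hi => ?_⟩
    rw [rowV_tw _ _ _ hi]
    rcases Nat.lt_trichotomy i m with h3 | rfl | h3
    · have : v (tw p i) = false := by
        have := h2 i h3
        simpa [hi] using this
      rw [this, decide_eq_false (by omega)]
    · rw [h1.2, decide_eq_true le_rfl]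
    · rw [decide_eq_true h3.le]
      by_contra h4
      exact h m h1.1 h1.2 ⟨i, h3, hi, by simpa using h4⟩
  · refine ⟨p, le_rfl, ext_crossings (by simp) (by simp) fun i hi => ?_⟩
    rw [rowV_tw _ _ _ hi, decide_eq_false (by omega)]
    by_contra h4
    exact he ⟨i, hi, by simpa using h4⟩

theorem sorted_rowV (a b : Bool) {m : ℕ} (hm : m ≤ p) : Sorted p (rowV p a b m) := by
  intro i hi h1 h2
  rw [rowV_tw _ _ _ hi] at h1
  rw [later_rowV_iff hm] at h2
  simp at h1
  omega

/-- The product of the dots on the first columns. -/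
def lead (p m : ℕ) : (twistKnot p).Dots :=
  X (upper p 0) * ∏ i ∈ Finset.range (m - 1), X (upper p (i + 1))

/-- Because of the truncated subtraction m = 0 and m = 1 give the same product: the marked column 0
carries its dot even if the row has no zero. -/
theorem lead_zero : lead p 0 = X (upper p 0) := by simp [lead]

theorem lead_one : lead p 1 = X (upper p 0) := by simp [lead]

theorem lead_succ {m : ℕ} (hm : 1 ≤ m) : lead p (m + 1) = lead p m * X (upper p m) := by
  obtain ⟨m, rfl⟩ : ∃ k, m = k + 1 := ⟨m - 1, by omega⟩
  rw [lead, lead, Nat.add_sub_cancel, Nat.add_sub_cancel, Finset.prod_range_succ, mul_assoc]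

theorem rowGen_rowV (a b : Bool) {m : ℕ} (hm : m ≤ p) : rowGen p (rowV p a b m) = lead p m := by
  classical
  rw [rowGen_of_sorted (sorted_rowV a b hm), dotProd, lead]
  congr 1
  have h : Finset.range (m - 1) = (Finset.range p).filter fun i => i + 1 < m := by
    ext i
    simp only [Finset.mem_range, Finset.mem_filter]
    omega
  rw [h, Finset.prod_filter]
  exact Finset.prod_congr rfl fun i _ => if_congr (later_rowV_iff hm) rfl rfl

theorem X_dvd_lead {k m : ℕ} (h : k = 0 ∨ k < m) : X (upper p k) ∣ lead p m := by
  rcases Nat.eq_zero_or_pos k with rfl | hk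
  · exact dvd_mul_right _ _
  · have h1 : k - 1 ∈ Finset.range (m - 1) := Finset.mem_range.2 (by omega)
    have h2 := (Finset.dvd_prod_of_mem (fun i => (X (upper p (i + 1)) : (twistKnot p).Dots))
      h1).mul_left (X (upper p 0))
    have h3 : k - 1 + 1 = k := by omega
    rw [lead]
    simpa only [h3] using h2

theorem gen_X_mul_lead {k m : ℕ} (h : k = 0 ∨ k < m) (v : Fin (p + 2) → Bool)
    (f : (twistKnot p).Dots) : (twistKnot p).gen v (X (upper p k) * (lead p m * f)) = 0 := by
  obtain ⟨g, hg⟩ := X_dvd_lead (p := p) h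
  have : X (upper p k) * (lead p m * f) = X (upper p k) ^ 2 * (g * f) := by
    rw [hg]
    ring
  rw [this, gen_X_sq]

/-! ### Circles of the rows -/

section

variable {a b : Bool} {m : ℕ}

theorem closed_rowV (hm : 1 ≤ m) (hmp : m ≤ p) : Closed (rowV p a b m) 0 :=
  closed_of_zero (i := 0) (by omega) (by rw [rowV_tw _ _ _ (by omega)]; simp; omega)

theorem circle_upper_rowV (hm : 1 ≤ m) (hmp : m ≤ p) {k : ℕ} (hk : m ≤ k) (hkp : k ≤ p) :
    (twistKnot p).circle (rowV p a b m) (upper p k) =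
      (twistKnot p).circle (rowV p a b m) (upper p p) :=
  circle_upper_eq (closed_rowV hm hmp) hkp le_rfl fun i h1 h2 => by
    rw [rowV_tw _ _ _ h2, decide_eq_true (by omega)]

theorem circle_lower_rowV (hm : 1 ≤ m) (hmp : m ≤ p) {k : ℕ} (hkp : k ≤ p) :
    (twistKnot p).circle (rowV p a b m) (lower p k) =
      (twistKnot p).circle (rowV p a b m) (upper p k) :=
  ((closed_iff _ hkp).2 (closed_rowV hm hmp)).symm

/-- The circles of the resolutions of the clasp, if the columns are closed. -/
theorem circles_clasp_of_closed {v : Fin (p + 2) → Bool} (hv : Closed v 0) :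
    (v 0 = false → (twistKnot p).circle v (bigon p false) = (twistKnot p).circle v (upper p p) ∧
      (twistKnot p).circle v (bigon p true) = (twistKnot p).circle v (upper p 0)) ∧
    (v 1 = false → (twistKnot p).circle v (bigon p false) = (twistKnot p).circle v (upper p p) ∧
      (twistKnot p).circle v (bigon p true) = (twistKnot p).circle v (upper p 0)) ∧
    (v 0 = true ∨ v 1 = true →
      (twistKnot p).circle v (bigon p false) = (twistKnot p).circle v (bigon p true) ∧
      (twistKnot p).circle v (upper p p) = (twistKnot p).circle v (upper p 0)) := by
  have h0 := circle_clasp_zero (v := v)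
  have h1 := circle_clasp_one (v := v)
  rw [circle_ending hv] at h0 h1
  have hv' := hv
  rw [Closed] at hv'
  rw [← hv'] at h1
  cases ha : v 0 <;> cases hb : v 1 <;> simp only [ha, hb, if_true, if_false,
    Bool.false_eq_true] at h0 h1 <;> simp [h0, h1]

theorem joined_clasp_of_closed {v : Fin (p + 2) → Bool} (hv : Closed v 0) (h : v 0 ≠ v 1) :
    (twistKnot p).Joined 0 v ∧ (twistKnot p).Joined 1 v := by
  obtain ⟨h1, h2, h3⟩ := circles_clasp_of_closed hv
  rw [joined_zero_iff, joined_one_iff, circle_ending hv]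
  cases ha : v 0 <;> cases hb : v 1 <;> simp_all

theorem not_joined_clasp_of_closed {v : Fin (p + 2) → Bool}
    (hc : Closed (flip 0 v) 0) (hc' : Closed (flip 1 v) 0) (h : v 0 = v 1) :
    ¬ (twistKnot p).Joined 0 v ∧ ¬ (twistKnot p).Joined 1 v := by
  refine ⟨(isOrientable p _ _).1 (joined_clasp_of_closed hc ?_).1,
    (isOrientable p _ _).1 (joined_clasp_of_closed hc' ?_).2⟩
  · rw [flip_same, flip_ne zero_ne_one_crossing.symm, h]
    cases v 1 <;> simp
  · rw [flip_same, flip_ne zero_ne_one_crossing, h]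
    cases v 1 <;> simp

theorem joined_rowV (hm : 1 ≤ m) (hmp : m ≤ p) (h : a ≠ b) :
    (twistKnot p).Joined 0 (rowV p a b m) ∧ (twistKnot p).Joined 1 (rowV p a b m) :=
  joined_clasp_of_closed (closed_rowV hm hmp) (by simpa using h)

theorem not_joined_rowV (hm : 1 ≤ m) (hmp : m ≤ p) (h : a = b) :
    ¬ (twistKnot p).Joined 0 (rowV p a b m) ∧ ¬ (twistKnot p).Joined 1 (rowV p a b m) :=
  not_joined_clasp_of_closed
    (by rw [flip_zero_rowV]; exact closed_rowV hm hmp)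
    (by rw [flip_one_rowV]; exact closed_rowV hm hmp) (by simpa using h)

/-- In a row of ones, every edge of the row lies on one of the two strands. -/
theorem circle_strand {v : Fin (p + 2) → Bool} (hv : ∀ i < p, v (tw p i) = true) {k : ℕ}
    (hk : k ≤ p) :
    (twistKnot p).circle v (upper p k) =
      (twistKnot p).circle v (if Even k then upper p 0 else lower p 0) ∧
    (twistKnot p).circle v (lower p k) =
      (twistKnot p).circle v (if Even k then lower p 0 else upper p 0) := by
  induction k with
  | zero => simp
  | succ k ih =>
    obtain ⟨h1, h2⟩ := ih (by omega)
    obtain ⟨h3, h4⟩ := circle_upper_of_one (show k < p by omega) (hv k (by omega))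
    rw [← h3, ← h4, h1, h2]
    by_cases he : Even k <;> simp [he, Nat.even_add_one]

theorem circle_strand_ending {v : Fin (p + 2) → Bool} (hv : ∀ i < p, v (tw p i) = true) :
    (twistKnot p).circle v (ending p false) = (twistKnot p).circle v (upper p 0) ∧
    (twistKnot p).circle v (ending p true) = (twistKnot p).circle v (lower p 0) := by
  obtain ⟨h1, h2⟩ := circle_strand hv le_rfl
  rw [ending, ending]
  by_cases he : Even p <;> simp [he] at h1 h2 ⊢ <;> simp [h1, h2]

theorem rowV_all_one (a b : Bool) : ∀ i < p, rowV p a b 0 (tw p i) = true := fun i hi => by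
  rw [rowV_tw _ _ _ hi, decide_eq_true (by omega)]

/-- The circles of the resolutions of the clasp, in a row of ones. -/
theorem circles_clasp_of_ones (a b : Bool) :
    let C := (twistKnot p).circle (rowV p a b 0)
    (a = false → C (bigon p false) = C (upper p 0) ∧ C (bigon p true) = C (upper p 0)) ∧
    (b = false → C (bigon p false) = C (lower p 0) ∧ C (bigon p true) = C (lower p 0)) ∧
    (a = true ∨ b = true → C (bigon p false) = C (bigon p true)) := by
  intro C
  have h0 := circle_clasp_zero (v := rowV p a b 0)
  have h1 := circle_clasp_one (v := rowV p a b 0)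
  obtain ⟨h2, h3⟩ := circle_strand_ending (rowV_all_one (p := p) a b)
  rw [h2, rowV_zero] at h0
  rw [h3, rowV_one] at h1
  cases a <;> cases b <;> simp at h0 h1
  · exact ⟨fun _ => h0, fun _ => h1, by simp⟩
  all_goals simp [C, h0, h1]

theorem joined_rowV_zero (b : Bool) :
    ((twistKnot p).Joined 0 (rowV p false b 0)) ∧ ((twistKnot p).Joined 1 (rowV p b false 0)) := by
  rw [joined_zero_iff, joined_one_iff, (circle_strand_ending (rowV_all_one _ _)).2]
  exact ⟨((circles_clasp_of_ones false b).1 rfl).1, ((circles_clasp_of_ones b false).2.1 rfl).2⟩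

theorem not_joined_rowV_zero (b : Bool) :
    (¬ (twistKnot p).Joined 0 (rowV p true b 0)) ∧
      (¬ (twistKnot p).Joined 1 (rowV p b true 0)) := by
  refine ⟨(isOrientable p _ _).1 ?_, (isOrientable p _ _).1 ?_⟩
  · rw [flip_zero_rowV]
    exact (joined_rowV_zero b).1
  · rw [flip_one_rowV]
    exact (joined_rowV_zero b).2

theorem joined_tw_rowV_zero {i : ℕ} (hi : i < p) :
    (twistKnot p).Joined (tw p i) (rowV p false false 0) := by
  have hc := circles_clasp_of_ones (p := p) false false
  have h0 : (twistKnot p).circle (rowV p false false 0) (lower p 0) =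
      (twistKnot p).circle (rowV p false false 0) (upper p 0) :=
    (hc.2.1 rfl).1.symm.trans (hc.1 rfl).1
  obtain ⟨h1, h2⟩ := circle_strand (rowV_all_one (p := p) false false) hi.le
  obtain ⟨h3, h4⟩ := circle_strand (rowV_all_one (p := p) false false) (k := i + 1) hi
  rw [KnotDiagram.Joined, edge_tw hi, edge_tw hi]
  by_cases he : Even i <;> simp [he, Nat.even_add_one] at h1 h2 h3 h4 ⊢ <;>
    simp [h1, h2, h3, h4, h0]

theorem joined_tw_rowV (hm : 1 ≤ m) {i : ℕ} (hi : i < p) (hmi : m ≤ i) :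
    (twistKnot p).Joined (tw p i) (rowV p a b m) :=
  joined_tw_of_one (closed_rowV hm (by omega)) hi
    (by rw [rowV_tw _ _ _ hi, decide_eq_true hmi])

end

end KnotDiagram.TwistKnot

/-! ### Multiples of an element on which few dots act differently -/

namespace KnotDiagram

open MvPolynomial (X)

variable {n : ℕ} {D : KnotDiagram n}

theorem rat_smul_gen (v : Fin n → Bool) (a : ℚ) (f : D.Dots) :
    a • D.gen v f = D.gen v (a • f) := ((D.gen v).restrictScalars ℚ).map_smul a f |>.symm

/-- A relation is pushed along a saddle; read backwards, this is a test for nonvanishing. -/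
theorem gen_coef_eq_zero (hD : D.IsOrientable) (c : Fin n) {v : Fin n → Bool} {f : D.Dots}
    (h : D.gen v f = 0) : D.gen (flip c v) (D.coef c v * f) = 0 := by
  have h1 := edgeMap_gen hD c (v c) v f
  rw [h, map_zero, if_pos rfl] at h1
  have h2 := congrArg (fun y => sign c v • y) h1
  simp only [smul_zero, smul_smul, sign_mul_self, one_smul] at h2
  exact h2.symm

/-- The multiples of an element of a resolution on which every dot acts as `0` or as one of two
dots. -/
theorem exists_gen_mul_eq {v : Fin n → Bool} {E : D.Dots} {ρ σ : ZMod (2 * n)}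
    (h : ∀ e, D.gen v (X e * E) = 0 ∨ D.gen v (X e * E) = D.gen v (X ρ * E) ∨
      D.gen v (X e * E) = D.gen v (X σ * E)) (f : D.Dots) :
    ∃ α β γ δ : ℚ, D.gen v (f * E) = α • D.gen v E + β • D.gen v (X ρ * E) +
      γ • D.gen v (X σ * E) + δ • D.gen v (X ρ * (X σ * E)) := by
  induction f using MvPolynomial.induction_on with
  | C a =>
    refine ⟨a, 0, 0, 0, ?_⟩
    rw [rat_smul_gen, MvPolynomial.smul_eq_C_mul]
    simp
  | add f g hf hg =>
    obtain ⟨α, β, γ, δ, h1⟩ := hf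
    obtain ⟨α', β', γ', δ', h2⟩ := hg
    refine ⟨α + α', β + β', γ + γ', δ + δ', ?_⟩
    rw [add_mul, map_add, h1, h2]
    module
  | mul_X f e hf =>
    obtain ⟨α, β, γ, δ, h1⟩ := hf
    have key : D.gen v (f * X e * E) = α • D.gen v (X e * E) +
        β • (X ρ : D.Dots) • D.gen v (X e * E) + γ • (X σ : D.Dots) • D.gen v (X e * E) +
        δ • (X ρ : D.Dots) • (X σ : D.Dots) • D.gen v (X e * E) := by
      have h2 : D.gen v (f * X e * E) = (X e : D.Dots) • D.gen v (f * E) := by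
        rw [smul_gen]
        congr 1
        ring
      have h3 : ∀ (q : ℚ) (y : D.Chain), (X e : D.Dots) • q • y = q • (X e : D.Dots) • y :=
        fun q y => smul_comm _ _ _
      rw [h2, h1, smul_add, smul_add, smul_add, h3, h3, h3, h3]
      simp only [smul_gen, mul_left_comm (X e : D.Dots)]
    have hs : ∀ (e' : ZMod (2 * n)) (g : D.Dots), (X e' : D.Dots) • D.gen v (X e' * g) = 0 :=
      fun e' g => by rw [smul_gen, ← mul_assoc, ← pow_two, gen_X_sq]
    have hc : ∀ (e' e'' : ZMod (2 * n)) (g : D.Dots), (X e' : D.Dots) • D.gen v (X e'' * g) =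
        D.gen v (X e' * (X e'' * g)) := fun e' e'' g => by rw [smul_gen]
    rw [key]
    rcases h e with h | h | h <;> rw [h]
    · exact ⟨0, 0, 0, 0, by simp⟩
    · refine ⟨0, α, 0, γ, ?_⟩
      rw [hs, smul_comm (X ρ : D.Dots) (X σ : D.Dots), hs, smul_zero, smul_zero, smul_zero, hc,
        mul_left_comm]
      module
    · refine ⟨0, 0, α, β, ?_⟩
      rw [hs, smul_zero, smul_zero, smul_zero, hc]
      module

theorem exists_gen_mul_eq_one {v : Fin n → Bool} {E : D.Dots} {ρ : ZMod (2 * n)}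
    (h : ∀ e, D.gen v (X e * E) = 0 ∨ D.gen v (X e * E) = D.gen v (X ρ * E)) (f : D.Dots) :
    ∃ α β : ℚ, D.gen v (f * E) = α • D.gen v E + β • D.gen v (X ρ * E) := by
  obtain ⟨α, β, γ, δ, h1⟩ := exists_gen_mul_eq (ρ := ρ) (σ := ρ)
    (fun e => (h e).imp_right Or.inl) f
  refine ⟨α, β + γ, ?_⟩
  rw [h1, ← mul_assoc (X ρ), ← pow_two, gen_X_sq]
  module

theorem exists_gen_mul_eq_zero {v : Fin n → Bool} {E : D.Dots}
    (h : ∀ e, D.gen v (X e * E) = 0) (f : D.Dots) :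
    ∃ α : ℚ, D.gen v (f * E) = α • D.gen v E := by
  obtain ⟨α, β, h1⟩ := exists_gen_mul_eq_one (ρ := 0) (fun e => Or.inl (h e)) f
  exact ⟨α, by rw [h1, h 0, smul_zero, add_zero]⟩

end KnotDiagram

namespace KnotDiagram.TwistKnot

open MvPolynomial (X)

variable {p : ℕ} {a b : Bool} {m : ℕ}

/-! ### The coefficients of the rows -/

theorem gen_X_lead_of_circle {v : Fin (p + 2) → Bool} {e : ZMod (2 * (p + 2))} {k : ℕ}
    (h : k = 0 ∨ k < m) (he : (twistKnot p).circle v e = (twistKnot p).circle v (upper p k)) :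
    (twistKnot p).gen v (X e * lead p m) = 0 := by
  rw [gen_X_congr _ he]
  simpa using gen_X_mul_lead (p := p) h v 1

/-- Dots on the columns before m occur in `lead` already, and the columns from m on lie on the
circle of the last one. Only the two edges of the bigon depend on the resolution of the clasp. -/
theorem gen_X_lead_cases (hm : 1 ≤ m) (hmp : m ≤ p) (e : ZMod (2 * (p + 2))) :
    (twistKnot p).gen (rowV p a b m) (X e * lead p m) = 0 ∨
    (twistKnot p).gen (rowV p a b m) (X e * lead p m) =
      (twistKnot p).gen (rowV p a b m) (X (upper p p) * lead p m) ∨ e = bigon p false ∨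
      e = bigon p true := by
  have key : ∀ k ≤ p, ∀ e, (twistKnot p).circle (rowV p a b m) e =
      (twistKnot p).circle (rowV p a b m) (upper p k) →
      (twistKnot p).gen (rowV p a b m) (X e * lead p m) = 0 ∨
      (twistKnot p).gen (rowV p a b m) (X e * lead p m) =
        (twistKnot p).gen (rowV p a b m) (X (upper p p) * lead p m) := by
    intro k hk e he
    rcases Nat.lt_or_ge k m with h | h
    · exact Or.inl (gen_X_lead_of_circle (Or.inr h) he)
    · exact Or.inr (gen_X_congr _ (he.trans (circle_upper_rowV hm hmp h hk)) _)
  rcases edge_cases e with ⟨k, hk, rfl⟩ | ⟨k, hk, rfl⟩ | h | h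
  · exact (key k hk _ rfl).imp_right Or.inl
  · exact (key k hk _ (circle_lower_rowV hm hmp hk)).imp_right Or.inl
  · exact Or.inr (Or.inr (Or.inl h))
  · exact Or.inr (Or.inr (Or.inr h))

theorem gen_X_ending_lead (hm : 1 ≤ m) (hmp : m ≤ p) (h : a = true ∨ b = true) :
    (twistKnot p).gen (rowV p a b m) (X (upper p p) * lead p m) = 0 :=
  gen_X_lead_of_circle (Or.inl rfl) ((circles_clasp_of_closed (closed_rowV hm hmp)).2.2
    (by simpa using h)).2

/-- Here and below, spanning sets for the multiples of `lead` come from the circles that it leaves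
without a dot. For the clasp resolutions 00, mixed, 11 they have 2, 1, 2 elements if m ≥ 1, and 1,
2, 4 if m = 0. -/
theorem exists_gen_lead_false (hm : 1 ≤ m) (hmp : m ≤ p) (f : (twistKnot p).Dots) :
    ∃ α β : ℚ, (twistKnot p).gen (rowV p false false m) (f * lead p m) =
      α • (twistKnot p).gen (rowV p false false m) (lead p m) +
      β • (twistKnot p).gen (rowV p false false m) (X (upper p p) * lead p m) := by
  refine exists_gen_mul_eq_one (fun e => ?_) f
  obtain ⟨h1, h2⟩ := (circles_clasp_of_closed (closed_rowV (a := false) (b := false) hm hmp)).1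
    (rowV_zero _ _ _)
  rcases gen_X_lead_cases (a := false) (b := false) hm hmp e with h | h | rfl | rfl
  · exact Or.inl h
  · exact Or.inr h
  · exact Or.inr (gen_X_congr _ h1 _)
  · exact Or.inl (gen_X_lead_of_circle (Or.inl rfl) h2)

theorem exists_gen_lead_ne (hm : 1 ≤ m) (hmp : m ≤ p) (hab : a ≠ b) (f : (twistKnot p).Dots) :
    ∃ α : ℚ, (twistKnot p).gen (rowV p a b m) (f * lead p m) =
      α • (twistKnot p).gen (rowV p a b m) (lead p m) := by
  refine exists_gen_mul_eq_zero (fun e => ?_) f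
  have hor : a = true ∨ b = true := by cases a <;> cases b <;> simp_all
  obtain ⟨h1, h2, h3⟩ := circles_clasp_of_closed (closed_rowV (a := a) (b := b) hm hmp)
  rw [rowV_zero, rowV_one] at h3
  have h4 : (twistKnot p).circle (rowV p a b m) (bigon p true) =
      (twistKnot p).circle (rowV p a b m) (upper p 0) := by
    rw [rowV_zero] at h1
    rw [rowV_one] at h2
    cases a <;> cases b <;> simp_all
  rcases gen_X_lead_cases (a := a) (b := b) hm hmp e with h | h | rfl | rfl
  · exact h
  · exact h.trans (gen_X_ending_lead hm hmp hor)
  · exact gen_X_lead_of_circle (Or.inl rfl) ((h3 hor).1.trans h4)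
  · exact gen_X_lead_of_circle (Or.inl rfl) h4

theorem exists_gen_lead_true (hm : 1 ≤ m) (hmp : m ≤ p) (f : (twistKnot p).Dots) :
    ∃ α β : ℚ, (twistKnot p).gen (rowV p true true m) (f * lead p m) =
      α • (twistKnot p).gen (rowV p true true m) (lead p m) +
      β • (twistKnot p).gen (rowV p true true m) (X (bigon p true) * lead p m) := by
  refine exists_gen_mul_eq_one (fun e => ?_) f
  obtain ⟨h1, -⟩ := (circles_clasp_of_closed (closed_rowV (a := true) (b := true) hm hmp)).2.2
    (by simp)
  rcases gen_X_lead_cases (a := true) (b := true) hm hmp e with h | h | rfl | rfl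
  · exact Or.inl h
  · exact Or.inl (h.trans (gen_X_ending_lead hm hmp (Or.inl rfl)))
  · exact Or.inr (gen_X_congr _ h1 _)
  · exact Or.inr rfl

theorem gen_X_lead_zero_cases (e : ZMod (2 * (p + 2))) :
    (twistKnot p).gen (rowV p a b 0) (X e * lead p 0) = 0 ∨
    (twistKnot p).gen (rowV p a b 0) (X e * lead p 0) =
      (twistKnot p).gen (rowV p a b 0) (X (lower p 0) * lead p 0) ∨ e = bigon p false ∨
      e = bigon p true := by
  rcases edge_cases e with ⟨k, hk, rfl⟩ | ⟨k, hk, rfl⟩ | h | h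
  · have h1 := (circle_strand (rowV_all_one (p := p) a b) hk).1
    split_ifs at h1 with he
    · exact Or.inl (gen_X_lead_of_circle (Or.inl rfl) h1)
    · exact Or.inr (Or.inl (gen_X_congr _ h1 _))
  · have h1 := (circle_strand (rowV_all_one (p := p) a b) hk).2
    split_ifs at h1 with he
    · exact Or.inr (Or.inl (gen_X_congr _ h1 _))
    · exact Or.inl (gen_X_lead_of_circle (Or.inl rfl) h1)
  · exact Or.inr (Or.inr (Or.inl h))
  · exact Or.inr (Or.inr (Or.inr h))

theorem exists_gen_lead_zero_false (f : (twistKnot p).Dots) :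
    ∃ α : ℚ, (twistKnot p).gen (rowV p false false 0) (f * lead p 0) =
      α • (twistKnot p).gen (rowV p false false 0) (lead p 0) := by
  refine exists_gen_mul_eq_zero (fun e => ?_) f
  obtain ⟨h1, h2, -⟩ := circles_clasp_of_ones (p := p) false false
  have hl := (h2 rfl).1.symm.trans (h1 rfl).1
  rcases gen_X_lead_zero_cases (a := false) (b := false) e with h | h | rfl | rfl
  · exact h
  · exact h.trans (gen_X_lead_of_circle (Or.inl rfl) hl)
  · exact gen_X_lead_of_circle (Or.inl rfl) (h1 rfl).1
  · exact gen_X_lead_of_circle (Or.inl rfl) (h1 rfl).2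

theorem exists_gen_lead_zero_ne (hab : a ≠ b) (f : (twistKnot p).Dots) :
    ∃ α β : ℚ, (twistKnot p).gen (rowV p a b 0) (f * lead p 0) =
      α • (twistKnot p).gen (rowV p a b 0) (lead p 0) +
      β • (twistKnot p).gen (rowV p a b 0) (X (lower p 0) * lead p 0) := by
  refine exists_gen_mul_eq_one (fun e => ?_) f
  obtain ⟨h1, h2, h3⟩ := circles_clasp_of_ones (p := p) a b
  have key : ∀ c, (twistKnot p).gen (rowV p a b 0) (X (bigon p c) * lead p 0) = 0 ∨
      (twistKnot p).gen (rowV p a b 0) (X (bigon p c) * lead p 0) =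
      (twistKnot p).gen (rowV p a b 0) (X (lower p 0) * lead p 0) := by
    intro c
    cases a
    · refine Or.inl (gen_X_lead_of_circle (Or.inl rfl) ?_)
      cases c
      exacts [(h1 rfl).1, (h1 rfl).2]
    · have hb : b = false := by simpa using hab.symm
      refine Or.inr (gen_X_congr _ ?_ _)
      cases c
      exacts [(h2 hb).1, (h2 hb).2]
  rcases gen_X_lead_zero_cases (a := a) (b := b) e with h | h | rfl | rfl
  exacts [Or.inl h, Or.inr h, key _, key _]

theorem exists_gen_lead_zero_true (f : (twistKnot p).Dots) :
    ∃ α β γ δ : ℚ, (twistKnot p).gen (rowV p true true 0) (f * lead p 0) =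
      α • (twistKnot p).gen (rowV p true true 0) (lead p 0) +
      β • (twistKnot p).gen (rowV p true true 0) (X (bigon p true) * lead p 0) +
      γ • (twistKnot p).gen (rowV p true true 0) (X (lower p 0) * lead p 0) +
      δ • (twistKnot p).gen (rowV p true true 0) (X (bigon p true) * (X (lower p 0) * lead p 0)) := by
  refine exists_gen_mul_eq (fun e => ?_) f
  obtain ⟨-, -, h3⟩ := circles_clasp_of_ones (p := p) true true
  rcases gen_X_lead_zero_cases (a := true) (b := true) e with h | h | rfl | rfl
  · exact Or.inl h
  · exact Or.inr (Or.inr h)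
  · exact Or.inr (Or.inl (gen_X_congr _ (h3 (by simp)) _))
  · exact Or.inr (Or.inl rfl)

/-! ### Nonvanishing -/

/-- Nonvanishing is carried along injective splits. From a single dotted circle at m = 0, every
further zero in the row splits off a column; the dot on the last column becomes the new factor of
`lead`, and only its copy on the new last circle survives. -/
theorem gen_ending_lead_ne_zero (hm : 1 ≤ m) (hmp : m ≤ p) :
    (twistKnot p).gen (rowV p false false m) (X (upper p p) * lead p m) ≠ 0 := by
  induction m, hm using Nat.le_induction with
  | base =>
    intro h
    have hp : 0 < p := hmp
    have hf : flip (tw p 0) (rowV p false false 0) = rowV p false false 1 :=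
      flip_tw_rowV' false false hp
    have h1 := gen_dotSum_tw (closed_rowV (a := false) (b := false) le_rfl hmp) hp (lead p 1)
    rw [add_mul, map_add, gen_X_congr _ (circle_upper_rowV le_rfl hmp (zero_add 1).ge hmp), h,
      add_zero, gen_X_lead_of_circle (Or.inl rfl) rfl] at h1
    refine gen_X_ne_zero (D := twistKnot p) (rowV p false false 0) (upper p 0)
      (gen_eq_zero_of_split (isOrientable p) (joined_tw_rowV_zero hp) ?_)
    rw [hf, ← lead_one]
    exact h1
  | succ m hm ih =>
    intro h
    refine ih (by omega) ?_
    rw [← gen_X_congr _ (circle_upper_rowV hm (by omega) le_rfl (by omega)), mul_comm (X _),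
      ← lead_succ hm]
    refine gen_eq_zero_of_split (isOrientable p) (joined_tw_rowV hm hmp le_rfl) ?_
    rw [flip_tw_rowV' _ _ hmp, gen_dotSum_tw (closed_rowV (by omega) hmp) hmp, add_mul, map_add,
      gen_X_congr _ (circle_upper_rowV (by omega) hmp le_rfl hmp), h, add_zero]
    simpa using gen_X_mul_lead (p := p) (m := m + 1) (Or.inr (Nat.lt_succ_self m))
      (rowV p false false (m + 1)) 1

theorem gen_lead_ne_zero (hm : 1 ≤ m) (hmp : m ≤ p) :
    (twistKnot p).gen (rowV p true false m) (lead p m) ≠ 0 := by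
  intro h
  refine gen_ending_lead_ne_zero hm hmp ?_
  have h1 := gen_coef_eq_zero (isOrientable p) 0 h
  obtain ⟨h2, -⟩ := (circles_clasp_of_closed (closed_rowV (a := false) (b := false) hm hmp)).1
    (rowV_zero _ _ _)
  rw [flip_zero_rowV, coef_joined _ (joined_rowV hm hmp (by simp)).1, dotSum_zero, add_mul, map_add,
    Bool.not_true, gen_X_congr _ h2, gen_X_lead_of_circle (Or.inl rfl) rfl, add_zero] at h1
  exact h1

theorem gen_bigon_lead_ne_zero (hm : 1 ≤ m) (hmp : m ≤ p) :
    (twistKnot p).gen (rowV p true true m) (X (bigon p true) * lead p m) ≠ 0 := by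
  intro h
  refine gen_lead_ne_zero hm hmp (gen_eq_zero_of_split (isOrientable p)
    (joined_rowV hm hmp (by simp)).2 ?_)
  rw [flip_one_rowV, dotSum_one, add_mul, map_add, Bool.not_false, h,
    gen_X_congr _ (circle_ending (closed_rowV hm hmp) true),
    gen_X_ending_lead hm hmp (Or.inl rfl), add_zero]

theorem gen_lower_lead_ne_zero :
    (twistKnot p).gen (rowV p true false 0) (X (lower p 0) * lead p 0) ≠ 0 := by
  intro h
  refine gen_X_ne_zero (D := twistKnot p) (rowV p false false 0) (upper p 0)
    (gen_eq_zero_of_split (isOrientable p) (joined_rowV_zero false).1 ?_)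
  rw [← lead_zero, flip_zero_rowV, dotSum_zero, add_mul, map_add, Bool.not_false,
    gen_X_congr _ ((circles_clasp_of_ones true false).2.1 rfl).1, h,
    gen_X_lead_of_circle (Or.inl rfl) rfl, add_zero]

theorem gen_bigon_lower_lead_ne_zero :
    (twistKnot p).gen (rowV p true true 0) (X (bigon p true) * (X (lower p 0) * lead p 0)) ≠ 0 := by
  intro h
  refine gen_lower_lead_ne_zero (p := p) (gen_eq_zero_of_split (isOrientable p)
    (joined_rowV_zero true).2 ?_)
  rw [flip_one_rowV, dotSum_one, add_mul, map_add, Bool.not_false, h,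
    gen_X_congr _ (circle_strand_ending (rowV_all_one _ _)).2, ← mul_assoc, ← pow_two, gen_X_sq,
    add_zero]

end KnotDiagram.TwistKnot

namespace KnotDiagram.TwistKnot

open MvPolynomial (X)

variable {p : ℕ} {a b : Bool} {m : ℕ}

/-! ### Signs -/

theorem tw_eq_succ {i : ℕ} (hi : i < p) : tw p i = Fin.succ (Fin.succ ⟨i, hi⟩) := by
  ext
  simp [tw_val hi]

theorem prod_crossings {M : Type*} [CommMonoid M] (F : Fin (p + 2) → M) :
    ∏ c, F c = F 0 * F 1 * ∏ i ∈ Finset.range p, F (tw p i) := by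
  rw [Fin.prod_univ_succ, Fin.prod_univ_succ, Finset.prod_range, mul_assoc (F 0)]
  congr 2
  exact Finset.prod_congr rfl fun i _ => by rw [tw_eq_succ i.2]

theorem sum_crossings {M : Type*} [AddCommMonoid M] (F : Fin (p + 2) → M) :
    ∑ c, F c = F 0 + F 1 + ∑ i ∈ Finset.range p, F (tw p i) := by
  rw [Fin.sum_univ_succ, Fin.sum_univ_succ, Finset.sum_range, add_assoc (F 0)]
  congr 2
  exact Finset.sum_congr rfl fun i _ => by rw [tw_eq_succ i.2]

/-- The sign of a value of a resolution. -/
def sgn (b : Bool) : ℤ := if b then -1 else 1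

theorem sign_zero (v : Fin (p + 2) → Bool) : sign 0 v = 1 := by
  rw [sign_eq_prod]
  refine Finset.prod_eq_one fun c _ => if_neg fun h => ?_
  exact absurd h.1 (Fin.not_lt_zero c)

theorem sign_one (v : Fin (p + 2) → Bool) : sign 1 v = sgn (v 0) := by
  have h01 : (0 : Fin (p + 2)) < 1 := Fin.mk_lt_mk.2 (by simp)
  rw [sign_eq_prod, prod_crossings, Finset.prod_eq_one, mul_one]
  · simp [h01, sgn]
  · intro i hi
    refine if_neg fun h => ?_
    have h1 := Fin.lt_def.1 h.1
    rw [tw_val (Finset.mem_range.1 hi)] at h1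
    simp at h1

theorem sign_tw (v : Fin (p + 2) → Bool) {i : ℕ} (hi : i < p) :
    sign (tw p i) v = sgn (v 0) * sgn (v 1) * ∏ k ∈ Finset.range i, sgn (v (tw p k)) := by
  have h0 : (0 : Fin (p + 2)) < tw p i := by rw [Fin.lt_def, tw_val hi]; simp
  have h1 : (1 : Fin (p + 2)) < tw p i := by rw [Fin.lt_def, tw_val hi]; simp
  rw [sign_eq_prod, prod_crossings]
  congr 1
  · simp [h0, h1, sgn]
  · rw [← Finset.prod_subset (Finset.range_mono hi.le)]
    · refine Finset.prod_congr rfl fun k hk => ?_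
      have hk' := Finset.mem_range.1 hk
      have : tw p k < tw p i := by
        rw [Fin.lt_def, tw_val hi, tw_val (by omega)]
        omega
      simp [this, sgn]
    · intro k hk hk'
      rw [Finset.mem_range] at hk hk'
      refine if_neg fun h => ?_
      have := Fin.lt_def.1 h.1
      rw [tw_val hi, tw_val hk] at this
      omega

theorem sign_tw_rowV {i : ℕ} (hi : i < p) (him : i ≤ m) :
    sign (tw p i) (rowV p a b m) = sgn a * sgn b := by
  rw [sign_tw _ hi, rowV_zero, rowV_one, Finset.prod_eq_one, mul_one]
  intro k hk
  have := Finset.mem_range.1 hk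
  rw [rowV_tw _ _ _ (by omega), decide_eq_false (by omega)]
  rfl

/-! ### The differential on the rows -/

theorem edgeMap_gen_of_false {c : Fin (p + 2)} {v : Fin (p + 2) → Bool} (h : v c = false)
    (f : (twistKnot p).Dots) : (twistKnot p).edgeMap c false ((twistKnot p).gen v f) =
      sign c v • (twistKnot p).gen (flip c v) ((twistKnot p).coef c v * f) := by
  rw [edgeMap_gen (isOrientable p), if_pos h]

theorem edgeMap_gen_of_true {c : Fin (p + 2)} {v : Fin (p + 2) → Bool} (h : v c = true)
    (f : (twistKnot p).Dots) : (twistKnot p).edgeMap c false ((twistKnot p).gen v f) = 0 := by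
  rw [edgeMap_gen (isOrientable p), if_neg (by simp [h])]

theorem diff_eq (x : (twistKnot p).Chain) : (twistKnot p).diff x =
    (twistKnot p).edgeMap 0 false x + (twistKnot p).edgeMap 1 false x +
      ∑ i ∈ Finset.range p, (twistKnot p).edgeMap (tw p i) false x := by
  rw [diff, LinearMap.sum_apply, sum_crossings]

/-- The zero at k keeps all columns closed, so the new one at i identifies the dots on columns i and
i + 1. -/
theorem gen_flip_eq_zero {v : Fin (p + 2) → Bool} {f : (twistKnot p).Dots} {i k : ℕ}
    (hik : i < k) (hk : k < p) (hi : v (tw p i) = false) (hv : v (tw p k) = false)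
    (hf : X (upper p i) - X (upper p (i + 1)) ∣ f) :
    (twistKnot p).gen (flip (tw p i) v) f = 0 := by
  have hip : i < p := by omega
  have hk' : flip (tw p i) v (tw p k) = false := by rw [flip_ne (tw_ne hk hip (by omega)), hv]
  obtain ⟨g, rfl⟩ := hf
  rw [sub_mul, map_sub, gen_X_congr _ (circle_upper_succ (closed_of_zero hk hk') hip
    (by rw [flip_same, hi]; rfl)), sub_self]

theorem edgeMap_tw_eq_zero {v : Fin (p + 2) → Bool} {f : (twistKnot p).Dots} {i k : ℕ}
    (hik : i < k) (hk : k < p) (hi : v (tw p i) = false) (hv : v (tw p k) = false)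
    (hf : X (upper p i) - X (upper p (i + 1)) ∣ f) :
    (twistKnot p).edgeMap (tw p i) false ((twistKnot p).gen v f) = 0 := by
  rw [edgeMap_gen_of_false hi, gen_flip_eq_zero hik hk hi hv (hf.mul_left _), smul_zero]

/-- The differences of consecutive dots in f are killed when a zero other than the last becomes a
one. So the row contributes only the saddle at its last zero. -/
theorem diff_gen_rowV (hmp : m ≤ p) {f : (twistKnot p).Dots}
    (hf : ∀ i, i + 1 < m → X (upper p i) - X (upper p (i + 1)) ∣ f) :
    (twistKnot p).diff ((twistKnot p).gen (rowV p a b m) f) =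
      (twistKnot p).edgeMap 0 false ((twistKnot p).gen (rowV p a b m) f) +
      (twistKnot p).edgeMap 1 false ((twistKnot p).gen (rowV p a b m) f) +
      if 1 ≤ m then (sgn a * sgn b) • (twistKnot p).gen (rowV p a b (m - 1))
        ((twistKnot p).coef (tw p (m - 1)) (rowV p a b m) * f) else 0 := by
  rw [diff_eq]
  congr 1
  split_ifs with hm
  · obtain ⟨m, rfl⟩ : ∃ k, m = k + 1 := ⟨m - 1, by omega⟩
    rw [Nat.add_sub_cancel]
    have hm' : m < p := by omega
    rw [Finset.sum_eq_single_of_mem m (Finset.mem_range.2 hm'), edgeMap_gen_of_false,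
      sign_tw_rowV hm' (by omega), flip_tw_rowV _ _ hm']
    · rw [rowV_tw _ _ _ hm', decide_eq_false (by omega)]
    · intro i hi him
      rw [Finset.mem_range] at hi
      rcases Nat.lt_or_gt_of_ne him with h | h
      · refine edgeMap_tw_eq_zero h hm' ?_ ?_ (hf i (by omega))
        · rw [rowV_tw _ _ _ hi, decide_eq_false (by omega)]
        · rw [rowV_tw _ _ _ hm', decide_eq_false (by omega)]
      · exact edgeMap_gen_of_true (by rw [rowV_tw _ _ _ hi, decide_eq_true (by omega)]) _
  · refine Finset.sum_eq_zero fun i hi => ?_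
    rw [Finset.mem_range] at hi
    exact edgeMap_gen_of_true (by rw [rowV_tw _ _ _ hi, decide_eq_true (by omega)]) _

theorem neg_one_pow_eq_neg {A : Type*} [CommRing A] (hm : 1 ≤ m) :
    ((-1) ^ m : A) = -(-1) ^ (m - 1) := by
  obtain ⟨m, rfl⟩ : ∃ k, m = k + 1 := ⟨m - 1, by omega⟩
  rw [Nat.add_sub_cancel, pow_succ, mul_neg_one]

/-- The product of the differences of the dots on consecutive columns. -/
def diffProd (p m : ℕ) : (twistKnot p).Dots :=
  ∏ i ∈ Finset.range (m - 1), (X (upper p i) - X (upper p (i + 1)))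

theorem diffProd_one : diffProd p 1 = 1 := by simp [diffProd]

theorem diffProd_zero : diffProd p 0 = 1 := by simp [diffProd]

theorem diffProd_succ (hm : 1 ≤ m) :
    diffProd p (m + 1) = diffProd p m * (X (upper p (m - 1)) - X (upper p m)) := by
  obtain ⟨m, rfl⟩ : ∃ k, m = k + 1 := ⟨m - 1, by omega⟩
  rw [diffProd, diffProd, Nat.add_sub_cancel, Nat.add_sub_cancel, Finset.prod_range_succ]

theorem dvd_diffProd {i : ℕ} (hi : i + 1 < m) :
    (X (upper p i) - X (upper p (i + 1)) : (twistKnot p).Dots) ∣ diffProd p m :=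
  Finset.dvd_prod_of_mem (fun i => (X (upper p i) - X (upper p (i + 1)) : (twistKnot p).Dots))
    (Finset.mem_range.2 (by omega))

/-- Multiplication by a dot on the first and on the last of the columns. -/
theorem algebraMap_diffProd_mul (v : Fin (p + 2) → Bool) (hm : 1 ≤ m) :
    algebraMap (twistKnot p).Dots ((twistKnot p).Res v) (diffProd p m) *
        algebraMap (twistKnot p).Dots ((twistKnot p).Res v) (X (upper p (m - 1))) =
      (-1) ^ (m - 1) * (algebraMap (twistKnot p).Dots ((twistKnot p).Res v) (diffProd p m) *
        algebraMap (twistKnot p).Dots ((twistKnot p).Res v) (X (upper p 0))) := by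
  induction m, hm using Nat.le_induction with
  | base => simp
  | succ m hm ih =>
    -- As squares vanish, (x - y) y = - (x - y) x: carrying the dot over one more column costs a
    -- sign.
    rw [diffProd_succ hm, Nat.add_sub_cancel, map_mul, map_sub]
    have h0 := algebraMap_X_sq (D := twistKnot p) v (upper p 0)
    have h1 := algebraMap_X_sq (D := twistKnot p) v (upper p m)
    have h2 : ((-1) ^ m : (twistKnot p).Res v) = -(-1) ^ (m - 1) := by
      conv_lhs => rw [show m = m - 1 + 1 by omega, pow_succ]
      ring
    have h3 : ((-1) ^ (m - 1) : (twistKnot p).Res v) * (-1) ^ (m - 1) = 1 := by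
      rw [← mul_pow]
      simp
    rw [h2]
    generalize ((-1) ^ (m - 1) : (twistKnot p).Res v) = ε at *
    generalize algebraMap (twistKnot p).Dots ((twistKnot p).Res v) (diffProd p m) = g at *
    generalize algebraMap (twistKnot p).Dots ((twistKnot p).Res v) (X (upper p (m - 1))) = x at *
    generalize algebraMap (twistKnot p).Dots ((twistKnot p).Res v) (X (upper p m)) = y at *
    generalize algebraMap (twistKnot p).Dots ((twistKnot p).Res v) (X (upper p 0)) = l at *
    linear_combination (y + ε * l) * ih - g * h1 + ε * ε * g * h0

/-- Starting from the dot on column 0, each factor X_i - X_{i+1} meets X_i and contributes -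
X_{i+1}. -/
theorem algebraMap_X_mul_diffProd (v : Fin (p + 2) → Bool) (m : ℕ) :
    algebraMap (twistKnot p).Dots ((twistKnot p).Res v) (X (upper p 0) * diffProd p m) =
      (-1) ^ (m - 1) * algebraMap (twistKnot p).Dots ((twistKnot p).Res v) (lead p m) := by
  rcases Nat.eq_zero_or_pos m with rfl | hm
  · simp [diffProd, lead]
  induction m, hm using Nat.le_induction with
  | base => simp [diffProd, lead]
  | succ m hm ih =>
    have h1 := gen_X_lead_of_circle (v := v) (Or.inr (show m - 1 < m by omega)) rfl
    rw [gen_eq_zero_iff, map_mul] at h1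
    rw [diffProd_succ hm, lead_succ hm, ← mul_assoc, map_mul, ih, map_mul, map_sub,
      Nat.add_sub_cancel]
    have h2 : ((-1) ^ m : (twistKnot p).Res v) = -(-1) ^ (m - 1) := by
      conv_lhs => rw [show m = m - 1 + 1 by omega, pow_succ]
      ring
    rw [h2]
    linear_combination (-1) ^ (m - 1) * h1

/-- The chain of the row that resolves both clasp crossings by `0`. -/
def sChain (p m : ℕ) : (twistKnot p).Chain :=
  (twistKnot p).gen (rowV p false false m) ((X (upper p 0) - X (upper p p)) * diffProd p m)

/-- The chain of the row that resolves both clasp crossings by `1`. -/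
def tChain (p m : ℕ) : (twistKnot p).Chain :=
  (twistKnot p).gen (rowV p true true m) (diffProd p m) +
    if m = 1 then (twistKnot p).gen (rowV p true false 0) 1 +
      (twistKnot p).gen (rowV p false true 0) 1 else 0

theorem coef_tw_rowV (hm : 1 ≤ m) (hmp : m < p) :
    (twistKnot p).coef (tw p m) (rowV p a b (m + 1)) = 1 := by
  refine coef_not_joined _ ?_
  rw [← flip_tw_rowV' a b hmp, isOrientable p, not_not]
  exact joined_tw_rowV hm hmp le_rfl

theorem circle_ending_rowV (hm : 1 ≤ m) (hmp : m ≤ p) (h : a = true ∨ b = true) :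
    (twistKnot p).circle (rowV p a b m) (upper p p) =
      (twistKnot p).circle (rowV p a b m) (upper p 0) :=
  ((circles_clasp_of_closed (closed_rowV hm hmp)).2.2 (by simpa using h)).2

/-- Either saddle of the clasp joins the first column to the last and thereby kills the factor X_0 -
X_p. -/
theorem diff_sChain (hm : 1 ≤ m) (hmp : m ≤ p) : (twistKnot p).diff (sChain p m) =
    (twistKnot p).gen (rowV p false false (m - 1))
      ((twistKnot p).coef (tw p (m - 1)) (rowV p false false m) *
        ((X (upper p 0) - X (upper p p)) * diffProd p m)) := by
  have key : ∀ a b, a = true ∨ b = true → (twistKnot p).gen (rowV p a b m)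
      ((X (upper p 0) - X (upper p p)) * diffProd p m) = 0 := by
    intro a b h
    rw [sub_mul, map_sub, gen_X_congr _ (circle_ending_rowV hm hmp h), sub_self]
  rw [sChain, diff_gen_rowV hmp fun i hi => (dvd_diffProd hi).mul_left _,
    edgeMap_gen_of_false (rowV_zero _ _ _), edgeMap_gen_of_false (rowV_one _ _ _),
    flip_zero_rowV, flip_one_rowV, coef_not_joined _ (not_joined_rowV hm hmp rfl).1,
    coef_not_joined _ (not_joined_rowV hm hmp rfl).2, one_mul, key _ _ (by simp),
    key _ _ (by simp), if_pos hm]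
  simp [sgn]

theorem circle_ending_rowV_zero : (twistKnot p).circle (rowV p false false 0) (upper p p) =
    (twistKnot p).circle (rowV p false false 0) (upper p 0) := by
  obtain ⟨h1, h2, -⟩ := circles_clasp_of_ones (p := p) false false
  have h3 := (circle_strand (rowV_all_one (p := p) false false) le_rfl).1
  split_ifs at h3
  · exact h3
  · exact h3.trans ((h2 rfl).1.symm.trans (h1 rfl).1)

/-- For the clasp resolution 00 and a row of ones the first and last columns lie on one circle;
index 0 is a dummy in all sums over `sChain`. -/
theorem sChain_zero : sChain p 0 = 0 := by
  rw [sChain, sub_mul, map_sub, gen_X_congr _ circle_ending_rowV_zero, sub_self]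

theorem diff_sChain_one (hp : 1 ≤ p) : (twistKnot p).diff (sChain p 1) = 0 := by
  rw [diff_sChain le_rfl hp, mul_left_comm, sub_mul, map_sub,
    gen_X_congr _ circle_ending_rowV_zero, sub_self]

/-- After the merge column m is the last column. In the product with X_{m-1} - X_p, carrying the dot
from column m - 1 to column 0 produces the sign that makes the two terms add up for odd m and cancel
for even m. -/
theorem diff_sChain_succ (hm : 1 ≤ m) (hmp : m < p) : (twistKnot p).diff (sChain p (m + 1)) =
    (1 - (-1) ^ m : ℚ) • (X (upper p 0) : (twistKnot p).Dots) • sChain p m := by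
  have hc := circle_upper_rowV (a := false) (b := false) hm hmp.le le_rfl hmp.le
  rw [diff_sChain (m := m + 1) (by omega) hmp, Nat.add_sub_cancel, coef_tw_rowV hm hmp, one_mul, sChain,
    smul_gen, rat_smul_gen, gen_eq_gen_iff, diffProd_succ hm]
  have h0 := algebraMap_X_sq (D := twistKnot p) (rowV p false false m) (upper p 0)
  have h1 := algebraMap_X_sq (D := twistKnot p) (rowV p false false m) (upper p p)
  have h2 := algebraMap_diffProd_mul (p := p) (rowV p false false m) hm
  have h3 : ((-1) ^ m : (twistKnot p).Res (rowV p false false m)) = -(-1) ^ (m - 1) :=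
    neg_one_pow_eq_neg hm
  simp only [MvPolynomial.smul_eq_C_mul, map_sub, map_one, map_pow, map_neg, map_mul]
  rw [algebraMap_X_eq _ hc, h3]
  generalize ((-1) ^ (m - 1) : (twistKnot p).Res (rowV p false false m)) = ε at *
  generalize algebraMap (twistKnot p).Dots ((twistKnot p).Res (rowV p false false m)) (diffProd p m) = g at *
  generalize algebraMap (twistKnot p).Dots ((twistKnot p).Res (rowV p false false m)) (X (upper p (m - 1))) = x at *
  generalize algebraMap (twistKnot p).Dots ((twistKnot p).Res (rowV p false false m)) (X (upper p p)) = y at *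
  generalize algebraMap (twistKnot p).Dots ((twistKnot p).Res (rowV p false false m)) (X (upper p 0)) = l at *
  linear_combination (l - y) * h2 + g * h1 - g * h0

theorem diff_tChain_zero : (twistKnot p).diff (tChain p 0) = 0 := by
  rw [tChain, if_neg (by omega), add_zero, diff_gen_rowV (Nat.zero_le _) (by omega),
    edgeMap_gen_of_true (rowV_zero _ _ _), edgeMap_gen_of_true (rowV_one _ _ _), if_neg (by omega)]
  simp

/-- The purpose of the correction in `tChain p 1`: the dots on the bigon cancel by the signs of the
cube, and the difference of the dots of the two strands remains. -/
theorem diff_gen_rowV_zero : (twistKnot p).diff ((twistKnot p).gen (rowV p true false 0) 1 +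
    (twistKnot p).gen (rowV p false true 0) 1) = (twistKnot p).gen (rowV p true true 0)
      (X (upper p 0) - X (lower p 0)) := by
  rw [map_add, diff_gen_rowV (Nat.zero_le _) (by omega), diff_gen_rowV (Nat.zero_le _) (by omega),
    edgeMap_gen_of_true (rowV_zero _ _ _), edgeMap_gen_of_false (rowV_one _ _ _),
    edgeMap_gen_of_true (v := rowV p false true 0) (rowV_one _ _ _),
    edgeMap_gen_of_false (v := rowV p false true 0) (rowV_zero _ _ _),
    if_neg (by omega), if_neg (by omega), sign_one, sign_zero, flip_zero_rowV, flip_one_rowV,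
    coef_joined _ (joined_rowV_zero _).1, coef_joined _ (joined_rowV_zero _).2, dotSum_zero,
    dotSum_one, rowV_zero, mul_one, mul_one, map_add, map_add, map_sub]
  obtain ⟨-, -, h3⟩ := circles_clasp_of_ones (p := p) true true
  have h4 := gen_X_congr (D := twistKnot p) (h3 (by simp)) 1
  have h5 := gen_X_congr (D := twistKnot p)
    (circle_strand_ending (rowV_all_one (p := p) true true)).2 1
  rw [mul_one, mul_one] at h4 h5
  simp only [Bool.not_false, h4, h5, sgn, if_true]
  module

/-- For m = 1 the last zero of the row splits a circle and yields the sum of the dots of the two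
strands. The correction adds their difference, leaving twice the marked dot. -/
theorem diff_tChain_one (hp : 1 ≤ p) : (twistKnot p).diff (tChain p 1) =
    (2 : ℚ) • (X (upper p 0) : (twistKnot p).Dots) • tChain p 0 := by
  have hp' : 0 < p := hp
  have hj : (twistKnot p).Joined (tw p 0) (rowV p true true 1) := by
    rw [KnotDiagram.Joined, edge_tw hp', edge_tw hp']
    have h1 := circle_lower_rowV (a := true) (b := true) le_rfl hp hp
    have h2 := circle_lower_rowV (a := true) (b := true) le_rfl hp (Nat.zero_le p)
    have h3 := circle_upper_rowV (a := true) (b := true) le_rfl hp le_rfl hp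
    have h4 := circle_ending_rowV (a := true) (b := true) le_rfl hp (Or.inl rfl)
    simpa using h1.trans (h3.trans (h4.trans h2.symm))
  have hc := (circle_upper_of_one hp' (rowV_all_one (p := p) true true 0 hp')).1
  have h5 := gen_X_congr (D := twistKnot p) hc.symm 1
  rw [mul_one, mul_one] at h5
  have h6 : (twistKnot p).gen (rowV p true true 0) ((twistKnot p).dotSum (tw p 0)) =
      (twistKnot p).gen (rowV p true true 0) (X (upper p 0) + X (lower p 0)) := by
    rw [dotSum, edge_tw hp', edge_tw hp', map_add, map_add, ← h5]
    simp
  rw [tChain, if_pos rfl, map_add, diff_gen_rowV_zero, diff_gen_rowV hp (by omega),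
    edgeMap_gen_of_true (rowV_zero _ _ _), edgeMap_gen_of_true (rowV_one _ _ _), if_pos le_rfl,
    Nat.sub_self, coef_joined _ hj, diffProd_one, mul_one, h6, tChain, if_neg (by omega), add_zero ((twistKnot p).gen _ _),
    diffProd_zero, smul_gen, mul_one, map_add, map_sub]
  simp only [sgn, if_true]
  module

/-- With the clasp resolved by 1 the last column is joined to column 0, so the new factor becomes
X_{m-1} - X_0, and `algebraMap_diffProd_mul` expresses X_{m-1} by X_0. -/
theorem diff_tChain_succ (hm : 1 ≤ m) (hmp : m < p) : (twistKnot p).diff (tChain p (m + 1)) =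
    (-1 - (-1) ^ m : ℚ) • (X (upper p 0) : (twistKnot p).Dots) • tChain p m := by
  have hc := (circle_upper_rowV (a := true) (b := true) hm hmp.le le_rfl hmp.le).trans
    (circle_ending_rowV hm hmp.le (Or.inl rfl))
  -- For m = 1 the coefficient is zero, so the correction term of `tChain` plays no role.
  have h1 : (-1 - (-1) ^ m : ℚ) • (X (upper p 0) : (twistKnot p).Dots) • tChain p m =
      (-1 - (-1) ^ m : ℚ) • (X (upper p 0) : (twistKnot p).Dots) •
        (twistKnot p).gen (rowV p true true m) (diffProd p m) := by
    rw [tChain]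
    split_ifs with h
    · subst h
      simp
    · rw [add_zero]
  rw [h1, tChain, if_neg (by omega), add_zero, diff_gen_rowV (m := m + 1) hmp fun i hi => dvd_diffProd hi,
    edgeMap_gen_of_true (rowV_zero _ _ _), edgeMap_gen_of_true (rowV_one _ _ _),
    if_pos (by omega), Nat.add_sub_cancel, coef_tw_rowV hm hmp, smul_gen, rat_smul_gen, one_mul,
    zero_add, zero_add]
  simp only [sgn, if_true, neg_mul_neg, one_mul, one_smul]
  rw [gen_eq_gen_iff, diffProd_succ hm]
  have h2 := algebraMap_diffProd_mul (p := p) (rowV p true true m) hm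
  have h3 : ((-1) ^ m : (twistKnot p).Res (rowV p true true m)) = -(-1) ^ (m - 1) :=
    neg_one_pow_eq_neg hm
  simp only [MvPolynomial.smul_eq_C_mul, map_sub, map_one, map_pow, map_neg, map_mul]
  rw [algebraMap_X_eq _ hc, h3]
  linear_combination h2

theorem X_smul_sChain (m : ℕ) : (X (upper p 0) : (twistKnot p).Dots) • sChain p m =
    (-(-1) ^ (m - 1) : ℚ) • (twistKnot p).gen (rowV p false false m)
      (X (upper p p) * lead p m) := by
  rw [sChain, smul_gen, rat_smul_gen, gen_eq_gen_iff]
  have h1 := algebraMap_X_mul_diffProd (p := p) (rowV p false false m) m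
  have h0 := algebraMap_X_sq (D := twistKnot p) (rowV p false false m) (upper p 0)
  rw [map_mul] at h1
  simp only [MvPolynomial.smul_eq_C_mul, map_sub, map_one, map_pow, map_neg, map_mul]
  linear_combination algebraMap (twistKnot p).Dots ((twistKnot p).Res (rowV p false false m)) (diffProd p m) * h0 -
    algebraMap (twistKnot p).Dots ((twistKnot p).Res (rowV p false false m)) (X (upper p p)) * h1

theorem X_smul_tChain (m : ℕ) : (X (upper p 0) : (twistKnot p).Dots) • tChain p m =
    ((-1) ^ (m - 1) : ℚ) • ((twistKnot p).gen (rowV p true true m) (lead p m) +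
      if m = 1 then (twistKnot p).gen (rowV p true false 0) (lead p 0) +
        (twistKnot p).gen (rowV p false true 0) (lead p 0) else 0) := by
  have h : (X (upper p 0) : (twistKnot p).Dots) • (twistKnot p).gen (rowV p true true m)
      (diffProd p m) = ((-1) ^ (m - 1) : ℚ) • (twistKnot p).gen (rowV p true true m)
        (lead p m) := by
    rw [smul_gen, rat_smul_gen, gen_eq_gen_iff, algebraMap_X_mul_diffProd]
    simp only [MvPolynomial.smul_eq_C_mul, map_one, map_pow, map_neg, map_mul]
  rw [tChain, smul_add, h, smul_add]
  congr 1
  split_ifs with hm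
  · subst hm
    rw [smul_add, smul_gen, smul_gen, mul_one, lead_zero, Nat.sub_self, pow_zero, one_smul]
  · simp

theorem diff_X_smul_sChain (hmp : m ≤ p) :
    (twistKnot p).diff ((X (upper p 0) : (twistKnot p).Dots) • sChain p m) = 0 := by
  rw [map_smul]
  rcases m with _ | _ | m
  · rw [sChain_zero, map_zero, smul_zero]
  · rw [diff_sChain_one hmp, smul_zero]
  · rw [diff_sChain_succ (by omega) hmp, smul_comm _ (_ : ℚ), X_smul_X_smul, smul_zero]

theorem diff_X_smul_tChain (hmp : m ≤ p) :
    (twistKnot p).diff ((X (upper p 0) : (twistKnot p).Dots) • tChain p m) = 0 := by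
  rw [map_smul]
  rcases m with _ | _ | m
  · rw [diff_tChain_zero, smul_zero]
  · rw [diff_tChain_one hmp, smul_comm _ (_ : ℚ), X_smul_X_smul, smul_zero]
  · rw [diff_tChain_succ (by omega) hmp, smul_comm _ (_ : ℚ), X_smul_X_smul, smul_zero]

end KnotDiagram.TwistKnot

namespace KnotDiagram.TwistKnot

open MvPolynomial (X C)

variable {p : ℕ} {a b : Bool} {m : ℕ}

/-! ### Components of the chains on the rows -/

theorem exists_apply_rowV {x : (twistKnot p).Chain}
    (hx : x ∈ (twistKnot p).multiples (rowGen p)) (a b : Bool) (hm : m ≤ p) :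
    ∃ f, x (rowV p a b m) = algebraMap (twistKnot p).Dots ((twistKnot p).Res _) (f * lead p m) := by
  obtain ⟨F, rfl⟩ := mem_multiples_iff.1 hx
  refine ⟨F (rowV p a b m), ?_⟩
  rw [sum_gen_apply, rowGen_rowV a b hm, mul_comm (lead p m)]

theorem apply_of_not_sorted {x : (twistKnot p).Chain}
    (hx : x ∈ (twistKnot p).multiples (rowGen p)) {v : Fin (p + 2) → Bool} (hv : ¬ Sorted p v) :
    x v = 0 := by
  obtain ⟨F, rfl⟩ := mem_multiples_iff.1 hx
  rw [sum_gen_apply, rowGen_of_not_sorted hv, zero_mul, map_zero]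

theorem ext_rowV {x y : (twistKnot p).Chain} (hx : x ∈ (twistKnot p).multiples (rowGen p))
    (hy : y ∈ (twistKnot p).multiples (rowGen p))
    (h : ∀ a b, ∀ m ≤ p, x (rowV p a b m) = y (rowV p a b m)) : x = y := by
  funext v
  by_cases hv : Sorted p v
  · obtain ⟨m, hm, h1⟩ := exists_rowV_of_sorted hv
    rw [h1]
    exact h _ _ m hm
  · rw [apply_of_not_sorted hx hv, apply_of_not_sorted hy hv]

/-- The sum of multiples of the generators of the rows with the same clasp resolution. -/
def rowSum (p : ℕ) (a b : Bool) (f : ℕ → (twistKnot p).Dots) : (twistKnot p).Chain :=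
  ∑ k ∈ Finset.range (p + 1), (twistKnot p).gen (rowV p a b k) (f k * lead p k)

theorem rowSum_mem (a b : Bool) (f : ℕ → (twistKnot p).Dots) :
    rowSum p a b f ∈ (twistKnot p).multiples (rowGen p) := by
  refine Submodule.sum_mem _ fun k hk => gen_mem_multiples_of_dvd ?_
  rw [rowGen_rowV a b (Nat.lt_succ_iff.1 (Finset.mem_range.1 hk))]
  exact dvd_mul_left _ _

theorem rowSum_apply (a b : Bool) (f : ℕ → (twistKnot p).Dots) (hm : m ≤ p) :
    rowSum p a b f (rowV p a b m) =
      algebraMap (twistKnot p).Dots ((twistKnot p).Res _) (f m * lead p m) := by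
  rw [rowSum, Finset.sum_apply, Finset.sum_eq_single_of_mem m (Finset.mem_range.2 (by omega)),
    gen_apply_same]
  intro k hk hkm
  rw [Finset.mem_range] at hk
  exact gen_apply_ne _ (fun h => hkm (rowV_injective hm (by omega) h).2.2.symm) _

theorem rowSum_apply_ne {a' b' : Bool} (h : a ≠ a' ∨ b ≠ b') (f : ℕ → (twistKnot p).Dots)
    (m : ℕ) : rowSum p a b f (rowV p a' b' m) = 0 := by
  rw [rowSum, Finset.sum_apply]
  refine Finset.sum_eq_zero fun k _ => gen_apply_ne _ (fun h1 => ?_) _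
  rcases h with h | h
  · exact h (by simpa using (congrFun h1 0).symm)
  · exact h (by simpa using (congrFun h1 1).symm)

theorem diff_mem_rowGen {x : (twistKnot p).Chain}
    (hx : x ∈ (twistKnot p).multiples (rowGen p)) :
    (twistKnot p).diff x ∈ (twistKnot p).multiples (rowGen p) :=
  diff_mem_multiples (fun v c => edgeMap_rowGen_mem le_rfl v c) hx

/-- The saddles of the row keep the clasp fixed, so only the clasp contributes where x vanishes. The
homology is therefore computed by descending through the clasp resolutions 11, mixed, 00. -/
theorem diff_apply_rowV {x : (twistKnot p).Chain}
    (hx : x ∈ (twistKnot p).multiples (rowGen p)) (h : ∀ m ≤ p, x (rowV p a b m) = 0)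
    (m : ℕ) : (twistKnot p).diff x (rowV p a b m) =
      (twistKnot p).edgeMap 0 false x (rowV p a b m) +
      (twistKnot p).edgeMap 1 false x (rowV p a b m) := by
  rw [diff_apply, sum_crossings, Finset.sum_eq_zero, add_zero]
  intro i hi
  rw [Finset.mem_range] at hi
  by_cases hv : rowV p a b m (tw p i) = true
  · have h0 : x (flip (tw p i) (rowV p a b m)) = 0 := by
      by_cases hs : Sorted p (flip (tw p i) (rowV p a b m))
      · obtain ⟨k, hk, h1⟩ := exists_rowV_of_sorted hs
        rw [h1, flip_ne (tw_ne_zero hi).symm, flip_ne (tw_ne_one hi).symm, rowV_zero, rowV_one]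
        exact h k hk
      · exact apply_of_not_sorted hx hs
    rw [edgeMap_apply_of_eq (isOrientable p) (f := 0) (by simpa using hv)
      (by rw [h0, map_zero]), mul_zero, map_zero, smul_zero]
  · exact edgeMap_apply_of_ne (by simpa using hv) x

theorem diff_apply_true_true {x : (twistKnot p).Chain}
    (hx : x ∈ (twistKnot p).multiples (rowGen p)) (h : ∀ m ≤ p, x (rowV p true true m) = 0)
    {f g : (twistKnot p).Dots}
    (hf : x (rowV p false true m) = algebraMap (twistKnot p).Dots ((twistKnot p).Res _) f)
    (hg : x (rowV p true false m) = algebraMap (twistKnot p).Dots ((twistKnot p).Res _) g) :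
    (twistKnot p).diff x (rowV p true true m) = algebraMap (twistKnot p).Dots ((twistKnot p).Res _)
      ((twistKnot p).coef 0 (rowV p false true m) * f -
        (twistKnot p).coef 1 (rowV p true false m) * g) := by
  rw [diff_apply_rowV hx h,
    edgeMap_apply_of_eq (isOrientable p) (c := 0) (f := f) (by simp)
      (by rw [flip_zero_rowV]; exact hf),
    edgeMap_apply_of_eq (isOrientable p) (c := 1) (f := g) (by simp)
      (by rw [flip_one_rowV]; exact hg), sign_zero, sign_one, rowV_zero, flip_zero_rowV,
    flip_one_rowV, map_sub, one_smul, sgn, if_pos rfl, neg_one_smul, sub_eq_add_neg,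
    Bool.not_true]

theorem diff_apply_true_false {x : (twistKnot p).Chain}
    (hx : x ∈ (twistKnot p).multiples (rowGen p)) (h : ∀ m ≤ p, x (rowV p true false m) = 0)
    {f : (twistKnot p).Dots}
    (hf : x (rowV p false false m) = algebraMap (twistKnot p).Dots ((twistKnot p).Res _) f) :
    (twistKnot p).diff x (rowV p true false m) = algebraMap (twistKnot p).Dots ((twistKnot p).Res _)
      ((twistKnot p).coef 0 (rowV p false false m) * f) := by
  rw [diff_apply_rowV hx h,
    edgeMap_apply_of_eq (isOrientable p) (c := 0) (f := f) (by simp)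
      (by rw [flip_zero_rowV]; exact hf), edgeMap_apply_of_ne (c := 1) (by simp), sign_zero,
    flip_zero_rowV, one_smul, add_zero, Bool.not_true]

theorem diff_apply_false_true {x : (twistKnot p).Chain}
    (hx : x ∈ (twistKnot p).multiples (rowGen p)) (h : ∀ m ≤ p, x (rowV p false true m) = 0)
    {f : (twistKnot p).Dots}
    (hf : x (rowV p false false m) = algebraMap (twistKnot p).Dots ((twistKnot p).Res _) f) :
    (twistKnot p).diff x (rowV p false true m) = algebraMap (twistKnot p).Dots ((twistKnot p).Res _)
      ((twistKnot p).coef 1 (rowV p false false m) * f) := by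
  rw [diff_apply_rowV hx h,
    edgeMap_apply_of_eq (isOrientable p) (c := 1) (f := f) (by simp)
      (by rw [flip_one_rowV]; exact hf), edgeMap_apply_of_ne (c := 0) (by simp), sign_one,
    rowV_zero, flip_one_rowV, sgn, if_neg (by simp), one_smul, zero_add, Bool.not_true]

theorem eq_zero_of_C_mul {v : Fin (p + 2) → Bool} {f : (twistKnot p).Dots} {t : ℚ}
    (hf : (twistKnot p).gen v f ≠ 0)
    (h : algebraMap (twistKnot p).Dots ((twistKnot p).Res v) (C t * f) = 0) : t = 0 := by
  rw [← gen_eq_zero_iff, ← MvPolynomial.smul_eq_C_mul, ← rat_smul_gen, smul_eq_zero] at h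
  exact h.resolve_right hf

/-! ### The clasp -/

/-- The chain of the rows that the reduced homology classes of `tChain` are made of. -/
def tSum (p : ℕ) (β : ℕ → ℚ) : (twistKnot p).Chain :=
  ∑ k ∈ Finset.range (p + 1), β k • (X (upper p 0) : (twistKnot p).Dots) • tChain p k

def sSum (p : ℕ) (α : ℕ → ℚ) : (twistKnot p).Chain :=
  ∑ k ∈ Finset.range (p + 1), α k • (X (upper p 0) : (twistKnot p).Dots) • sChain p k

theorem sSum_eq (α : ℕ → ℚ) : sSum p α =
    rowSum p false false fun k => C (-(-1) ^ (k - 1) * α k) * X (upper p p) := by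
  refine Finset.sum_congr rfl fun k _ => ?_
  rw [X_smul_sChain, smul_smul, rat_smul_gen, MvPolynomial.smul_eq_C_mul, mul_assoc,
    mul_comm (α k)]

theorem tSum_eq (β : ℕ → ℚ) : tSum p β =
    rowSum p true true (fun k => C ((-1) ^ (k - 1) * β k)) +
      (rowSum p true false (fun k => if k = 0 ∧ 1 ≤ p then C (β 1) else 0) +
        rowSum p false true (fun k => if k = 0 ∧ 1 ≤ p then C (β 1) else 0)) := by
  have key : ∀ a b, rowSum p a b (fun k => if k = 0 ∧ 1 ≤ p then C (β 1) else 0) =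
      if 1 ≤ p then β 1 • (twistKnot p).gen (rowV p a b 0) (lead p 0) else 0 := by
    intro a b
    rw [rowSum, Finset.sum_eq_single_of_mem 0 (by simp)]
    · by_cases hp : 1 ≤ p <;> simp [hp, rat_smul_gen, MvPolynomial.smul_eq_C_mul]
    · intro k _ hk
      rw [if_neg (by tauto), zero_mul, map_zero]
  have h1 : ∀ k, β k • (X (upper p 0) : (twistKnot p).Dots) • tChain p k =
      (twistKnot p).gen (rowV p true true k) (C ((-1) ^ (k - 1) * β k) * lead p k) +
      if k = 1 then β 1 • ((twistKnot p).gen (rowV p true false 0) (lead p 0) +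
        (twistKnot p).gen (rowV p false true 0) (lead p 0)) else 0 := by
    intro k
    rw [X_smul_tChain, smul_smul, smul_add, rat_smul_gen, MvPolynomial.smul_eq_C_mul,
      mul_comm (β k)]
    congr 1
    split_ifs with h
    · subst h
      simp
    · rw [smul_zero]
  rw [key, key, tSum, Finset.sum_congr rfl fun k _ => h1 k, Finset.sum_add_distrib]
  congr 1
  rw [Finset.sum_ite_eq']
  by_cases hp : 1 ≤ p
  · rw [if_pos (Finset.mem_range.2 (by omega)), if_pos hp, if_pos hp, smul_add]
  · rw [if_neg (by rw [Finset.mem_range]; omega), if_neg hp, if_neg hp, add_zero]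

theorem sSum_mem (α : ℕ → ℚ) : sSum p α ∈ (twistKnot p).multiples (rowGen p) := by
  rw [sSum_eq]
  exact rowSum_mem _ _ _

theorem tSum_mem (β : ℕ → ℚ) : tSum p β ∈ (twistKnot p).multiples (rowGen p) := by
  rw [tSum_eq]
  exact add_mem (rowSum_mem _ _ _) (add_mem (rowSum_mem _ _ _) (rowSum_mem _ _ _))

/-- On multiples of `lead` the dot on the marked column is zero, so the split only places a dot on
the bigon. -/
theorem coef_zero_mul_lead (hm : m ≤ p) :
    algebraMap (twistKnot p).Dots ((twistKnot p).Res (rowV p true true m))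
      ((twistKnot p).coef 0 (rowV p false true m)) * algebraMap (twistKnot p).Dots _ (lead p m) =
    algebraMap (twistKnot p).Dots ((twistKnot p).Res (rowV p true true m)) (X (bigon p true)) *
      algebraMap (twistKnot p).Dots _ (lead p m) := by
  have hl : algebraMap (twistKnot p).Dots ((twistKnot p).Res (rowV p true true m)) (X (upper p 0)) *
      algebraMap (twistKnot p).Dots _ (lead p m) = 0 := by
    rw [← map_mul, ← gen_eq_zero_iff]
    exact gen_X_lead_of_circle (Or.inl rfl) rfl
  have hb : (twistKnot p).circle (rowV p true true m) (bigon p false) =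
      (twistKnot p).circle (rowV p true true m) (bigon p true) := by
    have h := circle_clasp_zero (v := rowV p true true m)
    rw [rowV_zero, if_pos rfl] at h
    exact h.1
  have hj : (twistKnot p).Joined 0 (rowV p false true m) := by
    rcases Nat.eq_zero_or_pos m with rfl | h
    · exact (joined_rowV_zero true).1
    · exact (joined_rowV h hm (by simp)).1
  rw [coef_joined _ hj, dotSum_zero, map_add, algebraMap_X_eq _ hb]
  linear_combination hl

/-- For m ≥ 1 the other side of crossing 1 lies on the marked circle and drops out. For m = 0 it is
the second strand, a circle of its own without a dot. -/
theorem coef_one_mul_lead (hm : m ≤ p) :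
    algebraMap (twistKnot p).Dots ((twistKnot p).Res (rowV p true true m))
      ((twistKnot p).coef 1 (rowV p true false m)) * algebraMap (twistKnot p).Dots _ (lead p m) =
    (algebraMap (twistKnot p).Dots ((twistKnot p).Res (rowV p true true m)) (X (bigon p true)) +
      if m = 0 then algebraMap (twistKnot p).Dots _ (X (lower p 0)) else 0) *
      algebraMap (twistKnot p).Dots _ (lead p m) := by
  rcases Nat.eq_zero_or_pos m with rfl | h
  · rw [coef_joined _ (joined_rowV_zero true).2, dotSum_one, map_add, if_pos rfl,
      algebraMap_X_eq _ (circle_strand_ending (rowV_all_one _ _)).2]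
  · have hl : algebraMap (twistKnot p).Dots ((twistKnot p).Res (rowV p true true m)) (X (upper p 0)) *
        algebraMap (twistKnot p).Dots _ (lead p m) = 0 := by
      rw [← map_mul, ← gen_eq_zero_iff]
      exact gen_X_lead_of_circle (Or.inl rfl) rfl
    rw [coef_joined _ (joined_rowV h hm (by simp)).2, dotSum_one, map_add, if_neg (by omega),
      algebraMap_X_eq _ (circle_ending (closed_rowV h hm) true),
      algebraMap_X_eq _ (circle_ending_rowV h hm (Or.inl rfl))]
    linear_combination hl

theorem coef_false_mul_lead (hm : m ≤ p) :
    algebraMap (twistKnot p).Dots ((twistKnot p).Res (rowV p true false m))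
      ((twistKnot p).coef 0 (rowV p false false m)) * algebraMap (twistKnot p).Dots _ (lead p m) =
    (if m = 0 then algebraMap (twistKnot p).Dots ((twistKnot p).Res (rowV p true false m)) (X (lower p 0)) else 1) *
      algebraMap (twistKnot p).Dots _ (lead p m) := by
  rcases Nat.eq_zero_or_pos m with rfl | h
  · have hl : algebraMap (twistKnot p).Dots ((twistKnot p).Res (rowV p true false 0)) (X (upper p 0)) *
        algebraMap (twistKnot p).Dots _ (lead p 0) = 0 := by
      rw [← map_mul, ← gen_eq_zero_iff]
      exact gen_X_lead_of_circle (Or.inl rfl) rfl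
    rw [coef_joined _ (joined_rowV_zero false).1, dotSum_zero, map_add, if_pos rfl,
      algebraMap_X_eq _ ((circles_clasp_of_ones true false).2.1 rfl).1]
    linear_combination hl
  · rw [coef_not_joined _ (not_joined_rowV h hm rfl).1, if_neg (by omega), map_one]

theorem coef_false_mul_lead' (hm : m ≤ p) :
    algebraMap (twistKnot p).Dots ((twistKnot p).Res (rowV p false true m))
      ((twistKnot p).coef 1 (rowV p false false m)) * algebraMap (twistKnot p).Dots _ (lead p m) =
    (if m = 0 then algebraMap (twistKnot p).Dots ((twistKnot p).Res (rowV p false true m)) (X (lower p 0)) else 1) *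
      algebraMap (twistKnot p).Dots _ (lead p m) := by
  rcases Nat.eq_zero_or_pos m with rfl | h
  · have hl : algebraMap (twistKnot p).Dots ((twistKnot p).Res (rowV p false true 0)) (X (upper p 0)) *
        algebraMap (twistKnot p).Dots _ (lead p 0) = 0 := by
      rw [← map_mul, ← gen_eq_zero_iff]
      exact gen_X_lead_of_circle (Or.inl rfl) rfl
    rw [coef_joined _ (joined_rowV_zero false).2, dotSum_one, map_add, if_pos rfl,
      algebraMap_X_eq _ ((circles_clasp_of_ones false true).1 rfl).2,
      algebraMap_X_eq _ (circle_strand_ending (rowV_all_one _ _)).2]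
    linear_combination hl
  · rw [coef_not_joined _ (not_joined_rowV h hm rfl).2, if_neg (by omega), map_one]

/-- Modulo boundaries, only rational multiples of the generators remain in the rows that resolve
the clasp by `1`. -/
theorem exists_apply_true_true (x : (twistKnot p).Dots) (hm : m ≤ p) :
    ∃ (f g : (twistKnot p).Dots) (t : ℚ),
      algebraMap (twistKnot p).Dots ((twistKnot p).Res (rowV p true true m)) (x * lead p m) =
      algebraMap (twistKnot p).Dots ((twistKnot p).Res (rowV p true true m))
        ((twistKnot p).coef 0 (rowV p false true m) * (f * lead p m) -
          (twistKnot p).coef 1 (rowV p true false m) * (g * lead p m) + C t * lead p m) := by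
  have h0 := coef_zero_mul_lead hm
  have h1 := coef_one_mul_lead hm
  rcases Nat.eq_zero_or_pos m with rfl | h
  · obtain ⟨α, β, γ, δ, h2⟩ := exists_gen_lead_zero_true x
    simp only [rat_smul_gen, ← map_add, MvPolynomial.smul_eq_C_mul] at h2
    rw [gen_eq_gen_iff] at h2
    rw [if_pos rfl] at h1
    -- Crossing 0 supplies B times f and crossing 1 supplies B + L times g, with B the dot of the
    -- bigon and L that of the second strand. The term γ L needs crossing 1, and its by-product γ B
    -- is removed from f.
    refine ⟨C (β - γ) + C δ * X (lower p 0), -C γ, α, ?_⟩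
    rw [h2]
    simp only [map_add, map_sub, map_mul, map_neg] at h0 h1 ⊢
    linear_combination (-(algebraMap (twistKnot p).Dots ((twistKnot p).Res (rowV p true true 0)) (C β) -
        algebraMap (twistKnot p).Dots _ (C γ) + algebraMap (twistKnot p).Dots _ (C δ) * algebraMap (twistKnot p).Dots _ (X (lower p 0)))) * h0 -
      algebraMap (twistKnot p).Dots ((twistKnot p).Res (rowV p true true 0)) (C γ) * h1
  · obtain ⟨α, β, h2⟩ := exists_gen_lead_true h hm x
    simp only [rat_smul_gen, ← map_add, MvPolynomial.smul_eq_C_mul] at h2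
    rw [gen_eq_gen_iff] at h2
    refine ⟨C β, 0, α, ?_⟩
    rw [h2]
    simp only [map_add, map_sub, map_mul, map_zero] at h0 ⊢
    linear_combination (-algebraMap (twistKnot p).Dots ((twistKnot p).Res (rowV p true true m)) (C β)) * h0

theorem exists_apply_of_ne (hab : a ≠ b) (f : (twistKnot p).Dots) (hm : m ≤ p) :
    ∃ α β : ℚ, algebraMap (twistKnot p).Dots ((twistKnot p).Res (rowV p a b m)) (f * lead p m) =
      algebraMap (twistKnot p).Dots _ ((C α + C β * if m = 0 then X (lower p 0) else 0) * lead p m) := by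
  rcases Nat.eq_zero_or_pos m with rfl | h
  · obtain ⟨α, β, h2⟩ := exists_gen_lead_zero_ne hab f
    simp only [rat_smul_gen, ← map_add, MvPolynomial.smul_eq_C_mul] at h2
    rw [gen_eq_gen_iff] at h2
    refine ⟨α, β, ?_⟩
    rw [h2, if_pos rfl, add_mul, mul_assoc]
  · obtain ⟨α, h2⟩ := exists_gen_lead_ne h hm hab f
    simp only [rat_smul_gen, MvPolynomial.smul_eq_C_mul] at h2
    rw [gen_eq_gen_iff] at h2
    refine ⟨α, 0, ?_⟩
    rw [h2, map_zero, zero_mul, add_zero]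

/-- A chain on the rows with different resolutions of the clasp crossings whose boundary is a
rational multiple of a generator is a boundary. -/
theorem eq_of_clasp {α β γ δ t : ℚ} (hm : m ≤ p)
    (h : algebraMap (twistKnot p).Dots ((twistKnot p).Res (rowV p true true m))
        ((twistKnot p).coef 0 (rowV p false true m) *
          ((C γ + C δ * if m = 0 then X (lower p 0) else 0) * lead p m) -
          (twistKnot p).coef 1 (rowV p true false m) *
          ((C α + C β * if m = 0 then X (lower p 0) else 0) * lead p m)) =
      algebraMap (twistKnot p).Dots ((twistKnot p).Res (rowV p true true m)) (C t * lead p m)) :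
    t = 0 ∧ γ = α ∧ (m = 0 → α = 0 ∧ δ = β) := by
  have h0 := coef_zero_mul_lead hm
  have h1 := coef_one_mul_lead hm
  have hb := algebraMap_X_sq (D := twistKnot p) (rowV p true true m) (bigon p true)
  simp only [map_sub, map_mul, map_add] at h
  rcases Nat.eq_zero_or_pos m with rfl | hm'
  · have hl := algebraMap_X_sq (D := twistKnot p) (rowV p true true 0) (lower p 0)
    simp only [if_true] at h h1
    have key : ∀ {q : ℚ}, algebraMap (twistKnot p).Dots ((twistKnot p).Res (rowV p true true 0)) (C q) *
        (algebraMap (twistKnot p).Dots _ (X (bigon p true)) * (algebraMap (twistKnot p).Dots _ (X (lower p 0)) *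
          algebraMap (twistKnot p).Dots _ (lead p 0))) = 0 → q = 0 := fun {q} hq => by
      rw [← map_mul, ← map_mul, ← map_mul] at hq
      exact eq_zero_of_C_mul gen_bigon_lower_lead_ne_zero hq
    generalize hB : algebraMap (twistKnot p).Dots ((twistKnot p).Res (rowV p true true 0))
      (X (bigon p true)) = B at *
    generalize hL : algebraMap (twistKnot p).Dots ((twistKnot p).Res (rowV p true true 0))
      (X (lower p 0)) = L at *
    generalize hE : algebraMap (twistKnot p).Dots ((twistKnot p).Res (rowV p true true 0))
      (lead p 0) = E at *
    -- Multiplying the relation by B L, by B and by L in turn isolates t, α and γ as coefficients of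
    -- the nonzero top class B L E.
    have ht : t = 0 := key (by
      linear_combination (-B * L) * h + B * L * (algebraMap (twistKnot p).Dots _ (C γ) +
        algebraMap (twistKnot p).Dots _ (C δ) * L) * h0 - B * L * (algebraMap (twistKnot p).Dots _
        (C α) + algebraMap (twistKnot p).Dots _ (C β) * L) * h1 +
        (L * (algebraMap (twistKnot p).Dots _ (C γ) +
        algebraMap (twistKnot p).Dots _ (C δ) * L) * E - L * (algebraMap (twistKnot p).Dots _
        (C α) + algebraMap (twistKnot p).Dots _ (C β) * L) * E) * hb -
        B * (algebraMap (twistKnot p).Dots _ (C α) +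
          algebraMap (twistKnot p).Dots _ (C β) * L) * E * hl)
    subst ht
    rw [map_zero, map_zero, zero_mul] at h
    have hα : α = 0 := key (by
      linear_combination (-B) * h + B * (algebraMap (twistKnot p).Dots _ (C γ) +
        algebraMap (twistKnot p).Dots _ (C δ) * L) * h0 - B * (algebraMap (twistKnot p).Dots _
        (C α) + algebraMap (twistKnot p).Dots _ (C β) * L) * h1 +
        ((algebraMap (twistKnot p).Dots _ (C γ) +
        algebraMap (twistKnot p).Dots _ (C δ) * L) * E - (algebraMap (twistKnot p).Dots _
        (C α) + algebraMap (twistKnot p).Dots _ (C β) * L) * E) * hb -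
        B * algebraMap (twistKnot p).Dots _ (C β) * E * hl)
    subst hα
    rw [map_zero, map_zero] at h
    have hγ : γ = 0 := key (by
      linear_combination L * h - L * (algebraMap (twistKnot p).Dots _ (C γ) +
        algebraMap (twistKnot p).Dots _ (C δ) * L) * h0 +
        L * algebraMap (twistKnot p).Dots _ (C β) * L * h1 -
        (algebraMap (twistKnot p).Dots _ (C δ) * B - algebraMap (twistKnot p).Dots _ (C β) * B -
          algebraMap (twistKnot p).Dots _ (C β) * L) * E * hl)
    subst hγ
    rw [map_zero, map_zero] at h
    refine ⟨rfl, rfl, fun _ => ⟨rfl, sub_eq_zero.1 (key ?_)⟩⟩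
    rw [map_sub, map_sub]
    linear_combination h - algebraMap (twistKnot p).Dots _ (C δ) * L * h0 +
      algebraMap (twistKnot p).Dots _ (C β) * L * h1 +
      algebraMap (twistKnot p).Dots _ (C β) * E * hl
  · simp only [if_neg hm'.ne', map_zero, mul_zero, add_zero] at h h1
    have key : ∀ {q : ℚ}, algebraMap (twistKnot p).Dots ((twistKnot p).Res (rowV p true true m)) (C q) *
        (algebraMap (twistKnot p).Dots _ (X (bigon p true)) *
          algebraMap (twistKnot p).Dots _ (lead p m)) = 0 → q = 0 := fun {q} hq => by
      rw [← map_mul, ← map_mul] at hq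
      exact eq_zero_of_C_mul (gen_bigon_lead_ne_zero hm' hm) hq
    generalize hB : algebraMap (twistKnot p).Dots ((twistKnot p).Res (rowV p true true m))
      (X (bigon p true)) = B at *
    generalize hE : algebraMap (twistKnot p).Dots ((twistKnot p).Res (rowV p true true m))
      (lead p m) = E at *
    have ht : t = 0 := key (by
      linear_combination (-B) * h + B * algebraMap (twistKnot p).Dots _ (C γ) * h0 -
        B * algebraMap (twistKnot p).Dots _ (C α) * h1 +
        (algebraMap (twistKnot p).Dots _ (C γ) - algebraMap (twistKnot p).Dots _ (C α)) * E * hb)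
    subst ht
    rw [map_zero, map_zero, zero_mul] at h
    refine ⟨rfl, sub_eq_zero.1 (key ?_), fun h => absurd h hm'.ne'⟩
    rw [map_sub, map_sub]
    linear_combination h - algebraMap (twistKnot p).Dots _ (C γ) * h0 +
      algebraMap (twistKnot p).Dots _ (C α) * h1

/-! ### The homology of the rows -/

/-- Chains on the rows that vanish where both clasp crossings are resolved by `1`. -/
theorem exists_eq_tSum_add (x : (twistKnot p).Chain)
    (hx : x ∈ (twistKnot p).multiples (rowGen p)) :
    ∃ (β : ℕ → ℚ) (y z : (twistKnot p).Chain), y ∈ (twistKnot p).multiples (rowGen p) ∧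
      z ∈ (twistKnot p).multiples (rowGen p) ∧ (∀ m ≤ p, z (rowV p true true m) = 0) ∧
      x = tSum p β + (twistKnot p).diff y + z := by
  have key : ∀ m, ∃ (f g : (twistKnot p).Dots) (t : ℚ), m ≤ p → x (rowV p true true m) =
      algebraMap (twistKnot p).Dots ((twistKnot p).Res (rowV p true true m))
        ((twistKnot p).coef 0 (rowV p false true m) * (f * lead p m) -
          (twistKnot p).coef 1 (rowV p true false m) * (g * lead p m) + C t * lead p m) := by
    intro m
    by_cases hm : m ≤ p
    · obtain ⟨h, h1⟩ := exists_apply_rowV hx true true hm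
      obtain ⟨f, g, t, h2⟩ := exists_apply_true_true h hm
      exact ⟨f, g, t, fun _ => h1.trans h2⟩
    · exact ⟨0, 0, 0, fun h => absurd h hm⟩
  choose f g t h using key
  have hy : rowSum p false true f + rowSum p true false g ∈
      (twistKnot p).multiples (rowGen p) := add_mem (rowSum_mem _ _ _) (rowSum_mem _ _ _)
  refine ⟨fun k => (-1) ^ (k - 1) * t k, _, x - tSum p (fun k => (-1) ^ (k - 1) * t k) -
    (twistKnot p).diff (rowSum p false true f + rowSum p true false g), hy,
    sub_mem (sub_mem hx (tSum_mem _)) (diff_mem_rowGen hy), fun m hm => ?_, by abel⟩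
  have h1 : ∀ k, ((-1) ^ (k - 1) * ((-1) ^ (k - 1) * t k) : ℚ) = t k := fun k => by
    rw [← mul_assoc, ← mul_pow]
    simp
  rw [Pi.sub_apply, Pi.sub_apply, h m hm, tSum_eq, Pi.add_apply, Pi.add_apply,
    rowSum_apply _ _ _ hm, rowSum_apply_ne (by simp), rowSum_apply_ne (by simp),
    diff_apply_true_true hy (fun k hk => by
      rw [Pi.add_apply, rowSum_apply_ne (by simp), rowSum_apply_ne (by simp), add_zero])
      (f := f m * lead p m) (g := g m * lead p m)
      (by rw [Pi.add_apply, rowSum_apply _ _ _ hm, rowSum_apply_ne (by simp), add_zero])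
      (by rw [Pi.add_apply, rowSum_apply _ _ _ hm, rowSum_apply_ne (by simp), zero_add]),
    h1, map_add]
  abel

/-- If x vanishes at 11, the 11-part of d x is the clasp image of the mixed parts of x. By
`eq_of_clasp` it contains no rational multiple of a generator, and the mixed parts come from a
common chain at 00, whose boundary is subtracted. -/
theorem rowGen_homology_aux {x : (twistKnot p).Chain}
    (hx : x ∈ (twistKnot p).multiples (rowGen p)) (h0 : ∀ m ≤ p, x (rowV p true true m) = 0)
    {α β : ℕ → ℚ} (hd : (twistKnot p).diff x = sSum p α + tSum p β) :
    (∀ m ≤ p, β m = 0) ∧ ∃ (y z : (twistKnot p).Chain),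
      y ∈ (twistKnot p).multiples (rowGen p) ∧ z ∈ (twistKnot p).multiples (rowGen p) ∧
      (∀ a b, a = true ∨ b = true → ∀ m ≤ p, z (rowV p a b m) = 0) ∧
      x = (twistKnot p).diff y + z := by
  have key : ∀ m, ∃ c : (twistKnot p).Dots, m ≤ p → β m = 0 ∧
      x (rowV p true false m) = algebraMap (twistKnot p).Dots ((twistKnot p).Res (rowV p true false m))
        ((twistKnot p).coef 0 (rowV p false false m) * (c * lead p m)) ∧
      x (rowV p false true m) = algebraMap (twistKnot p).Dots ((twistKnot p).Res (rowV p false true m))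
        ((twistKnot p).coef 1 (rowV p false false m) * (c * lead p m)) := by
    intro m
    by_cases hm : m ≤ p
    swap
    · exact ⟨0, fun h => absurd h hm⟩
    obtain ⟨f, hf⟩ := exists_apply_rowV hx false true hm
    obtain ⟨γ, δ, hf'⟩ := exists_apply_of_ne (a := false) (b := true) (by simp) f hm
    obtain ⟨g, hg⟩ := exists_apply_rowV hx true false hm
    obtain ⟨α', β', hg'⟩ := exists_apply_of_ne (a := true) (b := false) (by simp) g hm
    have h1 := diff_apply_true_true hx h0 (hf.trans hf') (hg.trans hg')
    rw [hd, sSum_eq, tSum_eq, Pi.add_apply, Pi.add_apply, Pi.add_apply,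
      rowSum_apply_ne (by simp), rowSum_apply _ _ _ hm, rowSum_apply_ne (by simp),
      rowSum_apply_ne (by simp), zero_add, add_zero, add_zero] at h1
    obtain ⟨ht, rfl, h2⟩ := eq_of_clasp hm h1.symm
    have e0 := coef_false_mul_lead hm
    have e1 := coef_false_mul_lead' hm
    -- Out of 00 the saddles of the clasp split if m = 0, supplying the dot of the second strand,
    -- and merge if m ≥ 1. Hence the coefficient with that dot in the first case and without it in
    -- the second.
    refine ⟨if m = 0 then C β' else C γ, fun _ => ⟨by simpa using ht, ?_, ?_⟩⟩
    · rw [hg, hg']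
      simp only [map_mul, map_add]
      rcases Nat.eq_zero_or_pos m with rfl | h
      · obtain ⟨rfl, rfl⟩ := h2 rfl
        simp only [if_true, map_zero] at e0 ⊢
        linear_combination (-algebraMap (twistKnot p).Dots _ (C δ)) * e0
      · simp only [if_neg h.ne', map_zero] at e0 ⊢
        linear_combination (-algebraMap (twistKnot p).Dots _ (C γ)) * e0
    · rw [hf, hf']
      simp only [map_mul, map_add]
      rcases Nat.eq_zero_or_pos m with rfl | h
      · obtain ⟨rfl, rfl⟩ := h2 rfl
        simp only [if_true, map_zero] at e1 ⊢
        linear_combination (-algebraMap (twistKnot p).Dots _ (C δ)) * e1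
      · simp only [if_neg h.ne', map_zero] at e1 ⊢
        linear_combination (-algebraMap (twistKnot p).Dots _ (C γ)) * e1
  choose c hc using key
  have hy : rowSum p false false c ∈ (twistKnot p).multiples (rowGen p) := rowSum_mem _ _ _
  have hne : ∀ a b, a = true ∨ b = true → ∀ m, rowSum p false false c (rowV p a b m) = 0 :=
    fun a b h m => rowSum_apply_ne (by rcases h with rfl | rfl <;> simp) _ _
  refine ⟨fun m hm => (hc m hm).1, rowSum p false false c,
    x - (twistKnot p).diff (rowSum p false false c), hy, sub_mem hx (diff_mem_rowGen hy),
    ?_, by abel⟩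
  intro a b hab m hm
  rw [Pi.sub_apply, sub_eq_zero]
  cases a <;> cases b
  · simp at hab
  · rw [(hc m hm).2.2, diff_apply_false_true hy (fun k _ => hne _ _ (by simp) k)
      (rowSum_apply _ _ _ hm)]
  · rw [(hc m hm).2.1, diff_apply_true_false hy (fun k _ => hne _ _ (by simp) k)
      (rowSum_apply _ _ _ hm)]
  · rw [h0 m hm, diff_apply_true_true hy (fun k _ => hne _ _ (by simp) k) (f := 0) (g := 0)
      (by rw [hne _ _ (by simp), map_zero]) (by rw [hne _ _ (by simp), map_zero])]
    simp

theorem exists_apply_false (f : (twistKnot p).Dots) (hm : m ≤ p) :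
    ∃ α β : ℚ, (m = 0 → β = 0) ∧
      algebraMap (twistKnot p).Dots ((twistKnot p).Res (rowV p false false m)) (f * lead p m) =
      algebraMap (twistKnot p).Dots _ ((C α + C β * X (upper p p)) * lead p m) := by
  rcases Nat.eq_zero_or_pos m with rfl | h
  · obtain ⟨α, h2⟩ := exists_gen_lead_zero_false f
    simp only [rat_smul_gen, MvPolynomial.smul_eq_C_mul] at h2
    rw [gen_eq_gen_iff] at h2
    refine ⟨α, 0, fun _ => rfl, ?_⟩
    rw [h2, map_zero, zero_mul, add_zero]
  · obtain ⟨α, β, h2⟩ := exists_gen_lead_false h hm f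
    simp only [rat_smul_gen, ← map_add, MvPolynomial.smul_eq_C_mul] at h2
    rw [gen_eq_gen_iff] at h2
    refine ⟨α, β, fun h' => absurd h' h.ne', ?_⟩
    rw [h2, add_mul, mul_assoc]

theorem diff_sSum (α : ℕ → ℚ) : (twistKnot p).diff (sSum p α) = 0 := by
  rw [sSum, map_sum]
  refine Finset.sum_eq_zero fun k hk => ?_
  rw [Finset.mem_range] at hk
  rw [map_rat_smul, diff_X_smul_sChain (by omega), smul_zero]

theorem diff_tSum (β : ℕ → ℚ) : (twistKnot p).diff (tSum p β) = 0 := by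
  rw [tSum, map_sum]
  refine Finset.sum_eq_zero fun k hk => ?_
  rw [Finset.mem_range] at hk
  rw [map_rat_smul, diff_X_smul_tChain (by omega), smul_zero]

/-- Allowing d x to be a combination of the candidate classes, instead of zero, yields their
independence and the spanning property by a single argument. -/
theorem rowGen_homology {x : (twistKnot p).Chain}
    (hx : x ∈ (twistKnot p).multiples (rowGen p)) {α β : ℕ → ℚ}
    (hd : (twistKnot p).diff x = sSum p α + tSum p β) :
    (∀ m, 1 ≤ m → m ≤ p → α m = 0) ∧ (∀ m ≤ p, β m = 0) ∧
    ∃ (α' β' : ℕ → ℚ) (y : (twistKnot p).Chain), y ∈ (twistKnot p).multiples (rowGen p) ∧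
      x = sSum p α' + tSum p β' + (twistKnot p).diff y := by
  obtain ⟨β', y, x', hy, hx', h0, rfl⟩ := exists_eq_tSum_add x hx
  rw [map_add, map_add, diff_tSum, diff_diff (isOrientable p), zero_add, zero_add] at hd
  obtain ⟨hβ, y', z, hy', hz, hz0, rfl⟩ := rowGen_homology_aux hx' h0 hd
  have ht : tSum p β = 0 := Finset.sum_eq_zero fun k hk => by
    rw [hβ k (Nat.lt_succ_iff.1 (Finset.mem_range.1 hk)), zero_smul]
  rw [map_add, diff_diff (isOrientable p), zero_add, ht, add_zero] at hd
  have key : ∀ m, ∃ α' : ℚ, m ≤ p → z (rowV p false false m) =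
      algebraMap (twistKnot p).Dots ((twistKnot p).Res (rowV p false false m))
        (C (-(-1) ^ (m - 1) * α') * X (upper p p) * lead p m) := by
    intro m
    by_cases hm : m ≤ p
    swap
    · exact ⟨0, fun h => absurd h hm⟩
    obtain ⟨f, hf⟩ := exists_apply_rowV hz false false hm
    obtain ⟨δ, γ, hγ, hf'⟩ := exists_apply_false f hm
    have h1 := diff_apply_true_false hz (hz0 _ _ (by simp)) (hf.trans hf')
    rw [hd, sSum_eq, rowSum_apply_ne (by simp), mul_left_comm, map_mul _ _ (_ * _),
      map_mul _ _ (lead p m), coef_false_mul_lead hm] at h1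
    have hδ : δ = 0 := by
      rcases Nat.eq_zero_or_pos m with rfl | h
      · obtain rfl := hγ rfl
        rw [map_zero, zero_mul, add_zero, if_pos rfl, ← map_mul, ← map_mul] at h1
        exact eq_zero_of_C_mul gen_lower_lead_ne_zero h1.symm
      · have h2 := gen_X_ending_lead (a := true) (b := false) h hm (by simp)
        rw [gen_eq_zero_iff, map_mul] at h2
        refine eq_zero_of_C_mul (gen_lead_ne_zero h hm) ?_
        rw [if_neg h.ne', one_mul, map_add, map_mul] at h1
        rw [map_mul]
        linear_combination -h1 - algebraMap (twistKnot p).Dots ((twistKnot p).Res (rowV p true false m)) (C γ) * h2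
    have h3 : ((-1) ^ (m - 1) * (-1) ^ (m - 1) : ℚ) = 1 := by
      rw [← mul_pow]
      simp
    refine ⟨-(-1) ^ (m - 1) * γ, fun _ => ?_⟩
    rw [hf, hf', hδ, map_zero, zero_add, ← mul_assoc (-(-1) ^ (m - 1)), neg_mul_neg, h3, one_mul]
  choose α' hα' using key
  have hz' : z = sSum p α' := ext_rowV hz (sSum_mem _) fun a b m hm => by
    rw [sSum_eq]
    by_cases hab : a = true ∨ b = true
    · rw [hz0 a b hab m hm, rowSum_apply_ne (by rcases hab with rfl | rfl <;> simp)]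
    · push Not at hab
      obtain ⟨rfl, rfl⟩ : a = false ∧ b = false := by simpa using hab
      rw [hα' m hm, rowSum_apply _ _ _ hm]
  refine ⟨fun m h1 hm => ?_, hβ, α', β', y + y', add_mem hy hy', ?_⟩
  · rw [hz', diff_sSum, sSum_eq] at hd
    have h2 := rowSum_apply false false (fun k => C (-(-1) ^ (k - 1) * α k) * X (upper p p)) hm
    rw [← hd, mul_assoc] at h2
    simpa using eq_zero_of_C_mul (gen_ending_lead_ne_zero h1 hm) h2.symm
  · rw [hz', map_add]
    abel

theorem multiples_rowGen_le : (twistKnot p).multiples (rowGen p) ≤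
    (twistKnot p).reducedChain (upper p 0) := by
  rw [reducedChain_eq]
  refine multiples_le fun v => gen_mem_multiples_of_dvd ?_
  have key : ∀ j, rowGen 0 v ∣ rowGen (p := p) j v := by
    intro j
    induction j with
    | zero => exact dvd_rfl
    | succ j ih => exact ih.trans (rowGen_dvd_succ j v)
  exact key p

/-- The reduced homology. -/
theorem reduced_homology {x : (twistKnot p).Chain}
    (hx : x ∈ (twistKnot p).reducedChain (upper p 0)) {α β : ℕ → ℚ}
    (hd : (twistKnot p).diff x = sSum p α + tSum p β) :
    (∀ m, 1 ≤ m → m ≤ p → α m = 0) ∧ (∀ m ≤ p, β m = 0) ∧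
    ∃ (α' β' : ℕ → ℚ) (y : (twistKnot p).Chain), y ∈ (twistKnot p).reducedChain (upper p 0) ∧
      x = sSum p α' + tSum p β' + (twistKnot p).diff y := by
  obtain ⟨a, ha, b, hb, rfl⟩ := goodPair_rowGen x hx
    (by rw [hd]; exact add_mem (sSum_mem _) (tSum_mem _))
  rw [map_add, diff_diff (isOrientable p), add_zero] at hd
  obtain ⟨h1, h2, α', β', y, hy, rfl⟩ := rowGen_homology ha hd
  refine ⟨h1, h2, α', β', y + b, add_mem (multiples_rowGen_le hy) hb, ?_⟩
  rw [map_add]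
  abel

end KnotDiagram.TwistKnot

/-! ### Bases of the homology and their reindexing -/

section Code

set_option linter.unusedSectionVars false

variable {R M : Type*} [CommRing R] [Algebra ℚ R] [AddCommGroup M] [Module R M] [Module ℚ M]
  [IsScalarTower ℚ R M] {κ τ : Type*} [Fintype τ] [DecidableEq κ]

/-- The classes of `B x`, for `x` in `s`, are a basis of the homology of `W`. -/
structure IsHomologyBasis (d : M →ₗ[R] M) (W : Submodule R M) (s : Finset κ) (B : κ → M) :
    Prop where
  indep : ∀ c : κ → ℚ, ∑ x ∈ s, c x • B x ∈ W.map d → ∀ x ∈ s, c x = 0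
  span : ∀ y ∈ W, d y = 0 → ∃ c : κ → ℚ, y - ∑ x ∈ s, c x • B x ∈ W.map d

variable {d : M →ₗ[R] M} {W : Submodule R M} {s : Finset κ} {B : κ → M}

/-- Strings index the classes by their positions and rescale them, so that e acts without
coefficients. -/
theorem IsHomologyBasis.reindex (h : IsHomologyBasis d W s B) (f : τ → κ)
    (hf : Function.Injective f) (hs : ∀ j, f j ∈ s) (hc : s.card = Fintype.card τ) {u : τ → ℚ}
    (hu : ∀ j, u j ≠ 0) :
    (∀ α : τ → ℚ, ∑ j, α j • u j • B (f j) ∈ W.map d → ∀ j, α j = 0) ∧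
    ∀ y ∈ W, d y = 0 → ∃ α : τ → ℚ, y - ∑ j, α j • u j • B (f j) ∈ W.map d := by
  classical
  have himg : Finset.univ.image f = s := by
    refine Finset.eq_of_subset_of_card_le (fun x hx => ?_) ?_
    · obtain ⟨j, -, rfl⟩ := Finset.mem_image.1 hx
      exact hs j
    · rw [hc, Finset.card_image_of_injective _ hf, Finset.card_univ]
  have hsum : ∀ c : κ → ℚ, ∑ x ∈ s, c x • B x = ∑ j, c (f j) • B (f j) := fun c => by
    rw [← himg, Finset.sum_image hf.injOn]
  constructor
  · intro α hα j
    have h1 := h.indep (Function.extend f (fun j => α j * u j) 0) (by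
      have e : ∑ j, Function.extend f (fun j => α j * u j) 0 (f j) • B (f j) =
          ∑ j, α j • u j • B (f j) :=
        Finset.sum_congr rfl fun j _ => by rw [hf.extend_apply, smul_smul]
      rw [hsum, e]
      exact hα) (f j) (hs j)
    rw [hf.extend_apply] at h1
    exact (mul_eq_zero.1 h1).resolve_right (hu j)
  · intro y hy hd
    obtain ⟨c, h1⟩ := h.span y hy hd
    refine ⟨fun j => c (f j) * (u j)⁻¹, ?_⟩
    have e : ∑ j, (c (f j) * (u j)⁻¹) • u j • B (f j) = ∑ j, c (f j) • B (f j) :=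
      Finset.sum_congr rfl fun j _ => by rw [smul_smul, inv_mul_cancel_right₀ (hu j)]
    rw [e, ← hsum]
    exact h1

end Code

namespace KnotDiagram.TwistKnot

open MvPolynomial (X C)

variable {p : ℕ} {m : ℕ}

/-! ### The unreduced homology -/

theorem diff_sChain_eq (hm : m < p) : (twistKnot p).diff (sChain p (m + 1)) =
    (1 - (-1) ^ m : ℚ) • (X (upper p 0) : (twistKnot p).Dots) • sChain p m := by
  rcases Nat.eq_zero_or_pos m with rfl | h
  · rw [diff_sChain_one hm, sChain_zero]
    simp
  · exact diff_sChain_succ h hm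

/-- The coefficient of the differential of `tChain`. -/
def tCoef (m : ℕ) : ℚ := if m = 0 then 2 else -1 - (-1) ^ m

theorem tCoef_of_odd (h : Odd m) : tCoef m = 0 := by
  rw [tCoef, if_neg (by rintro rfl; simp at h), h.neg_one_pow]
  norm_num

theorem tCoef_of_even (h : Even m) : tCoef m ≠ 0 := by
  rw [tCoef, h.neg_one_pow]
  split_ifs <;> norm_num

theorem diff_tChain_eq (hm : m < p) : (twistKnot p).diff (tChain p (m + 1)) =
    tCoef m • (X (upper p 0) : (twistKnot p).Dots) • tChain p m := by
  rcases Nat.eq_zero_or_pos m with rfl | h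
  · rw [diff_tChain_one hm, tCoef, if_pos rfl]
  · rw [diff_tChain_succ h hm, tCoef, if_neg h.ne']

def sLift (p : ℕ) (α : ℕ → ℚ) : (twistKnot p).Chain :=
  ∑ k ∈ Finset.range (p + 1), α k • sChain p k

def tLift (p : ℕ) (α : ℕ → ℚ) : (twistKnot p).Chain :=
  ∑ k ∈ Finset.range (p + 1), α k • tChain p k

theorem X_smul_sLift (α : ℕ → ℚ) :
    (X (upper p 0) : (twistKnot p).Dots) • sLift p α = sSum p α := by
  rw [sLift, sSum, Finset.smul_sum]
  exact Finset.sum_congr rfl fun k _ => smul_comm _ _ _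

theorem X_smul_tLift (α : ℕ → ℚ) :
    (X (upper p 0) : (twistKnot p).Dots) • tLift p α = tSum p α := by
  rw [tLift, tSum, Finset.smul_sum]
  exact Finset.sum_congr rfl fun k _ => smul_comm _ _ _

theorem X_smul_sSum (α : ℕ → ℚ) : (X (upper p 0) : (twistKnot p).Dots) • sSum p α = 0 := by
  rw [← X_smul_sLift, X_smul_X_smul]

theorem X_smul_tSum (α : ℕ → ℚ) : (X (upper p 0) : (twistKnot p).Dots) • tSum p α = 0 := by
  rw [← X_smul_tLift, X_smul_X_smul]

/-- The connecting map of 0 → Im X → C → Im X → 0 on the basis; nothing hits the index p. -/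
theorem diff_sLift (α : ℕ → ℚ) : (twistKnot p).diff (sLift p α) =
    sSum p fun k => if k < p then α (k + 1) * (1 - (-1) ^ k) else 0 := by
  rw [sLift, sSum, map_sum, Finset.sum_range_succ', Finset.sum_range_succ, if_neg (lt_irrefl p),
    zero_smul, sChain_zero, smul_zero, map_zero]
  congr 1
  refine Finset.sum_congr rfl fun k hk => ?_
  rw [Finset.mem_range] at hk
  rw [map_rat_smul, diff_sChain_eq hk, if_pos hk, smul_smul]

theorem diff_tLift (α : ℕ → ℚ) : (twistKnot p).diff (tLift p α) =
    tSum p fun k => if k < p then α (k + 1) * tCoef k else 0 := by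
  rw [tLift, tSum, map_sum, Finset.sum_range_succ', Finset.sum_range_succ, if_neg (lt_irrefl p),
    zero_smul, map_rat_smul, diff_tChain_zero, smul_zero]
  congr 1
  refine Finset.sum_congr rfl fun k hk => ?_
  rw [Finset.mem_range] at hk
  rw [map_rat_smul, diff_tChain_eq hk, if_pos hk, smul_smul]

theorem sSum_sub (α β : ℕ → ℚ) : sSum p (fun k => α k - β k) = sSum p α - sSum p β := by
  simp only [sSum, sub_smul, Finset.sum_sub_distrib]

theorem tSum_sub (α β : ℕ → ℚ) : tSum p (fun k => α k - β k) = tSum p α - tSum p β := by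
  simp only [tSum, sub_smul, Finset.sum_sub_distrib]

theorem sSum_zero : sSum p (fun _ => 0) = 0 := by simp [sSum]

theorem tSum_zero : tSum p (fun _ => 0) = 0 := by simp [tSum]

/-- The long exact sequence in explicit form. The chain X x is a reduced cycle, so x agrees up to a
boundary with a combination of the s_m and t_m modulo the kernel of X. The remainder is X v, and the
reduced computation applies to it once more. -/
theorem unreduced_homology {x : (twistKnot p).Chain} {α β : ℕ → ℚ}
    (hd : (twistKnot p).diff x = sSum p α + tSum p β) : ∃ (γ δ α' β' : ℕ → ℚ)
      (y : (twistKnot p).Chain),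
      (∀ m, 1 ≤ m → m ≤ p → α m = if m < p then γ (m + 1) * (1 - (-1) ^ m) else 0) ∧
      (∀ m ≤ p, β m = if m < p then δ (m + 1) * tCoef m else 0) ∧
      x = sLift p γ + tLift p δ + (sSum p α' + tSum p β') + (twistKnot p).diff y := by
  have hX : ∀ y : (twistKnot p).Chain,
      (X (upper p 0) : (twistKnot p).Dots) • y ∈ (twistKnot p).reducedChain (upper p 0) :=
    fun y => ⟨y, rfl⟩
  have h0 : (twistKnot p).diff ((X (upper p 0) : (twistKnot p).Dots) • x) =
      sSum p (fun _ => 0) + tSum p (fun _ => 0) := by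
    rw [map_smul, hd, smul_add, X_smul_sSum, X_smul_tSum, sSum_zero, tSum_zero]
  obtain ⟨-, -, γ, δ, _, ⟨w, rfl⟩, hw⟩ := reduced_homology (hX x) h0
  rw [LinearMap.lsmul_apply, map_smul, ← X_smul_sLift, ← X_smul_tLift, ← smul_add, ← smul_add,
    ← sub_eq_zero, ← smul_sub] at hw
  obtain ⟨v, hv⟩ := exists_eq_X_smul hw
  have h1 : (twistKnot p).diff ((X (upper p 0) : (twistKnot p).Dots) • v) =
      sSum p (fun k => α k - if k < p then γ (k + 1) * (1 - (-1) ^ k) else 0) +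
      tSum p (fun k => β k - if k < p then δ (k + 1) * tCoef k else 0) := by
    rw [← hv, map_sub, map_add, map_add, hd, diff_diff (isOrientable p), diff_sLift, diff_tLift,
      sSum_sub, tSum_sub]
    abel
  obtain ⟨h2, h3, α', β', y, -, h4⟩ := reduced_homology (hX v) h1
  refine ⟨γ, δ, α', β', w + y, fun m h h' => sub_eq_zero.1 (h2 m h h'),
    fun m h => sub_eq_zero.1 (h3 m h), ?_⟩
  rw [sub_eq_iff_eq_add.1 hv, h4, map_add]
  abel

/-! ### Bases of the homology -/

/-- The cycles of the reduced complex. -/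
def reducedBasis (p : ℕ) (x : Bool × ℕ) : (twistKnot p).Chain :=
  (X (upper p 0) : (twistKnot p).Dots) • if x.1 then tChain p x.2 else sChain p x.2

theorem sum_bool_range {M : Type*} [AddCommMonoid M] (F : Bool × ℕ → M) (N : ℕ) :
    ∑ x ∈ Finset.univ ×ˢ Finset.range N, F x =
      (∑ k ∈ Finset.range N, F (false, k)) + ∑ k ∈ Finset.range N, F (true, k) := by
  rw [Finset.sum_product, Fintype.sum_bool, add_comm]

theorem sum_reducedBasis (c : Bool × ℕ → ℚ) :
    ∑ x ∈ (Finset.univ ×ˢ Finset.range (p + 1)).erase (false, 0), c x • reducedBasis p x =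
      sSum p (fun k => c (false, k)) + tSum p (fun k => c (true, k)) := by
  rw [Finset.sum_erase, sum_bool_range]
  · rfl
  · simp [reducedBasis, sChain_zero]

theorem isHomologyBasis_reduced : IsHomologyBasis (twistKnot p).diff
    ((twistKnot p).reducedChain (upper p 0))
    ((Finset.univ ×ˢ Finset.range (p + 1)).erase (false, 0)) (reducedBasis p) where
  indep c := by
    rintro ⟨y, hy, h⟩ ⟨b, m⟩ hm
    rw [sum_reducedBasis] at h
    obtain ⟨h1, h2, -⟩ := reduced_homology hy h
    rw [Finset.mem_erase, Finset.mem_product, Finset.mem_range] at hm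
    cases b
    · refine h1 m (Nat.pos_of_ne_zero fun h => hm.1 (by rw [h])) (by omega)
    · exact h2 m (by omega)
  span y hy hd := by
    obtain ⟨-, -, α, β, z, hz, h⟩ := reduced_homology (α := fun _ => 0) (β := fun _ => 0) hy
      (by rw [hd, sSum_zero, tSum_zero, add_zero])
    refine ⟨fun x => if x.1 then β x.2 else α x.2, z, hz, ?_⟩
    rw [sum_reducedBasis]
    simp only [if_true, Bool.false_eq_true, if_false]
    rw [h]
    abel

/-- The cycles of the unreduced complex. The pair `(true, 0)` stands for the last of the cycles
with a dot. -/
def unreducedBasis (p : ℕ) (x : Bool × ℕ) : (twistKnot p).Chain :=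
  if x.1 then
    if x.2 = 0 then (X (upper p 0) : (twistKnot p).Dots) • if Even p then tChain p p else sChain p p
    else (X (upper p 0) : (twistKnot p).Dots) • if Even x.2 then sChain p x.2 else tChain p x.2
  else if Even x.2 then tChain p x.2 else sChain p x.2

/-- Bookkeeping by parity; the coefficient of the exceptional pair `(true, 0)` is added at index p,
to the family whose parity does not cover p. -/
theorem sum_unreducedBasis (c : Bool × ℕ → ℚ) :
    ∑ x ∈ Finset.univ ×ˢ Finset.range (p + 1), c x • unreducedBasis p x =
      sLift p (fun k => if Even k then 0 else c (false, k)) +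
      tLift p (fun k => if Even k then c (false, k) else 0) +
      (sSum p (fun k => (if Even k then c (true, k) else 0) +
        if k = p ∧ ¬ Even p then c (true, 0) else 0) +
      tSum p (fun k => (if Even k then 0 else c (true, k)) +
        if k = p ∧ Even p then c (true, 0) else 0)) := by
  have h1 : ∀ (P : Prop) [Decidable P] (q : ℚ), sSum p (fun k => if k = p ∧ P then q else 0) =
      if P then q • (X (upper p 0) : (twistKnot p).Dots) • sChain p p else 0 := by
    intro P _ q
    rw [sSum, Finset.sum_range_succ, Finset.sum_eq_zero, zero_add]
    · by_cases hP : P <;> simp [hP]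
    · intro k hk
      rw [Finset.mem_range] at hk
      rw [if_neg (by omega), zero_smul]
  have h2 : ∀ (P : Prop) [Decidable P] (q : ℚ), tSum p (fun k => if k = p ∧ P then q else 0) =
      if P then q • (X (upper p 0) : (twistKnot p).Dots) • tChain p p else 0 := by
    intro P _ q
    rw [tSum, Finset.sum_range_succ, Finset.sum_eq_zero, zero_add]
    · by_cases hP : P <;> simp [hP]
    · intro k hk
      rw [Finset.mem_range] at hk
      rw [if_neg (by omega), zero_smul]
  have h3 : ∀ k, c (true, k) • unreducedBasis p (true, k) =
      (if k = 0 then c (true, 0) • unreducedBasis p (true, 0) else 0) +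
      ((if Even k then c (true, k) else 0) • (X (upper p 0) : (twistKnot p).Dots) • sChain p k +
      (if Even k then 0 else c (true, k)) • (X (upper p 0) : (twistKnot p).Dots) •
        tChain p k) := by
    intro k
    by_cases hk : k = 0
    · subst hk
      simp [sChain_zero]
    · by_cases he : Even k <;> simp [unreducedBasis, hk, he]
  have h4 : ∀ k, c (false, k) • unreducedBasis p (false, k) =
      (if Even k then 0 else c (false, k)) • sChain p k +
      (if Even k then c (false, k) else 0) • tChain p k := by
    intro k
    by_cases he : Even k <;> simp [unreducedBasis, he]
  have h5 : c (true, 0) • unreducedBasis p (true, 0) =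
      (if ¬ Even p then c (true, 0) • (X (upper p 0) : (twistKnot p).Dots) • sChain p p else 0) +
      if Even p then c (true, 0) • (X (upper p 0) : (twistKnot p).Dots) • tChain p p else 0 := by
    by_cases he : Even p <;> simp [unreducedBasis, he]
  have h6 := h1 (¬ Even p) (c (true, 0))
  have h7 := h2 (Even p) (c (true, 0))
  rw [sum_bool_range, Finset.sum_congr rfl fun k _ => h3 k, Finset.sum_congr rfl fun k _ => h4 k,
    Finset.sum_add_distrib, Finset.sum_add_distrib, Finset.sum_add_distrib, Finset.sum_ite_eq',
    if_pos (by simp), h5, ← h6, ← h7]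
  simp only [sSum, tSum, sLift, tLift, add_smul, Finset.sum_add_distrib]
  abel

theorem sSum_congr {α β : ℕ → ℚ} (h : ∀ k, 1 ≤ k → k ≤ p → α k = β k) :
    sSum p α = sSum p β := by
  refine Finset.sum_congr rfl fun k hk => ?_
  rw [Finset.mem_range] at hk
  rcases Nat.eq_zero_or_pos k with rfl | h1
  · simp [sChain_zero]
  · rw [h k h1 (by omega)]

theorem sLift_congr {α β : ℕ → ℚ} (h : ∀ k, 1 ≤ k → k ≤ p → α k = β k) :
    sLift p α = sLift p β := by
  refine Finset.sum_congr rfl fun k hk => ?_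
  rw [Finset.mem_range] at hk
  rcases Nat.eq_zero_or_pos k with rfl | h1
  · simp [sChain_zero]
  · rw [h k h1 (by omega)]

theorem tSum_congr {α β : ℕ → ℚ} (h : ∀ k ≤ p, α k = β k) : tSum p α = tSum p β :=
  Finset.sum_congr rfl fun k hk => by rw [h k (Nat.lt_succ_iff.1 (Finset.mem_range.1 hk))]

theorem tLift_congr {α β : ℕ → ℚ} (h : ∀ k ≤ p, α k = β k) : tLift p α = tLift p β :=
  Finset.sum_congr rfl fun k hk => by rw [h k (Nat.lt_succ_iff.1 (Finset.mem_range.1 hk))]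

/-- The kernel of the connecting map lifts to s_m for odd m and t_m for even m. Its cokernel
consists of X s_m for even m ≥ 2, X t_m for odd m, and the class at index p that no s_{p+1} or
t_{p+1} can kill. -/
theorem isHomologyBasis_unreduced : IsHomologyBasis (twistKnot p).diff ⊤
    (Finset.univ ×ˢ Finset.range (p + 1)) (unreducedBasis p) where
  indep c := by
    rintro ⟨y, -, h⟩
    rw [sum_unreducedBasis] at h
    -- The dot kills the dotted classes and leaves a relation among the lifted ones in the reduced
    -- homology.
    have h0 := congrArg (fun z => (X (upper p 0) : (twistKnot p).Dots) • z) h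
    rw [← map_smul, smul_add, smul_add, X_smul_sLift, X_smul_tLift, smul_add, X_smul_sSum,
      X_smul_tSum, add_zero, add_zero] at h0
    obtain ⟨h1, h2, -⟩ := reduced_homology ⟨y, rfl⟩ h0
    have hs : sLift p (fun k => if Even k then 0 else c (false, k)) = 0 := by
      rw [sLift_congr (β := fun _ => 0) h1]
      simp [sLift]
    have ht : tLift p (fun k => if Even k then c (false, k) else 0) = 0 := by
      rw [tLift_congr (β := fun _ => 0) h2]
      simp [tLift]
    rw [hs, ht, zero_add, zero_add] at h
    obtain ⟨γ, δ, -, -, -, h3, h4, -⟩ := unreduced_homology h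
    rintro ⟨b, m⟩ hm
    rw [Finset.mem_product, Finset.mem_range] at hm
    have hmp : m ≤ p := Nat.lt_succ_iff.1 hm.2
    cases b
    · by_cases he : Even m
      · simpa [he] using h2 m hmp
      · have hm1 : 1 ≤ m := Nat.pos_of_ne_zero (by rintro rfl; simp at he)
        simpa [he] using h1 m hm1 hmp
    · rcases Nat.eq_zero_or_pos m with rfl | hm1
      · by_cases he : Even p
        · have h5 := h4 p le_rfl
          rw [if_neg (lt_irrefl p)] at h5
          simpa [he] using h5
        · have h5 := h3 p (Nat.pos_of_ne_zero (by rintro rfl; simp at he)) le_rfl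
          rw [if_neg (lt_irrefl p)] at h5
          simpa [he] using h5
      · by_cases he : Even m
        · have h5 := h3 m hm1 hmp
          rw [he.neg_one_pow] at h5
          have h6 : ¬ (m = p ∧ ¬ Even p) := by rintro ⟨rfl, h⟩; exact h he
          simp only [if_pos he, if_neg h6] at h5
          simpa using h5
        · have h5 := h4 m hmp
          rw [tCoef_of_odd (Nat.not_even_iff_odd.1 he)] at h5
          have h6 : ¬ (m = p ∧ Even p) := by rintro ⟨rfl, h⟩; exact he h
          simpa [he, h6] using h5
  span y _ hd := by
    obtain ⟨γ, δ, α, β, z, h1, h2, h⟩ := unreduced_homology (x := y) (α := fun _ => 0)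
      (β := fun _ => 0) (by rw [hd, sSum_zero, tSum_zero, add_zero])
    let c : Bool × ℕ → ℚ := fun x =>
      if x.1 then
        if x.2 = 0 then if Even p then β p else α p else if Even x.2 then α x.2 else β x.2
      else if Even x.2 then δ x.2 else γ x.2
    have hγ : sLift p γ = sLift p (fun k => if Even k then 0 else c (false, k)) := by
      refine sLift_congr fun k hk hkp => ?_
      split_ifs with he
      · have hk2 : k - 1 + 1 = k := by omega
        have ho : Odd (k - 1) := by
          by_contra ho
          rw [Nat.not_odd_iff_even] at ho
          exact Nat.not_even_iff_odd.2 ho.add_one (by rwa [hk2])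
        have hk3 : 1 ≤ k - 1 := Nat.pos_of_ne_zero fun h => by rw [h] at ho; simp at ho
        have h3 := h1 (k - 1) hk3 (by omega)
        rw [if_pos (by omega), hk2, ho.neg_one_pow] at h3
        linarith
      · simp [c, he]
    have hδ : tLift p δ = tLift p (fun k => if Even k then c (false, k) else 0) := by
      refine tLift_congr fun k hkp => ?_
      split_ifs with he
      · simp [c, he]
      · have hk : 1 ≤ k := Nat.pos_of_ne_zero (by rintro rfl; simp at he)
        have hk2 : k - 1 + 1 = k := by omega
        have ho : Even (k - 1) := by
          by_contra ho
          rw [Nat.not_even_iff_odd] at ho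
          exact he (by rw [← hk2]; exact ho.add_one)
        have h3 := h2 (k - 1) (by omega)
        rw [if_pos (by omega), hk2] at h3
        exact (mul_eq_zero.1 h3.symm).resolve_right (tCoef_of_even ho)
    -- For odd k < p the class X s_k is half the boundary of s_{k+1}. For even k the connecting
    -- coefficient is zero, so the value chosen there is immaterial.
    have hα : sSum p α - sSum p (fun k => (if Even k then c (true, k) else 0) +
        if k = p ∧ ¬ Even p then c (true, 0) else 0) =
        (twistKnot p).diff (sLift p fun k => α (k - 1) / 2) := by
      rw [diff_sLift, ← sSum_sub]
      refine sSum_congr fun k hk hkp => ?_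
      have hk0 : k ≠ 0 := by omega
      rcases Nat.eq_or_lt_of_le hkp with rfl | hlt
      · by_cases he : Even k <;> simp [c, hk0, he]
      · by_cases he : Even k
        · simp [c, hk0, he, hlt.ne]
        · simp [c, he, hlt, hlt.ne, (Nat.not_even_iff_odd.1 he).neg_one_pow]
          ring
    have hβ : tSum p β - tSum p (fun k => (if Even k then 0 else c (true, k)) +
        if k = p ∧ Even p then c (true, 0) else 0) =
        (twistKnot p).diff (tLift p fun k => β (k - 1) / tCoef (k - 1)) := by
      rw [diff_tLift, ← tSum_sub]
      refine tSum_congr fun k hkp => ?_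
      rcases Nat.eq_or_lt_of_le hkp with rfl | hlt
      · by_cases he : Even k
        · simp [c, he]
        · have hk0 : k ≠ 0 := by rintro rfl; simp at he
          simp [c, hk0, he]
      · by_cases he : Even k
        · simp [he, hlt, hlt.ne, div_mul_cancel₀ _ (tCoef_of_even he)]
        · have hk0 : k ≠ 0 := by rintro rfl; simp at he
          simp [c, hk0, he, hlt.ne, tCoef_of_odd (Nat.not_even_iff_odd.1 he)]
    refine ⟨c, _, trivial, (?_ : (twistKnot p).diff (z + (sLift p fun k => α (k - 1) / 2) +
      tLift p fun k => β (k - 1) / tCoef (k - 1)) = _)⟩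
    rw [map_add, map_add, ← hα, ← hβ, sum_unreducedBasis, h, hγ, hδ]
    abel

end KnotDiagram.TwistKnot

/-! ### Pairing sums along a clasp and a row traversed twice -/

section PairSum

variable {A : Type*} [Ring A]

theorem pairSum_add (u : ℕ → A) (m k : ℕ) : pairSum u (m + k) = pairSum u m +
    (∑ i ∈ Finset.range m, u i) * (∑ i ∈ Finset.range k, u (m + i)) +
      pairSum (fun i => u (m + i)) k := by
  induction k with
  | zero => simp [pairSum]
  | succ k ih =>
    rw [← add_assoc, pairSum_succ, ih, pairSum_succ, Finset.sum_range_succ, Finset.sum_range_add]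
    noncomm_ring

/-- Reversal exchanges the two factors of each pair, which costs one sign. -/
theorem pairSum_reflect {u : ℕ → A} {m : ℕ} (h : ∀ i j, u i * u j = -(u j * u i)) :
    pairSum (fun i => u (m - 1 - i)) m = -pairSum u m := by
  rw [pairSum_eq_sum_ite, pairSum_eq_sum_ite, ← Finset.sum_range_reflect, Finset.sum_comm (f :=
    fun i j => if i < j then u i * u j else 0), ← Finset.sum_neg_distrib]
  refine Finset.sum_congr rfl fun i hi => ?_
  rw [← Finset.sum_range_reflect, ← Finset.sum_neg_distrib]
  refine Finset.sum_congr rfl fun j hj => ?_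
  rw [Finset.mem_range] at hi hj
  rw [show m - 1 - (m - 1 - i) = i by omega, show m - 1 - (m - 1 - j) = j by omega]
  by_cases hij : j < i
  · rw [if_pos hij, if_pos (by omega), h]
  · rw [if_neg hij, if_neg (by omega), neg_zero]

theorem pairSum_congr_of_lt {u w : ℕ → A} {m : ℕ} (h : ∀ i < m, u i = w i) :
    pairSum u m = pairSum w m := by
  refine Finset.sum_congr rfl fun j hj => ?_
  rw [Finset.mem_range] at hj
  rw [h j hj, Finset.sum_congr rfl fun i hi => h i ((Finset.mem_range.1 hi).trans hj)]

theorem pairSum_two (u : ℕ → A) : pairSum u 2 = u 0 * u 1 := by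
  simp [pairSum, Finset.sum_range_succ]

/-- The pairing sum of a sequence of anticommuting elements that runs through a clasp `a, b`, a row
`T`, the clasp again, and the row in the reverse direction. -/
theorem pairSum_twist [Module ℚ A] {a b : A} {T u : ℕ → A} {p : ℕ}
    (hT : ∀ i j, T i * T j = -(T j * T i)) (hTa : ∀ i, T i * a = -(a * T i))
    (hTb : ∀ i, T i * b = -(b * T i)) (hab : a * b = -(b * a)) (ha : a * a = 0) (hb : b * b = 0)
    (u0 : u 0 = b) (u1 : u 1 = -a) (uT : ∀ i < p, u (2 + i) = T i)
    (uT' : ∀ i < p, u (2 + p + (2 + i)) = -T (p - 1 - i)) :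
    (u (2 + p) = a → u (2 + p + 1) = -b → pairSum u (2 * (p + 2)) =
      (2 : ℤ) • (b * (∑ i ∈ Finset.range p, T i) - a * ∑ i ∈ Finset.range p, T i)) ∧
    (u (2 + p) = -b → u (2 + p + 1) = a → pairSum u (2 * (p + 2)) =
      (2 : ℤ) • (b * (∑ i ∈ Finset.range p, T i) - a * ∑ i ∈ Finset.range p, T i) -
        (2 : ℤ) • (b * a)) := by
  set S := ∑ i ∈ Finset.range p, T i with hS
  have hSa : S * a = -(a * S) := by
    rw [hS, Finset.sum_mul, Finset.mul_sum, ← Finset.sum_neg_distrib]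
    exact Finset.sum_congr rfl fun i _ => hTa i
  have hSb : S * b = -(b * S) := by
    rw [hS, Finset.sum_mul, Finset.mul_sum, ← Finset.sum_neg_distrib]
    exact Finset.sum_congr rfl fun i _ => hTb i
  have hSS : S * S = 0 := by
    have h1 : S * S = -(S * S) := by
      conv_lhs => rw [hS, Finset.sum_mul_sum, Finset.sum_comm]
      rw [hS, Finset.sum_mul_sum, ← Finset.sum_neg_distrib]
      refine Finset.sum_congr rfl fun i _ => ?_
      rw [← Finset.sum_neg_distrib]
      exact Finset.sum_congr rfl fun j _ => hT _ _
    have h2 : (2 : ℚ) • (S * S) = 0 := by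
      rw [two_smul]
      nth_rewrite 1 [h1]
      exact neg_add_cancel _
    exact (smul_eq_zero.1 h2).resolve_left two_ne_zero
  have hs : ∑ i ∈ Finset.range p, u (2 + i) = S :=
    Finset.sum_congr rfl fun i hi => uT i (Finset.mem_range.1 hi)
  have hs' : ∑ i ∈ Finset.range p, u (2 + p + (2 + i)) = -S := by
    rw [Finset.sum_congr rfl fun i hi => uT' i (Finset.mem_range.1 hi), Finset.sum_neg_distrib,
      Finset.sum_range_reflect]
  have hq : pairSum (fun i => u (2 + i)) p = pairSum T p := pairSum_congr_of_lt uT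
  have hq' : pairSum (fun i => u (2 + p + (2 + i))) p = -pairSum T p := by
    rw [pairSum_congr_of_lt uT', ← pairSum_reflect hT]
    exact pairSum_congr fun i j => neg_mul_neg _ _
  -- The pairs inside the two runs through the row cancel, since the runs have opposite directions.
  have hu : pairSum u (2 * (p + 2)) = u 0 * u 1 + (u 0 + u 1) * S +
      (u 0 + u 1 + S) * (u (2 + p) + u (2 + p + 1) - S) +
      (u (2 + p) * u (2 + p + 1) - (u (2 + p) + u (2 + p + 1)) * S) := by
    rw [show 2 * (p + 2) = 2 + p + (2 + p) by ring, pairSum_add, pairSum_add u 2 p,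
      pairSum_add (fun i => u (2 + p + i)) 2 p, Finset.sum_range_add, Finset.sum_range_add, hs, hs',
      hq, hq', pairSum_two, pairSum_two]
    simp only [Finset.sum_range_succ, Finset.sum_range_zero, zero_add, add_zero]
    noncomm_ring
  refine ⟨fun v0 v1 => ?_, fun v0 v1 => ?_⟩ <;>
  · rw [hu, u0, u1, v0, v1]
    simp only [sub_eq_add_neg, mul_add, add_mul, mul_neg, neg_mul, ha, hb, hSS, hab, hSa, hSb,
      neg_neg, neg_add]
    abel

end PairSum

namespace KnotDiagram.TwistKnot

open MvPolynomial (X C)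

variable {p : ℕ} {m : ℕ}

/-! ### The operator `e` of a twist knot -/

theorem passage_of_incoming {x : Fin (p + 2) × Bool} {j : ℕ}
    (h : (twistKnot p).incoming x = (j : ZMod (2 * (p + 2)))) :
    (twistKnot p).passage (j : ZMod (2 * (p + 2))) = x := by
  rw [← h, passage_incoming]

theorem incoming_twistKnot (c : Fin (p + 2)) (s : Bool) : (twistKnot p).incoming (c, s) =
    ((match (c : ℕ), s with
      | 0, false => 1
      | 0, true => if Even p then p + 2 else p + 3
      | 1, false => if Even p then p + 3 else p + 2
      | 1, true => 0
      | i + 2, s => if (Even i ↔ s = true) then i + 2 else 2 * p + 3 - i : ℕ) :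
        ZMod (2 * (p + 2))) := by
  have h : (twistKnot p).incoming (c, s) = ((twistCode p c
      (if s then (if twistPos p c then 3 else 1) else 0) : ℕ) : ZMod (2 * (p + 2))) := by
    cases s
    · rw [incoming_false, edge_eq]
      simp
    · rw [incoming_true, edge_eq]
      rfl
  rw [h, twistCode_incoming p c s c.2]
  rcases c with ⟨_ | _ | i, hc⟩ <;> cases s <;> rfl

theorem passage_zero : ((twistKnot p).passage ((0 : ℕ) : ZMod (2 * (p + 2)))).1 = 1 := by
  rw [passage_of_incoming (x := (1, true)) (by rw [incoming_twistKnot]; simp)]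

theorem passage_one : ((twistKnot p).passage ((1 : ℕ) : ZMod (2 * (p + 2)))).1 = 0 := by
  rw [passage_of_incoming (x := (0, false)) (by rw [incoming_twistKnot]; simp)]

theorem passage_left {i : ℕ} (hi : i < p) :
    ((twistKnot p).passage ((2 + i : ℕ) : ZMod (2 * (p + 2)))).1 = tw p i := by
  rw [passage_of_incoming (x := (tw p i, decide (Even i)))
    (by rw [incoming_twistKnot, tw_val hi]; simp [add_comm])]

theorem passage_right {i : ℕ} (hi : i < p) :
    ((twistKnot p).passage ((2 * p + 3 - i : ℕ) : ZMod (2 * (p + 2)))).1 = tw p i := by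
  rw [passage_of_incoming (x := (tw p i, !decide (Even i)))
    (by rw [incoming_twistKnot, tw_val hi]; by_cases h : Even i <;> simp [h])]

theorem passage_ending (b : Bool) :
    ((twistKnot p).passage ((p + 2 + (if b then 1 else 0) : ℕ) : ZMod (2 * (p + 2)))).1 =
      if (Even p ↔ b = false) then 0 else 1 := by
  by_cases h : Even p <;> cases b
  · rw [passage_of_incoming (x := (0, true)) (by rw [incoming_twistKnot]; simp [h])]
    simp [h]
  · rw [passage_of_incoming (x := (1, false)) (by rw [incoming_twistKnot]; simp [h, add_assoc])]
    simp [h]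
  · rw [passage_of_incoming (x := (1, false)) (by rw [incoming_twistKnot]; simp [h])]
    simp [h]
  · rw [passage_of_incoming (x := (0, true)) (by rw [incoming_twistKnot]; simp [h, add_assoc])]
    simp [h]

/-- The dot-sliding homotopy of a twist crossing, with the sign of the first passage. -/
def twistSlide (p i : ℕ) : Module.End (twistKnot p).Dots (twistKnot p).Chain :=
  (-1 : ℤ) ^ i • (twistKnot p).dotSlide (tw p i)

/-- The signed sum of the dot-sliding homotopies of the twist crossings. -/
def twistSlideSum (p : ℕ) : Module.End (twistKnot p).Dots (twistKnot p).Chain :=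
  ∑ i ∈ Finset.range p, twistSlide p i

/-- From edge 0 the knot passes crossings 1 and 0, the row, the clasp again (0, 1 for even p and 1,
0 for odd p), and the row backwards. Second passages carry the opposite sign, so `pairSum_twist`
applies with a = χ_0 and b = χ_1. -/
theorem eChain_twistKnot {θ : ZMod (2 * (p + 2)) → Bool} (hθ : (twistKnot p).IsAdmissible θ)
    (b : ZMod (2 * (p + 2))) (x : (twistKnot p).Chain) : (twistKnot p).eChain θ b x =
      (2 : ℤ) • ((twistKnot p).dotSlide 1 (twistSlideSum p x) -
        (twistKnot p).dotSlide 0 (twistSlideSum p x)) -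
      if Even p then 0 else (2 : ℤ) • (twistKnot p).dotSlide 1 ((twistKnot p).dotSlide 0 x) := by
  have hu := hθ.eChain_eq b
  set u : ℕ → Module.End (twistKnot p).Dots (twistKnot p).Chain :=
    fun j => (-1 : ℤ) ^ j • (twistKnot p).dotSlide ((twistKnot p).passage (j : ℕ)).1 with hu'
  have hanti : ∀ i j, twistSlide p i * twistSlide p j = -(twistSlide p j * twistSlide p i) := by
    intro i j
    rw [twistSlide, twistSlide, smul_mul_smul_comm, smul_mul_smul_comm, Module.End.mul_eq_comp,
      Module.End.mul_eq_comp, dotSlide_anticomm (isOrientable p), smul_neg,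
      mul_comm ((-1 : ℤ) ^ i)]
  have hc : ∀ c i, twistSlide p i * (twistKnot p).dotSlide c =
      -((twistKnot p).dotSlide c * twistSlide p i) := by
    intro c i
    rw [twistSlide, mul_smul_comm, smul_mul_assoc, Module.End.mul_eq_comp,
      Module.End.mul_eq_comp, dotSlide_anticomm (isOrientable p), smul_neg]
  have u0 : u 0 = (twistKnot p).dotSlide 1 := by
    simp only [hu', passage_zero, pow_zero, one_smul]
  have u1 : u 1 = -(twistKnot p).dotSlide 0 := by
    simp only [hu', passage_one, pow_one, neg_one_smul]
  have uT : ∀ i < p, u (2 + i) = twistSlide p i := by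
    intro i hi
    simp only [hu', passage_left hi, twistSlide, pow_add]
    norm_num
  have uT' : ∀ i < p, u (2 + p + (2 + i)) = -twistSlide p (p - 1 - i) := by
    intro i hi
    have h1 : 2 + p + (2 + i) = 2 * p + 3 - (p - 1 - i) := by omega
    have h2 : ((-1) ^ (2 * p + 3 - (p - 1 - i)) : ℤ) = -(-1) ^ (p - 1 - i) := by
      obtain ⟨k, hk⟩ : ∃ k, 2 * p + 3 - (p - 1 - i) = 2 * k + 1 + (p - 1 - i) :=
        ⟨i + 2, by omega⟩
      rw [hk, pow_add, pow_add, pow_mul]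
      norm_num
    rw [h1]
    simp only [hu', passage_right (show p - 1 - i < p by omega), twistSlide, h2, neg_smul]
  have e0 := passage_ending (p := p) false
  have e1 := passage_ending (p := p) true
  simp only [Bool.false_eq_true, if_false, if_true, add_zero, iff_true, iff_false,
    Bool.true_eq_false] at e0 e1
  obtain ⟨he, ho⟩ := pairSum_twist hanti (hc 0) (hc 1) (dotSlide_anticomm (isOrientable p) 0 1)
    (dotSlide_comp_self (isOrientable p) 0) (dotSlide_comp_self (isOrientable p) 1) u0 u1 uT uT'
  rw [hu]
  by_cases h : Even p
  · have v0 : u (2 + p) = (twistKnot p).dotSlide 0 := by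
      rw [add_comm 2 p]
      simp only [hu', e0, if_pos h, (h.add even_two).neg_one_pow, one_smul]
    have v1 : u (2 + p + 1) = -(twistKnot p).dotSlide 1 := by
      rw [add_comm 2 p]
      simp only [hu', e1, if_neg (not_not.2 h), (h.add even_two).add_one.neg_one_pow, neg_one_smul]
    rw [he v0 v1, if_pos h, sub_zero]
    rfl
  · have ho' := Nat.not_even_iff_odd.1 h
    have v0 : u (2 + p) = -(twistKnot p).dotSlide 1 := by
      rw [add_comm 2 p]
      simp only [hu', e0, if_neg h, (ho'.add_even even_two).neg_one_pow, neg_one_smul]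
    have v1 : u (2 + p + 1) = (twistKnot p).dotSlide 0 := by
      rw [add_comm 2 p]
      simp only [hu', e1, if_pos h, (ho'.add_even even_two).add_one.neg_one_pow, one_smul]
    rw [ho v0 v1, if_neg h]
    rfl

end KnotDiagram.TwistKnot

/-! ### The homotopies of the clasp and of the row on the chains -/

namespace KnotDiagram.TwistKnot

open MvPolynomial (X C)

variable {p : ℕ} {m : ℕ}

theorem dotSlide_gen_of_true {c : Fin (p + 2)} {v : Fin (p + 2) → Bool} (h : v c = true)
    (f : (twistKnot p).Dots) : (twistKnot p).dotSlide c ((twistKnot p).gen v f) =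
      sign c v • (twistKnot p).gen (flip c v) ((twistKnot p).coef c v * f) := by
  rw [dotSlide, edgeMap_gen (isOrientable p), if_pos h]

theorem dotSlide_gen_of_false {c : Fin (p + 2)} {v : Fin (p + 2) → Bool} (h : v c = false)
    (f : (twistKnot p).Dots) : (twistKnot p).dotSlide c ((twistKnot p).gen v f) = 0 := by
  rw [dotSlide, edgeMap_gen (isOrientable p), if_neg (by simp [h])]

/-- The difference of the dot-sliding homotopies of the clasp crossings. -/
def claspSlide (p : ℕ) : (twistKnot p).Chain →ₗ[(twistKnot p).Dots] (twistKnot p).Chain :=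
  (twistKnot p).dotSlide 1 - (twistKnot p).dotSlide 0

theorem claspSlide_apply (x : (twistKnot p).Chain) :
    claspSlide p x = (twistKnot p).dotSlide 1 x - (twistKnot p).dotSlide 0 x := rfl

theorem twistSlideSum_apply (x : (twistKnot p).Chain) : twistSlideSum p x =
    ∑ i ∈ Finset.range p, (-1 : ℤ) ^ i • (twistKnot p).dotSlide (tw p i) x := by
  rw [twistSlideSum, LinearMap.sum_apply]
  rfl

theorem dotSlide_dotSlide (c c' : Fin (p + 2)) (x : (twistKnot p).Chain) :
    (twistKnot p).dotSlide c ((twistKnot p).dotSlide c' x) =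
      -(twistKnot p).dotSlide c' ((twistKnot p).dotSlide c x) :=
  LinearMap.congr_fun (dotSlide_anticomm (isOrientable p) c c') x

theorem claspSlide_twistSlideSum (x : (twistKnot p).Chain) :
    claspSlide p (twistSlideSum p x) = -twistSlideSum p (claspSlide p x) := by
  rw [twistSlideSum_apply, twistSlideSum_apply, map_sum, ← Finset.sum_neg_distrib]
  refine Finset.sum_congr rfl fun i _ => ?_
  rw [map_zsmul, claspSlide_apply, claspSlide_apply, map_sub, dotSlide_dotSlide 1,
    dotSlide_dotSlide 0, ← smul_neg]
  congr 1
  abel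

/-- Where the two dot sums of the clasp agree, `claspSlide` anticommutes with d and so takes
boundaries to boundaries. -/
theorem claspSlide_diff (x : (twistKnot p).Chain) :
    claspSlide p ((twistKnot p).diff x) =
      ((twistKnot p).dotSum 1 - (twistKnot p).dotSum 0) • x -
        (twistKnot p).diff (claspSlide p x) := by
  rw [claspSlide_apply, claspSlide_apply, map_sub, diff_dotSlide (isOrientable p),
    diff_dotSlide (isOrientable p), sub_smul]
  abel

theorem eChain_eq_claspSlide {θ : ZMod (2 * (p + 2)) → Bool} (hθ : (twistKnot p).IsAdmissible θ)
    (b : ZMod (2 * (p + 2))) (x : (twistKnot p).Chain) : (twistKnot p).eChain θ b x =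
      (2 : ℤ) • claspSlide p (twistSlideSum p x) -
      if Even p then 0 else (2 : ℤ) • (twistKnot p).dotSlide 1 ((twistKnot p).dotSlide 0 x) :=
  eChain_twistKnot hθ b x

/-! ### The clasp homotopies on rows -/

theorem not_joined_rowV_same (hmp : m ≤ p) :
    ¬ (twistKnot p).Joined 0 (rowV p true true m) ∧
      ¬ (twistKnot p).Joined 1 (rowV p true true m) := by
  rcases Nat.eq_zero_or_pos m with rfl | hm
  · exact not_joined_rowV_zero true
  · exact not_joined_rowV hm hmp rfl

theorem dotSlide_zero_rowV (hmp : m ≤ p) (f : (twistKnot p).Dots) :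
    (twistKnot p).dotSlide 0 ((twistKnot p).gen (rowV p true true m) f) =
      (twistKnot p).gen (rowV p false true m) f := by
  rw [dotSlide_gen_of_true (rowV_zero _ _ _), sign_zero, flip_zero_rowV,
    coef_not_joined _ (not_joined_rowV_same hmp).1, one_mul, one_smul, Bool.not_true]

theorem dotSlide_one_rowV (hmp : m ≤ p) (f : (twistKnot p).Dots) :
    (twistKnot p).dotSlide 1 ((twistKnot p).gen (rowV p true true m) f) =
      -(twistKnot p).gen (rowV p true false m) f := by
  rw [dotSlide_gen_of_true (rowV_one _ _ _), sign_one, flip_one_rowV, rowV_zero,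
    coef_not_joined _ (not_joined_rowV_same hmp).2, one_mul, Bool.not_true]
  simp [sgn]

theorem claspSlide_gen_rowV (hmp : m ≤ p) (f : (twistKnot p).Dots) :
    claspSlide p ((twistKnot p).gen (rowV p true true m) f) =
      -((twistKnot p).gen (rowV p true false m) f + (twistKnot p).gen (rowV p false true m) f) := by
  rw [claspSlide_apply, dotSlide_zero_rowV hmp, dotSlide_one_rowV hmp]
  abel

theorem dotSlide_one_dotSlide_zero (hmp : m ≤ p) (f : (twistKnot p).Dots) :
    (twistKnot p).dotSlide 1 ((twistKnot p).dotSlide 0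
      ((twistKnot p).gen (rowV p true true m) f)) = (twistKnot p).gen (rowV p false false m)
        ((if m = 0 then 1 else X (upper p 0) + X (upper p p)) * f) := by
  rw [dotSlide_zero_rowV hmp, dotSlide_gen_of_true (rowV_one _ _ _), sign_one, flip_one_rowV,
    rowV_zero, Bool.not_true]
  simp only [sgn, Bool.false_eq_true, if_false, one_smul]
  split_ifs with hm
  · rw [hm, coef_not_joined _ (not_joined_rowV_zero false).2]
  · have hm' : 1 ≤ m := by omega
    have hcl := closed_rowV (a := false) (b := false) hm' hmp
    rw [coef_joined _ (joined_clasp_of_closed (closed_rowV hm' hmp) (by simp)).2, dotSum_one,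
      add_mul, add_mul, map_add, map_add,
      gen_X_congr _ ((circles_clasp_of_closed hcl).1 (rowV_zero _ _ _)).2,
      gen_X_congr _ (circle_ending hcl true)]

/-- The correction in `tChain p 1` is invisible to e: its two images at the clasp resolution 00
cancel. -/
theorem claspSlide_gen_correction :
    claspSlide p ((twistKnot p).gen (rowV p true false 0) 1 +
      (twistKnot p).gen (rowV p false true 0) 1) = 0 ∧
    (twistKnot p).dotSlide 1 ((twistKnot p).dotSlide 0 ((twistKnot p).gen (rowV p true false 0) 1 +
      (twistKnot p).gen (rowV p false true 0) 1)) = 0 := by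
  have h1 : (twistKnot p).dotSlide 0 ((twistKnot p).gen (rowV p true false 0) 1) =
      (twistKnot p).gen (rowV p false false 0) 1 := by
    rw [dotSlide_gen_of_true (rowV_zero _ _ _), sign_zero, flip_zero_rowV,
      coef_not_joined _ (not_joined_rowV_zero false).1, one_mul, one_smul, Bool.not_true]
  have h2 : (twistKnot p).dotSlide 1 ((twistKnot p).gen (rowV p false true 0) 1) =
      (twistKnot p).gen (rowV p false false 0) 1 := by
    rw [dotSlide_gen_of_true (rowV_one _ _ _), sign_one, flip_one_rowV, rowV_zero,
      coef_not_joined _ (not_joined_rowV_zero false).2, one_mul, Bool.not_true]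
    simp [sgn]
  have h3 : (twistKnot p).dotSlide 0 ((twistKnot p).gen (rowV p false true 0) 1) = 0 :=
    dotSlide_gen_of_false (rowV_zero _ _ _) _
  have h4 : (twistKnot p).dotSlide 1 ((twistKnot p).gen (rowV p true false 0) 1) = 0 :=
    dotSlide_gen_of_false (rowV_one _ _ _) _
  have h5 : (twistKnot p).dotSlide 1 ((twistKnot p).gen (rowV p false false 0) 1) = 0 :=
    dotSlide_gen_of_false (rowV_one _ _ _) _
  rw [claspSlide_apply, map_add, map_add, h1, h2, h3, h4]
  simp [h5]

theorem eChain_eq_zero_of_claspSlide {θ : ZMod (2 * (p + 2)) → Bool}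
    (hθ : (twistKnot p).IsAdmissible θ) (b : ZMod (2 * (p + 2))) {x : (twistKnot p).Chain}
    (h : claspSlide p x = 0)
    (h' : (twistKnot p).dotSlide 1 ((twistKnot p).dotSlide 0 x) = 0) :
    (twistKnot p).eChain θ b x = 0 := by
  rw [eChain_eq_claspSlide hθ, claspSlide_twistSlideSum, h, h']
  simp

theorem eChain_sChain {θ : ZMod (2 * (p + 2)) → Bool}
    (hθ : (twistKnot p).IsAdmissible θ) (b : ZMod (2 * (p + 2))) (m : ℕ) :
    (twistKnot p).eChain θ b (sChain p m) = 0 := by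
  have h0 : (twistKnot p).dotSlide 0 (sChain p m) = 0 := dotSlide_gen_of_false (rowV_zero _ _ _) _
  have h1 : (twistKnot p).dotSlide 1 (sChain p m) = 0 := dotSlide_gen_of_false (rowV_one _ _ _) _
  refine eChain_eq_zero_of_claspSlide hθ b ?_ ?_
  · rw [claspSlide_apply, h0, h1, sub_zero]
  · rw [h0, map_zero]

/-! ### The twist homotopies on rows -/

/-- The image of a generator of a row under the dot-sliding homotopy of a twist crossing. -/
def gapGen (p m i : ℕ) (f : (twistKnot p).Dots) : (twistKnot p).Chain :=
  (twistKnot p).gen (flip (tw p i) (rowV p true true m))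
    ((if m = 0 then 1 else X (upper p i) + X (upper p 0)) * f)

theorem prod_sgn_rowV {v : Fin (p + 2) → Bool} {i : ℕ} (hmi : m ≤ i)
    (hv : ∀ k < i, v (tw p k) = decide (m ≤ k)) :
    ∏ k ∈ Finset.range i, sgn (v (tw p k)) = (-1) ^ (i - m) := by
  obtain ⟨j, rfl⟩ := Nat.exists_eq_add_of_le hmi
  rw [Finset.prod_range_add, Finset.prod_eq_one, one_mul, Nat.add_sub_cancel_left,
    Finset.prod_eq_pow_card (b := -1), Finset.card_range]
  · intro k hk
    rw [hv _ (by rw [Finset.mem_range] at hk; omega), decide_eq_true (by omega)]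
    rfl
  · intro k hk
    rw [Finset.mem_range] at hk
    rw [hv _ (by omega), decide_eq_false (by omega)]
    rfl

theorem sign_tw_rowV_of_le {i : ℕ} (hmi : m ≤ i) (hi : i < p) :
    sign (tw p i) (rowV p true true m) = (-1) ^ (i - m) := by
  rw [sign_tw _ hi, prod_sgn_rowV hmi fun k hk => rowV_tw _ _ _ (by omega), rowV_zero, rowV_one]
  simp [sgn]

theorem closed_flip_rowV {i : ℕ} (hmi : m ≤ i) (hi : i < p) :
    Closed (flip (tw p i) (rowV p true true m)) 0 :=
  closed_of_zero hi (by rw [flip_same, rowV_tw _ _ _ hi, decide_eq_true hmi, Bool.not_true])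

theorem flip_rowV_clasp (a b : Bool) {v : Fin (p + 2) → Bool} (h0 : v 0 = a) (h1 : v 1 = b) {i : ℕ}
    (hi : i < p) : flip (tw p i) v 0 = a ∧ flip (tw p i) v 1 = b :=
  ⟨by rw [flip_ne (tw_ne_zero hi).symm, h0], by rw [flip_ne (tw_ne_one hi).symm, h1]⟩

/-- For m ≥ 1 the gap splits the circle of the last columns, and the part to the right of the gap is
connected to column 0 through the clasp. For m = 0 the gap merges the two strands. -/
theorem dotSlide_tw_gen_rowV {i : ℕ} (hmi : m ≤ i) (hi : i < p) (f : (twistKnot p).Dots) :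
    (twistKnot p).dotSlide (tw p i) ((twistKnot p).gen (rowV p true true m) f) =
      ((-1) ^ (i - m) : ℤ) • gapGen p m i f := by
  rw [dotSlide_gen_of_true (by rw [rowV_tw _ _ _ hi, decide_eq_true hmi]),
    sign_tw_rowV_of_le hmi hi, gapGen]
  congr 1
  have hcl := closed_flip_rowV (p := p) hmi hi
  have hv := flip_rowV_clasp (p := p) true true (rowV_zero true true m) (rowV_one true true m) hi
  have h1 : (twistKnot p).circle (flip (tw p i) (rowV p true true m)) (upper p (i + 1)) =
      (twistKnot p).circle (flip (tw p i) (rowV p true true m)) (upper p 0) := by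
    rw [circle_upper_eq hcl (show i + 1 ≤ p by omega) le_rfl fun k h1 h2 => ?_,
      ((circles_clasp_of_closed hcl).2.2 (Or.inl hv.1)).2]
    rw [flip_ne (tw_ne h2 hi (by omega)), rowV_tw _ _ _ h2, decide_eq_true (by omega)]
  split_ifs with hm
  · rw [coef_not_joined]
    refine fun hj => (isOrientable p (tw p i) _).1 ?_ hj
    rw [joined_tw_iff hcl hi, h1]
    refine (circle_upper_eq hcl (Nat.zero_le i) hi.le fun k _ h2 => ?_).symm
    rw [flip_ne (tw_ne (by omega) hi (by omega)), rowV_tw _ _ _ (by omega),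
      decide_eq_true (by omega)]
  · rw [coef_joined _ (joined_tw_rowV (by omega) hi hmi), gen_dotSum_tw hcl hi, add_mul, add_mul,
      map_add, map_add, gen_X_congr _ h1]

theorem twistSlideSum_gen_rowV (hmp : m ≤ p) (f : (twistKnot p).Dots) :
    twistSlideSum p ((twistKnot p).gen (rowV p true true m) f) =
      (-1 : ℤ) ^ m • ∑ i ∈ Finset.range (p - m), gapGen p m (m + i) f := by
  obtain ⟨N, rfl⟩ := Nat.exists_eq_add_of_le hmp
  rw [twistSlideSum_apply, Finset.sum_range_add, Finset.sum_eq_zero, zero_add, Finset.smul_sum,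
    Nat.add_sub_cancel_left]
  · refine Finset.sum_congr rfl fun i hi => ?_
    rw [Finset.mem_range] at hi
    rw [dotSlide_tw_gen_rowV (Nat.le_add_right _ _) (by omega), smul_smul, Nat.add_sub_cancel_left,
      pow_add, mul_assoc, ← mul_pow]
    simp
  · intro i hi
    rw [Finset.mem_range] at hi
    rw [dotSlide_gen_of_false (by rw [rowV_tw _ _ _ (by omega), decide_eq_false (by omega)]),
      smul_zero]

/-- The chain with two gaps in the row of ones. -/
def twoGapGen (p m i : ℕ) (f : (twistKnot p).Dots) : (twistKnot p).Chain :=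
  (twistKnot p).gen (flip (tw p (i + 1)) (flip (tw p i) (rowV p true true m)))
    ((if m = 0 then 1 else X (upper p i) + X (upper p 0)) * f)

/-- Closing either of two adjacent gaps leaves the other one. The zeros before m - 1 contribute
nothing because of the differences in f. Closing the zero at m - 1 connects its column to column i,
and the result vanishes by `hz`. -/
theorem diff_twoGapGen {i : ℕ} (hmi : m ≤ i) (hi : i + 1 < p) {f : (twistKnot p).Dots}
    (hf : ∀ k, k + 1 < m → X (upper p k) - X (upper p (k + 1)) ∣ f)
    (hz : ∀ v, 1 ≤ m → algebraMap (twistKnot p).Dots ((twistKnot p).Res v)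
      ((X (upper p (m - 1)) + X (upper p 0)) * f) = 0) :
    (twistKnot p).diff (twoGapGen p m i f) =
      (-1 : ℤ) ^ (i - m) • (gapGen p m i f + gapGen p m (i + 1) f) := by
  have hi' : i < p := by omega
  set r := rowV p true true m with hr
  set v := flip (tw p (i + 1)) (flip (tw p i) r) with hv
  have hne : tw p i ≠ tw p (i + 1) := tw_ne hi' hi (by omega)
  have vi : v (tw p i) = false := by
    rw [hv, flip_ne hne, flip_same, hr, rowV_tw _ _ _ hi', decide_eq_true hmi, Bool.not_true]
  have vi' : v (tw p (i + 1)) = false := by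
    rw [hv, flip_same, flip_ne hne.symm, hr, rowV_tw _ _ _ hi, decide_eq_true (by omega),
      Bool.not_true]
  have vk : ∀ k < p, k ≠ i → k ≠ i + 1 → v (tw p k) = decide (m ≤ k) := fun k hk h1 h2 => by
    rw [hv, flip_ne (tw_ne hk hi h2), flip_ne (tw_ne hk hi' h1), hr, rowV_tw _ _ _ hk]
  have vc : v 0 = true ∧ v 1 = true := by
    obtain ⟨h0, h1⟩ := flip_rowV_clasp (p := p) true true (rowV_zero true true m)
      (rowV_one true true m) hi'
    exact flip_rowV_clasp true true h0 h1 hi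
  have e1 : (twistKnot p).edgeMap (tw p i) false (twoGapGen p m i f) =
      (-1 : ℤ) ^ (i - m) • gapGen p m (i + 1) f := by
    have hfl : flip (tw p i) v = flip (tw p (i + 1)) r := by
      rw [hv, flip_comm, flip_flip]
    rw [twoGapGen, edgeMap_gen_of_false vi, coef_not_joined _ (not_joined_tw hi' hi (by omega)
      vi vi'), one_mul, hfl, sign_flip_of_lt (by rw [Fin.lt_def, tw_val hi', tw_val hi]; omega),
      sign_flip_same, sign_tw_rowV_of_le hmi hi', gapGen]
    congr 1
    split_ifs
    · rfl
    · have hcl := closed_flip_rowV (p := p) (show m ≤ i + 1 by omega) hi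
      have h1 := circle_upper_succ hcl hi' (by
        rw [flip_ne hne, rowV_tw _ _ _ hi', decide_eq_true hmi])
      rw [add_mul, add_mul, map_add, map_add, gen_X_congr _ h1]
  have e2 : (twistKnot p).edgeMap (tw p (i + 1)) false (twoGapGen p m i f) =
      (-1 : ℤ) ^ (i - m) • gapGen p m i f := by
    rw [twoGapGen, edgeMap_gen_of_false vi', coef_not_joined _ (not_joined_tw hi hi' (by omega)
      vi' vi), one_mul, flip_flip, sign_flip_same,
      sign_flip_of_gt (by rw [Fin.lt_def, tw_val hi', tw_val hi]; omega),
      sign_tw_rowV_of_le (by omega) hi, gapGen]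
    congr 1
    rw [show i + 1 - m = i - m + 1 by omega, pow_succ, mul_neg_one, neg_neg]
  have e0 : ∀ k < p, k ≠ i → k ≠ i + 1 →
      (twistKnot p).edgeMap (tw p k) false (twoGapGen p m i f) = 0 := by
    intro k hk h1 h2
    rcases Nat.lt_or_ge k m with hkm | hkm
    · have hk0 : v (tw p k) = false := by rw [vk k hk h1 h2, decide_eq_false (by omega)]
      rcases Nat.lt_or_ge (k + 1) m with hkm' | hkm'
      · exact edgeMap_tw_eq_zero (show k < i by omega) hi' hk0 vi ((hf k hkm').mul_left _)
      · obtain rfl : k = m - 1 := by omega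
        rw [twoGapGen, edgeMap_gen_of_false hk0, coef_not_joined _ (not_joined_tw hk hi' h1
          hk0 vi), one_mul, if_neg (by omega)]
        have hcl : Closed (flip (tw p (m - 1)) v) 0 :=
          closed_of_zero hi' (by rw [flip_ne (tw_ne hi' hk (by omega)), vi])
        have h3 := circle_upper_eq hcl (show m - 1 ≤ i by omega) hi'.le fun j hj hj' => by
          rcases eq_or_ne j (m - 1) with rfl | hj1
          · rw [flip_same, hk0, Bool.not_false]
          · rw [flip_ne (tw_ne (by omega) hk hj1), vk j (by omega) (by omega) (by omega),
              decide_eq_true (by omega)]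
        have h4 := hz (flip (tw p (m - 1)) v) (by omega)
        rw [← gen_eq_zero_iff, add_mul, map_add, gen_X_congr _ h3] at h4
        rw [add_mul, map_add, h4, smul_zero]
    · exact edgeMap_gen_of_true ((vk k hk h1 h2).trans (decide_eq_true hkm)) _
  rw [diff_eq, twoGapGen, edgeMap_gen_of_true vc.1, edgeMap_gen_of_true vc.2, ← twoGapGen,
    Finset.sum_eq_add_of_mem i (i + 1) (Finset.mem_range.2 hi') (Finset.mem_range.2 hi) (by omega)
      fun k hk hk' => e0 k (Finset.mem_range.1 hk) hk'.1 hk'.2, e1, e2, zero_add, zero_add,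
    ← smul_add, add_comm (gapGen p m (i + 1) f)]

/-- With the clasp resolved by 1, either dot sum is a dot on the bigon plus a dot on the circle of
the first and last columns. -/
theorem clasp_dotSum_smul_twoGapGen {i : ℕ} (hmi : m ≤ i) (hi : i + 1 < p)
    (f : (twistKnot p).Dots) :
    ((twistKnot p).dotSum 1 - (twistKnot p).dotSum 0) • twoGapGen p m i f = 0 := by
  have hi' : i < p := by omega
  have hcl : Closed (flip (tw p (i + 1)) (flip (tw p i) (rowV p true true m))) 0 :=
    closed_of_zero hi (by rw [flip_same, flip_ne (tw_ne hi hi' (by omega)), rowV_tw _ _ _ hi,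
      decide_eq_true (by omega), Bool.not_true])
  obtain ⟨h0, h1⟩ := flip_rowV_clasp (p := p) true true (rowV_zero true true m)
      (rowV_one true true m) hi'
  obtain ⟨h2, h3⟩ := (circles_clasp_of_closed hcl).2.2 (Or.inl (flip_rowV_clasp true true h0 h1 hi).1)
  rw [twoGapGen, smul_gen, dotSum_zero, dotSum_one, sub_mul, add_mul, add_mul, map_sub, map_add,
    map_add, gen_X_congr _ h2, gen_X_congr _ (circle_ending hcl true), gen_X_congr _ h3, sub_self]

end KnotDiagram.TwistKnot

/-! ### Sums whose neighbouring terms cancel -/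

section Pairs

/-- Neighbours drop out in pairs, so the parity of N decides whether the first term is left over. -/
theorem sum_range_sub_mem {M : Type*} [AddCommGroup M] {S : AddSubgroup M} {Z : ℕ → M} {N : ℕ}
    (h : ∀ i, i + 1 < N → Z i + Z (i + 1) ∈ S) :
    ∑ i ∈ Finset.range N, Z i - (if Even N then 0 else Z 0) ∈ S := by
  induction N generalizing Z with
  | zero => simp
  | succ N ih =>
    have h1 := ih (Z := fun i => Z (i + 1)) fun i hi => h (i + 1) (by omega)
    rw [Finset.sum_range_succ']
    by_cases hN : Even N
    · rw [if_pos hN] at h1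
      rw [if_neg (Nat.even_add_one.not.2 (not_not.2 hN))]
      simpa using h1
    · rw [if_neg hN] at h1
      rw [if_pos (Nat.even_add_one.2 hN), sub_zero]
      have h2 : 0 < N := by
        rcases Nat.eq_zero_or_pos N with rfl | h3
        · exact absurd Even.zero hN
        · exact h3
      convert S.add_mem h1 (h 0 (by omega)) using 1
      simp only [zero_add]
      abel

end Pairs

/-! ### The values of e on the basic chains -/

namespace KnotDiagram.TwistKnot

open MvPolynomial (X C)

variable {p : ℕ} {m : ℕ}

/-- The multiples of `f`. -/
def dotRange (p : ℕ) (f : (twistKnot p).Dots) :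
    Submodule (twistKnot p).Dots (twistKnot p).Chain :=
  LinearMap.range (LinearMap.lsmul (twistKnot p).Dots (twistKnot p).Chain f)

theorem map_mem_dotRange {f : (twistKnot p).Dots}
    (L : (twistKnot p).Chain →ₗ[(twistKnot p).Dots] (twistKnot p).Chain) {x : (twistKnot p).Chain}
    (hx : x ∈ dotRange p f) : L x ∈ dotRange p f := by
  obtain ⟨y, rfl⟩ := hx
  exact ⟨L y, by simp⟩

theorem gen_mem_dotRange (v : Fin (p + 2) → Bool) (f g h : (twistKnot p).Dots) :
    (twistKnot p).gen v (h * (f * g)) ∈ dotRange p f :=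
  ⟨(twistKnot p).gen v (h * g), by rw [LinearMap.lsmul_apply, smul_gen, mul_left_comm]⟩

/-- Up to boundaries the sum over all gaps collapses to the first gap or to zero. The bounding
chains have two gaps, where the dot sums of the clasp agree, so `claspSlide` preserves the relation.
Divisibility by f is recorded because the reduced complex requires it. -/
theorem claspSlide_twistSlideSum_gen (hmp : m ≤ p) {f : (twistKnot p).Dots}
    (hz : ∀ v, 1 ≤ m → algebraMap (twistKnot p).Dots ((twistKnot p).Res v)
      ((X (upper p (m - 1)) + X (upper p 0)) * (f * diffProd p m)) = 0) :
    claspSlide p (twistSlideSum p ((twistKnot p).gen (rowV p true true m) (f * diffProd p m))) -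
      (-1 : ℤ) ^ m • (if Even (p - m) then 0 else claspSlide p (gapGen p m m (f * diffProd p m))) ∈
        (dotRange p f).map (twistKnot p).diff := by
  have hf : ∀ k, k + 1 < m → X (upper p k) - X (upper p (k + 1)) ∣ f * diffProd p m :=
    fun k hk => (dvd_diffProd hk).mul_left _
  set F := f * diffProd p m with hF
  set K := LinearMap.ker (LinearMap.lsmul (twistKnot p).Dots (twistKnot p).Chain
    ((twistKnot p).dotSum 1 - (twistKnot p).dotSum 0)) with hK
  have h1 := sum_range_sub_mem (S := ((dotRange p f ⊓ K).map (twistKnot p).diff).toAddSubgroup)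
    (Z := fun i => gapGen p m (m + i) F) (N := p - m) fun i hi => by
      have hg : twoGapGen p m (m + i) F ∈ dotRange p f ⊓ K :=
        ⟨gen_mem_dotRange _ _ _ _, clasp_dotSum_smul_twoGapGen (by omega) (by omega) _⟩
      refine ⟨(-1 : ℤ) ^ i • twoGapGen p m (m + i) F, zsmul_mem hg _, ?_⟩
      rw [map_zsmul, diff_twoGapGen (by omega) (by omega) hf hz, smul_smul,
        Nat.add_sub_cancel_left, ← mul_pow]
      simp [add_assoc]
  obtain ⟨z, ⟨hz1, hz2⟩, hz3⟩ := h1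
  rw [twistSlideSum_gen_rowV hmp, map_zsmul, ← smul_sub]
  refine zsmul_mem ?_ _
  refine ⟨-claspSlide p z, neg_mem (map_mem_dotRange _ hz1), ?_⟩
  have h2 := claspSlide_diff z
  rw [show ((twistKnot p).dotSum 1 - (twistKnot p).dotSum 0) • z = 0 from hz2, zero_sub, hz3,
    map_sub] at h2
  rw [map_neg, ← h2, add_zero]
  split_ifs <;> simp

/-- A gap at the first one gives a row with m + 1 zeros, which `claspSlide` sends to minus the two
mixed terms. The same polynomial at 00 with m + 1 zeros has as boundary these mixed terms plus the
row of m zeros at 00. -/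
theorem claspSlide_gapGen (hmp : m < p) {f : (twistKnot p).Dots}
    (hz : ∀ v, 1 ≤ m → algebraMap (twistKnot p).Dots ((twistKnot p).Res v)
      ((X (upper p (m - 1)) + X (upper p 0)) * (f * diffProd p m)) = 0) :
    claspSlide p (gapGen p m m (f * diffProd p m)) -
      (twistKnot p).dotSlide 1 ((twistKnot p).dotSlide 0
        ((twistKnot p).gen (rowV p true true m) (f * diffProd p m))) ∈
        (dotRange p f).map (twistKnot p).diff := by
  -- By `hz`, the gap factor X_m + X_0 acts on f times `diffProd p m` as X_m - X_{m-1}, the negative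
  -- of the next factor of `diffProd`.
  set s : (twistKnot p).Dots := if m = 0 then 1 else -1 with hs
  set h := s * (f * diffProd p (m + 1)) with hh
  have key : ∀ v, algebraMap (twistKnot p).Dots ((twistKnot p).Res v) h =
      algebraMap (twistKnot p).Dots ((twistKnot p).Res v)
        ((if m = 0 then 1 else X (upper p m) + X (upper p 0)) * (f * diffProd p m)) := by
    intro v
    rcases Nat.eq_zero_or_pos m with rfl | hm
    · simp [hh, hs, diffProd_zero, diffProd_one]
    · have h1 := hz v hm
      have hm' : m ≠ 0 := by omega
      rw [hh, hs, if_neg hm', if_neg hm', diffProd_succ hm]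
      simp only [map_mul, map_add, map_sub, map_neg, map_one] at h1 ⊢
      linear_combination -h1
  have h1 : gapGen p m m (f * diffProd p m) = (twistKnot p).gen (rowV p true true (m + 1)) h := by
    rw [gapGen, flip_tw_rowV' _ _ hmp, gen_eq_gen_iff, key]
  have h2 : (twistKnot p).dotSlide 1 ((twistKnot p).dotSlide 0
      ((twistKnot p).gen (rowV p true true m) (f * diffProd p m))) =
        (twistKnot p).gen (rowV p false false m) h := by
    rw [dotSlide_one_dotSlide_zero hmp.le, gen_eq_gen_iff, key]
    split_ifs with hm
    · rfl
    · simp only [map_mul, map_add, algebraMap_X_eq _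
        (circle_upper_rowV (a := false) (b := false) (by omega) hmp.le le_rfl hmp.le)]
      ring
  have h3 : (twistKnot p).diff ((twistKnot p).gen (rowV p false false (m + 1)) h) =
      (twistKnot p).gen (rowV p true false (m + 1)) h +
        (twistKnot p).gen (rowV p false true (m + 1)) h +
          (twistKnot p).gen (rowV p false false m) h := by
    have hc : (twistKnot p).coef (tw p m) (rowV p false false (m + 1)) = 1 := by
      refine coef_not_joined _ ?_
      rw [← flip_tw_rowV' _ _ hmp, isOrientable p, not_not]
      rcases Nat.eq_zero_or_pos m with rfl | hm
      · exact joined_tw_rowV_zero hmp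
      · exact joined_tw_rowV hm hmp le_rfl
    obtain ⟨hj0, hj1⟩ := not_joined_rowV (p := p) (a := false) (b := false) (m := m + 1)
      (by omega) hmp rfl
    rw [diff_gen_rowV (m := m + 1) hmp fun k hk => ((dvd_diffProd hk).mul_left _).mul_left _,
      edgeMap_gen_of_false (rowV_zero _ _ _), edgeMap_gen_of_false (rowV_one _ _ _),
      flip_zero_rowV, flip_one_rowV, coef_not_joined _ hj0, coef_not_joined _ hj1, one_mul,
      if_pos (by omega), Nat.add_sub_cancel, hc, one_mul, sign_zero, sign_one, rowV_zero, ← hh]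
    simp [sgn]
  rw [h1, h2, claspSlide_gen_rowV hmp]
  refine ⟨-(twistKnot p).gen (rowV p false false (m + 1)) h,
    neg_mem (gen_mem_dotRange _ _ _ _), ?_⟩
  rw [map_neg, h3]
  abel

/-- The gaps contribute 2 (-1)^m χ_1 χ_0 if p - m is odd, and the clasp contributes - 2 χ_1 χ_0 if p
is odd. For either parity of p the total is 0 for even m and - 2 χ_1 χ_0 for odd m. -/
theorem eChain_gen_rowV {θ : ZMod (2 * (p + 2)) → Bool} (hθ : (twistKnot p).IsAdmissible θ)
    (b : ZMod (2 * (p + 2))) (hmp : m ≤ p) {f : (twistKnot p).Dots}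
    (hz : ∀ v, 1 ≤ m → algebraMap (twistKnot p).Dots ((twistKnot p).Res v)
      ((X (upper p (m - 1)) + X (upper p 0)) * (f * diffProd p m)) = 0) :
    (twistKnot p).eChain θ b ((twistKnot p).gen (rowV p true true m) (f * diffProd p m)) +
      (if Even m then 0 else (2 : ℤ) • (twistKnot p).dotSlide 1 ((twistKnot p).dotSlide 0
        ((twistKnot p).gen (rowV p true true m) (f * diffProd p m)))) ∈
        (dotRange p f).map (twistKnot p).diff := by
  rw [eChain_eq_claspSlide hθ]
  have h1 := claspSlide_twistSlideSum_gen hmp hz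
  by_cases hpm : Even (p - m)
  · rw [if_pos hpm, smul_zero, sub_zero] at h1
    rw [Nat.even_sub hmp] at hpm
    convert zsmul_mem h1 2 using 1
    by_cases hm : Even m
    · simp [hm, hpm.2 hm]
    · simp [hm, hpm]
  · have hlt : m < p := by
      rcases hmp.eq_or_lt with rfl | h
      · simp at hpm
      · exact h
    have h2 := claspSlide_gapGen hlt hz
    rw [if_neg hpm] at h1
    rw [Nat.even_sub hmp] at hpm
    convert add_mem (zsmul_mem h1 2) (zsmul_mem h2 (2 * (-1) ^ m)) using 1
    by_cases hm : Even m
    · rw [if_pos hm, if_neg (by tauto), hm.neg_one_pow]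
      module
    · rw [if_neg hm, if_pos (by tauto), (Nat.not_even_iff_odd.1 hm).neg_one_pow]
      module

/-- For even m ≥ 2 the dots on columns m - 1 and 0 act on `diffProd` with opposite signs, so no
additional dot is needed for the condition on f. -/
theorem eChain_tChain_of_even {θ : ZMod (2 * (p + 2)) → Bool}
    (hθ : (twistKnot p).IsAdmissible θ) (b : ZMod (2 * (p + 2))) (hmp : m ≤ p) (hm : Even m) :
    ∃ y, (twistKnot p).eChain θ b (tChain p m) = (twistKnot p).diff y := by
  have h1 := eChain_gen_rowV hθ b hmp (f := 1) fun v h => by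
    have h2 := algebraMap_diffProd_mul (p := p) v h
    have h3 := neg_one_pow_eq_neg (A := (twistKnot p).Res v) h
    rw [hm.neg_one_pow] at h3
    rw [one_mul, map_mul, map_add]
    linear_combination h2 + algebraMap (twistKnot p).Dots ((twistKnot p).Res v) (diffProd p m) *
      algebraMap (twistKnot p).Dots ((twistKnot p).Res v) (X (upper p 0)) * h3
  rw [if_pos hm, add_zero, one_mul] at h1
  obtain ⟨y, -, hy⟩ := h1
  refine ⟨y, ?_⟩
  rw [hy, tChain, if_neg (by rintro rfl; simp at hm), add_zero]

/-- For odd m the condition on f needs the dot X_0. Here χ_1 χ_0 contributes X_0 + X_p, and X_0 (X_0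
+ X_p) = - X_0 (X_0 - X_p) recovers s_m with the opposite sign. -/
theorem eChain_X_smul_tChain {θ : ZMod (2 * (p + 2)) → Bool}
    (hθ : (twistKnot p).IsAdmissible θ) (b : ZMod (2 * (p + 2))) (hmp : m ≤ p) (hm : ¬ Even m) :
    (twistKnot p).eChain θ b ((X (upper p 0) : (twistKnot p).Dots) • tChain p m) -
      (2 : ℚ) • (X (upper p 0) : (twistKnot p).Dots) • sChain p m ∈
        ((twistKnot p).reducedChain (upper p 0)).map (twistKnot p).diff := by
  have hm1 : 1 ≤ m := by
    rcases Nat.eq_zero_or_pos m with rfl | h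
    · simp at hm
    · exact h
  have h1 := eChain_gen_rowV hθ b hmp (f := X (upper p 0)) fun v h => by
    have h2 := algebraMap_diffProd_mul (p := p) v h
    have h3 := algebraMap_X_sq (D := twistKnot p) v (upper p 0)
    simp only [map_mul, map_add]
    linear_combination algebraMap (twistKnot p).Dots ((twistKnot p).Res v) (X (upper p 0)) * h2 +
      ((-1) ^ (m - 1) + 1) *
        algebraMap (twistKnot p).Dots ((twistKnot p).Res v) (diffProd p m) * h3
  rw [if_neg hm, dotSlide_one_dotSlide_zero hmp, if_neg (by omega)] at h1
  have h4 : (twistKnot p).eChain θ b ((X (upper p 0) : (twistKnot p).Dots) • tChain p m) =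
      (twistKnot p).eChain θ b ((twistKnot p).gen (rowV p true true m)
        (X (upper p 0) * diffProd p m)) := by
    rw [tChain, smul_add, map_add, smul_gen]
    refine add_eq_left.2 ?_
    split_ifs
    · rw [map_smul, eChain_eq_zero_of_claspSlide hθ b claspSlide_gen_correction.1
        claspSlide_gen_correction.2, smul_zero]
    · rw [smul_zero, map_zero]
  have h5 : (X (upper p 0) : (twistKnot p).Dots) • sChain p m =
      -(twistKnot p).gen (rowV p false false m)
        ((X (upper p 0) + X (upper p p)) * (X (upper p 0) * diffProd p m)) := by
    rw [sChain, smul_gen, ← map_neg, gen_eq_gen_iff]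
    have h3 := algebraMap_X_sq (D := twistKnot p) (rowV p false false m) (upper p 0)
    simp only [map_mul, map_add, map_neg, map_sub]
    linear_combination 2 * algebraMap (twistKnot p).Dots ((twistKnot p).Res _) (diffProd p m) * h3
  rw [h4, h5, smul_neg, sub_neg_eq_add, two_smul ℚ, ← two_zsmul]
  exact h1

end KnotDiagram.TwistKnot

namespace KnotDiagram.TwistKnot

open MvPolynomial (X C)

variable {p : ℕ} {m : ℕ} {a b : Bool}

/-! ### The bidegrees of the cycles -/

theorem ones_rowV (a b : Bool) (hmp : m ≤ p) :
    ones (rowV p a b m) = a.toNat + b.toNat + (p - m) := by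
  rw [ones, Finset.card_filter, sum_crossings, rowV_zero, rowV_one]
  obtain ⟨N, rfl⟩ := Nat.exists_eq_add_of_le hmp
  rw [Finset.sum_range_add, Finset.sum_eq_zero, Finset.sum_congr rfl (g := fun _ => 1)]
  · cases a <;> cases b <;> simp
  · intro i hi
    rw [Finset.mem_range] at hi
    rw [rowV_tw _ _ _ (by omega), decide_eq_true (by omega), if_pos rfl]
  · intro i hi
    rw [Finset.mem_range] at hi
    rw [rowV_tw _ _ _ (by omega), decide_eq_false (by omega), if_neg (by simp)]

theorem pos_twistKnot (c : Fin (p + 2)) : (twistKnot p).pos c = twistPos p c := rfl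

theorem posCount_twistKnot : (twistKnot p).posCount = if Even p then p else p + 2 := by
  rw [posCount, Finset.card_filter, sum_crossings, Finset.sum_congr rfl (g := fun _ => 1)]
  · by_cases h : Even p <;> simp [pos_twistKnot, twistPos, h, add_comm]
  · intro i hi
    rw [Finset.mem_range] at hi
    simp [pos_twistKnot, twistPos, tw_val hi]

theorem negCount_twistKnot : (twistKnot p).negCount = if Even p then 2 else 0 := by
  rw [negCount, Finset.card_filter, sum_crossings, Finset.sum_eq_zero]
  · by_cases h : Even p <;> simp [pos_twistKnot, twistPos, h]
  · intro i hi
    rw [Finset.mem_range] at hi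
    simp [pos_twistKnot, twistPos, tw_val hi]

theorem card_circles_flip_of_joined {c : Fin (p + 2)} {v : Fin (p + 2) → Bool}
    (h : (twistKnot p).Joined c v) :
    Nat.card ((twistKnot p).Circles (flip c v)) = Nat.card ((twistKnot p).Circles v) + 1 := by
  have h1 := card_circles_flip (D := twistKnot p) (isOrientable p) (c := c) (v := flip c v)
    fun h2 => (isOrientable p c v).1 h2 h
  rw [flip_flip] at h1
  exact h1.symm

theorem card_circles_rowV_zero :
    Nat.card ((twistKnot p).Circles (rowV p false false 0)) = 1 := by
  obtain ⟨h1, h2, -⟩ := circles_clasp_of_ones (p := p) false false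
  have h0 : (twistKnot p).circle (rowV p false false 0) (lower p 0) =
      (twistKnot p).circle (rowV p false false 0) (upper p 0) :=
    (h2 rfl).1.symm.trans (h1 rfl).1
  rw [Nat.card_eq_one_iff_unique]
  suffices h : ∀ e, (twistKnot p).circle (rowV p false false 0) e =
      (twistKnot p).circle (rowV p false false 0) (upper p 0) by
    refine ⟨⟨fun x y => ?_⟩, ⟨(twistKnot p).circle _ (upper p 0)⟩⟩
    obtain ⟨x, rfl⟩ := Quot.exists_rep x
    obtain ⟨y, rfl⟩ := Quot.exists_rep y
    exact (h x).trans (h y).symm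
  intro e
  rcases edge_cases e with ⟨k, hk, rfl⟩ | ⟨k, hk, rfl⟩ | rfl | rfl
  · rw [(circle_strand (rowV_all_one false false) hk).1]
    split_ifs
    exacts [rfl, h0]
  · rw [(circle_strand (rowV_all_one false false) hk).2]
    split_ifs
    exacts [h0, rfl]
  · exact (h1 rfl).1
  · exact (h1 rfl).2

theorem card_circles_rowV (hmp : m ≤ p) :
    Nat.card ((twistKnot p).Circles (rowV p false false m)) = m + 1 := by
  induction m with
  | zero => exact card_circles_rowV_zero
  | succ m ih =>
    rw [← flip_tw_rowV' _ _ hmp, card_circles_flip_of_joined, ih (by omega)]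
    rcases Nat.eq_zero_or_pos m with rfl | hm
    · exact joined_tw_rowV_zero hmp
    · exact joined_tw_rowV hm hmp le_rfl

theorem card_circles_rowV_zero_ne (hab : a ≠ b) :
    Nat.card ((twistKnot p).Circles (rowV p a b 0)) = 2 := by
  have h1 := card_circles_flip_of_joined (p := p) (joined_rowV_zero false).1
  have h2 := card_circles_flip_of_joined (p := p) (joined_rowV_zero false).2
  rw [flip_zero_rowV, card_circles_rowV_zero] at h1
  rw [flip_one_rowV, card_circles_rowV_zero] at h2
  cases a <;> cases b <;> first | exact absurd rfl hab | exact h1 | exact h2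

theorem card_circles_rowV_true (hmp : m ≤ p) :
    Nat.card ((twistKnot p).Circles (rowV p true true m)) = if m = 0 then 3 else m + 1 := by
  split_ifs with hm
  · have h1 := card_circles_flip_of_joined (p := p) (joined_rowV_zero true).2
    rw [flip_one_rowV, card_circles_rowV_zero_ne (a := true) (b := false) (by simp)] at h1
    rw [hm]
    exact h1
  · have hm' : 1 ≤ m := by omega
    have h1 := card_circles_flip (isOrientable p)
      (not_joined_rowV (p := p) (a := false) (b := false) hm' hmp rfl).1
    rw [flip_zero_rowV, card_circles_rowV hmp] at h1
    have h2 := card_circles_flip_of_joined (p := p)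
      (joined_clasp_of_closed (closed_rowV (a := true) (b := false) hm' hmp) (by simp)).2
    rw [flip_one_rowV] at h2
    simp only [Bool.not_false] at h1 h2
    omega

theorem isHomogeneous_X_sub_X (e f : ZMod (2 * (p + 2))) :
    (X e - X f : (twistKnot p).Dots).IsHomogeneous 1 :=
  (MvPolynomial.isHomogeneous_X _ _).sub (MvPolynomial.isHomogeneous_X _ _)

theorem isHomogeneous_diffProd (m : ℕ) : (diffProd p m).IsHomogeneous (m - 1) := by
  have h := MvPolynomial.IsHomogeneous.prod (Finset.range (m - 1))
    (fun i => (X (upper p i) - X (upper p (i + 1)) : (twistKnot p).Dots)) (fun _ => 1)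
    fun i _ => isHomogeneous_X_sub_X _ _
  rw [Finset.sum_const, Finset.card_range, smul_eq_mul, mul_one] at h
  exact h

/-- All s_m and t_m lie on one diagonal, δ = -1 for even p and δ = -3 for odd p; multiplication by a
dot raises δ by two. -/
theorem tChain_mem_bidegree (hmp : m ≤ p) {t q : ℤ}
    (ht : t = if Even p then (p - m : ℤ) else p + 2 - m)
    (hq : q = if Even p then -1 - 2 * t else -3 - 2 * t) :
    tChain p m ∈ (twistKnot p).bidegree t q := by
  have hpos := posCount_twistKnot (p := p)
  have hneg := negCount_twistKnot (p := p)
  refine Submodule.add_mem _ (gen_mem_bidegree (isHomogeneous_diffProd m) ?_ ?_) ?_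
  · rw [homDegree, ones_rowV _ _ hmp, hneg, ht]
    split_ifs <;> simp <;> omega
  · rw [qDegree, ones_rowV _ _ hmp, hneg, hpos, hq, ht, card_circles_rowV_true hmp]
    split_ifs <;> simp <;> omega
  · split_ifs with hm
    · subst hm
      refine Submodule.add_mem _ (gen_mem_bidegree (MvPolynomial.isHomogeneous_one _ _) ?_ ?_)
        (gen_mem_bidegree (MvPolynomial.isHomogeneous_one _ _) ?_ ?_)
      · rw [homDegree, ones_rowV _ _ (Nat.zero_le _), hneg, ht]
        split_ifs <;> simp <;> omega
      · rw [qDegree, ones_rowV _ _ (Nat.zero_le _), hneg, hpos, hq, ht,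
          card_circles_rowV_zero_ne (by simp)]
        split_ifs <;> simp <;> omega
      · rw [homDegree, ones_rowV _ _ (Nat.zero_le _), hneg, ht]
        split_ifs <;> simp <;> omega
      · rw [qDegree, ones_rowV _ _ (Nat.zero_le _), hneg, hpos, hq, ht,
          card_circles_rowV_zero_ne (by simp)]
        split_ifs <;> simp <;> omega
    · exact Submodule.zero_mem _

theorem sChain_mem_bidegree (hmp : m ≤ p) {t q : ℤ}
    (ht : t = if Even p then (p - m - 2 : ℤ) else p - m)
    (hq : q = if Even p then -1 - 2 * t else -3 - 2 * t) :
    sChain p m ∈ (twistKnot p).bidegree t q := by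
  rcases Nat.eq_zero_or_pos m with rfl | hm
  · rw [sChain_zero]
    exact Submodule.zero_mem _
  have hpos := posCount_twistKnot (p := p)
  have hneg := negCount_twistKnot (p := p)
  have hh := (isHomogeneous_X_sub_X (upper p 0) (upper p p)).mul (isHomogeneous_diffProd (p := p) m)
  rw [show 1 + (m - 1) = m by omega] at hh
  refine gen_mem_bidegree hh ?_ ?_
  · rw [homDegree, ones_rowV _ _ hmp, hneg, ht]
    split_ifs <;> simp <;> omega
  · rw [qDegree, ones_rowV _ _ hmp, hneg, hpos, hq, ht, card_circles_rowV hmp]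
    split_ifs <;> simp <;> omega

theorem X_smul_tChain_mem_bidegree (hmp : m ≤ p) {t q : ℤ}
    (ht : t = if Even p then (p - m : ℤ) else p + 2 - m)
    (hq : q = if Even p then 1 - 2 * t else -1 - 2 * t) :
    (X (upper p 0) : (twistKnot p).Dots) • tChain p m ∈ (twistKnot p).bidegree t q := by
  have h := X_smul_mem_bidegree (upper p 0) (tChain_mem_bidegree hmp (q := q - 2) ht (by
    rw [hq]; split_ifs <;> omega))
  rwa [sub_add_cancel] at h

theorem X_smul_sChain_mem_bidegree (hmp : m ≤ p) {t q : ℤ}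
    (ht : t = if Even p then (p - m - 2 : ℤ) else p - m)
    (hq : q = if Even p then 1 - 2 * t else -1 - 2 * t) :
    (X (upper p 0) : (twistKnot p).Dots) • sChain p m ∈ (twistKnot p).bidegree t q := by
  have h := X_smul_mem_bidegree (upper p 0) (sChain_mem_bidegree hmp (q := q - 2) ht (by
    rw [hq]; split_ifs <;> omega))
  rwa [sub_add_cancel] at h

end KnotDiagram.TwistKnot

/-! ### From a basis of the homology to a family of strings -/

section HomologyBasis

variable {R M : Type*} [CommRing R] [Algebra ℚ R] [AddCommGroup M] [Module R M] [Module ℚ M]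
  [IsScalarTower ℚ R M] {κ : Type*} {ι : Type*} [Fintype ι]

/-- Within a string e gives twice the next basis element; scaling the a-th element by 2^a absorbs
this factor. -/
theorem IsHomologyBasis.isStringFamily [DecidableEq κ] {d e : M →ₗ[R] M} {W : Submodule R M}
    {s : Finset κ} {B : κ → M} (h : IsHomologyBasis d W s B) {G : ℤ → ℤ → Submodule ℚ M}
    {S : ι → EString} (f : ι → ℕ → κ)
    (hf : ∀ i a i' a', a < (S i).len → a' < (S i').len → f i a = f i' a' → i = i' ∧ a = a')
    (hs : ∀ i, ∀ a < (S i).len, f i a ∈ s) (hc : s.card = ∑ i, (S i).len)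
    (hW : ∀ x ∈ s, B x ∈ W) (hd : ∀ x ∈ s, d (B x) = 0)
    (hG : ∀ i, ∀ a < (S i).len, B (f i a) ∈ G ((S i).t - 2 * a) ((S i).q + 4 * a))
    (he : ∀ i a, a + 1 < (S i).len → e (B (f i a)) - (2 : ℚ) • B (f i (a + 1)) ∈ W.map d)
    (he' : ∀ i a, a + 1 = (S i).len → e (B (f i a)) ∈ W.map d) :
    ∃ z, IsStringFamily d e W G S z := by
  have hinj : Function.Injective fun j : Σ i, Fin (S i).len => f j.1 j.2 := by
    rintro ⟨i, a⟩ ⟨i', a'⟩ hij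
    obtain ⟨rfl, h2⟩ := hf i a i' a' a.2 a'.2 hij
    rw [Fin.ext h2]
  have hcard : s.card = Fintype.card (Σ i, Fin (S i).len) := by simp [hc]
  obtain ⟨h1, h2⟩ := h.reindex _ hinj (fun j => hs j.1 j.2 j.2.2) hcard
    (u := fun j => (2 : ℚ) ^ (j.2 : ℕ)) fun _ => by positivity
  refine ⟨fun j => (2 : ℚ) ^ (j.2 : ℕ) • B (f j.1 j.2), fun j => ?_, fun j => ?_,
    fun i a => Submodule.smul_mem _ _ (hG i a a.2), fun i a => ?_, h1, h2⟩
  · rw [← algebraMap_smul R]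
    exact W.smul_mem _ (hW _ (hs j.1 j.2 j.2.2))
  · rw [← algebraMap_smul R, map_smul, hd _ (hs j.1 j.2 j.2.2), smul_zero]
  · rw [← algebraMap_smul R ((2 : ℚ) ^ (a : ℕ)), map_smul]
    split_ifs with hlt
    · have h3 := (W.map d).smul_mem (algebraMap ℚ R ((2 : ℚ) ^ (a : ℕ))) (he i a hlt)
      rwa [smul_sub, algebraMap_smul R _ ((2 : ℚ) • _), smul_smul, ← pow_succ] at h3
    · rw [sub_zero]
      exact (W.map d).smul_mem _ (he' i a (by omega))

end HomologyBasis

/-! ### The basis elements as cycles, and e on them -/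

namespace KnotDiagram.TwistKnot

open MvPolynomial (X C)

variable {p : ℕ} {m : ℕ}

theorem reducedBasis_mem (x : Bool × ℕ) :
    reducedBasis p x ∈ (twistKnot p).reducedChain (upper p 0) := ⟨_, rfl⟩

theorem diff_reducedBasis {x : Bool × ℕ} (hx : x.2 ≤ p) :
    (twistKnot p).diff (reducedBasis p x) = 0 := by
  rw [reducedBasis]
  split_ifs
  exacts [diff_X_smul_tChain hx, diff_X_smul_sChain hx]

theorem diff_unreducedBasis {x : Bool × ℕ} (hx : x.2 ≤ p) :
    (twistKnot p).diff (unreducedBasis p x) = 0 := by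
  rcases x with ⟨b, m⟩
  rw [unreducedBasis]
  simp only at hx ⊢
  cases b
  · simp only [Bool.false_eq_true, if_false]
    split_ifs with hm
    · rcases Nat.eq_zero_or_pos m with rfl | h
      · exact diff_tChain_zero
      · obtain ⟨k, rfl⟩ : ∃ k, m = k + 1 := ⟨m - 1, by omega⟩
        rw [diff_tChain_eq hx, tCoef_of_odd (by
          rw [← Nat.not_even_iff_odd]; exact Nat.even_add_one.1 hm), zero_smul]
    · rcases Nat.eq_zero_or_pos m with rfl | h
      · exact absurd Even.zero hm
      · obtain ⟨k, rfl⟩ : ∃ k, m = k + 1 := ⟨m - 1, by omega⟩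
        rw [diff_sChain_eq hx, Even.neg_one_pow (by rwa [Nat.even_add_one, not_not] at hm),
          sub_self, zero_smul]
  · simp only [if_true]
    split_ifs
    exacts [diff_X_smul_tChain le_rfl, diff_X_smul_sChain le_rfl, diff_X_smul_sChain hx,
      diff_X_smul_tChain hx]

variable {θ : ZMod (2 * (p + 2)) → Bool}

theorem eChain_X_smul_sChain (hθ : (twistKnot p).IsAdmissible θ) (b : ZMod (2 * (p + 2))) (m : ℕ) :
    (twistKnot p).eChain θ b ((X (upper p 0) : (twistKnot p).Dots) • sChain p m) = 0 := by
  rw [map_smul, eChain_sChain hθ, smul_zero]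

theorem eChain_X_smul_tChain_of_even (hθ : (twistKnot p).IsAdmissible θ) (b : ZMod (2 * (p + 2)))
    (hmp : m ≤ p) (hm : Even m) :
    (twistKnot p).eChain θ b ((X (upper p 0) : (twistKnot p).Dots) • tChain p m) ∈
      ((twistKnot p).reducedChain (upper p 0)).map (twistKnot p).diff := by
  obtain ⟨y, hy⟩ := eChain_tChain_of_even hθ b hmp hm
  exact ⟨X (upper p 0) • y, ⟨y, rfl⟩, by rw [map_smul, map_smul, hy]⟩

/-- In the unreduced homology, the strings of the reduced homology get shorter. -/
theorem eChain_X_smul_tChain_of_lt (hθ : (twistKnot p).IsAdmissible θ) (b : ZMod (2 * (p + 2)))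
    (hmp : m < p) :
    (twistKnot p).eChain θ b ((X (upper p 0) : (twistKnot p).Dots) • tChain p m) ∈
      (⊤ : Submodule (twistKnot p).Dots (twistKnot p).Chain).map (twistKnot p).diff := by
  by_cases hm : Even m
  · exact Submodule.map_mono le_top (eChain_X_smul_tChain_of_even hθ b hmp.le hm)
  · have h1 := Submodule.map_mono (f := (twistKnot p).diff) le_top
      (eChain_X_smul_tChain hθ b hmp.le hm)
    -- For odd m < p the would-be second element of the string, twice X s_m, is the boundary of
    -- s_{m+1}.
    have h2 := diff_sChain_eq (p := p) hmp
    rw [(Nat.not_even_iff_odd.1 hm).neg_one_pow, show (1 - -1 : ℚ) = 2 by norm_num] at h2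
    rw [← h2] at h1
    have h3 := add_mem h1 (Submodule.mem_map_of_mem (f := (twistKnot p).diff)
      (Submodule.mem_top (x := sChain p (m + 1))))
    rwa [sub_add_cancel] at h3

end KnotDiagram.TwistKnot

namespace KnotDiagram.TwistKnot

open MvPolynomial (X C)

/-! ### The strings of the twist knots -/

/-- The chains of the strings of the reduced homology. -/
def reducedIndex (k N : ℕ) {l : ℕ} : (Fin (k + 1) ⊕ Fin k) ⊕ Fin l → ℕ → Bool × ℕ
  | Sum.inl (Sum.inl j), _ => (true, 2 * k - 2 * j)
  | Sum.inl (Sum.inr j), _ => (false, 2 * k - 2 * j)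
  | Sum.inr j, a => (decide (a = 0), N - 2 * j)

theorem exists_isStringFamily_reduced_even (k : ℕ) {θ : ZMod (2 * (2 * k + 2)) → Bool}
    (hθ : (twistKnot (2 * k)).IsAdmissible θ) (b : ZMod (2 * (2 * k + 2))) :
    ∃ z, IsStringFamily (twistKnot (2 * k)).diff ((twistKnot (2 * k)).eChain θ b)
      ((twistKnot (2 * k)).reducedChain (upper (2 * k) 0))
      (fun t q => (twistKnot (2 * k)).bidegree t (q + 1)) (rkhStringsEven k) z := by
  have hp : Even (2 * k) := even_two_mul k
  -- The odd indices m = 2k - 1 - 2j carry the strings from X t_m to X s_m, and the even ones the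
  -- single classes. For k = 0 there is no odd index, so the truncation of 2k - 1 does no harm.
  refine isHomologyBasis_reduced.isStringFamily (reducedIndex k (2 * k - 1)) ?_ ?_ ?_
    (fun x _ => reducedBasis_mem x) (fun x hx => diff_reducedBasis (by simp at hx; omega)) ?_ ?_ ?_
  · rintro ((j | j) | j) a ((j' | j') | j') a' ha ha' h <;>
      simp [reducedIndex, rkhStringsEven, Fin.ext_iff] at ha ha' h ⊢ <;> omega
  · rintro ((j | j) | j) a ha <;> simp [reducedIndex] <;> omega
  · rw [Finset.card_erase_of_mem (by simp), Finset.card_product]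
    simp [rkhStringsEven]
    omega
  · rintro ((j | j) | j) a ha <;> simp only [rkhStringsEven] at ha ⊢
    · obtain rfl : a = 0 := by omega
      exact X_smul_tChain_mem_bidegree (m := 2 * k - 2 * j) (by omega) (by rw [if_pos hp]; push_cast; omega)
        (by rw [if_pos hp]; push_cast; omega)
    · obtain rfl : a = 0 := by omega
      exact X_smul_sChain_mem_bidegree (m := 2 * k - 2 * j) (by omega) (by rw [if_pos hp]; push_cast; omega)
        (by rw [if_pos hp]; push_cast; omega)
    · obtain rfl | rfl : a = 0 ∨ a = 1 := by omega
      · exact X_smul_tChain_mem_bidegree (m := 2 * k - 1 - 2 * j) (by omega)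
          (by rw [if_pos hp]; push_cast; omega) (by rw [if_pos hp]; push_cast; omega)
      · exact X_smul_sChain_mem_bidegree (m := 2 * k - 1 - 2 * j) (by omega)
          (by rw [if_pos hp]; push_cast; omega) (by rw [if_pos hp]; push_cast; omega)
  · rintro ((j | j) | j) a ha <;> simp only [rkhStringsEven] at ha
    · omega
    · omega
    · obtain rfl : a = 0 := by omega
      exact eChain_X_smul_tChain hθ b (m := 2 * k - 1 - 2 * j) (by omega) (by rw [Nat.even_iff]; omega)
  · rintro ((j | j) | j) a ha <;> simp only [rkhStringsEven] at ha
    · exact eChain_X_smul_tChain_of_even hθ b (m := 2 * k - 2 * j) (by omega)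
        (by rw [Nat.even_iff]; omega)
    · exact (eChain_X_smul_sChain hθ b _).symm ▸ Submodule.zero_mem _
    · obtain rfl : a = 1 := by omega
      exact (eChain_X_smul_sChain hθ b _).symm ▸ Submodule.zero_mem _

theorem exists_isStringFamily_reduced_odd (k : ℕ) {θ : ZMod (2 * (2 * k + 1 + 2)) → Bool}
    (hθ : (twistKnot (2 * k + 1)).IsAdmissible θ) (b : ZMod (2 * (2 * k + 1 + 2))) :
    ∃ z, IsStringFamily (twistKnot (2 * k + 1)).diff ((twistKnot (2 * k + 1)).eChain θ b)
      ((twistKnot (2 * k + 1)).reducedChain (upper (2 * k + 1) 0))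
      (fun t q => (twistKnot (2 * k + 1)).bidegree t (q + 1)) (rkhStringsOdd k) z := by
  have hp : ¬ Even (2 * k + 1) := Nat.not_even_two_mul_add_one k
  refine isHomologyBasis_reduced.isStringFamily (reducedIndex k (2 * k + 1)) ?_ ?_ ?_
    (fun x _ => reducedBasis_mem x) (fun x hx => diff_reducedBasis (by simp at hx; omega)) ?_ ?_ ?_
  · rintro ((j | j) | j) a ((j' | j') | j') a' ha ha' h <;>
      simp [reducedIndex, rkhStringsOdd, Fin.ext_iff] at ha ha' h ⊢ <;> omega
  · rintro ((j | j) | j) a ha <;> simp [reducedIndex] <;> omega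
  · rw [Finset.card_erase_of_mem (by simp), Finset.card_product]
    simp [rkhStringsOdd]
    omega
  · rintro ((j | j) | j) a ha <;> simp only [rkhStringsOdd] at ha ⊢
    · obtain rfl : a = 0 := by omega
      exact X_smul_tChain_mem_bidegree (m := 2 * k - 2 * j) (by omega) (by rw [if_neg hp]; push_cast; omega)
        (by rw [if_neg hp]; push_cast; omega)
    · obtain rfl : a = 0 := by omega
      exact X_smul_sChain_mem_bidegree (m := 2 * k - 2 * j) (by omega) (by rw [if_neg hp]; push_cast; omega)
        (by rw [if_neg hp]; push_cast; omega)
    · obtain rfl | rfl : a = 0 ∨ a = 1 := by omega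
      · exact X_smul_tChain_mem_bidegree (m := 2 * k + 1 - 2 * j) (by omega)
          (by rw [if_neg hp]; push_cast; omega) (by rw [if_neg hp]; push_cast; omega)
      · exact X_smul_sChain_mem_bidegree (m := 2 * k + 1 - 2 * j) (by omega)
          (by rw [if_neg hp]; push_cast; omega) (by rw [if_neg hp]; push_cast; omega)
  · rintro ((j | j) | j) a ha <;> simp only [rkhStringsOdd] at ha
    · omega
    · omega
    · obtain rfl : a = 0 := by omega
      exact eChain_X_smul_tChain hθ b (m := 2 * k + 1 - 2 * j) (by omega) (by rw [Nat.even_iff]; omega)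
  · rintro ((j | j) | j) a ha <;> simp only [rkhStringsOdd] at ha
    · exact eChain_X_smul_tChain_of_even hθ b (m := 2 * k - 2 * j) (by omega)
        (by rw [Nat.even_iff]; omega)
    · exact (eChain_X_smul_sChain hθ b _).symm ▸ Submodule.zero_mem _
    · obtain rfl : a = 1 := by omega
      exact (eChain_X_smul_sChain hθ b _).symm ▸ Submodule.zero_mem _

end KnotDiagram.TwistKnot

/-! ### The strings of the unreduced homology -/

namespace KnotDiagram.TwistKnot

open MvPolynomial (X C)

variable {p m : ℕ}

theorem unreducedBasis_zero (p : ℕ) : unreducedBasis p (true, 0) =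
    (X (upper p 0) : (twistKnot p).Dots) • if Even p then tChain p p else sChain p p := by
  simp [unreducedBasis]

theorem unreducedBasis_true_of_even (h0 : m ≠ 0) (hm : Even m) : unreducedBasis p (true, m) =
    (X (upper p 0) : (twistKnot p).Dots) • sChain p m := by
  simp [unreducedBasis, h0, hm]

theorem unreducedBasis_true_of_odd (hm : ¬ Even m) : unreducedBasis p (true, m) =
    (X (upper p 0) : (twistKnot p).Dots) • tChain p m := by
  have h0 : m ≠ 0 := by rintro rfl; exact hm Even.zero
  simp [unreducedBasis, h0, hm]

theorem unreducedBasis_false_of_even (hm : Even m) :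
    unreducedBasis p (false, m) = tChain p m := by
  simp [unreducedBasis, hm]

theorem unreducedBasis_false_of_odd (hm : ¬ Even m) :
    unreducedBasis p (false, m) = sChain p m := by
  simp [unreducedBasis, hm]

/-- The chains of the strings of the unreduced homology, with the exception of two or three. -/
def unreducedIndex (k j : ℕ) (i : Fin 4) : Bool × ℕ :=
  ![(true, 2 * k - 2 * j), (false, 2 * k - 1 - 2 * j), (true, 2 * k - 1 - 2 * j),
    (false, 2 * k - 2 - 2 * j)] i

/-- The chains of the strings of the unreduced homology of an even twist knot. -/
def unreducedIndexEven (k : ℕ) : Fin 2 ⊕ Fin k × Fin 4 → ℕ → Bool × ℕ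
  | Sum.inl i, _ => ![(true, 0), (false, 2 * k)] i
  | Sum.inr (j, i), _ => unreducedIndex k j i

/-- The chains of the strings of the unreduced homology of an odd twist knot. -/
def unreducedIndexOdd (k : ℕ) : Fin 3 ⊕ Fin k × Fin 4 → ℕ → Bool × ℕ
  | Sum.inl i, a => ![(true, if a = 0 then 2 * k + 1 else 0), (false, 2 * k + 1), (false, 2 * k)] i
  | Sum.inr (j, i), _ => unreducedIndex k j i

theorem even_sub (k j : ℕ) : Even (2 * k - 2 * j) := by rw [Nat.even_iff]; omega

theorem not_even_sub {k j : ℕ} (h : j < k) : ¬ Even (2 * k - 1 - 2 * j) := by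
  rw [Nat.even_iff]; omega

theorem even_sub_two (k j : ℕ) : Even (2 * k - 2 - 2 * j) := by rw [Nat.even_iff]; omega

/-- The bound on k keeps the odd index strictly below p, where the reduced string from X t_m to X
s_m is cut. -/
theorem eChain_unreducedIndex {θ : ZMod (2 * (p + 2)) → Bool} (hθ : (twistKnot p).IsAdmissible θ)
    (b : ZMod (2 * (p + 2))) {k j : ℕ} (hj : j < k) (hk : 2 * k ≤ p) (i : Fin 4) :
    (twistKnot p).eChain θ b (unreducedBasis p (unreducedIndex k j i)) ∈
      (⊤ : Submodule (twistKnot p).Dots (twistKnot p).Chain).map (twistKnot p).diff := by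
  fin_cases i
  · change (twistKnot p).eChain θ b (unreducedBasis p (true, 2 * k - 2 * j)) ∈ _
    rw [unreducedBasis_true_of_even (by omega) (even_sub k j), eChain_X_smul_sChain hθ]
    exact Submodule.zero_mem _
  · change (twistKnot p).eChain θ b (unreducedBasis p (false, 2 * k - 1 - 2 * j)) ∈ _
    rw [unreducedBasis_false_of_odd (not_even_sub hj), eChain_sChain hθ]
    exact Submodule.zero_mem _
  · change (twistKnot p).eChain θ b (unreducedBasis p (true, 2 * k - 1 - 2 * j)) ∈ _
    rw [unreducedBasis_true_of_odd (not_even_sub hj)]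
    exact eChain_X_smul_tChain_of_lt hθ b (by omega)
  · change (twistKnot p).eChain θ b (unreducedBasis p (false, 2 * k - 2 - 2 * j)) ∈ _
    rw [unreducedBasis_false_of_even (even_sub_two k j)]
    obtain ⟨y, hy⟩ := eChain_tChain_of_even hθ b (show 2 * k - 2 - 2 * j ≤ p by omega)
      (even_sub_two k j)
    exact ⟨y, trivial, hy.symm⟩

/-- Outside the pattern of four there are only t_p and X t_p, in homological degree 0. As p is even,
every odd index is below p, and e vanishes. -/
theorem exists_isStringFamily_even (k : ℕ) {θ : ZMod (2 * (2 * k + 2)) → Bool}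
    (hθ : (twistKnot (2 * k)).IsAdmissible θ) (b : ZMod (2 * (2 * k + 2))) :
    ∃ z, IsStringFamily (twistKnot (2 * k)).diff ((twistKnot (2 * k)).eChain θ b) ⊤
      (twistKnot (2 * k)).bidegree (khStringsEven k) z := by
  have hp : Even (2 * k) := even_two_mul k
  refine isHomologyBasis_unreduced.isStringFamily (unreducedIndexEven k) ?_ ?_ ?_
    (fun x _ => trivial) (fun x hx => diff_unreducedBasis (by simp at hx; omega)) ?_ ?_ ?_
  · rintro (i | ⟨j, i⟩) a (i' | ⟨j', i'⟩) a' ha ha' h <;> fin_cases i <;> fin_cases i' <;>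
      simp [unreducedIndexEven, unreducedIndex, khStringsEven, Fin.ext_iff] at ha ha' h ⊢ <;> omega
  · rintro (i | ⟨j, i⟩) a ha <;> fin_cases i <;> simp [unreducedIndexEven, unreducedIndex] <;> omega
  · rw [Finset.card_product]
    simp [khStringsEven, Fin.sum_univ_succ, Fintype.sum_prod_type]
    omega
  · rintro (i | ⟨j, i⟩) a ha
    · have ha0 : a = 0 := by fin_cases i <;> simp [khStringsEven] at ha <;> exact ha
      subst ha0
      fin_cases i <;> simp [khStringsEven]
      · change unreducedBasis (2 * k) (true, 0) ∈ (twistKnot (2 * k)).bidegree _ _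
        rw [unreducedBasis_zero, if_pos hp]
        exact X_smul_tChain_mem_bidegree le_rfl (by rw [if_pos hp]; push_cast; omega)
          (by rw [if_pos hp]; norm_num)
      · change unreducedBasis (2 * k) (false, 2 * k) ∈ (twistKnot (2 * k)).bidegree _ _
        rw [unreducedBasis_false_of_even hp]
        exact tChain_mem_bidegree le_rfl (by rw [if_pos hp]; push_cast; omega)
          (by rw [if_pos hp]; norm_num)
    · have ha0 : a = 0 := by fin_cases i <;> simp [khStringsEven] at ha <;> exact ha
      subst ha0
      fin_cases i <;> simp [khStringsEven]
      · change unreducedBasis (2 * k) (true, 2 * k - 2 * j) ∈ (twistKnot (2 * k)).bidegree _ _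
        rw [unreducedBasis_true_of_even (by omega) (even_sub k j)]
        exact X_smul_sChain_mem_bidegree (by omega) (by rw [if_pos hp]; push_cast; omega)
          (by rw [if_pos hp]; omega)
      · change unreducedBasis (2 * k) (false, 2 * k - 1 - 2 * j) ∈ (twistKnot (2 * k)).bidegree _ _
        rw [unreducedBasis_false_of_odd (not_even_sub j.2)]
        exact sChain_mem_bidegree (by omega) (by rw [if_pos hp]; push_cast; omega)
          (by rw [if_pos hp]; omega)
      · change unreducedBasis (2 * k) (true, 2 * k - 1 - 2 * j) ∈ (twistKnot (2 * k)).bidegree _ _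
        rw [unreducedBasis_true_of_odd (not_even_sub j.2)]
        exact X_smul_tChain_mem_bidegree (by omega) (by rw [if_pos hp]; push_cast; omega)
          (by rw [if_pos hp]; omega)
      · change unreducedBasis (2 * k) (false, 2 * k - 2 - 2 * j) ∈ (twistKnot (2 * k)).bidegree _ _
        rw [unreducedBasis_false_of_even (even_sub_two k j)]
        exact tChain_mem_bidegree (by omega) (by rw [if_pos hp]; push_cast; omega)
          (by rw [if_pos hp]; omega)
  · rintro (i | ⟨j, i⟩) a ha <;> fin_cases i <;> simp [khStringsEven] at ha
  · rintro (i | ⟨j, i⟩) a ha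
    · fin_cases i
      · change (twistKnot (2 * k)).eChain θ b (unreducedBasis (2 * k) (true, 0)) ∈ _
        rw [unreducedBasis_zero, if_pos hp]
        exact Submodule.map_mono le_top (eChain_X_smul_tChain_of_even hθ b le_rfl hp)
      · change (twistKnot (2 * k)).eChain θ b (unreducedBasis (2 * k) (false, 2 * k)) ∈ _
        rw [unreducedBasis_false_of_even hp]
        obtain ⟨y, hy⟩ := eChain_tChain_of_even hθ b le_rfl hp
        exact ⟨y, trivial, hy.symm⟩
    · exact eChain_unreducedIndex hθ b j.2 le_rfl i

/-- For odd p no s_{p+1} exists to bound X s_p, so X t_p starts the one string that survives; s_p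
and t_{p-1} are the other classes outside the pattern. -/
theorem exists_isStringFamily_odd (k : ℕ) {θ : ZMod (2 * (2 * k + 1 + 2)) → Bool}
    (hθ : (twistKnot (2 * k + 1)).IsAdmissible θ) (b : ZMod (2 * (2 * k + 1 + 2))) :
    ∃ z, IsStringFamily (twistKnot (2 * k + 1)).diff ((twistKnot (2 * k + 1)).eChain θ b) ⊤
      (twistKnot (2 * k + 1)).bidegree (khStringsOdd k) z := by
  have hp : ¬ Even (2 * k + 1) := Nat.not_even_two_mul_add_one k
  refine isHomologyBasis_unreduced.isStringFamily (unreducedIndexOdd k) ?_ ?_ ?_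
    (fun x _ => trivial) (fun x hx => diff_unreducedBasis (by simp at hx; omega)) ?_ ?_ ?_
  · rintro (i | ⟨j, i⟩) a (i' | ⟨j', i'⟩) a' ha ha' h <;> fin_cases i <;> fin_cases i' <;>
      simp [unreducedIndexOdd, unreducedIndex, khStringsOdd, Fin.ext_iff] at ha ha' h ⊢ <;>
      first | omega | (split_ifs at h <;> omega)
  · rintro (i | ⟨j, i⟩) a ha <;> fin_cases i <;> simp [unreducedIndexOdd, unreducedIndex] <;>
      first | omega | (split_ifs <;> omega)
  · rw [Finset.card_product]
    simp [khStringsOdd, Fin.sum_univ_succ, Fintype.sum_prod_type]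
    omega
  · rintro (i | ⟨j, i⟩) a ha
    · fin_cases i
      · have ha2 : a < 2 := ha
        obtain rfl | rfl : a = 0 ∨ a = 1 := by omega
        · change unreducedBasis (2 * k + 1) (true, 2 * k + 1) ∈ (twistKnot (2 * k + 1)).bidegree _ _
          rw [unreducedBasis_true_of_odd hp]
          exact X_smul_tChain_mem_bidegree le_rfl
            (by rw [if_neg hp]; change (2 : ℤ) - 2 * 0 = _; omega)
            (by rw [if_neg hp]; change (-5 : ℤ) + 4 * 0 = -1 - 2 * (2 - 2 * 0); omega)
        · change unreducedBasis (2 * k + 1) (true, 0) ∈ (twistKnot (2 * k + 1)).bidegree _ _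
          rw [unreducedBasis_zero, if_neg hp]
          exact X_smul_sChain_mem_bidegree le_rfl
            (by rw [if_neg hp]; change (2 : ℤ) - 2 * 1 = _; omega)
            (by rw [if_neg hp]; change (-5 : ℤ) + 4 * 1 = -1 - 2 * (2 - 2 * 1); omega)
      · obtain rfl : a = 0 := by have : a < 1 := ha; omega
        change unreducedBasis (2 * k + 1) (false, 2 * k + 1) ∈ (twistKnot (2 * k + 1)).bidegree _ _
        rw [unreducedBasis_false_of_odd hp]
        exact sChain_mem_bidegree le_rfl
          (by rw [if_neg hp]; change (0 : ℤ) - 2 * 0 = _; omega)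
          (by rw [if_neg hp]; change (-3 : ℤ) + 4 * 0 = -3 - 2 * (0 - 2 * 0); omega)
      · obtain rfl : a = 0 := by have : a < 1 := ha; omega
        change unreducedBasis (2 * k + 1) (false, 2 * k) ∈ (twistKnot (2 * k + 1)).bidegree _ _
        rw [unreducedBasis_false_of_even (even_two_mul k)]
        exact tChain_mem_bidegree (by omega)
          (by rw [if_neg hp]; change (3 : ℤ) - 2 * 0 = _; omega)
          (by rw [if_neg hp]; change (-9 : ℤ) + 4 * 0 = -3 - 2 * (3 - 2 * 0); omega)
    · have ha0 : a = 0 := by fin_cases i <;> simp [khStringsOdd] at ha <;> exact ha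
      subst ha0
      fin_cases i <;> simp [khStringsOdd]
      · change unreducedBasis (2 * k + 1) (true, 2 * k - 2 * j) ∈ (twistKnot (2 * k + 1)).bidegree _ _
        rw [unreducedBasis_true_of_even (by omega) (even_sub k j)]
        exact X_smul_sChain_mem_bidegree (by omega) (by rw [if_neg hp]; push_cast; omega)
          (by rw [if_neg hp]; omega)
      · change unreducedBasis (2 * k + 1) (false, 2 * k - 1 - 2 * j) ∈ (twistKnot (2 * k + 1)).bidegree _ _
        rw [unreducedBasis_false_of_odd (not_even_sub j.2)]
        exact sChain_mem_bidegree (by omega) (by rw [if_neg hp]; push_cast; omega)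
          (by rw [if_neg hp]; omega)
      · change unreducedBasis (2 * k + 1) (true, 2 * k - 1 - 2 * j) ∈ (twistKnot (2 * k + 1)).bidegree _ _
        rw [unreducedBasis_true_of_odd (not_even_sub j.2)]
        exact X_smul_tChain_mem_bidegree (by omega) (by rw [if_neg hp]; push_cast; omega)
          (by rw [if_neg hp]; omega)
      · change unreducedBasis (2 * k + 1) (false, 2 * k - 2 - 2 * j) ∈ (twistKnot (2 * k + 1)).bidegree _ _
        rw [unreducedBasis_false_of_even (even_sub_two k j)]
        exact tChain_mem_bidegree (by omega) (by rw [if_neg hp]; push_cast; omega)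
          (by rw [if_neg hp]; omega)
  · rintro (i | ⟨j, i⟩) a ha
    · fin_cases i
      · obtain rfl : a = 0 := by have : a + 1 < 2 := ha; omega
        change (twistKnot (2 * k + 1)).eChain θ b (unreducedBasis (2 * k + 1) (true, 2 * k + 1)) -
          (2 : ℚ) • unreducedBasis (2 * k + 1) (true, 0) ∈ _
        rw [unreducedBasis_zero, if_neg hp, unreducedBasis_true_of_odd hp]
        exact Submodule.map_mono le_top (eChain_X_smul_tChain hθ b le_rfl hp)
      · have : a + 1 < 1 := ha
        omega
      · have : a + 1 < 1 := ha
        omega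
    · fin_cases i <;> simp [khStringsOdd] at ha
  · rintro (i | ⟨j, i⟩) a ha
    · fin_cases i
      · obtain rfl : a = 1 := by have : a + 1 = 2 := ha; omega
        change (twistKnot (2 * k + 1)).eChain θ b (unreducedBasis (2 * k + 1) (true, 0)) ∈ _
        rw [unreducedBasis_zero, if_neg hp, eChain_X_smul_sChain hθ]
        exact Submodule.zero_mem _
      · change (twistKnot (2 * k + 1)).eChain θ b (unreducedBasis (2 * k + 1) (false, 2 * k + 1)) ∈ _
        rw [unreducedBasis_false_of_odd hp, eChain_sChain hθ]
        exact Submodule.zero_mem _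
      · change (twistKnot (2 * k + 1)).eChain θ b (unreducedBasis (2 * k + 1) (false, 2 * k)) ∈ _
        rw [unreducedBasis_false_of_even (even_two_mul k)]
        obtain ⟨y, hy⟩ := eChain_tChain_of_even hθ b (show 2 * k ≤ 2 * k + 1 by omega)
          (even_two_mul k)
        exact ⟨y, trivial, hy.symm⟩
    · exact eChain_unreducedIndex hθ b j.2 (by omega) i

end KnotDiagram.TwistKnot

end

/-! ### The theorem -/

namespace KnotDiagram.TwistKnot

theorem eq_zero_of_hasStringDecomposition {H : Type*} [AddCommGroup H] [Module ℚ H]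
    {G : ℤ → ℤ → Submodule ℚ H} {e : H →ₗ[ℚ] H} {ι : Type*} {S : ι → EString}
    (h : HasStringDecomposition G e S) (hS : ∀ i, (S i).len = 1) : e = 0 := by
  obtain ⟨B, hB⟩ := h
  refine B.ext fun ⟨i, a⟩ => ?_
  rw [(hB i a).2, dif_neg (by have := hS i; omega), LinearMap.zero_apply]

end KnotDiagram.TwistKnot

theorem mainTheorem8 :
    (∀ p : ℕ, ∃ θ, (twistKnot p).IsAdmissible θ) ∧
    (∀ p : ℕ, (twistKnot p).diff ∘ₗ (twistKnot p).diff = 0) ∧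
    ∃ he : ∀ (p : ℕ) (θ : ZMod (2 * (p + 2)) → Bool), (twistKnot p).IsAdmissible θ →
        ∀ b, (twistKnot p).diff ∘ₗ (twistKnot p).eChain θ b =
          (twistKnot p).eChain θ b ∘ₗ (twistKnot p).diff,
      ∀ k : ℕ,
        (∀ θ (hθ : (twistKnot (2 * k)).IsAdmissible θ) b,
          SupportedOnDelta (twistKnot (2 * k)).KhBidegree {1, -1} ∧
          (twistKnot (2 * k)).eKh θ b (he _ θ hθ b) = 0 ∧
          HasStringDecomposition (twistKnot (2 * k)).KhBidegree
            ((twistKnot (2 * k)).eKh θ b (he _ θ hθ b)) (khStringsEven k)) ∧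
        (∀ θ (hθ : (twistKnot (2 * k + 1)).IsAdmissible θ) b,
          SupportedOnDelta (twistKnot (2 * k + 1)).KhBidegree {-1, -3} ∧
          HasStringDecomposition (twistKnot (2 * k + 1)).KhBidegree
            ((twistKnot (2 * k + 1)).eKh θ b (he _ θ hθ b)) (khStringsOdd k)) ∧
        (∀ θ (hθ : (twistKnot (2 * k)).IsAdmissible θ) b x,
          SupportedOnDelta ((twistKnot (2 * k)).RKhBidegree x) {0} ∧
          HasStringDecomposition ((twistKnot (2 * k)).RKhBidegree x)
            ((twistKnot (2 * k)).eRKh x θ b (he _ θ hθ b)) (rkhStringsEven k)) ∧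
        (∀ θ (hθ : (twistKnot (2 * k + 1)).IsAdmissible θ) b x,
          SupportedOnDelta ((twistKnot (2 * k + 1)).RKhBidegree x) {-2} ∧
          HasStringDecomposition ((twistKnot (2 * k + 1)).RKhBidegree x)
            ((twistKnot (2 * k + 1)).eRKh x θ b (he _ θ hθ b)) (rkhStringsOdd k)) := by
  refine ⟨fun p => ⟨_, KnotDiagram.TwistKnot.isAdmissible_parityColoring p⟩, fun p =>
      KnotDiagram.diff_comp_diff (KnotDiagram.TwistKnot.isOrientable p),
    fun p θ hθ b => hθ.diff_comp_eChain b, fun k => ⟨fun θ hθ b => ?_, fun θ hθ b => ?_,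
      fun θ hθ b x => ?_, fun θ hθ b x => ?_⟩⟩
  · obtain ⟨z, hz⟩ := KnotDiagram.TwistKnot.exists_isStringFamily_even k hθ b
    obtain ⟨h1, h2⟩ := hθ.kh_of_isStringFamily hz (hθ.diff_comp_eChain b) (Δ := {1, -1}) (by
      rintro (i | ⟨j, i⟩) <;> fin_cases i <;> simp [khStringsEven] <;> omega)
    refine ⟨h1, KnotDiagram.TwistKnot.eq_zero_of_hasStringDecomposition h2 ?_, h2⟩
    rintro (i | ⟨j, i⟩) <;> fin_cases i <;> rfl
  · obtain ⟨z, hz⟩ := KnotDiagram.TwistKnot.exists_isStringFamily_odd k hθ b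
    exact hθ.kh_of_isStringFamily hz (hθ.diff_comp_eChain b) (by
      rintro (i | ⟨j, i⟩) <;> fin_cases i <;> simp [khStringsOdd] <;> omega)
  · exact hθ.rkh_of_isStringFamily (by omega)
      (KnotDiagram.TwistKnot.exists_isStringFamily_reduced_even k hθ b) x (hθ.diff_comp_eChain b) (by
        rintro ((j | j) | j) <;> simp [rkhStringsEven] <;> omega)
  · exact hθ.rkh_of_isStringFamily (by omega)
      (KnotDiagram.TwistKnot.exists_isStringFamily_reduced_odd k hθ b) x (hθ.diff_comp_eChain b) (by
        rintro ((j | j) | j) <;> simp [rkhStringsOdd] <;> omega)
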